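/- **Difference estimate for the vector-valued Allen–Cahn equation.** *Domain and interface.* Let $N\ge 2$, let $\Omega\subset\mathbb R^N$ be a bounded smooth domain with outer unit normal $\nu$, let $T_0>0$ and $Q_T:=\Omega\times(0,T)$. Let $\Sigma\subset\mathbb R^N$ be a smooth, orientable, compact, connected hypersurface with boundary $\partial\Sigma$, and let $\Gamma_t=X_0(\Sigma,t)$, $t\in[0,T_0]$, be a smooth evolving hypersurface, with $X_0:\Sigma\times[0,T_0]\to\overline\Omega$ smooth, $X_0(\cdot,t)$ an injective immersion, $X_0(\Sigma\setminus\partial\Sigma,t)\subset\Omega$, $X_0(\partial\Sigma,t)\subset\partial\Omega$, contact angle $\frac\pi2$ with $\partial\Omega$, and smooth unit normal $\vec n(s,t)$. Assume that $X_0$ extends smoothly to $\Sigma_0\times(-\tau_0,T_0+\tau_0)$, as an injective immersion of $\Sigma_0$ at each time, where $\tau_0>0$ and $\Sigma_0\supsetneq\Sigma$ is a smooth, orientable, connected hypersurface without boundary. *Coordinates.* Let $\delta>0$ and let $X:[-2\delta,2\delta]\times\Sigma\times[0,T_0]\to\overline\Omega$ be smooth such that $\overline X:=(X,\mathrm{pr}_t)$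 extends to a smooth diffeomorphism from an open neighbourhood of $[-2\delta,2\delta]\times\Sigma\times[0,T_0]$ in $\mathbb R\times\Sigma_0\times\mathbb R$ onto an open subset of $\mathbb R^{N+1}$, with inverse $(r,s,\mathrm{pr}_t)$; $\Gamma(\eta):=\overline X((-\eta,\eta)\times\Sigma\times[0,T_0])$ is relatively open in $\overline\Omega\times[0,T_0]$ for $0<\eta\le2\delta$; $X|_{r=0}=X_0$; $X(r,s,t)\in\partial\Omega$ iff $s\in\partial\Sigma$; and $\nabla r=\vec n$, $D_xs\,\nabla r=0$, $\partial_r(|\nabla r|^2\circ\overline X)|_{r=0}=0$ on $\bigcup_t\Gamma_t\times\{t\}$. Let $\Gamma_t(\delta)$ be the slice of $\Gamma(\delta)$ at time $t$, $\partial_n\psi:=\partial_r(\psi\circ\overline X)\circ\overline X^{-1}$ and $\nabla_\tau\psi:=(D_xs)^\top[\nabla_\Sigma(\psi\circ\overline X)\circ\overline X^{-1}]$, componentwise for vector-valued $\psi$; matrices carry the Frobenius norm. *Potential.* Let $W:\mathbb R^m\to\mathbb R$ be smooth, and either (a) $W$ has exactly two global minimizers $\vec a\ne\vec b$ and is invariant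 under the reflection at the hyperplane $\frac12(\vec a+\vec b)+\mathrm{span}\{\vec a-\vec b\}^\perp$, or (b) $m=2$, $W$ has exactly three global minimizers, these are the vertices of an equilateral triangle, and $W$ is invariant under the symmetry group of this triangle. In both cases let $W=0$ and $D^2W$ be positive definite at the minimizers, let $\vec u\cdot\nabla W(\vec u)\ge0$ whenever $|\vec u|\ge \check R_0$, for some $\check R_0>0$, and assume that for some pair $\vec u_-\neq\vec u_+$ of minimizers there is a smooth solution $\vec\theta_0:\mathbb R\to\mathbb R^m$ of $-\vec\theta_0''+\nabla W(\vec\theta_0)=0$ with $\vec\theta_0(\pm\infty)=\vec u_\pm$, odd with respect to the reflection interchanging $\vec u_\pm$ (i.e. $\vec\theta_0(-z)$ is the reflection of $\vec\theta_0(z)$), for which the operator $-\frac{d^2}{dz^2}+D^2W(\vec\theta_0)$ on $H^2(\mathbb R)^m$ has a one-dimensional kernel. *Approximate solutions.* Let $\varepsilon_0>0$, $k(N):=\max\{2,\frac N2\}$, $M\in\mathbb N$ with $M\ge k(N)$, and let $\vec u^A_\varepsilon\in C^2(\overline{Q_{T_0}})^m$, $\varepsilon\in(0,\varepsilon_0]$,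 satisfy $\sup_\varepsilon\|\vec u^A_\varepsilon\|_{L^\infty(Q_{T_0})}<\infty$ and the following spectral estimate with constants $c_0,C_0>0$: $$\int_\Omega|\nabla\vec\psi|^2+\tfrac1{\varepsilon^2}\vec\psi\cdot D^2W(\vec u^A_\varepsilon(\cdot,t))\vec\psi\,dx\ \ge\ -C_0\|\vec\psi\|^2_{L^2(\Omega)}+\|\nabla\vec\psi\|^2_{L^2(\Omega\setminus\Gamma_t(\delta))}+c_0\|\nabla_\tau\vec\psi\|^2_{L^2(\Gamma_t(\delta))}$$ for all $\vec\psi\in H^1(\Omega)^m$, $\varepsilon\in(0,\varepsilon_0]$, $t\in[0,T_0]$. For $R,A,C>0$ and real $M'$ we say that $(\vec u_{0,\varepsilon},\vec u_\varepsilon)_{\varepsilon\in(0,\varepsilon_0]}$ is *admissible with $(R,A,C,M')$* if, for all $\varepsilon\in(0,\varepsilon_0]$: * $\vec u_{0,\varepsilon}\in C^2(\overline\Omega)^m$, $\partial_\nu\vec u_{0,\varepsilon}=0$ on $\partial\Omega$, and $\vec u_\varepsilon\in C^2(\overline{Q_{T_0}})^m$ solves $\partial_t\vec u_\varepsilon-\Delta\vec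 u_\varepsilon+\varepsilon^{-2}\nabla W(\vec u_\varepsilon)=0$ in $Q_{T_0}$, $\partial_\nu\vec u_\varepsilon=0$ on $\partial\Omega\times(0,T_0)$, $\vec u_\varepsilon|_{t=0}=\vec u_{0,\varepsilon}$ in $\Omega$; * $\|\vec u_{0,\varepsilon}\|_{L^\infty(\Omega)}\le A$; * with $\underline u_\varepsilon:=\vec u_\varepsilon-\vec u^A_\varepsilon$, $\vec r^A_\varepsilon:=\partial_t\vec u^A_\varepsilon-\Delta\vec u^A_\varepsilon+\varepsilon^{-2}\nabla W(\vec u^A_\varepsilon)$, $\vec s^A_\varepsilon:=\partial_\nu\vec u^A_\varepsilon$, for all $t\in(0,T_0]$, $$\Big|\int_{\partial\Omega}\vec s^A_\varepsilon\cdot\underline u_\varepsilon(t)\,d\mathcal H^{N-1}+\int_\Omega\vec r^A_\varepsilon\cdot\underline u_\varepsilon(t)\,dx\Big|\le C\varepsilon^{M'+\frac12}\big(\|\underline u_\varepsilon(t)\|_{L^2(\Omega)}+\|\nabla_\tau\underline u_\varepsilon(t)\|_{L^2(\Gamma_t(\delta))}+\|\nabla\underline u_\varepsilon(t)\|_{L^2(\Omega\setminus\Gamma_t(\delta))}\big);$$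 * $\|\vec u_{0,\varepsilon}-\vec u^A_\varepsilon|_{t=0}\|_{L^2(\Omega)}\le R\,\varepsilon^{M+\frac12}$. For $\beta\ge0$ let $g_\beta(t):=e^{-\beta t}$, and denote by $(\ast)_{\beta,R,\varepsilon,T}$ the two bounds $$\sup_{t\in[0,T]}\|(g_\beta\underline u_\varepsilon)(t)\|^2_{L^2(\Omega)}+\|g_\beta\nabla\underline u_\varepsilon\|^2_{L^2(Q_T\setminus\Gamma(\delta))}\le2R^2\varepsilon^{2M+1},$$ $$c_0\|g_\beta\nabla_\tau\underline u_\varepsilon\|^2_{L^2(Q_T\cap\Gamma(\delta))}+\varepsilon^2\|g_\beta\partial_n\underline u_\varepsilon\|^2_{L^2(Q_T\cap\Gamma(\delta))}\le2R^2\varepsilon^{2M+1}.$$ **Theorem.** 1. If $M>k(N)$, then for all $R,A,C>0$ and every family admissible with $(R,A,C,M)$ there are $\beta>0$ and $\varepsilon_1\in(0,\varepsilon_0]$ such that $(\ast)_{\beta,R,\varepsilon,T}$ holds for all $\varepsilon\in(0,\varepsilon_1]$, $T\in(0,T_0]$. 2. If $M=k(N)$, then for every real $\check M>M$ and all $A,C>0$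 there are $\beta,\check R>0$ and $\varepsilon_1\in(0,\varepsilon_0]$ such that for every family admissible with $(\check R,A,C,\check M)$, $(\ast)_{\beta,\check R,\varepsilon,T}$ holds for all $\varepsilon\in(0,\varepsilon_1]$, $T\in(0,T_0]$. 3. If $N\in\{2,3\}$ and $M=2$, then for all $R,A,C>0$ and every family admissible with $(R,A,C,M)$ there are $\varepsilon_1\in(0,\varepsilon_0]$, $T_1\in(0,T_0]$ such that $(\ast)_{0,R,\varepsilon,T}$ holds for all $\varepsilon\in(0,\varepsilon_1]$, $T\in(0,T_1]$. -/

import Mathlib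

open MeasureTheory Set Filter Topology
open scoped ContDiff InnerProductSpace

noncomputable section

namespace AllenCahn

/-- `ℝⁿ` with the Euclidean norm. -/
abbrev Euc (n : ℕ) : Type := EuclideanSpace ℝ (Fin n)

/-! ### Smooth domains and hypersurfaces -/

/-- `φ` is a smooth defining function of the open set `Ω` near the point `p`:
near `p` the set `Ω` is `{φ < 0}`, and `∇φ(p) ≠ 0`. -/
def IsBoundaryDefining {N : ℕ} (Ω : Set (Euc N)) (p : Euc N) (φ : Euc N → ℝ) : Prop :=
  gradient φ p ≠ 0 ∧
    ∃ U : Set (Euc N), IsOpen U ∧ p ∈ U ∧ ContDiffOn ℝ ∞ φ U ∧ Ω ∩ U = {x ∈ U | φ x < 0}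

/-- Bounded smooth domain: nonempty, open, connected, bounded, with smooth boundary
(the domain lying locally on one side of its boundary). -/
structure IsSmoothBoundedDomain {N : ℕ} (Ω : Set (Euc N)) : Prop where
  isOpen : IsOpen Ω
  isConnected : IsConnected Ω
  isBounded : Bornology.IsBounded Ω
  smooth_boundary : ∀ p ∈ frontier Ω, ∃ φ : Euc N → ℝ, IsBoundaryDefining Ω p φ

/-- `v` is the outer unit normal of `Ω` at the boundary point `p`. -/
def IsOuterUnitNormal {N : ℕ} (Ω : Set (Euc N)) (p v : Euc N) : Prop :=
  ∃ φ : Euc N → ℝ, IsBoundaryDefining Ω p φ ∧ v = ‖gradient φ p‖⁻¹ • gradient φ p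

/-- Near `p`, the set `S` is a smooth (embedded) hypersurface without boundary. -/
def IsInteriorHypersurfacePoint {N : ℕ} (S : Set (Euc N)) (p : Euc N) : Prop :=
  ∃ (U : Set (Euc N)) (φ : Euc N → ℝ), IsOpen U ∧ p ∈ U ∧ ContDiffOn ℝ ∞ φ U ∧
    gradient φ p ≠ 0 ∧ S ∩ U = {x ∈ U | φ x = 0}

/-- Near `p`, the set `S` is a smooth (embedded) hypersurface with boundary, and `p` is one of its
boundary points: near `p` it is `{φ = 0, χ ≤ 0}` with `∇φ(p)`, `∇χ(p)` linearly independent and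
`χ(p) = 0`. -/
def IsBoundaryHypersurfacePoint {N : ℕ} (S : Set (Euc N)) (p : Euc N) : Prop :=
  ∃ (U : Set (Euc N)) (φ χ : Euc N → ℝ), IsOpen U ∧ p ∈ U ∧
    ContDiffOn ℝ ∞ φ U ∧ ContDiffOn ℝ ∞ χ U ∧ χ p = 0 ∧
    LinearIndependent ℝ ![gradient φ p, gradient χ p] ∧ S ∩ U = {x ∈ U | φ x = 0 ∧ χ x ≤ 0}

/-- The tangent space at `p` of a submanifold (possibly with boundary) of `ℝᴺ`: the linear span of
all tangent directions. -/
def tangentSpaceAt {N : ℕ} (S : Set (Euc N)) (p : Euc N) : Submodule ℝ (Euc N) :=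
  Submodule.span ℝ (tangentConeAt ℝ S p)

/-- Orientability of a hypersurface of `ℝᴺ`: existence of a continuous unit normal field. -/
def IsOrientable {N : ℕ} (S : Set (Euc N)) : Prop :=
  ∃ n₀ : Euc N → Euc N, ContinuousOn n₀ S ∧
    ∀ p ∈ S, ‖n₀ p‖ = 1 ∧ ∀ v ∈ tangentSpaceAt S p, ⟪n₀ p, v⟫_ℝ = 0

/-! ### Evolving hypersurface with contact angle `π/2` -/

/-- A smooth evolving hypersurface `Γ_t = X₀(Σ, t)`, `t ∈ [0, T]`, in `closure Ω`, parametrized over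
a smooth, orientable, compact, connected reference hypersurface `Σ` (here `S`) with boundary `∂Σ`
(here `bd`), whose boundary lies on `∂Ω` and which meets `∂Ω` at the contact angle `π/2`.
The map `X₀` is smoothly extended as an evolving injective immersion of a larger hypersurface
`Σ₀` (here `S₀`) without boundary, for times in `(-τ₀, T + τ₀)`.
Smoothness of a map on a submanifold is expressed by a smooth extension to an open set. -/
structure EvolvingHypersurface {N : ℕ} (Ω : Set (Euc N)) (T : ℝ) where
  S : Set (Euc N)
  bd : Set (Euc N)
  S₀ : Set (Euc N)
  τ₀ : ℝ
  X₀ : Euc N × ℝ → Euc N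
  /-- the unit normal field `n(s,t)` of `Γ_t` at `X₀(s,t)` -/
  n : Euc N × ℝ → Euc N
  isCompact_S : IsCompact S
  isConnected_S : IsConnected S
  isOrientable_S : IsOrientable S
  bd_subset : bd ⊆ S
  interior_point : ∀ p ∈ S \ bd, IsInteriorHypersurfacePoint S p
  boundary_point : ∀ p ∈ bd, IsBoundaryHypersurfacePoint S p
  isConnected_S₀ : IsConnected S₀
  isOrientable_S₀ : IsOrientable S₀
  hypersurface_S₀ : ∀ p ∈ S₀, IsInteriorHypersurfacePoint S₀ p
  S_ssubset : S ⊂ S₀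
  τ₀_pos : 0 < τ₀
  smooth_X₀ : ∃ U : Set (Euc N × ℝ), IsOpen U ∧ S₀ ×ˢ Ioo (-τ₀) (T + τ₀) ⊆ U ∧
    ContDiffOn ℝ ∞ X₀ U
  injective_X₀ : ∀ t ∈ Ioo (-τ₀) (T + τ₀), InjOn (fun p => X₀ (p, t)) S₀
  immersion_X₀ : ∀ t ∈ Ioo (-τ₀) (T + τ₀), ∀ p ∈ S₀, ∀ v ∈ tangentSpaceAt S₀ p,
    fderiv ℝ (fun q => X₀ (q, t)) p v = 0 → v = 0
  X₀_mem : ∀ t ∈ Icc 0 T, ∀ p ∈ S \ bd, X₀ (p, t) ∈ Ω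
  X₀_mem_boundary : ∀ t ∈ Icc 0 T, ∀ p ∈ bd, X₀ (p, t) ∈ frontier Ω
  smooth_n : ∃ U : Set (Euc N × ℝ), IsOpen U ∧ S ×ˢ Icc 0 T ⊆ U ∧ ContDiffOn ℝ ∞ n U
  norm_n : ∀ t ∈ Icc 0 T, ∀ p ∈ S, ‖n (p, t)‖ = 1
  normal_n : ∀ t ∈ Icc 0 T, ∀ p ∈ S, ∀ v ∈ tangentSpaceAt S p,
    ⟪n (p, t), fderiv ℝ (fun q => X₀ (q, t)) p v⟫_ℝ = 0
  /-- contact angle `π/2` -/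
  contact_angle : ∀ t ∈ Icc 0 T, ∀ p ∈ bd, ∀ v, IsOuterUnitNormal Ω (X₀ (p, t)) v →
    ⟪v, n (p, t)⟫_ℝ = 0

/-! ### Curvilinear coordinates -/

/-- Curvilinear coordinates `(r, s)` of width `a` around `Γ`: a smooth map
`X : [-a,a] × Σ × [0,T] → closure Ω` such that `(r,s,t) ↦ (X(r,s,t), t)` extends to a smooth
diffeomorphism from a neighbourhood `dom ∩ (ℝ × Σ₀ × ℝ)` of `[-a,a] × Σ × [0,T]` in `ℝ × Σ₀ × ℝ`
onto an open set `cod ⊆ ℝᴺ × ℝ`, with smooth inverse `(r, s, pr_t)`. -/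
structure CurvilinearCoordinates {N : ℕ} {Ω : Set (Euc N)} {T : ℝ}
    (Γ : EvolvingHypersurface Ω T) (a : ℝ) where
  X : ℝ × Euc N × ℝ → Euc N
  r : Euc N × ℝ → ℝ
  s : Euc N × ℝ → Euc N
  dom : Set (ℝ × Euc N × ℝ)
  cod : Set (Euc N × ℝ)
  isOpen_dom : IsOpen dom
  isOpen_cod : IsOpen cod
  subset_dom : Icc (-a) a ×ˢ Γ.S ×ˢ Icc 0 T ⊆ dom
  smooth_X : ContDiffOn ℝ ∞ X dom
  smooth_r : ContDiffOn ℝ ∞ r cod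
  smooth_s : ContDiffOn ℝ ∞ s cod
  left_inv : ∀ ρ p t, (ρ, p, t) ∈ dom → p ∈ Γ.S₀ →
    (X (ρ, p, t), t) ∈ cod ∧ r (X (ρ, p, t), t) = ρ ∧ s (X (ρ, p, t), t) = p
  right_inv : ∀ x t, (x, t) ∈ cod →
    s (x, t) ∈ Γ.S₀ ∧ (r (x, t), s (x, t), t) ∈ dom ∧ X (r (x, t), s (x, t), t) = x
  X_mem : ∀ ρ ∈ Icc (-a) a, ∀ p ∈ Γ.S, ∀ t ∈ Icc 0 T, X (ρ, p, t) ∈ closure Ω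
  /-- for `0 < η ≤ a` the image of `(-η,η) × Σ × [0,T]` is relatively open in
  `closure Ω × [0,T]` -/
  tube_open : ∀ η ∈ Ioc 0 a, ∃ O : Set (Euc N × ℝ), IsOpen O ∧
    (fun q : ℝ × Euc N × ℝ => (X q, q.2.2)) '' (Ioo (-η) η ×ˢ Γ.S ×ˢ Icc 0 T) =
      O ∩ closure Ω ×ˢ Icc 0 T
  X_zero : ∀ p ∈ Γ.S, ∀ t ∈ Icc 0 T, X (0, p, t) = Γ.X₀ (p, t)
  mem_boundary_iff : ∀ ρ ∈ Icc (-a) a, ∀ p ∈ Γ.S, ∀ t ∈ Icc 0 T,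
    (X (ρ, p, t) ∈ frontier Ω ↔ p ∈ Γ.bd)
  gradient_r : ∀ p ∈ Γ.S, ∀ t ∈ Icc 0 T,
    gradient (fun y => r (y, t)) (Γ.X₀ (p, t)) = Γ.n (p, t)
  Ds_gradient_r : ∀ p ∈ Γ.S, ∀ t ∈ Icc 0 T,
    fderiv ℝ (fun y => s (y, t)) (Γ.X₀ (p, t)) (Γ.n (p, t)) = 0
  deriv_norm_gradient_r : ∀ p ∈ Γ.S, ∀ t ∈ Icc 0 T,
    deriv (fun ρ => ‖gradient (fun y => r (y, t)) (X (ρ, p, t))‖ ^ 2) 0 = 0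

namespace CurvilinearCoordinates

variable {N : ℕ} {Ω : Set (Euc N)} {T : ℝ} {Γ : EvolvingHypersurface Ω T} {a : ℝ}

/-- The tubular neighbourhood `Γ(η) ⊆ closure Ω × [0,T]`, the image of `(-η,η) × Σ × [0,T]`. -/
def tube (K : CurvilinearCoordinates Γ a) (η : ℝ) : Set (Euc N × ℝ) :=
  (fun q : ℝ × Euc N × ℝ => (K.X q, q.2.2)) '' (Ioo (-η) η ×ˢ Γ.S ×ˢ Icc 0 T)

/-- The time slice `Γ_t(η)` of the tubular neighbourhood. -/
def slice (K : CurvilinearCoordinates Γ a) (η t : ℝ) : Set (Euc N) :=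
  {x | (x, t) ∈ K.tube η}

/-- For a function `ψ` with spatial derivative `D` at `(x,t)`: the derivative
`v ↦ d_Σ(ψ(X(r,·,t)))|_{s(x,t)} (D_x s v)`, where `d_Σ(ψ ∘ X) = D ∘ d_Σ X` by the chain rule.
Its transpose is the matrix `∇_τ ψ = (D_x s)ᵀ [∇_Σ(ψ ∘ X)]` at `(x,t)`. This form makes sense both
for classical and for weak derivatives. -/
def tangentialDeriv {m : ℕ} (K : CurvilinearCoordinates Γ a) (z : Euc N × ℝ)
    (D : Euc N →L[ℝ] Euc m) : Euc N →L[ℝ] Euc m :=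
  (D.comp (fderiv ℝ (fun p => K.X (K.r z, p, z.2)) (K.s z))).comp
    (fderiv ℝ (fun y => K.s (y, z.2)) z.1)

/-- For a function `ψ` with spatial derivative `D` at `(x,t)`: the normal derivative
`∂_n ψ = ∂_r(ψ(X(·,s,t)))` at `r = r(x,t)`, `s = s(x,t)`, by the chain rule. -/
def normalDeriv {m : ℕ} (K : CurvilinearCoordinates Γ a) (z : Euc N × ℝ)
    (D : Euc N →L[ℝ] Euc m) : Euc m :=
  D (deriv (fun ρ => K.X (ρ, K.s z, z.2)) (K.r z))

theorem differentiableAt_X (K : CurvilinearCoordinates Γ a) {x : Euc N} {t : ℝ}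
    (hz : (x, t) ∈ K.cod) : DifferentiableAt ℝ K.X (K.r (x, t), K.s (x, t), t) :=
  (K.smooth_X.contDiffAt (K.isOpen_dom.mem_nhds (K.right_inv x t hz).2.1)).differentiableAt
    (by simp)

/-- The tangential derivative is what its name says for classically differentiable functions. -/
theorem tangentialDeriv_eq {m : ℕ} (K : CurvilinearCoordinates Γ a) {x : Euc N} {t : ℝ}
    (hz : (x, t) ∈ K.cod) {ψ : Euc N → Euc m} (hψ : DifferentiableAt ℝ ψ x) :
    K.tangentialDeriv (x, t) (fderiv ℝ ψ x) =
      (fderiv ℝ (fun p => ψ (K.X (K.r (x, t), p, t))) (K.s (x, t))).comp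
        (fderiv ℝ (fun y => K.s (y, t)) x) := by
  have hx := (K.right_inv x t hz).2.2
  have hX : DifferentiableAt ℝ (fun p => K.X (K.r (x, t), p, t)) (K.s (x, t)) :=
    (K.differentiableAt_X hz).comp (K.s (x, t))
      (f := fun p => ((K.r (x, t), p, t) : ℝ × Euc N × ℝ)) (by fun_prop)
  have h := fderiv_comp (𝕜 := ℝ) (K.s (x, t)) (g := ψ)
    (f := fun p => K.X (K.r (x, t), p, t)) (by simpa only [hx] using hψ) hX
  simp only [hx] at h
  unfold tangentialDeriv
  rw [← h]
  rfl

/-- The normal derivative is what its name says for classically differentiable functions. -/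
theorem normalDeriv_eq {m : ℕ} (K : CurvilinearCoordinates Γ a) {x : Euc N} {t : ℝ}
    (hz : (x, t) ∈ K.cod) {ψ : Euc N → Euc m} (hψ : DifferentiableAt ℝ ψ x) :
    K.normalDeriv (x, t) (fderiv ℝ ψ x) =
      deriv (fun ρ => ψ (K.X (ρ, K.s (x, t), t))) (K.r (x, t)) := by
  have hx := (K.right_inv x t hz).2.2
  have hX : DifferentiableAt ℝ (fun ρ => K.X (ρ, K.s (x, t), t)) (K.r (x, t)) :=
    (K.differentiableAt_X hz).comp (K.r (x, t))
      (f := fun ρ => ((ρ, K.s (x, t), t) : ℝ × Euc N × ℝ)) (by fun_prop)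
  have h := fderiv_comp_deriv (𝕜 := ℝ) (K.r (x, t)) (l := ψ)
    (f := fun ρ => K.X (ρ, K.s (x, t), t)) (by simpa only [hx] using hψ) hX
  simp only [hx] at h
  exact h.symm

end CurvilinearCoordinates

/-! ### The potential -/

/-- Reflection of `ℝᵐ` at the hyperplane `(a + b)/2 + span{a - b}^⊥`. -/
def wellReflection {m : ℕ} (a b u : Euc m) : Euc m :=
  u - (2 * ⟪u - (2⁻¹ : ℝ) • (a + b), a - b⟫_ℝ / ‖a - b‖ ^ 2) • (a - b)

/-- The set of global minimizers of `W`. -/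
def minimizers {m : ℕ} (W : Euc m → ℝ) : Set (Euc m) := {u | ∀ v, W u ≤ W v}

/-- The vector `D²W(u) v`. -/
def hess {m : ℕ} (W : Euc m → ℝ) (u v : Euc m) : Euc m := fderiv ℝ (gradient W) u v

/-- Exactly two global minima, and symmetry with respect to the hyperplane in the middle. -/
def IsSymmetricDoubleWell {m : ℕ} (W : Euc m → ℝ) : Prop :=
  ∃ a b : Euc m, a ≠ b ∧ minimizers W = {a, b} ∧ ∀ u, W (wellReflection a b u) = W u

/-- `m = 2`, exactly three global minima, the vertices of an equilateral triangle, and symmetry with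
respect to the symmetry group of this triangle. -/
def IsSymmetricTripleWell {m : ℕ} (W : Euc m → ℝ) : Prop :=
  m = 2 ∧ ∃ x₁ x₃ x₅ : Euc m, x₁ ≠ x₃ ∧ dist x₁ x₃ = dist x₃ x₅ ∧ dist x₃ x₅ = dist x₅ x₁ ∧
    minimizers W = {x₁, x₃, x₅} ∧
    ∀ g : Euc m ≃ᵢ Euc m, g '' {x₁, x₃, x₅} = {x₁, x₃, x₅} → ∀ u, W (g u) = W u

/-- `θ` is a smooth solution of `-θ'' + ∇W(θ) = 0` on `ℝ` connecting `a` (at `-∞`) to `b` (at `+∞`)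
that is odd with respect to the reflection interchanging `a` and `b`. -/
structure IsOddProfile {m : ℕ} (W : Euc m → ℝ) (a b : Euc m) (θ : ℝ → Euc m) : Prop where
  smooth : ContDiff ℝ ∞ θ
  ode : ∀ z, -deriv (deriv θ) z + gradient W (θ z) = 0
  tendsto_atBot : Tendsto θ atBot (𝓝 a)
  tendsto_atTop : Tendsto θ atTop (𝓝 b)
  odd : ∀ z, θ (-z) = wellReflection a b (θ z)

/-- The kernel of `-d²/dz² + D²W(θ)` on `H²(ℝ)ᵐ` (its elements are `C²` by the equation). -/
def linearizedKernel {m : ℕ} (W : Euc m → ℝ) (θ : ℝ → Euc m) : Set (ℝ → Euc m) :=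
  {w | ContDiff ℝ 2 w ∧ MemLp w 2 volume ∧ MemLp (deriv w) 2 volume ∧
    MemLp (deriv (deriv w)) 2 volume ∧ ∀ z, -deriv (deriv w) z + hess W (θ z) (w z) = 0}

/-- The admissible potentials `W : ℝᵐ → ℝ` of the vector-valued Allen-Cahn equation. -/
structure IsPotential {m : ℕ} (W : Euc m → ℝ) : Prop where
  smooth : ContDiff ℝ ∞ W
  wells : IsSymmetricDoubleWell W ∨ IsSymmetricTripleWell W
  zero_at_wells : ∀ u ∈ minimizers W, W u = 0
  posDef_at_wells : ∀ u ∈ minimizers W, ∀ v, v ≠ 0 → 0 < ⟪v, hess W u v⟫_ℝ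
  outward : ∃ R₀ : ℝ, 0 < R₀ ∧ ∀ u, R₀ ≤ ‖u‖ → 0 ≤ ⟪u, gradient W u⟫_ℝ
  /-- For a pair of distinct wells and an odd profile between them, the kernel of the
  linearized operator is one-dimensional. -/
  kernel_dim_one : ∃ a ∈ minimizers W, ∃ b ∈ minimizers W, a ≠ b ∧ ∃ θ : ℝ → Euc m,
    IsOddProfile W a b θ ∧ ∃ w₀ ∈ linearizedKernel W θ, w₀ ≠ 0 ∧
      ∀ w ∈ linearizedKernel W θ, ∃ c : ℝ, w = c • w₀

/-! ### The vector-valued Allen-Cahn equation -/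

/-- The squared Frobenius norm of (the matrix of) a linear map. -/
def frobSq {N m : ℕ} (L : Euc N →L[ℝ] Euc m) : ℝ :=
  ∑ i, ‖L (EuclideanSpace.single i 1)‖ ^ 2

/-- The spatial derivative at `z = (x,t)` of a function on `closure Ω × [0,T]`
(one-sided at boundary points `x ∈ ∂Ω`). -/
def spaceDeriv {N m : ℕ} (Ω : Set (Euc N)) (u : Euc N × ℝ → Euc m) (z : Euc N × ℝ) :
    Euc N →L[ℝ] Euc m :=
  fderivWithin ℝ (fun y => u (y, z.2)) (closure Ω) z.1

/-- `∂_t u - Δu + ε⁻² ∇W(u)` at `(x,t)`, for `x ∈ Ω` and `t ∈ [0,T]`. -/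
def residual {N m : ℕ} (T : ℝ) (W : Euc m → ℝ) (ε : ℝ) (u : Euc N × ℝ → Euc m)
    (x : Euc N) (t : ℝ) : Euc m :=
  derivWithin (fun τ => u (x, τ)) (Icc 0 T) t - Laplacian.laplacian (fun y => u (y, t)) x
    + (ε ^ 2)⁻¹ • gradient W (u (x, t))

/-- `u ∈ C²(closure (Ω × (0,T)))ᵐ`. -/
def IsC2 {N m : ℕ} (Ω : Set (Euc N)) (T : ℝ) (u : Euc N × ℝ → Euc m) : Prop :=
  ContDiffOn ℝ 2 u (closure Ω ×ˢ Icc 0 T)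

/-- `u₀ ∈ C²(closure Ω)ᵐ` with `∂_ν u₀ = 0` on `∂Ω`. -/
def IsInitialValue {N m : ℕ} (Ω : Set (Euc N)) (ν : Euc N → Euc N) (u₀ : Euc N → Euc m) : Prop :=
  ContDiffOn ℝ 2 u₀ (closure Ω) ∧ ∀ x ∈ frontier Ω, fderivWithin ℝ u₀ (closure Ω) x (ν x) = 0

/-- Exact `C²`-solutions `u` of the vector-valued Allen-Cahn equation with homogeneous Neumann
boundary condition and initial value `u₀` on the time interval `[0,T]`;
`ν` is the outer unit normal of `∂Ω`. -/
structure IsSolution {N m : ℕ} (Ω : Set (Euc N)) (ν : Euc N → Euc N) (T : ℝ) (W : Euc m → ℝ)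
    (ε : ℝ) (u₀ : Euc N → Euc m) (u : Euc N × ℝ → Euc m) : Prop where
  isC2 : IsC2 Ω T u
  pde : ∀ x ∈ Ω, ∀ t ∈ Ioo 0 T, residual T W ε u x t = 0
  neumann : ∀ x ∈ frontier Ω, ∀ t ∈ Ioo 0 T, spaceDeriv Ω u (x, t) (ν x) = 0
  initial : ∀ x ∈ Ω, u (x, 0) = u₀ x

/-! ### Function spaces and the estimates -/

/-- `ψ ∈ H¹(Ω)ᵐ` with weak derivative `G`. -/
structure IsH1 {N m : ℕ} (Ω : Set (Euc N)) (ψ : Euc N → Euc m)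
    (G : Euc N → Euc N →L[ℝ] Euc m) : Prop where
  memLp : MemLp ψ 2 (volume.restrict Ω)
  memLp_deriv : MemLp G 2 (volume.restrict Ω)
  weak_deriv : ∀ φ : Euc N → ℝ, ContDiff ℝ ∞ φ → HasCompactSupport φ → tsupport φ ⊆ Ω →
    ∀ v : Euc N, ∫ x in Ω, fderiv ℝ φ x v • ψ x = -∫ x in Ω, φ x • G x v

variable {N m : ℕ} {Ω : Set (Euc N)} {T : ℝ} {Γ : EvolvingHypersurface Ω T} {a : ℝ}

/-- The spectral estimate with constants `c₀`, `C` for the function `w = uᴬ_ε`, at all times. -/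
def SpectralEstimate (K : CurvilinearCoordinates Γ a) (δ : ℝ) (W : Euc m → ℝ) (c₀ C ε : ℝ)
    (w : Euc N × ℝ → Euc m) : Prop :=
  ∀ t ∈ Icc 0 T, ∀ (ψ : Euc N → Euc m) (G : Euc N → Euc N →L[ℝ] Euc m), IsH1 Ω ψ G →
    -C * (∫ x in Ω, ‖ψ x‖ ^ 2) + (∫ x in Ω \ K.slice δ t, frobSq (G x))
        + c₀ * ∫ x in Ω ∩ K.slice δ t, frobSq (K.tangentialDeriv (x, t) (G x)) ≤
      ∫ x in Ω, (frobSq (G x) + (ε ^ 2)⁻¹ * ⟪ψ x, hess W (w (x, t)) (ψ x)⟫_ℝ)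

/-- The estimate of the remainders of the approximate solution `w = uᴬ_ε` tested with the difference
`u - w` to the exact solution, with constant `C` and order `M`. The boundary integral is taken with
respect to the `(N-1)`-dimensional Hausdorff measure (normalized as surface measure). -/
def RemainderEstimate (K : CurvilinearCoordinates Γ a) (δ : ℝ) (ν : Euc N → Euc N)
    (W : Euc m → ℝ) (C M ε : ℝ) (w u : Euc N × ℝ → Euc m) : Prop :=
  ∀ t ∈ Ioc 0 T,
    |(∫ x in frontier Ω, ⟪spaceDeriv Ω w (x, t) (ν x), u (x, t) - w (x, t)⟫_ℝ
          ∂(Measure.euclideanHausdorffMeasure (N - 1)))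
        + ∫ x in Ω, ⟪residual T W ε w x t, u (x, t) - w (x, t)⟫_ℝ| ≤
      C * ε ^ (M + 1 / 2) *
        (√(∫ x in Ω, ‖u (x, t) - w (x, t)‖ ^ 2)
          + √(∫ x in Ω ∩ K.slice δ t,
              frobSq (K.tangentialDeriv (x, t) (spaceDeriv Ω (u - w) (x, t))))
          + √(∫ x in Ω \ K.slice δ t, frobSq (spaceDeriv Ω (u - w) (x, t))))

/-- The weighted energy bounds on `[0,τ]`, with weight `g_β(t) = exp (-β t)`, for the difference
`v = u_ε - uᴬ_ε`, with right hand side `B`. -/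
def EnergyBounds (K : CurvilinearCoordinates Γ a) (δ c₀ ε β B τ : ℝ)
    (v : Euc N × ℝ → Euc m) : Prop :=
  (∀ t ∈ Icc 0 τ,
    (∫ x in Ω, ‖Real.exp (-β * t) • v (x, t)‖ ^ 2)
      + (∫ z in (Ω ×ˢ Ioo 0 τ) \ K.tube δ,
          frobSq (Real.exp (-β * z.2) • spaceDeriv Ω v z)) ≤ B) ∧
  c₀ * (∫ z in (Ω ×ˢ Ioo 0 τ) ∩ K.tube δ,
        frobSq (Real.exp (-β * z.2) • K.tangentialDeriv z (spaceDeriv Ω v z)))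
    + ε ^ 2 * (∫ z in (Ω ×ˢ Ioo 0 τ) ∩ K.tube δ,
        ‖Real.exp (-β * z.2) • K.normalDeriv z (spaceDeriv Ω v z)‖ ^ 2) ≤ B

/-- The critical order `k(N) = max {2, N/2}`. -/
def critOrder (N : ℕ) : ℝ := max 2 ((N : ℝ) / 2)

/-- Well-prepared initial data: `‖u₀ - w(·,0)‖_{L²(Ω)} ≤ R ε^{M+1/2}`. -/
def WellPrepared (Ω : Set (Euc N)) (R M ε : ℝ) (w : Euc N × ℝ → Euc m) (u₀ : Euc N → Euc m) :
    Prop :=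
  √(∫ x in Ω, ‖u₀ x - w (x, 0)‖ ^ 2) ≤ R * ε ^ (M + 1 / 2)

end AllenCahn

end

open AllenCahn

set_option linter.unusedSectionVars false

noncomputable section

/-! Put `v = u - w` with `w` the approximate solution, and `y(t) = ‖v(t)‖²` in `L²(Ω)`. Subtracting
the two equations and testing with `v` gives `y' = -2‖∇v‖² - 2ε⁻² ∫ v·(∇W(u) - ∇W(w)) - 2·remainder`
(`energy_identity`). Both functions are bounded independently of `ε`, `u` by a maximum principle
(`IsSolution.norm_le`), so `∇W(u) - ∇W(w) = D²W(w)v + O(|v|²)`. The linear part is handled by the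
spectral estimate. A fraction of order `ε²` of `‖∇v‖²` is held back from it to control `ε²‖∂ₙv‖²`,
and Young's inequality absorbs the remainder (`energy_rate_le`).

The delicate term is `ε⁻² ∫ |v|³`. Pointwise, `ε⁻²|v|³ ≤ k₁|v|² + η ε^(-4k/N) |v|^(2+4/N)` with `k =
max {2, N/2}` (`exists_cubic_le`): for `N < 4` this is Young's inequality, since `4/N > 1`, and for
`N ≥ 4` it follows from the boundedness of `v`. The superquadratic integral obeys an anisotropic
Gagliardo-Nirenberg inequality (`exists_interpolation`), `∫ |v|^(2+4/N) ≤ C ε^(-2/N) y^(2/N) ·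
energy`. In this energy the normal derivative near the interface carries the weight `ε`. In charts
adapted to the interface only one of the `N` coordinate directions is normal, so the grid-lines
inequality loses just one factor `ε⁻¹` in the product over all directions, hence the power `2/N`. As
long as `y` is of order `R² ε^(2M+1)`, the cubic term is thus at most `k₁ y` plus the dissipation
and `y` times a coefficient of order `η R^(4/N) ε^(4(M-k)/N)` (`rpow_scaling`). This explains the
critical order `k`.

If that coefficient is small, `exists_differential_inequality` yields `y' ≤ -(7/5)·dissipation + K₁
y + K₂ ε^(2M'+1)`, where `M'` is the order of the remainder. A continuation argument
(`add_integral_le_of_bootstrap`) for `e^(-2βt) y` shows that the assumed bound `2E`, `E = R²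
ε^(2M+1)`, improves to `11/10 E` and therefore never fails. The three assertions differ in how the
coefficient and the source are made small. For `M > k`, `ε` is small and `β` is large. For `M = k`,
the radius `R` is small, which is compatible with a fixed `β` because the remainder has the higher
order `M' > M`. For `N ≤ 3` and `M = 2`, the factor `η` is small at the price of a large `k₁`, with
`β = 0` on a short time interval.

Green's formula on `Ω` rests on a divergence theorem with respect to Hausdorff measure
(`IsSmoothBoundedDomain.integral_deriv`), obtained from local graphs, an area formula for graphs and
a partition of unity. -/

namespace AllenCahn

/-! ### Level sets as graphs, and cone conditions for sublevel sets. -/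

section Geometry

variable {V : Type*} [NormedAddCommGroup V] [InnerProductSpace ℝ V]

/-- The affine coordinates `(h, s) ↦ p + h + s e` with `h` orthogonal to `e`. -/
def orthoCoord (p e : V) (q : (ℝ ∙ e)ᗮ × ℝ) : V := p + (q.1 : V) + q.2 • e

theorem contDiff_orthoCoord (p e : V) : ContDiff ℝ ∞ (orthoCoord p e) := by
  unfold orthoCoord
  have : ContDiff ℝ ∞ (fun q : (ℝ ∙ e)ᗮ × ℝ => ((ℝ ∙ e)ᗮ.subtypeL q.1)) := by fun_prop
  exact (contDiff_const.add this).add (contDiff_snd.smul contDiff_const)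

/-- The derivative of `orthoCoord`. -/
def orthoCoordL (e : V) : (ℝ ∙ e)ᗮ × ℝ →L[ℝ] V :=
  (ℝ ∙ e)ᗮ.subtypeL.comp (ContinuousLinearMap.fst ℝ _ _) +
    (ContinuousLinearMap.snd ℝ _ _).smulRight e

theorem orthoCoordL_apply (e : V) (q : (ℝ ∙ e)ᗮ × ℝ) :
    orthoCoordL e q = (q.1 : V) + q.2 • e := rfl

theorem hasFDerivAt_orthoCoord (p e : V) (q : (ℝ ∙ e)ᗮ × ℝ) :
    HasFDerivAt (orthoCoord p e) (orthoCoordL e) q := by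
  have h := (orthoCoordL e).hasFDerivAt (x := q) |>.const_add p
  refine h.congr_of_eventuallyEq (Eventually.of_forall fun q => ?_)
  simp [orthoCoord, orthoCoordL_apply, add_assoc]

variable [FiniteDimensional ℝ V]

/-- Near a regular point `p` of the level set of `φ`, this level set is a graph in direction `e`. -/
theorem exists_graph {φ : V → ℝ} {p e : V} (hφ : ContDiffAt ℝ 1 φ p) (h0 : φ p = 0)
    (hpos : 0 < fderiv ℝ φ p e) {O : Set V} (hO : O ∈ 𝓝 p) :
    ∃ (g : (ℝ ∙ e)ᗮ → ℝ) (ρ κ : ℝ), 0 < ρ ∧ 0 < κ ∧ g 0 = 0 ∧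
      ContDiffOn ℝ 1 g (Metric.ball 0 ρ) ∧ (∀ h ∈ Metric.ball 0 ρ, |g h| < κ) ∧
      ∀ h ∈ Metric.ball 0 ρ, ∀ s ∈ Icc (-κ) κ, orthoCoord p e (h, s) ∈ O ∧
        DifferentiableAt ℝ φ (orthoCoord p e (h, s)) ∧
        0 < fderiv ℝ φ (orthoCoord p e (h, s)) e ∧
        (φ (orthoCoord p e (h, s)) < 0 ↔ s < g h) ∧
        (φ (orthoCoord p e (h, s)) = 0 ↔ s = g h) := by
  have hp0 : orthoCoord p e (0, 0) = p := by simp [orthoCoord]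
  set f : (ℝ ∙ e)ᗮ × ℝ → ℝ := fun q => φ (orthoCoord p e q) with hf
  have hfc : ContDiffAt ℝ 1 f (0, 0) := by
    refine ContDiffAt.comp _ (by rwa [hp0]) ((contDiff_orthoCoord p e).of_le (by simp)).contDiffAt
  have hfd : fderiv ℝ f (0, 0) = (fderiv ℝ φ p).comp (orthoCoordL e) := by
    have h1 : HasFDerivAt φ (fderiv ℝ φ p) (orthoCoord p e (0, 0)) := by
      rw [hp0]; exact (hφ.differentiableAt one_ne_zero).hasFDerivAt
    exact (h1.comp _ (hasFDerivAt_orthoCoord p e (0, 0))).fderiv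
  have hinv : (fderiv ℝ f (0, 0) ∘L .inr ℝ (ℝ ∙ e)ᗮ ℝ).IsInvertible := by
    refine ⟨ContinuousLinearEquiv.unitsEquivAut ℝ (Units.mk0 (fderiv ℝ φ p e) hpos.ne'), ?_⟩
    ext
    simp [hfd, orthoCoordL_apply]
  set g := hfc.implicitFunction one_ne_zero hinv with hg
  have hg0 : g 0 = 0 := hfc.implicitFunction_apply_self one_ne_zero hinv
  have hgz : ∀ᶠ h in 𝓝 (0 : (ℝ ∙ e)ᗮ), f (h, g h) = f (0, 0) :=
    hfc.eventually_apply_implicitFunction one_ne_zero hinv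
  have hgc : ContDiffAt ℝ 1 g 0 := hfc.contDiffAt_implicitFunction one_ne_zero hinv
  have hf0 : f (0, 0) = 0 := by simp [hf, hp0, h0]
  -- a neighbourhood where everything is fine
  have hnice : ∀ᶠ x in 𝓝 p, x ∈ O ∧ DifferentiableAt ℝ φ x ∧ 0 < fderiv ℝ φ x e := by
    have h1 : ∀ᶠ x in 𝓝 p, ContDiffAt ℝ 1 φ x := hφ.eventually (by simp)
    have h2 : ContinuousAt (fun x => fderiv ℝ φ x e) p :=
      (hφ.continuousAt_fderiv one_ne_zero).clm_apply continuousAt_const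
    filter_upwards [hO, h1, h2.eventually (lt_mem_nhds hpos)] with x a b c
    exact ⟨a, b.differentiableAt one_ne_zero, c⟩
  have hnice' : ∀ᶠ q in 𝓝 ((0 : (ℝ ∙ e)ᗮ), (0 : ℝ)), orthoCoord p e q ∈ O ∧
      DifferentiableAt ℝ φ (orthoCoord p e q) ∧ 0 < fderiv ℝ φ (orthoCoord p e q) e := by
    have hc : ContinuousAt (orthoCoord p e) (0, 0) := (contDiff_orthoCoord p e).continuous.continuousAt
    rw [ContinuousAt, hp0] at hc
    exact hc.eventually hnice
  rw [nhds_prod_eq] at hnice'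
  obtain ⟨A, hA, B, hB, hAB⟩ := eventually_prod_iff.1 hnice'
  obtain ⟨κ, hκ, hκB⟩ := Metric.nhds_basis_closedBall.mem_iff.1 hB
  have hgκ : ∀ᶠ h in 𝓝 (0 : (ℝ ∙ e)ᗮ), |g h| < κ := by
    have : Tendsto (fun h => |g h|) (𝓝 0) (𝓝 |g 0|) := hgc.continuousAt.tendsto.abs
    rw [hg0, abs_zero] at this
    exact this.eventually (gt_mem_nhds hκ)
  obtain ⟨ρ, hρ, hρA⟩ := Metric.eventually_nhds_iff_ball.1
    (hA.and (hgκ.and (hgz.and (hgc.eventually (by simp)))))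
  refine ⟨g, ρ, κ, hρ, hκ, hg0, fun h hh => (hρA h hh).2.2.2.contDiffWithinAt,
    fun h hh => (hρA h hh).2.1, fun h hh s hs => ?_⟩
  have key : ∀ s ∈ Icc (-κ) κ, orthoCoord p e (h, s) ∈ O ∧
      DifferentiableAt ℝ φ (orthoCoord p e (h, s)) ∧
      0 < fderiv ℝ φ (orthoCoord p e (h, s)) e := fun s hs =>
    hAB (hρA h hh).1 (hκB (by simpa [Real.dist_eq, abs_le] using hs))
  -- The implicit function theorem only produces a zero at `s = g h`. Strict monotonicity in `s`
  -- makes it the only one on the segment and fixes the sign of `φ` on either side.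
  have hmono : StrictMonoOn (fun s => φ (orthoCoord p e (h, s))) (Icc (-κ) κ) := by
    have hder : ∀ s ∈ Icc (-κ) κ, HasDerivAt (fun s => φ (orthoCoord p e (h, s)))
        (fderiv ℝ φ (orthoCoord p e (h, s)) e) s := by
      intro s hs
      have h1 : HasDerivAt (fun s : ℝ => orthoCoord p e (h, s)) e s := by
        unfold orthoCoord
        simpa using ((hasDerivAt_id s).smul_const e).const_add (p + (h : V))
      exact (key s hs).2.1.hasFDerivAt.comp_hasDerivAt s h1
    refine strictMonoOn_of_deriv_pos (convex_Icc _ _)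
      (fun s hs => (hder s hs).continuousAt.continuousWithinAt) fun s hs => ?_
    rw [interior_Icc] at hs
    rw [(hder s (Ioo_subset_Icc_self hs)).deriv]
    exact (key s (Ioo_subset_Icc_self hs)).2.2
  have hgh : g h ∈ Icc (-κ) κ := abs_le.1 (hρA h hh).2.1.le
  have hz : φ (orthoCoord p e (h, g h)) = 0 := by
    have := (hρA h hh).2.2.1
    rw [hf0] at this; exact this
  refine ⟨(key s hs).1, (key s hs).2.1, (key s hs).2.2, ?_, ?_⟩
  · rw [← hz]; exact hmono.lt_iff_lt hs hgh
  · rw [← hz]; exact hmono.injOn.eq_iff hs hgh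

/-- A nonzero linear functional is negative on all vectors of some basis. -/
theorem exists_basis_neg (ℓ : V →L[ℝ] ℝ) (hℓ : ℓ ≠ 0) {n : ℕ} (hn : Module.finrank ℝ V = n) :
    ∃ b : Module.Basis (Fin n) ℝ V, ∀ i, ℓ (b i) < 0 := by
  obtain ⟨w, hw⟩ : ∃ w, ℓ w < 0 := by
    obtain ⟨w, hw⟩ : ∃ w, ℓ w ≠ 0 := by
      by_contra! h
      exact hℓ (ContinuousLinearMap.ext h)
    rcases lt_or_gt_of_ne hw with h | h
    · exact ⟨w, h⟩
    · exact ⟨-w, by simpa using h⟩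
  -- An open half-space spans: a suitable multiple of `w` moves any `x` into it. A basis can
  -- therefore be selected from its elements.
  have hspan : (⊤ : Submodule ℝ V) ≤ Submodule.span ℝ {x | ℓ x < 0} := by
    intro x _
    obtain ⟨c, hc⟩ : ∃ c : ℝ, ℓ (x + c • w) < 0 := by
      refine ⟨(-ℓ x - 1) / ℓ w, ?_⟩
      rw [map_add, map_smul, smul_eq_mul, div_mul_cancel₀ _ hw.ne]
      linarith
    have : x = (x + c • w) - c • w := by abel
    rw [this]
    exact Submodule.sub_mem _ (Submodule.subset_span hc)
      (Submodule.smul_mem _ _ (Submodule.subset_span hw))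
  let b := Module.Basis.ofSpan hspan
  have : Fintype ((linearIndepOn_empty ℝ id).extend (empty_subset {x : V | ℓ x < 0})) :=
    FiniteDimensional.fintypeBasisIndex b
  have hcard := Module.finrank_eq_card_basis b
  rw [hn] at hcard
  refine ⟨b.reindex (Fintype.equivFinOfCardEq hcard.symm), fun i => ?_⟩
  rw [Module.Basis.reindex_apply]
  exact Module.Basis.ofSpan_subset hspan (mem_range_self _)

/-- Cone condition for sublevel sets: near a point where either `h < 0` or `Dh ≠ 0`, the directions
of a suitable basis decrease `h`. -/
theorem exists_cone {h : V → ℝ} {z : V} (hh : ContDiffAt ℝ 1 h z)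
    (hz : h z < 0 ∨ fderiv ℝ h z ≠ 0) {n : ℕ} (hn : Module.finrank ℝ V = n) :
    ∃ (b : Module.Basis (Fin n) ℝ V) (ρ ℓ : ℝ), 0 < ρ ∧ 0 < ℓ ∧
      ∀ x ∈ Metric.ball z ρ, h x ≤ 0 → ∀ i, ∀ τ ∈ Ioc 0 ℓ, h (x + τ • b i) < 0 := by
  -- Where `h < 0`, short steps along any basis keep `h` negative by continuity. Where `Dh ≠ 0`, a
  -- basis of descent directions is chosen, and these remain descent directions nearby.
  rcases hz with hz | hz
  · let b := (Module.finBasisOfFinrankEq ℝ V hn)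
    have h1 : ∀ᶠ x in 𝓝 z, h x < 0 := hh.continuousAt.eventually (gt_mem_nhds hz)
    have h2 : ∀ᶠ q : V × ℝ in 𝓝 (z, 0), ∀ i, h (q.1 + q.2 • b i) < 0 := by
      refine eventually_all.2 fun i => ?_
      have : Tendsto (fun q : V × ℝ => q.1 + q.2 • b i) (𝓝 (z, 0)) (𝓝 z) := by
        have : Continuous (fun q : V × ℝ => q.1 + q.2 • b i) := by fun_prop
        simpa using this.tendsto (z, 0)
      exact this.eventually h1
    obtain ⟨r, hr, hrb⟩ := Metric.eventually_nhds_iff_ball.1 h2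
    refine ⟨b, r, r / 2, hr, by positivity, fun x hx _ i τ hτ => hrb (x, τ) ?_ i⟩
    rw [← ball_prod_same]
    refine ⟨hx, ?_⟩
    simp only [Metric.mem_ball, dist_zero_right, Real.norm_eq_abs, abs_of_pos hτ.1]
    linarith [hτ.2]
  · obtain ⟨b, hb⟩ := exists_basis_neg (fderiv ℝ h z) hz hn
    have h1 : ∀ᶠ x in 𝓝 z, DifferentiableAt ℝ h x ∧ ∀ i, fderiv ℝ h x (b i) < 0 := by
      have h1 : ∀ᶠ x in 𝓝 z, ContDiffAt ℝ 1 h x := hh.eventually (by simp)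
      have h2 : ∀ᶠ x in 𝓝 z, ∀ i, fderiv ℝ h x (b i) < 0 := by
        refine eventually_all.2 fun i => ?_
        have h2 : ContinuousAt (fun x => fderiv ℝ h x (b i)) z :=
          (hh.continuousAt_fderiv one_ne_zero).clm_apply continuousAt_const
        exact h2.eventually (gt_mem_nhds (hb i))
      filter_upwards [h1, h2] with x a c
      exact ⟨a.differentiableAt one_ne_zero, c⟩
    have h2 : ∀ᶠ q : V × ℝ in 𝓝 (z, 0), ∀ i, DifferentiableAt ℝ h (q.1 + q.2 • b i) ∧
        fderiv ℝ h (q.1 + q.2 • b i) (b i) < 0 := by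
      refine eventually_all.2 fun i => ?_
      have : Tendsto (fun q : V × ℝ => q.1 + q.2 • b i) (𝓝 (z, 0)) (𝓝 z) := by
        have : Continuous (fun q : V × ℝ => q.1 + q.2 • b i) := by fun_prop
        simpa using this.tendsto (z, 0)
      filter_upwards [this.eventually h1] with q hq
      exact ⟨hq.1, hq.2 i⟩
    obtain ⟨r, hr, hrb⟩ := Metric.eventually_nhds_iff_ball.1 h2
    refine ⟨b, r, r / 2, hr, by positivity, fun x hx hx0 i τ hτ => ?_⟩
    have key : ∀ s ∈ Icc 0 (r / 2), DifferentiableAt ℝ h (x + s • b i) ∧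
        fderiv ℝ h (x + s • b i) (b i) < 0 := by
      intro s hs
      refine hrb (x, s) ?_ i
      rw [← ball_prod_same]
      refine ⟨hx, ?_⟩
      simp only [Metric.mem_ball, dist_zero_right, Real.norm_eq_abs, abs_of_nonneg hs.1]
      linarith [hs.2]
    have hanti : StrictAntiOn (fun s : ℝ => h (x + s • b i)) (Icc 0 (r / 2)) := by
      have hder : ∀ s ∈ Icc 0 (r / 2), HasDerivAt (fun s : ℝ => h (x + s • b i))
          (fderiv ℝ h (x + s • b i) (b i)) s := by
        intro s hs
        have h1 : HasDerivAt (fun s : ℝ => x + s • b i) (b i) s := by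
          simpa using ((hasDerivAt_id s).smul_const (b i)).const_add x
        exact (key s hs).1.hasFDerivAt.comp_hasDerivAt s h1
      refine strictAntiOn_of_deriv_neg (convex_Icc _ _)
        (fun s hs => (hder s hs).continuousAt.continuousWithinAt) fun s hs => ?_
      rw [interior_Icc] at hs
      rw [(hder s (Ioo_subset_Icc_self hs)).deriv]
      exact (key s (Ioo_subset_Icc_self hs)).2
    have := hanti ⟨le_rfl, by positivity⟩ ⟨hτ.1.le, hτ.2⟩ hτ.1
    simp only [zero_smul, add_zero] at this
    linarith

end Geometry

/-! ### Local structure of smooth domains and uniqueness of the outer normal. -/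

section Domain

theorem eventually_neg_of_hasDerivAt {f : ℝ → ℝ} {c : ℝ} (hf : HasDerivAt f c 0) (h0 : f 0 = 0)
    (hc : c < 0) : ∀ᶠ τ in 𝓝[>] (0 : ℝ), f τ < 0 := by
  have h1 := (hasDerivAt_iff_tendsto_slope.1 hf).mono_left
    (nhdsWithin_mono 0 (fun x (hx : 0 < x) => hx.ne') : 𝓝[>] (0 : ℝ) ≤ 𝓝[≠] 0)
  filter_upwards [h1.eventually (gt_mem_nhds hc), self_mem_nhdsWithin] with τ hτ hτ0
  rw [slope_def_field, h0, sub_zero, sub_zero] at hτ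
  have := (div_neg_iff.1 hτ)
  rcases this with h | h
  · exact absurd h.2 (not_lt.2 (le_of_lt hτ0))
  · exact h.1

variable {N : ℕ} {Ω : Set (Euc N)}

theorem inner_gradient (φ : Euc N → ℝ) (p v : Euc N) :
    ⟪gradient φ p, v⟫_ℝ = fderiv ℝ φ p v := by
  unfold gradient
  exact InnerProductSpace.toDual_symm_apply

theorem fderiv_ne_zero_of_gradient {φ : Euc N → ℝ} {p : Euc N} (h : gradient φ p ≠ 0) :
    fderiv ℝ φ p ≠ 0 := by
  intro h0
  apply h
  unfold gradient
  rw [h0, map_zero]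

theorem continuousAt_gradient {φ : Euc N → ℝ} {p : Euc N} (h : ContDiffAt ℝ 1 φ p) :
    ContinuousAt (gradient φ) p := by
  unfold gradient
  exact (InnerProductSpace.toDual ℝ (Euc N)).symm.continuous.continuousAt.comp
    (h.continuousAt_fderiv one_ne_zero)

/-- The local description of a smooth domain and of its closure and boundary by a defining
function. -/
theorem IsBoundaryDefining.eventually {p : Euc N} {φ : Euc N → ℝ} (hΩ : IsOpen Ω)
    (hp : p ∈ frontier Ω) (h : IsBoundaryDefining Ω p φ) :
    φ p = 0 ∧ ContDiffAt ℝ 1 φ p ∧ ∀ᶠ x in 𝓝 p, (x ∈ Ω ↔ φ x < 0) ∧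
      (x ∈ closure Ω ↔ φ x ≤ 0) ∧ (x ∈ frontier Ω ↔ φ x = 0) ∧
      (x ∈ frontier Ω → IsBoundaryDefining Ω x φ) := by
  obtain ⟨hg, U, hU, hpU, hφ, hΩU⟩ := h
  have hmem : ∀ x ∈ U, (x ∈ Ω ↔ φ x < 0) := fun x hx => by
    have := Set.ext_iff.1 hΩU x
    simpa [hx] using this
  have hcd : ∀ x ∈ U, ContDiffAt ℝ 1 φ x := fun x hx =>
    (hφ.contDiffAt (hU.mem_nhds hx)).of_le (by simp)
  have hcl : ∀ x ∈ U, x ∈ closure Ω → φ x ≤ 0 := by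
    intro x hx hxc
    by_contra! hpos
    have : ∀ᶠ y in 𝓝 x, 0 < φ y ∧ y ∈ U :=
      ((hcd x hx).continuousAt.eventually (lt_mem_nhds hpos)).and (hU.mem_nhds hx)
    obtain ⟨y, hy, hyΩ⟩ := mem_closure_iff_nhds.1 hxc _ this
    exact absurd ((hmem y hy.2).1 hyΩ) (not_lt.2 hy.1.le)
  have hp' : p ∈ closure Ω ∧ p ∉ Ω := by rwa [hΩ.frontier_eq] at hp
  have hp0 : φ p = 0 := le_antisymm (hcl p hpU hp'.1)
    (not_lt.1 fun hlt => hp'.2 ((hmem p hpU).2 hlt))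
  refine ⟨hp0, hcd p hpU, ?_⟩
  -- The cone directions show that a point with `φ ≤ 0` is a limit of points of `Ω`, which
  -- identifies the closure and then the frontier.
  obtain ⟨b, ρ, ℓ, hρ, hℓ, hb⟩ := exists_cone (hcd p hpU)
    (Or.inr (fderiv_ne_zero_of_gradient hg)) (finrank_euclideanSpace_fin (𝕜 := ℝ) (n := N))
  have hgr : ∀ᶠ x in 𝓝 p, gradient φ x ≠ 0 :=
    (continuousAt_gradient (hcd p hpU)).eventually_ne hg
  filter_upwards [hU.mem_nhds hpU, Metric.ball_mem_nhds p hρ, hgr] with x hxU hxρ hxg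
  have hclx : x ∈ closure Ω ↔ φ x ≤ 0 := by
    refine ⟨hcl x hxU, fun hx0 => ?_⟩
    -- In dimension zero there is no direction to move in, but there no gradient is nonzero either.
    rcases isEmpty_or_nonempty (Fin N) with hE | ⟨⟨i⟩⟩
    · exact absurd (Subsingleton.elim _ _) hxg
    have ht : Tendsto (fun τ : ℝ => x + τ • b i) (𝓝[>] 0) (𝓝 x) := by
      have : Continuous (fun τ : ℝ => x + τ • b i) := by fun_prop
      simpa using (this.tendsto 0).mono_left nhdsWithin_le_nhds
    refine mem_closure_of_tendsto ht ?_
    filter_upwards [ht.eventually (hU.mem_nhds hxU), Ioc_mem_nhdsGT hℓ] with τ hτU hτ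
    exact (hmem _ hτU).2 (hb x hxρ hx0 i τ hτ)
  refine ⟨hmem x hxU, hclx, ?_, fun _ => ⟨hxg, U, hU, hxU, hφ, hΩU⟩⟩
  rw [hΩ.frontier_eq, Set.mem_sdiff, hclx, hmem x hxU, not_lt]
  exact ⟨fun h => le_antisymm h.1 h.2, fun h => ⟨h.le, h.ge⟩⟩

/-- The closure of a smooth domain satisfies a local cone condition. -/
theorem IsSmoothBoundedDomain.exists_cone (hΩ : IsSmoothBoundedDomain Ω) {p : Euc N}
    (hp : p ∈ closure Ω) : ∃ (b : Module.Basis (Fin N) ℝ (Euc N)) (ρ ℓ : ℝ), 0 < ρ ∧ 0 < ℓ ∧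
      ∀ x ∈ Metric.ball p ρ, x ∈ closure Ω → ∀ i, ∀ τ ∈ Ioc 0 ℓ, x + τ • b i ∈ Ω := by
  have hfin := finrank_euclideanSpace_fin (𝕜 := ℝ) (n := N)
  -- a local description of `Ω` as sublevel set suffices
  have key : ∀ φ : Euc N → ℝ, ContDiffAt ℝ 1 φ p → (φ p < 0 ∨ fderiv ℝ φ p ≠ 0) →
      (∀ᶠ x in 𝓝 p, (φ x < 0 → x ∈ Ω) ∧ (x ∈ closure Ω → φ x ≤ 0)) →
      ∃ (b : Module.Basis (Fin N) ℝ (Euc N)) (ρ ℓ : ℝ), 0 < ρ ∧ 0 < ℓ ∧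
      ∀ x ∈ Metric.ball p ρ, x ∈ closure Ω → ∀ i, ∀ τ ∈ Ioc 0 ℓ, x + τ • b i ∈ Ω := by
    intro φ hφ h0 hloc
    obtain ⟨b, ρ, ℓ, hρ, hℓ, hb⟩ := AllenCahn.exists_cone hφ h0 hfin
    have h2 : ∀ᶠ q : Euc N × ℝ in 𝓝 (p, 0), ∀ i, φ (q.1 + q.2 • b i) < 0 →
        q.1 + q.2 • b i ∈ Ω := by
      refine eventually_all.2 fun i => ?_
      have : Tendsto (fun q : Euc N × ℝ => q.1 + q.2 • b i) (𝓝 (p, 0)) (𝓝 p) := by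
        have : Continuous (fun q : Euc N × ℝ => q.1 + q.2 • b i) := by fun_prop
        simpa using this.tendsto (p, 0)
      filter_upwards [this.eventually hloc] with q hq using hq.1
    obtain ⟨r, hr, hrb⟩ := Metric.eventually_nhds_iff_ball.1 h2
    obtain ⟨r', hr', hrb'⟩ := Metric.eventually_nhds_iff_ball.1 hloc
    refine ⟨b, min ρ (min r r'), min ℓ (r / 2), lt_min hρ (lt_min hr hr'),
      lt_min hℓ (by positivity), fun x hx hxc i τ hτ => ?_⟩
    rw [Metric.mem_ball, lt_min_iff, lt_min_iff] at hx
    refine hrb (x, τ) ?_ i (hb x hx.1 ((hrb' x hx.2.2).2 hxc) i τ ⟨hτ.1, hτ.2.trans (min_le_left _ _)⟩)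
    rw [← ball_prod_same]
    refine ⟨hx.2.1, ?_⟩
    simp only [Metric.mem_ball, dist_zero_right, Real.norm_eq_abs, abs_of_pos hτ.1]
    linarith [hτ.2.trans (min_le_right _ _)]
  by_cases hpΩ : p ∈ Ω
  -- At an interior point the constant `-1` serves as local defining function.
  · refine key (fun _ => -1) contDiffAt_const (Or.inl (by norm_num)) ?_
    filter_upwards [hΩ.isOpen.mem_nhds hpΩ] with x hx
    exact ⟨fun _ => hx, fun _ => by norm_num⟩
  · have hpf : p ∈ frontier Ω := by rw [hΩ.isOpen.frontier_eq]; exact ⟨hp, hpΩ⟩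
    obtain ⟨φ, hφ⟩ := hΩ.smooth_boundary p hpf
    obtain ⟨-, hc, hev⟩ := hφ.eventually hΩ.isOpen hpf
    refine key φ hc (Or.inr (fderiv_ne_zero_of_gradient hφ.1)) ?_
    filter_upwards [hev] with x hx
    exact ⟨hx.1.2, hx.2.1.1⟩

/-- Each segment puts its direction into the tangent cone, and a basis of such directions spans.
This makes one-sided derivatives on `closure Ω` unique. -/
theorem uniqueDiffWithinAt_of_basis {V : Type*} [NormedAddCommGroup V] [NormedSpace ℝ V]
    {ι : Type*} (b : Module.Basis ι ℝ V) {s : Set V} {x : V} (hx : x ∈ s) {ℓ : ℝ} (hℓ : 0 < ℓ)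
    (h : ∀ i, ∀ τ ∈ Ioc 0 ℓ, x + τ • b i ∈ s) : UniqueDiffWithinAt ℝ s x := by
  refine ⟨?_, subset_closure hx⟩
  have hsub : (⊤ : Submodule ℝ V) ≤ Submodule.span ℝ (tangentConeAt ℝ s x) := by
    rw [← b.span_eq]
    refine Submodule.span_mono ?_
    rintro _ ⟨i, rfl⟩
    refine mem_tangentConeAt_of_add_smul_mem (tendsto_id'.mpr <| nhdsGT_le_nhdsNE (0 : ℝ)) ?_
    filter_upwards [Ioc_mem_nhdsGT hℓ] with τ hτ using h i τ hτ
  rw [top_le_iff.1 hsub]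
  simp

theorem IsSmoothBoundedDomain.uniqueDiffOn_closure (hΩ : IsSmoothBoundedDomain Ω) :
    UniqueDiffOn ℝ (closure Ω) := by
  intro x hx
  obtain ⟨b, ρ, ℓ, hρ, hℓ, hb⟩ := hΩ.exists_cone hx
  exact uniqueDiffWithinAt_of_basis b hx hℓ fun i τ hτ =>
    subset_closure (hb x (Metric.mem_ball_self hρ) hx i τ hτ)

/-- If two defining functions `φ`, `ψ` had different unit normals `n₁ ≠ n₂`, then along `n₂ - n₁`
the first would decrease and the second increase. Going a short way backwards and forwards would
contradict that both describe the same `Ω`; below, points `p + τ(n₂ - n₁)` with small `τ > 0` lie in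
`Ω` by the one and outside by the other. -/
theorem IsBoundaryDefining.normal_eq {p : Euc N} {φ : Euc N → ℝ} (hΩ : IsOpen Ω)
    (hp : p ∈ frontier Ω) (h : IsBoundaryDefining Ω p φ) {v : Euc N}
    (hv : IsOuterUnitNormal Ω p v) : v = ‖gradient φ p‖⁻¹ • gradient φ p := by
  obtain ⟨ψ, hψ, rfl⟩ := hv
  obtain ⟨h0, hc, hev⟩ := h.eventually hΩ hp
  obtain ⟨h0', hc', hev'⟩ := hψ.eventually hΩ hp
  by_contra hne
  set n₁ := ‖gradient φ p‖⁻¹ • gradient φ p with hn₁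
  set n₂ := ‖gradient ψ p‖⁻¹ • gradient ψ p with hn₂
  have hn₁' : ‖n₁‖ = 1 := norm_smul_inv_norm h.1
  have hn₂' : ‖n₂‖ = 1 := norm_smul_inv_norm hψ.1
  have hlt : ⟪n₁, n₂⟫_ℝ < 1 := inner_lt_one_iff_real_of_norm_eq_one hn₁' hn₂' |>.2 (Ne.symm hne)
  have hφv : fderiv ℝ φ p (n₂ - n₁) < 0 := by
    have : ⟪n₁, n₂ - n₁⟫_ℝ < 0 := by
      rw [inner_sub_right, real_inner_self_eq_norm_sq, hn₁']; linarith
    rw [hn₁, inner_smul_left, ← hn₁, inner_gradient] at this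
    exact neg_of_mul_neg_right this (by simp)
  have hψv : 0 < fderiv ℝ ψ p (n₂ - n₁) := by
    have : 0 < ⟪n₂, n₂ - n₁⟫_ℝ := by
      rw [inner_sub_right, real_inner_self_eq_norm_sq, hn₂', real_inner_comm]; linarith
    rw [hn₂, inner_smul_left, ← hn₂, inner_gradient] at this
    exact pos_of_mul_pos_right this (by simp)
  have hline : ∀ χ : Euc N → ℝ, ContDiffAt ℝ 1 χ p →
      HasDerivAt (fun τ : ℝ => χ (p + τ • (n₂ - n₁))) (fderiv ℝ χ p (n₂ - n₁)) 0 := by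
    intro χ hχ
    have h1 : HasDerivAt (fun s : ℝ => p + s • (n₂ - n₁)) (n₂ - n₁) 0 := by
      simpa using ((hasDerivAt_id (0 : ℝ)).smul_const (n₂ - n₁)).const_add p
    have h2 : HasFDerivAt χ (fderiv ℝ χ p) (p + (0 : ℝ) • (n₂ - n₁)) := by
      simpa using (hχ.differentiableAt one_ne_zero).hasFDerivAt
    exact h2.comp_hasDerivAt (0 : ℝ) h1
  have ht : Tendsto (fun τ : ℝ => p + τ • (n₂ - n₁)) (𝓝[>] 0) (𝓝 p) := by
    have : Continuous (fun τ : ℝ => p + τ • (n₂ - n₁)) := by fun_prop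
    simpa using (this.tendsto 0).mono_left nhdsWithin_le_nhds
  have e1 := eventually_neg_of_hasDerivAt (hline φ hc) (by simpa using h0) hφv
  have e2 := eventually_neg_of_hasDerivAt (hline ψ hc').neg (by simpa using h0') (by simpa using hψv)
  obtain ⟨τ, h1, h2, h3, h4⟩ :=
    (e1.and (e2.and ((ht.eventually hev).and (ht.eventually hev')))).exists
  have := h4.1.1 (h3.1.2 h1)
  simp only [Pi.neg_apply] at h2
  linarith

end Domain

/-! ### Area formula for graphs of `C¹` functions. -/

section AreaFormula

open scoped NNReal ENNReal

/-- Countably many of the given neighbourhoods cover `U`. Made disjoint, they allow the local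
inequalities to be summed with the same `c`, after which `c` tends to one. No finiteness of the
measures is needed. -/
theorem measure_le_of_locally_le {X : Type*} [TopologicalSpace X] [SecondCountableTopology X]
    [MeasurableSpace X] [OpensMeasurableSpace X] {μ ν : Measure X} {U : Set X}
    (h : ∀ x ∈ U, ∀ c : ℝ≥0, 1 < c → ∃ s ∈ 𝓝 x, ∀ E ⊆ s ∩ U, MeasurableSet E → μ E ≤ c * ν E)
    {E : Set X} (hEU : E ⊆ U) (hE : MeasurableSet E) : μ E ≤ ν E := by
  have key : ∀ c : ℝ≥0, 1 < c → μ E ≤ c * ν E := by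
    intro c hc
    choose! s hs hsE using fun x hx => h x hx c hc
    obtain ⟨t, htU, htc, ht⟩ := TopologicalSpace.countable_cover_nhdsWithin
      (f := fun x => interior (s x)) (s := U) fun x hx =>
        mem_nhdsWithin_of_mem_nhds (interior_mem_nhds.2 (hs x hx))
    rcases t.eq_empty_or_nonempty with rfl | hne
    · have : E = ∅ := by
        apply eq_empty_of_subset_empty
        simpa using hEU.trans ht
      simp [this]
    obtain ⟨x, rfl⟩ := htc.exists_eq_range hne
    set D := disjointed fun n => interior (s (x n)) with hD
    have hDm : ∀ n, MeasurableSet (D n) :=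
      MeasurableSet.disjointed fun n => isOpen_interior.measurableSet
    have hEeq : E = ⋃ n, E ∩ D n := by
      rw [← inter_iUnion, hD, iUnion_disjointed, eq_comm, inter_eq_left]
      refine hEU.trans (ht.trans ?_)
      simp
    have hdis : Pairwise (Function.onFun Disjoint fun n => E ∩ D n) := fun i j hij =>
      ((disjoint_disjointed _) hij).mono inter_subset_right inter_subset_right
    rw [hEeq, measure_iUnion hdis fun n => hE.inter (hDm n),
      measure_iUnion hdis fun n => hE.inter (hDm n), ← ENNReal.tsum_mul_left]
    refine ENNReal.tsum_le_tsum fun n => ?_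
    refine hsE (x n) (htU (mem_range_self n)) _ ?_ (hE.inter (hDm n))
    intro y hy
    exact ⟨interior_subset (disjointed_subset _ n hy.2), hEU hy.1⟩
  have ht : Tendsto (fun c : ℝ≥0 => (c : ℝ≥0∞) * ν E) (𝓝[>] 1) (𝓝 (1 * ν E)) := by
    refine ENNReal.Tendsto.mul_const ?_ (Or.inl one_ne_zero)
    exact (ENNReal.continuous_coe.tendsto 1).mono_left nhdsWithin_le_nhds
  rw [one_mul] at ht
  exact ge_of_tendsto ht (by filter_upwards [self_mem_nhdsWithin] with c hc using key c hc)

variable {V : Type*} [NormedAddCommGroup V] [InnerProductSpace ℝ V] [FiniteDimensional ℝ V]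

/-- The derivative of a graph map over the orthogonal complement of `e`. -/
def graphL (e : V) (L : (ℝ ∙ e)ᗮ →L[ℝ] ℝ) : (ℝ ∙ e)ᗮ →L[ℝ] V :=
  (ℝ ∙ e)ᗮ.subtypeL + L.smulRight e

theorem graphL_apply (e : V) (L : (ℝ ∙ e)ᗮ →L[ℝ] ℝ) (h : (ℝ ∙ e)ᗮ) :
    graphL e L h = (h : V) + L h • e := rfl

theorem inner_orthoCoordL {e : V} (he : ‖e‖ = 1) (h k : (ℝ ∙ e)ᗮ) (s t : ℝ) :
    ⟪(h : V) + s • e, (k : V) + t • e⟫_ℝ = ⟪h, k⟫_ℝ + s * t := by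
  have h1 : ⟪(h : V), e⟫_ℝ = 0 := by
    rw [real_inner_comm]; exact Submodule.mem_orthogonal_singleton_iff_inner_right.1 h.2
  have h2 : ⟪e, (k : V)⟫_ℝ = 0 := Submodule.mem_orthogonal_singleton_iff_inner_right.1 k.2
  simp [inner_add_left, inner_add_right, inner_smul_left, inner_smul_right, h1, h2, he, mul_comm]

theorem norm_le_norm_graphL {e : V} (he : ‖e‖ = 1) (L : (ℝ ∙ e)ᗮ →L[ℝ] ℝ) (h : (ℝ ∙ e)ᗮ) :
    ‖h‖ ≤ ‖graphL e L h‖ := by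
  refine le_of_sq_le_sq ?_ (norm_nonneg _)
  rw [← real_inner_self_eq_norm_sq (graphL e L h), graphL_apply, inner_orthoCoordL he,
    real_inner_self_eq_norm_sq]
  nlinarith [mul_self_nonneg (L h)]

/-- In an orthonormal basis the Gram matrix of a linear graph is the identity plus the rank-one
matrix of the products `L(bᵢ) L(bⱼ)`. The matrix determinant lemma gives `1 + ‖L‖²`. -/
theorem normDet_graphL {e : V} (he : ‖e‖ = 1) (L : (ℝ ∙ e)ᗮ →L[ℝ] ℝ) :
    (graphL e L).toLinearMap.normDet = √(1 + ‖L‖ ^ 2) := by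
  let hb := stdOrthonormalBasis ℝ (ℝ ∙ e)ᗮ
  rw [eq_comm, Real.sqrt_eq_iff_mul_self_eq (by positivity) (LinearMap.normDet_nonneg _), ← sq]
  have h1 := LinearMap.normDet_sq_eq_det_gram (graphL e L).toLinearMap hb
  rw [show ((graphL e L).toLinearMap.normDet ^ 2 : ℝ) = _ from h1]
  have hgram : Matrix.gram ℝ (fun i => (graphL e L).toLinearMap (hb i)) =
      1 + Matrix.replicateCol Unit (fun i => L (hb i)) *
        Matrix.replicateRow Unit (fun i => L (hb i)) := by
    ext i j
    rw [Matrix.gram_apply]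
    change ⟪graphL e L (hb i), graphL e L (hb j)⟫_ℝ = _
    rw [graphL_apply, graphL_apply, inner_orthoCoordL he, hb.inner_eq_ite]
    simp [Matrix.one_apply, Matrix.mul_apply]
  rw [hgram, Matrix.det_one_add_replicateCol_mul_replicateRow]
  have h2 : ‖L‖ = ‖(InnerProductSpace.toDual ℝ (ℝ ∙ e)ᗮ).symm L‖ := by simp
  rw [h2, ← hb.sum_sq_norm_inner_right]
  simp only [dotProduct]
  congr 1
  refine Finset.sum_congr rfl fun i _ => ?_
  rw [real_inner_comm, InnerProductSpace.toDual_symm_apply, Real.norm_eq_abs, sq_abs, sq]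

variable [MeasurableSpace V] [BorelSpace V]

theorem euclideanHausdorffMeasure_image_le {X Y : Type*} [MetricSpace X] [MeasurableSpace X]
    [BorelSpace X] [MetricSpace Y] [MeasurableSpace Y] [BorelSpace Y] {f : X → Y} {s : Set X}
    {K : ℝ≥0} (h : LipschitzOnWith K f s) (n : ℕ) :
    (μHE[n] : Measure Y) (f '' s) ≤ (K : ℝ≥0∞) ^ n * μHE[n] s := by
  simp_rw [Measure.euclideanHausdorffMeasure_def, Measure.smul_apply,
    Measure.nnreal_smul_coe_apply]
  have := h.hausdorffMeasure_image_le (d := n) (by positivity)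
  rw [ENNReal.rpow_natCast] at this
  calc _ ≤ _ := mul_le_mul_right this _
    _ = _ := by ring

/-- The graph map of `g` in direction `e` over the hyperplane through `p`. -/
def graphMap (p e : V) (g : (ℝ ∙ e)ᗮ → ℝ) (h : (ℝ ∙ e)ᗮ) : V := orthoCoord p e (h, g h)

theorem norm_graphL_sub_le {p e : V} (he : ‖e‖ = 1) {g : (ℝ ∙ e)ᗮ → ℝ} {L : (ℝ ∙ e)ᗮ →L[ℝ] ℝ}
    {h₀ : (ℝ ∙ e)ᗮ} (hg : HasStrictFDerivAt g L h₀) {η : ℝ} (hη : 0 < η) :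
    ∃ s ∈ 𝓝 h₀, ∀ a ∈ s, ∀ b ∈ s,
      ‖graphMap p e g a - graphMap p e g b - (graphL e L a - graphL e L b)‖ ≤
        η * ‖graphL e L a - graphL e L b‖ := by
  have h1 := hg.isLittleO.def hη
  rw [nhds_prod_eq] at h1
  obtain ⟨s, hs, hsb⟩ := mem_prod_same_iff.1 h1
  refine ⟨s, hs, fun a ha b hb => ?_⟩
  have e1 : graphMap p e g a - graphMap p e g b - (graphL e L a - graphL e L b) =
      (g a - g b - L (a - b)) • e := by
    simp only [graphMap, orthoCoord, graphL_apply, map_sub, sub_smul]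
    abel
  have e2 : graphL e L a - graphL e L b = graphL e L (a - b) := by rw [map_sub]
  rw [e1, norm_smul, he, mul_one, e2]
  exact (hsb (mk_mem_prod ha hb)).trans (mul_le_mul_of_nonneg_left (norm_le_norm_graphL he L _) hη.le)

theorem orthogonalProjection_graphL {e : V} (h : (ℝ ∙ e)ᗮ) (s : ℝ) :
    (ℝ ∙ e)ᗮ.orthogonalProjectionOnto ((h : V) + s • e) = h := by
  rw [map_add, map_smul, Submodule.orthogonalProjectionOnto_mem_subspace_eq_self,
    Submodule.orthogonalProjectionOnto_orthogonalComplement_singleton_eq_zero, smul_zero, add_zero]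

/-- Near `h₀` the graph map and its linearization differ by a relative error `η`. The maps from
tangent plane to graph and back are therefore Lipschitz with constants `1 + η` and `(1 - η)⁻¹`; both
are written through the orthogonal projection, which inverts the two parametrizations. On the
tangent plane the measure is known from linear algebra. -/
theorem measure_graph_near {p e : V} (he : ‖e‖ = 1) {g : (ℝ ∙ e)ᗮ → ℝ}
    {L : (ℝ ∙ e)ᗮ →L[ℝ] ℝ} {h₀ : (ℝ ∙ e)ᗮ} (hg : HasStrictFDerivAt g L h₀) {η : ℝ≥0}
    (hη : 0 < η) (hη1 : η < 1) :
    ∃ s ∈ 𝓝 h₀, ∀ E ⊆ s,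
      (μHE[Module.finrank ℝ (ℝ ∙ e)ᗮ] : Measure V) (graphMap p e g '' E) ≤
        ((1 + η : ℝ≥0) : ℝ≥0∞) ^ Module.finrank ℝ (ℝ ∙ e)ᗮ *
          (ENNReal.ofReal √(1 + ‖L‖ ^ 2) * volume E) ∧
      ENNReal.ofReal √(1 + ‖L‖ ^ 2) * volume E ≤
        (((1 - η)⁻¹ : ℝ≥0) : ℝ≥0∞) ^ Module.finrank ℝ (ℝ ∙ e)ᗮ *
          (μHE[Module.finrank ℝ (ℝ ∙ e)ᗮ] : Measure V) (graphMap p e g '' E) := by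
  obtain ⟨s, hs, hsb⟩ := norm_graphL_sub_le (p := p) he hg (η := η) hη
  refine ⟨s, hs, fun E hE => ?_⟩
  have hlin := LinearMap.euclideanHausdorffMeasure_image_eq_normDet_mul_volume
    (graphL e L).toLinearMap E
  rw [normDet_graphL he] at hlin
  have hproj : ∀ a, (ℝ ∙ e)ᗮ.orthogonalProjectionOnto (graphL e L a) = a := fun a =>
    orthogonalProjection_graphL a _
  have hproj' : ∀ a, (ℝ ∙ e)ᗮ.orthogonalProjectionOnto (graphMap p e g a - p) = a := fun a => by
    have : graphMap p e g a - p = (a : V) + g a • e := by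
      simp only [graphMap, orthoCoord]; abel
    rw [this]; exact orthogonalProjection_graphL a _
  constructor
  · have hL : LipschitzOnWith (1 + η)
        (fun x => graphMap p e g ((ℝ ∙ e)ᗮ.orthogonalProjectionOnto x))
        ((graphL e L).toLinearMap '' E) := by
      refine LipschitzOnWith.of_dist_le_mul ?_
      rintro _ ⟨a, ha, rfl⟩ _ ⟨b, hb, rfl⟩
      change dist (graphMap p e g ((ℝ ∙ e)ᗮ.orthogonalProjectionOnto (graphL e L a)))
        (graphMap p e g ((ℝ ∙ e)ᗮ.orthogonalProjectionOnto (graphL e L b))) ≤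
        _ * dist (graphL e L a) (graphL e L b)
      rw [hproj, hproj, dist_eq_norm, dist_eq_norm]
      have := hsb a (hE ha) b (hE hb)
      have h2 := norm_le_norm_sub_add (graphMap p e g a - graphMap p e g b)
        (graphL e L a - graphL e L b)
      push_cast
      linarith
    have := euclideanHausdorffMeasure_image_le hL (Module.finrank ℝ (ℝ ∙ e)ᗮ)
    rw [hlin, image_image] at this
    convert this using 3
    exact congrArg _ (hproj _).symm
  · have hL : LipschitzOnWith (1 - η)⁻¹
        (fun x => graphL e L ((ℝ ∙ e)ᗮ.orthogonalProjectionOnto (x - p)))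
        (graphMap p e g '' E) := by
      refine LipschitzOnWith.of_dist_le_mul ?_
      rintro _ ⟨a, ha, rfl⟩ _ ⟨b, hb, rfl⟩
      rw [hproj', hproj', dist_eq_norm, dist_eq_norm]
      have := hsb a (hE ha) b (hE hb)
      have h2 := norm_le_norm_sub_add (graphL e L a - graphL e L b)
        (graphMap p e g a - graphMap p e g b)
      rw [norm_sub_rev (graphL e L a - graphL e L b) (graphMap p e g a - graphMap p e g b)] at h2
      have h3 : ((1 - η : ℝ≥0) : ℝ) = 1 - η := NNReal.coe_sub hη1.le
      have h4 : (0 : ℝ) < 1 - η := sub_pos.2 (by exact_mod_cast hη1)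
      rw [NNReal.coe_inv, h3, inv_mul_eq_div, le_div_iff₀ h4]
      linarith
    have := euclideanHausdorffMeasure_image_le hL (Module.finrank ℝ (ℝ ∙ e)ᗮ)
    rw [image_image] at this
    rw [← hlin]
    convert this using 3
    exact congrArg _ (hproj' _).symm

theorem exists_small_nnreal (n : ℕ) {c : ℝ≥0} (hc : 1 < c) :
    ∃ η : ℝ≥0, 0 < η ∧ η < 1 ∧ (1 + η) ^ n ≤ c ∧ ((1 - η)⁻¹) ^ n ≤ c := by
  have h1 : Tendsto (fun η : ℝ≥0 => (1 + η) ^ n) (𝓝 0) (𝓝 1) := by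
    have : Continuous fun η : ℝ≥0 => (1 + η) ^ n := by fun_prop
    simpa using this.tendsto 0
  have h2 : Tendsto (fun η : ℝ≥0 => ((1 - η)⁻¹) ^ n) (𝓝 0) (𝓝 1) := by
    have h3 : Tendsto (fun η : ℝ≥0 => 1 - η) (𝓝 0) (𝓝 1) := by
      have : Continuous fun η : ℝ≥0 => 1 - η := by fun_prop
      simpa using this.tendsto 0
    have := (h3.inv₀ one_ne_zero).pow n
    simpa using this
  have h3 := ((h1.eventually (ge_mem_nhds hc)).and (h2.eventually (ge_mem_nhds hc))).and
    (gt_mem_nhds (zero_lt_one (α := ℝ≥0)))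
  obtain ⟨η, h, hη⟩ := ((h3.filter_mono (nhdsWithin_le_nhds (s := Ioi 0))).and self_mem_nhdsWithin).exists
  exact ⟨η, hη, h.2, h.1.1, h.1.2⟩

theorem graphMap_sub (p e : V) (g : (ℝ ∙ e)ᗮ → ℝ) (a : (ℝ ∙ e)ᗮ) :
    graphMap p e g a - p = (a : V) + g a • e := by
  simp only [graphMap, orthoCoord]; abel

theorem eq_orthoCoord {p e : V} (he : ‖e‖ = 1) (x : V) :
    orthoCoord p e ((ℝ ∙ e)ᗮ.orthogonalProjectionOnto (x - p), ⟪e, x - p⟫_ℝ) = x := by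
  have h := Submodule.starProjection_add_starProjection_orthogonal (K := ℝ ∙ e) (x - p)
  rw [Submodule.starProjection_unit_singleton ℝ he] at h
  rw [orthoCoord, ← Submodule.starProjection_apply, add_assoc, add_comm _ (⟪e, x - p⟫_ℝ • e), h]
  abel

theorem inner_orthoCoord_sub {p e : V} (he : ‖e‖ = 1) (h : (ℝ ∙ e)ᗮ) (s : ℝ) :
    ⟪e, orthoCoord p e (h, s) - p⟫_ℝ = s := by
  have h1 : orthoCoord p e (h, s) - p = (h : V) + s • e := by simp only [orthoCoord]; abel
  have := inner_orthoCoordL he 0 h 1 s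
  rw [h1]
  simpa using this

theorem measurableEmbedding_graphMap {p e : V} (he : ‖e‖ = 1) {g : (ℝ ∙ e)ᗮ → ℝ}
    (hgm : Measurable g) : MeasurableEmbedding (graphMap p e g) := by
  have hpm : Measurable fun x => (ℝ ∙ e)ᗮ.orthogonalProjectionOnto (x - p) :=
    ((ℝ ∙ e)ᗮ.orthogonalProjectionOnto.continuous.comp
        (continuous_id.sub continuous_const)).measurable
  refine MeasurableEmbedding.of_measurable_inverse
    ((contDiff_orthoCoord p e).continuous.measurable.comp (measurable_id.prodMk hgm)) ?_ hpm ?_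
  · have : range (graphMap p e g) =
        {x | g ((ℝ ∙ e)ᗮ.orthogonalProjectionOnto (x - p)) = ⟪e, x - p⟫_ℝ} := by
      ext x
      constructor
      · rintro ⟨a, rfl⟩
        change g ((ℝ ∙ e)ᗮ.orthogonalProjectionOnto (graphMap p e g a - p)) =
          ⟪e, orthoCoord p e (a, g a) - p⟫_ℝ
        rw [graphMap_sub, orthogonalProjection_graphL, inner_orthoCoord_sub he]
      · intro hx
        refine ⟨(ℝ ∙ e)ᗮ.orthogonalProjectionOnto (x - p), ?_⟩
        change g _ = _ at hx
        rw [graphMap, hx, eq_orthoCoord he]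
    rw [this]
    refine measurableSet_eq_fun (hgm.comp hpm) ?_
    exact (continuous_const.inner (continuous_id.sub continuous_const)).measurable
  · intro a
    change (ℝ ∙ e)ᗮ.orthogonalProjectionOnto (graphMap p e g a - p) = a
    rw [graphMap_sub]
    exact orthogonalProjection_graphL a _

/-- The area formula for graphs of `C¹` functions. -/
theorem measure_graph {p e : V} (he : ‖e‖ = 1) {g : (ℝ ∙ e)ᗮ → ℝ} (hgm : Measurable g)
    {U : Set (ℝ ∙ e)ᗮ} (hU : IsOpen U) (hg : ContDiffOn ℝ 1 g U) :
    ((μHE[Module.finrank ℝ (ℝ ∙ e)ᗮ] : Measure V).comap (graphMap p e g)).restrict U =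
      (volume.withDensity fun h => ENNReal.ofReal √(1 + ‖fderiv ℝ g h‖ ^ 2)).restrict U := by
  have hemb := measurableEmbedding_graphMap (p := p) he hgm
  set n := Module.finrank ℝ (ℝ ∙ e)ᗮ
  set J : (ℝ ∙ e)ᗮ → ℝ := fun h => √(1 + ‖fderiv ℝ g h‖ ^ 2) with hJ
  have hJpos : ∀ h, 0 < J h := fun h => Real.sqrt_pos.2 (by positivity)
  -- both measures are comparable near every point, with constants close to one
  have key : ∀ x ∈ U, ∀ c : ℝ≥0, 1 < c → ∃ s ∈ 𝓝 x, ∀ E ⊆ s ∩ U, MeasurableSet E →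
      (μHE[n] : Measure V).comap (graphMap p e g) E ≤
        c * (volume.withDensity fun h => ENNReal.ofReal (J h)) E ∧
      (volume.withDensity fun h => ENNReal.ofReal (J h)) E ≤
        c * (μHE[n] : Measure V).comap (graphMap p e g) E := by
    intro x hx c hc
    -- The constant `c` is split as `q · q`: one factor pays for the Lipschitz constants, the other
    -- for the oscillation of the density `J` near `x`.
    set q : ℝ≥0 := NNReal.sqrt c with hq
    have hq1 : 1 < q := by
      rw [hq, ← NNReal.sqrt_one]; exact NNReal.sqrt_lt_sqrt.2 hc
    have hqc : (q : ℝ≥0∞) * q = c := by rw [← ENNReal.coe_mul, hq, NNReal.mul_self_sqrt]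
    obtain ⟨η, hη, hη1, hη2, hη3⟩ := exists_small_nnreal n hq1
    have hgx : ContDiffAt ℝ 1 g x := hg.contDiffAt (hU.mem_nhds hx)
    obtain ⟨s, hs, hsE⟩ := measure_graph_near (p := p) he
      (hgx.hasStrictFDerivAt one_ne_zero) hη hη1
    have hJc : ContinuousAt J x :=
      ((continuousAt_const.add ((hgx.continuousAt_fderiv one_ne_zero).norm.pow 2)).sqrt)
    have hev1 : ∀ᶠ h in 𝓝 x, J h < q * J x :=
      hJc.eventually (gt_mem_nhds (lt_mul_of_one_lt_left (hJpos x) (by exact_mod_cast hq1)))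
    have hev2 : ∀ᶠ h in 𝓝 x, J x < q * J h :=
      (hJc.const_mul (q : ℝ)).eventually
        (lt_mem_nhds (lt_mul_of_one_lt_left (hJpos x) (by exact_mod_cast hq1)))
    refine ⟨s ∩ {h | J h < q * J x ∧ J x < q * J h}, inter_mem hs (hev1.and hev2),
      fun E hE hEm => ?_⟩
    obtain ⟨h1, h2⟩ := hsE E (hE.trans (inter_subset_left.trans inter_subset_left))
    rw [hemb.comap_apply, withDensity_apply _ hEm]
    change _ ≤ _ * (ENNReal.ofReal (J x) * volume E) at h1
    change ENNReal.ofReal (J x) * volume E ≤ _ at h2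
    have hq' : ∀ y : ℝ, 0 ≤ y → ENNReal.ofReal (q * y) = q * ENNReal.ofReal y := fun y hy => by
      rw [ENNReal.ofReal_mul (by positivity), ENNReal.ofReal_coe_nnreal]
    have h3 : ∫⁻ h in E, ENNReal.ofReal (J h) ≤ q * (ENNReal.ofReal (J x) * volume E) := by
      calc ∫⁻ h in E, ENNReal.ofReal (J h) ≤ ∫⁻ h in E, q * ENNReal.ofReal (J x) := by
            refine setLIntegral_mono measurable_const fun h hh => ?_
            rw [← hq' _ (hJpos x).le]
            exact ENNReal.ofReal_le_ofReal (hE hh).1.2.1.le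
        _ = _ := by rw [setLIntegral_const, mul_assoc]
    have h4 : ENNReal.ofReal (J x) * volume E ≤ q * ∫⁻ h in E, ENNReal.ofReal (J h) := by
      rw [← lintegral_const_mul' _ _ ENNReal.coe_ne_top, ← setLIntegral_const]
      refine setLIntegral_mono' hEm fun h hh => ?_
      rw [← hq' _ (hJpos h).le]
      exact ENNReal.ofReal_le_ofReal (hE hh).1.2.2.le
    have h5 : ((1 + η : ℝ≥0) : ℝ≥0∞) ^ n ≤ q := by exact_mod_cast hη2
    have h6 : (((1 - η)⁻¹ : ℝ≥0) : ℝ≥0∞) ^ n ≤ q := by exact_mod_cast hη3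
    constructor
    · calc _ ≤ _ := h1
        _ ≤ q * (q * ∫⁻ h in E, ENNReal.ofReal (J h)) := mul_le_mul' h5 h4
        _ = _ := by rw [← mul_assoc, hqc]
    · calc _ ≤ _ := h3
        _ ≤ q * (q * μHE[n] (graphMap p e g '' E)) :=
          mul_le_mul' le_rfl (h2.trans (mul_le_mul' h6 le_rfl))
        _ = _ := by rw [← mul_assoc, hqc]
  ext E hE
  rw [Measure.restrict_apply hE, Measure.restrict_apply hE]
  refine le_antisymm ?_ ?_
  · refine measure_le_of_locally_le (U := U) (fun x hx c hc => ?_) inter_subset_right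
      (hE.inter hU.measurableSet)
    obtain ⟨s, hs, h⟩ := key x hx c hc
    exact ⟨s, hs, fun E hE hEm => (h E hE hEm).1⟩
  · refine measure_le_of_locally_le (U := U) (fun x hx c hc => ?_) inter_subset_right
      (hE.inter hU.measurableSet)
    obtain ⟨s, hs, h⟩ := key x hx c hc
    exact ⟨s, hs, fun E hE hEm => (h E hE hEm).2⟩

/-- Integration over a graph with respect to the surface measure. -/
theorem setIntegral_graph {p e : V} (he : ‖e‖ = 1) {g : (ℝ ∙ e)ᗮ → ℝ} (hgm : Measurable g)
    {U : Set (ℝ ∙ e)ᗮ} (hU : IsOpen U) (hg : ContDiffOn ℝ 1 g U) (f : V → ℝ) :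
    ∫ x in graphMap p e g '' U, f x ∂(μHE[Module.finrank ℝ (ℝ ∙ e)ᗮ] : Measure V) =
      ∫ h in U, √(1 + ‖fderiv ℝ g h‖ ^ 2) * f (graphMap p e g h) := by
  have hemb := measurableEmbedding_graphMap (p := p) he hgm
  have h1 : (μHE[Module.finrank ℝ (ℝ ∙ e)ᗮ] : Measure V).restrict (graphMap p e g '' U) =
      ((volume.withDensity fun h => ENNReal.ofReal √(1 + ‖fderiv ℝ g h‖ ^ 2)).restrict U).map
        (graphMap p e g) := by
    rw [← measure_graph he hgm hU hg, ← hemb.injective.preimage_image U, ← hemb.restrict_map,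
      hemb.map_comap, Measure.restrict_restrict (hemb.measurableSet_image.2 hU.measurableSet),
      hemb.injective.preimage_image, inter_eq_left.2 (image_subset_range _ _)]
  rw [h1, hemb.integral_map, restrict_withDensity hU.measurableSet,
    integral_withDensity_eq_integral_toReal_smul]
  · refine integral_congr_ae (Eventually.of_forall fun h => ?_)
    simp [ENNReal.toReal_ofReal (Real.sqrt_nonneg _)]
  · exact ((measurable_const.add ((measurable_fderiv ℝ g).norm.pow_const 2)).sqrt).ennreal_ofReal
  · exact Eventually.of_forall fun h => ENNReal.ofReal_lt_top

end AreaFormula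

/-! ### Boundary charts and the fundamental theorem of calculus below a graph. -/

section LocalDivergence

variable {V : Type*} [NormedAddCommGroup V] [InnerProductSpace ℝ V] [FiniteDimensional ℝ V]
  [MeasurableSpace V] [BorelSpace V]

/-- A normal vector of a graph is proportional to `e` minus the gradient of the graph function.
Consequently the component of the unit normal along `e` is the reciprocal of the surface density,
and the two cancel in the divergence theorem. -/
theorem norm_eq_of_orthogonal_graph {e : V} (he : ‖e‖ = 1) {L : (ℝ ∙ e)ᗮ →L[ℝ] ℝ} {G : V}
    (hG : ∀ w : (ℝ ∙ e)ᗮ, ⟪G, graphL e L w⟫_ℝ = 0) (hpos : 0 < ⟪G, e⟫_ℝ) :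
    ‖G‖ = ⟪G, e⟫_ℝ * √(1 + ‖L‖ ^ 2) := by
  set c := ⟪G, e⟫_ℝ with hc
  set P := (ℝ ∙ e)ᗮ.orthogonalProjectionOnto G with hP
  have hGeq : (P : V) + c • e = G := by
    have := eq_orthoCoord (p := 0) he G
    simpa [orthoCoord, hP, hc, real_inner_comm] using this
  have hPw : ∀ w : (ℝ ∙ e)ᗮ, ⟪P, w⟫_ℝ = -c * L w := by
    intro w
    have h1 := hG w
    rw [← hGeq, graphL_apply, inner_orthoCoordL he] at h1
    linarith
  have hdual : InnerProductSpace.toDual ℝ (ℝ ∙ e)ᗮ P = (-c) • L := by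
    ext w
    simp only [InnerProductSpace.toDual_apply_apply, hPw]
    simp
  have hnP : ‖P‖ = c * ‖L‖ := by
    rw [← (InnerProductSpace.toDual ℝ (ℝ ∙ e)ᗮ).norm_map P, hdual, norm_smul, norm_neg,
      Real.norm_of_nonneg hpos.le]
  have hsq : ‖G‖ ^ 2 = (c * √(1 + ‖L‖ ^ 2)) ^ 2 := by
    rw [← real_inner_self_eq_norm_sq, ← hGeq, inner_orthoCoordL he, real_inner_self_eq_norm_sq,
      hnP, mul_pow c, mul_pow, Real.sq_sqrt (show 0 ≤ 1 + ‖L‖ ^ 2 by positivity)]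
    ring
  exact (pow_left_inj₀ (norm_nonneg _) (by positivity) two_ne_zero).1 hsq

theorem injective_orthoCoord {p e : V} (he : ‖e‖ = 1) : Function.Injective (orthoCoord p e) := by
  rintro ⟨h, s⟩ ⟨k, t⟩ hq
  have h1 : s = t := by
    rw [← inner_orthoCoord_sub (p := p) he h s, hq, inner_orthoCoord_sub he]
  subst h1
  simp only [orthoCoord, add_left_inj, add_right_inj] at hq
  rw [Subtype.ext hq]

theorem norm_orthoCoord_sub_sq {p e : V} (he : ‖e‖ = 1) (h : (ℝ ∙ e)ᗮ) (s : ℝ) :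
    ‖orthoCoord p e (h, s) - p‖ ^ 2 = ‖h‖ ^ 2 + s ^ 2 := by
  have h1 : orthoCoord p e (h, s) - p = (h : V) + s • e := by simp only [orthoCoord]; abel
  rw [h1, ← real_inner_self_eq_norm_sq, inner_orthoCoordL he, real_inner_self_eq_norm_sq]
  ring

theorem measurePreserving_orthoCoord {p e : V} (he : ‖e‖ = 1) :
    MeasurePreserving (orthoCoord p e) volume volume := by
  have h1 := ((ℝ ∙ e).measurePreserving_measurableEquivProd p).symm
  rw [InnerProductSpace.euclideanHausdorffMeasure_eq_volume] at h1
  have h2 : MeasurePreserving (Prod.map (LinearIsometryEquiv.toSpanUnitSingleton (𝕜 := ℝ) e he)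
      (id : (ℝ ∙ e)ᗮ → (ℝ ∙ e)ᗮ)) (volume.prod volume) (volume.prod volume) :=
    (LinearIsometryEquiv.measurePreserving _).prod (MeasurePreserving.id _)
  have h3 : MeasurePreserving (Prod.swap : (ℝ ∙ e)ᗮ × ℝ → ℝ × (ℝ ∙ e)ᗮ)
    (volume.prod volume) (volume.prod volume) := Measure.measurePreserving_swap
  have h4 := h1.comp (h2.comp h3)
  have hfun : orthoCoord p e = ⇑((ℝ ∙ e).measurableEquivProd p).symm ∘
      Prod.map (⇑(LinearIsometryEquiv.toSpanUnitSingleton (𝕜 := ℝ) e he)) id ∘ Prod.swap := by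
    funext q
    simp [orthoCoord, LinearIsometryEquiv.toSpanUnitSingleton_apply]
    abel
  rw [hfun]
  exact h4

theorem measurableEmbedding_orthoCoord {p e : V} (he : ‖e‖ = 1) :
    MeasurableEmbedding (orthoCoord p e) :=
  (contDiff_orthoCoord p e).continuous.measurableEmbedding (injective_orthoCoord he)

theorem finrank_orthogonal_span {e : V} (he : ‖e‖ = 1) :
    Module.finrank ℝ (ℝ ∙ e)ᗮ = Module.finrank ℝ V - 1 := by
  have h1 := (ℝ ∙ e).finrank_add_finrank_orthogonal
  rw [finrank_span_singleton (by rintro rfl; simp at he)] at h1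
  omega

/-- The fundamental theorem of calculus in the direction of `e` on the region below a graph. -/
theorem setIntegral_below_graph {p e : V} (he : ‖e‖ = 1) {g : (ℝ ∙ e)ᗮ → ℝ} {B : Set (ℝ ∙ e)ᗮ}
    (hB : MeasurableSet B) (hg : Measurable g) {κ : ℝ} (hκ : ∀ h ∈ B, |g h| < κ)
    {f : V → ℝ} {f' : V → ℝ}
    (hf : ∀ h ∈ B, ContinuousOn (fun s => f (orthoCoord p e (h, s))) (Icc (-κ) (g h)))
    (hf' : ∀ h ∈ B, ∀ s ∈ Ioo (-κ) (g h),
      HasDerivAt (fun s => f (orthoCoord p e (h, s))) (f' (orthoCoord p e (h, s))) s)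
    (h0 : ∀ h ∈ B, f (orthoCoord p e (h, -κ)) = 0)
    (hint : IntegrableOn f'
      (orthoCoord p e '' {q : (ℝ ∙ e)ᗮ × ℝ | q.1 ∈ B ∧ q.2 ∈ Ioo (-κ) (g q.1)})) :
    ∫ x in orthoCoord p e '' {q : (ℝ ∙ e)ᗮ × ℝ | q.1 ∈ B ∧ q.2 ∈ Ioo (-κ) (g q.1)}, f' x =
      ∫ h in B, f (graphMap p e g h) := by
  set D : Set ((ℝ ∙ e)ᗮ × ℝ) := {q | q.1 ∈ B ∧ q.2 ∈ Ioo (-κ) (g q.1)} with hD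
  have hDm : MeasurableSet D := by
    refine (measurable_fst hB).inter ?_
    exact (measurableSet_lt measurable_const measurable_snd).inter
      (measurableSet_lt measurable_snd (hg.comp measurable_fst))
  have hmp := measurePreserving_orthoCoord (p := p) he
  have hme := measurableEmbedding_orthoCoord (p := p) he
  rw [hmp.setIntegral_image_emb hme]
  have hintD : IntegrableOn (fun q => f' (orthoCoord p e q)) D := by
    rw [← hme.injective.preimage_image D]
    exact (hmp.integrableOn_comp_preimage hme).2 hint
  rw [← integral_indicator hDm]
  rw [← integrable_indicator_iff hDm] at hintD
  have hvol : (volume : Measure ((ℝ ∙ e)ᗮ × ℝ)) = volume.prod volume := rfl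
  rw [hvol] at hintD ⊢
  rw [integral_prod _ hintD, ← integral_indicator hB]
  refine integral_congr_ae ?_
  filter_upwards [hintD.prod_right_ae] with h hh
  by_cases hhB : h ∈ B
  · have e1 : (fun s => D.indicator (fun q => f' (orthoCoord p e q)) (h, s)) =
        (Ioo (-κ) (g h)).indicator fun s => f' (orthoCoord p e (h, s)) := by
      ext s
      by_cases hs : s ∈ Ioo (-κ) (g h)
      · rw [indicator_of_mem hs, indicator_of_mem (show (h, s) ∈ D from ⟨hhB, hs⟩)]
      · rw [indicator_of_notMem hs, indicator_of_notMem (fun hq : (h, s) ∈ D => hs hq.2)]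
    rw [e1] at hh ⊢
    rw [integrable_indicator_iff measurableSet_Ioo] at hh
    rw [integral_indicator measurableSet_Ioo, indicator_of_mem hhB]
    have hle : -κ ≤ g h := (neg_lt_of_abs_lt (hκ h hhB)).le
    rw [← integral_Ioc_eq_integral_Ioo, ← intervalIntegral.integral_of_le hle,
      intervalIntegral.integral_eq_sub_of_hasDerivAt_of_le hle (hf h hhB) (hf' h hhB), h0 h hhB,
      sub_zero]
    · rfl
    · rw [intervalIntegrable_iff_integrableOn_Ioo_of_le hle]
      exact hh
  · have e1 : (fun s => D.indicator (fun q => f' (orthoCoord p e q)) (h, s)) = fun _ => 0 := by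
      ext s
      rw [indicator_of_notMem (fun hq : (h, s) ∈ D => hhB hq.1)]
    rw [e1, indicator_of_notMem hhB]
    simp

variable {N : ℕ} {Ω : Set (Euc N)}

/-- A boundary chart of a smooth domain: near a boundary point, `Ω` is the region below the graph
of a `C¹` function, and `⟪ν, e⟫` is the reciprocal of the surface density of the graph. -/
theorem exists_boundary_chart (hΩ : IsOpen Ω) {ν : Euc N → Euc N}
    (hν : ∀ x ∈ frontier Ω, IsOuterUnitNormal Ω x (ν x)) {p e : Euc N} (hp : p ∈ frontier Ω)
    (he : ‖e‖ = 1) (hpe : 0 < ⟪ν p, e⟫_ℝ) :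
    ∃ (g : (ℝ ∙ e)ᗮ → ℝ) (ρ κ : ℝ), 0 < ρ ∧ 0 < κ ∧ Measurable g ∧
      ContDiffOn ℝ 1 g (Metric.ball 0 ρ) ∧ (∀ h ∈ Metric.ball 0 ρ, |g h| < κ) ∧
      (∀ h ∈ Metric.ball 0 ρ, ∀ s ∈ Icc (-κ) κ,
        (orthoCoord p e (h, s) ∈ Ω ↔ s < g h) ∧
        (orthoCoord p e (h, s) ∈ closure Ω ↔ s ≤ g h) ∧
        (orthoCoord p e (h, s) ∈ frontier Ω ↔ s = g h)) ∧
      (∀ h ∈ Metric.ball 0 ρ, √(1 + ‖fderiv ℝ g h‖ ^ 2) * ⟪ν (graphMap p e g h), e⟫_ℝ = 1) := by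
  obtain ⟨φ, hφ, hνp⟩ := hν p hp
  obtain ⟨h0, hc, hev⟩ := hφ.eventually hΩ hp
  have hpos : 0 < fderiv ℝ φ p e := by
    rw [hνp, inner_smul_left, inner_gradient] at hpe
    exact pos_of_mul_pos_right hpe (by simp)
  obtain ⟨g, ρ, κ, hρ, hκ, hg0, hgc, hgκ, hgr⟩ := exists_graph hc h0 hpos hev
  set B : Set (ℝ ∙ e)ᗮ := Metric.ball 0 ρ with hB
  -- Nothing is known about the implicit function outside the ball. Setting it to zero there makes
  -- it measurable everywhere, as required for Fubini's theorem and the area formula.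
  have heq : EqOn (B.indicator g) g B := fun h hh => indicator_of_mem hh g
  have hgc' : ContDiffOn ℝ 1 (B.indicator g) B := hgc.congr heq
  have hmem : ∀ h ∈ B, ∀ s ∈ Icc (-κ) κ,
        (orthoCoord p e (h, s) ∈ Ω ↔ s < g h) ∧
        (orthoCoord p e (h, s) ∈ closure Ω ↔ s ≤ g h) ∧
        (orthoCoord p e (h, s) ∈ frontier Ω ↔ s = g h) := by
    intro h hh s hs
    obtain ⟨h1, -, -, h3, h4⟩ := hgr h hh s hs
    refine ⟨h1.1.trans h3, ?_, h1.2.2.1.trans h4⟩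
    rw [h1.2.1, le_iff_lt_or_eq, le_iff_lt_or_eq, h3, h4]
  refine ⟨B.indicator g, ρ, κ, hρ, hκ, ?_, hgc', ?_, ?_, ?_⟩
  · classical
    rw [← piecewise_eq_indicator]
    exact hgc.continuousOn.measurable_piecewise continuousOn_const
      Metric.isOpen_ball.measurableSet
  · intro h hh; rw [heq hh]; exact hgκ h hh
  · intro h hh; rw [heq hh]; exact hmem h hh
  · intro h hh
    have hfd : fderiv ℝ (B.indicator g) h = fderiv ℝ g h :=
      (heq.eventuallyEq_of_mem (Metric.isOpen_ball.mem_nhds hh)).fderiv_eq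
    have hgm : graphMap p e (B.indicator g) h = graphMap p e g h := by
      simp only [graphMap, heq hh]
    rw [hfd, hgm]
    have hgs : g h ∈ Icc (-κ) κ := abs_le.1 (hgκ h hh).le
    obtain ⟨h1, h2, h3, -, -⟩ := hgr h hh (g h) hgs
    have hfr : graphMap p e g h ∈ frontier Ω := (hmem h hh _ hgs).2.2.2 rfl
    have hdef := h1.2.2.2 hfr
    rw [hdef.normal_eq hΩ hfr (hν _ hfr)]
    have hgd : HasFDerivAt g (fderiv ℝ g h) h :=
      ((hgc.contDiffAt (Metric.isOpen_ball.mem_nhds hh)).differentiableAt one_ne_zero).hasFDerivAt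
    have hΦ : HasFDerivAt (graphMap p e g) (graphL e (fderiv ℝ g h)) h := by
      have := (hasFDerivAt_orthoCoord p e (h, g h)).comp h ((hasFDerivAt_id h).prodMk hgd)
      exact this
    have hzero : HasFDerivAt (fun k => φ (graphMap p e g k))
        ((fderiv ℝ φ (graphMap p e g h)).comp (graphL e (fderiv ℝ g h))) h :=
      h2.hasFDerivAt.comp h hΦ
    have hzero' : HasFDerivAt (fun k => φ (graphMap p e g k)) (0 : (ℝ ∙ e)ᗮ →L[ℝ] ℝ) h := by
      refine (hasFDerivAt_const (0 : ℝ) h).congr_of_eventuallyEq ?_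
      filter_upwards [Metric.isOpen_ball.mem_nhds hh] with k hk
      exact (hgr k hk (g k) (abs_le.1 (hgκ k hk).le)).2.2.2.2.2 rfl
    -- Since `φ` vanishes along the graph, its gradient is orthogonal to every tangent vector of the
    -- graph.
    have hL := hzero.unique hzero'
    have hn := norm_eq_of_orthogonal_graph he (L := fderiv ℝ g h)
      (G := gradient φ (graphMap p e g h)) (fun w => by
        rw [inner_gradient]
        exact DFunLike.congr_fun hL w) (by rw [inner_gradient]; exact h3)
    rw [inner_smul_left, hn]
    have hc0 : ⟪gradient φ (graphMap p e g h), e⟫_ℝ ≠ 0 := by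
      rw [inner_gradient]; exact h3.ne'
    have hs0 : √(1 + ‖fderiv ℝ g h‖ ^ 2) ≠ 0 := (Real.sqrt_pos.2 (by positivity)).ne'
    simp only [conj_trivial]
    field_simp

end LocalDivergence

/-! ### The divergence theorem on bounded smooth domains. -/

section Divergence

variable {N : ℕ} {Ω : Set (Euc N)}

theorem norm_of_isOuterUnitNormal {p v : Euc N} (h : IsOuterUnitNormal Ω p v) : ‖v‖ = 1 := by
  obtain ⟨φ, hφ, rfl⟩ := h
  exact norm_smul_inv_norm hφ.1

theorem continuousOn_normal (hΩ : IsOpen Ω) {ν : Euc N → Euc N}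
    (hν : ∀ x ∈ frontier Ω, IsOuterUnitNormal Ω x (ν x)) : ContinuousOn ν (frontier Ω) := by
  intro p hp
  obtain ⟨φ, hφ, hνp⟩ := hν p hp
  obtain ⟨h0, hc, hev⟩ := hφ.eventually hΩ hp
  have hg := continuousAt_gradient hc
  have h1 : ContinuousAt (fun x => ‖gradient φ x‖⁻¹ • gradient φ x) p :=
    (hg.norm.inv₀ (norm_ne_zero_iff.2 hφ.1)).smul hg
  refine h1.continuousWithinAt.congr_of_eventuallyEq ?_ hνp
  filter_upwards [mem_nhdsWithin_of_mem_nhds hev, self_mem_nhdsWithin] with x hx hxf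
  exact (hx.2.2.2 hxf).normal_eq hΩ hxf (hν x hxf)

/-- Points near `p` have small orthogonal coordinates. -/
theorem eventually_coord {p e : Euc N} {s : Set (ℝ ∙ e)ᗮ} (hs : s ∈ 𝓝 0) {κ : ℝ} (hκ : 0 < κ) :
    ∀ᶠ x in 𝓝 p, (ℝ ∙ e)ᗮ.orthogonalProjectionOnto (x - p) ∈ s ∧
      ⟪e, x - p⟫_ℝ ∈ Ioo (-κ) κ := by
  have h1 : Tendsto (fun x => (ℝ ∙ e)ᗮ.orthogonalProjectionOnto (x - p)) (𝓝 p) (𝓝 0) := by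
    have : Continuous (fun x => (ℝ ∙ e)ᗮ.orthogonalProjectionOnto (x - p)) := by fun_prop
    simpa using this.tendsto p
  have h2 : Tendsto (fun x => ⟪e, x - p⟫_ℝ) (𝓝 p) (𝓝 0) := by
    have : Continuous (fun x => ⟪e, x - p⟫_ℝ) := by fun_prop
    simpa using this.tendsto p
  exact (h1.eventually hs).and (h2.eventually (Ioo_mem_nhds (neg_lt_zero.2 hκ) hκ))

/-- Near a boundary point `Ω` lies below a graph only in directions transversal to the boundary. A
whole basis of such directions exists, and by linearity these suffice for the divergence theorem. -/
theorem exists_boundary_direction {n : Euc N} (hn : ‖n‖ = 1) :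
    ∃ b : Module.Basis (Fin N) ℝ (Euc N), ∀ i, ‖b i‖ = 1 ∧ 0 < ⟪n, b i⟫_ℝ := by
  have hne : -(innerSL ℝ n) ≠ 0 := by
    intro h
    have := DFunLike.congr_fun h n
    simp [hn] at this
  obtain ⟨b, hb⟩ := exists_basis_neg (-(innerSL ℝ n)) hne
    (finrank_euclideanSpace_fin (𝕜 := ℝ) (n := N))
  have hb0 : ∀ i, ‖b i‖⁻¹ ≠ 0 := fun i => inv_ne_zero (norm_ne_zero_iff.2 (b.ne_zero i))
  refine ⟨b.isUnitSMul (w := fun i => ‖b i‖⁻¹) fun i => (hb0 i).isUnit, fun i => ?_⟩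
  rw [Module.Basis.isUnitSMul_apply]
  refine ⟨norm_smul_inv_norm (b.ne_zero i), ?_⟩
  rw [inner_smul_right]
  have h1 : 0 < ⟪n, b i⟫_ℝ := by simpa using hb i
  exact mul_pos (inv_pos.2 (norm_pos_iff.2 (b.ne_zero i))) h1

theorem finrank_orthogonal_euc {e : Euc N} (he : ‖e‖ = 1) :
    Module.finrank ℝ (ℝ ∙ e)ᗮ = N - 1 := by
  rw [finrank_orthogonal_span he, finrank_euclideanSpace_fin]

/-- The boundary of a bounded smooth domain has finite surface measure. -/
theorem IsSmoothBoundedDomain.measure_frontier_lt_top (hΩ : IsSmoothBoundedDomain Ω) :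
    (μHE[N - 1] : Measure (Euc N)) (frontier Ω) < ⊤ := by
  have hcomp : IsCompact (frontier Ω) :=
    hΩ.isBounded.isCompact_closure.of_isClosed_subset isClosed_frontier frontier_subset_closure
  have hν : ∀ x ∈ frontier Ω, ∃ v, IsOuterUnitNormal Ω x v := fun x hx => by
    obtain ⟨φ, hφ⟩ := hΩ.smooth_boundary x hx
    exact ⟨_, φ, hφ, rfl⟩
  choose! ν hν using hν
  refine hcomp.measure_lt_top_of_nhdsWithin fun p hp => ?_
  have he : ‖ν p‖ = 1 := norm_of_isOuterUnitNormal (hν p hp)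
  obtain ⟨g, ρ, κ, hρ, hκ, hgm, hgc, hgκ, hgr, -⟩ := exists_boundary_chart hΩ.isOpen hν hp he
    (by rw [real_inner_self_eq_norm_sq, he]; norm_num)
  have hg0 : HasStrictFDerivAt g (fderiv ℝ g 0) 0 :=
    (hgc.contDiffAt (Metric.ball_mem_nhds _ hρ)).hasStrictFDerivAt one_ne_zero
  obtain ⟨s, hs, hsE⟩ := measure_graph_near (p := p) he hg0 (η := 1 / 2) (by norm_num)
    (by rw [div_lt_one] <;> norm_num)
  have hev := eventually_coord (p := p) (inter_mem hs (Metric.ball_mem_nhds _ hρ)) hκ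
  refine ⟨_, mem_nhdsWithin_of_mem_nhds hev |> fun h => inter_mem h self_mem_nhdsWithin, ?_⟩
  have hsub : {x | (ℝ ∙ ν p)ᗮ.orthogonalProjectionOnto (x - p) ∈ s ∩ Metric.ball 0 ρ ∧
      ⟪ν p, x - p⟫_ℝ ∈ Ioo (-κ) κ} ∩ frontier Ω ⊆
      graphMap p (ν p) g '' (s ∩ Metric.ball 0 ρ) := by
    rintro x ⟨⟨h1, h2⟩, h3⟩
    refine ⟨_, h1, ?_⟩
    have h4 := (hgr _ h1.2 _ (Ioo_subset_Icc_self h2)).2.2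
    rw [eq_orthoCoord he] at h4
    rw [graphMap, ← h4.1 h3, eq_orthoCoord he]
  refine (measure_mono hsub).trans_lt ?_
  have h5 := (hsE (s ∩ Metric.ball 0 ρ) inter_subset_left).1
  rw [finrank_orthogonal_euc he] at h5
  refine h5.trans_lt ?_
  refine ENNReal.mul_lt_top (ENNReal.pow_lt_top ENNReal.coe_lt_top)
    (ENNReal.mul_lt_top ENNReal.ofReal_lt_top ?_)
  exact (measure_mono inter_subset_right).trans_lt measure_ball_lt_top

theorem IsSmoothBoundedDomain.volume_frontier (hΩ : IsSmoothBoundedDomain Ω) (hN : 1 ≤ N) :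
    volume (frontier Ω) = 0 := by
  have h := Measure.euclideanHausdorffMeasure_zero_or_top (show N - 1 < N by omega) (frontier Ω)
  rw [EuclideanSpace.euclideanHausdorffMeasure_eq_volume] at h
  exact h.resolve_right hΩ.measure_frontier_lt_top.ne

/-- `f` is continuously differentiable up to the boundary of `Ω`, with derivative `f'`. -/
structure HasC1Closure {F : Type*} [NormedAddCommGroup F] [NormedSpace ℝ F]
    (Ω : Set (Euc N)) (f : Euc N → F) (f' : Euc N → Euc N →L[ℝ] F) : Prop where
  cont : ContinuousOn f (closure Ω)
  cont' : ContinuousOn f' (closure Ω)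
  deriv : ∀ x ∈ Ω, HasFDerivAt f (f' x) x

theorem integrableOn_of_continuousOn_closure {F : Type*} [NormedAddCommGroup F]
    (hb : Bornology.IsBounded Ω) {f : Euc N → F} (hf : ContinuousOn f (closure Ω)) :
    IntegrableOn f Ω :=
  (hf.integrableOn_compact hb.isCompact_closure).mono_set subset_closure

theorem integrableOn_frontier (hΩ : IsSmoothBoundedDomain Ω) {f : Euc N → ℝ}
    (hf : ContinuousOn f (frontier Ω)) :
    IntegrableOn f (frontier Ω) (μHE[N - 1] : Measure (Euc N)) := by
  have hcomp : IsCompact (frontier Ω) :=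
    hΩ.isBounded.isCompact_closure.of_isClosed_subset isClosed_frontier frontier_subset_closure
  obtain ⟨C, hC⟩ := hcomp.exists_bound_of_continuousOn hf
  refine ⟨hf.aestronglyMeasurable isClosed_frontier.measurableSet,
    HasFiniteIntegral.restrict_of_bounded C hΩ.measure_frontier_lt_top ?_⟩
  exact (ae_restrict_iff' isClosed_frontier.measurableSet).2 (Eventually.of_forall hC)

/-- The fundamental theorem of calculus in a chart of `Ω` for functions supported near `p`. -/
theorem setIntegral_chart (hΩ : IsOpen Ω) {p e : Euc N} (he : ‖e‖ = 1) {g : (ℝ ∙ e)ᗮ → ℝ}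
    {ρ κ r : ℝ} (hgm : Measurable g) (hgκ : ∀ h ∈ Metric.ball 0 ρ, |g h| < κ)
    (hgr : ∀ h ∈ Metric.ball 0 ρ, ∀ s ∈ Icc (-κ) κ, (s < g h → orthoCoord p e (h, s) ∈ Ω) ∧
      (s ≤ g h → orthoCoord p e (h, s) ∈ closure Ω))
    (hr : 0 < r) (hrκ : 2 * r ≤ κ)
    (hsub : Ω ∩ Metric.ball p (2 * r) ⊆
      orthoCoord p e '' {q : (ℝ ∙ e)ᗮ × ℝ | q.1 ∈ Metric.ball 0 ρ ∧ q.2 ∈ Ioo (-κ) (g q.1)})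
    {f : Euc N → ℝ} {f' : Euc N → Euc N →L[ℝ] ℝ} (hf : HasC1Closure Ω f f')
    (hb : Bornology.IsBounded Ω)
    (h0 : ∀ x ∈ closure Ω, x ∉ Metric.ball p r → f x = 0) :
    ∫ x in Ω, f' x e = ∫ h in Metric.ball 0 ρ, f (graphMap p e g h) := by
  set D := orthoCoord p e '' {q : (ℝ ∙ e)ᗮ × ℝ | q.1 ∈ Metric.ball 0 ρ ∧ q.2 ∈ Ioo (-κ) (g q.1)}
    with hD
  have hDΩ : D ⊆ Ω := by
    rintro _ ⟨⟨h, s⟩, ⟨h1, h2⟩, rfl⟩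
    exact (hgr h h1 s ⟨h2.1.le, h2.2.le.trans (abs_lt.1 (hgκ h h1)).2.le⟩).1 h2.2
  have hint : IntegrableOn (fun x => f' x e) Ω :=
    integrableOn_of_continuousOn_closure hb (hf.cont'.clm_apply continuousOn_const)
  -- A point of `Ω` outside `D` has distance at least `2r` from `p`. There `f` vanishes in a whole
  -- neighbourhood, hence so does `f'`; this is why the ball in `hsub` is larger than the support.
  have e1 : ∫ x in Ω, f' x e = ∫ x in D, f' x e := by
    refine setIntegral_eq_of_subset_of_forall_sdiff_eq_zero (μ := volume)
      hΩ.measurableSet hDΩ ?_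
    rintro x ⟨hx, hxD⟩
    have hxb : x ∉ Metric.ball p (2 * r) := fun h => hxD (hsub ⟨hx, h⟩)
    have hz : f' x = 0 := by
      refine (hf.deriv x hx).unique ((hasFDerivAt_const (0 : ℝ) x).congr_of_eventuallyEq ?_)
      have hxc : x ∈ (Metric.closedBall p r)ᶜ := by
        simp only [Metric.mem_ball, not_lt, mem_compl_iff, Metric.mem_closedBall, not_le] at hxb ⊢
        linarith
      filter_upwards [hΩ.mem_nhds hx, Metric.isClosed_closedBall.isOpen_compl.mem_nhds hxc]
        with y hy hyc
      exact h0 y (subset_closure hy) fun h => hyc (Metric.ball_subset_closedBall h)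
    rw [hz]; rfl
  rw [e1]
  have hline : Continuous fun q : (ℝ ∙ e)ᗮ × ℝ => orthoCoord p e q :=
    (contDiff_orthoCoord p e).continuous
  refine setIntegral_below_graph (f' := fun x => f' x e) he Metric.isOpen_ball.measurableSet
    hgm hgκ ?_ ?_ ?_ (hint.mono_set hDΩ)
  · intro h hh
    refine hf.cont.comp (hline.comp (by fun_prop : Continuous fun s : ℝ => (h, s))).continuousOn ?_
    intro s hs
    exact (hgr h hh s ⟨hs.1, hs.2.trans (abs_lt.1 (hgκ h hh)).2.le⟩).2 hs.2
  · intro h hh s hs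
    have hm := (hgr h hh s ⟨hs.1.le, hs.2.le.trans (abs_lt.1 (hgκ h hh)).2.le⟩).1 hs.2
    have h1 : HasDerivAt (fun s : ℝ => orthoCoord p e (h, s)) e s := by
      unfold orthoCoord
      simpa using ((hasDerivAt_id s).smul_const e).const_add (p + (h : Euc N))
    exact (hf.deriv _ hm).comp_hasDerivAt s h1
  · intro h hh
    have hκ : 0 < κ := by linarith
    -- The bottom `s = -κ` of the chart is at distance at least `κ ≥ 2r` from `p`, outside the
    -- support of `f`.
    refine h0 _ ((hgr h hh (-κ) ⟨le_rfl, by linarith⟩).2 (neg_lt_of_abs_lt (hgκ h hh)).le) ?_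
    rw [Metric.mem_ball, dist_eq_norm, not_lt]
    refine le_of_sq_le_sq ?_ (norm_nonneg _)
    rw [norm_orthoCoord_sub_sq he]
    nlinarith [norm_nonneg h]

theorem mem_ball_coord {p e x : Euc N} (he : ‖e‖ = 1) {r : ℝ} (hx : x ∈ Metric.ball p r) :
    (ℝ ∙ e)ᗮ.orthogonalProjectionOnto (x - p) ∈ Metric.ball 0 r ∧ ⟪e, x - p⟫_ℝ ∈ Ioo (-r) r := by
  have hr : 0 < r := Metric.pos_of_mem_ball hx
  rw [Metric.mem_ball, dist_eq_norm] at hx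
  have h1 := norm_orthoCoord_sub_sq (p := p) he
    ((ℝ ∙ e)ᗮ.orthogonalProjectionOnto (x - p)) ⟪e, x - p⟫_ℝ
  rw [eq_orthoCoord he] at h1
  have h2 : ‖x - p‖ ^ 2 < r ^ 2 := pow_lt_pow_left₀ hx (norm_nonneg _) two_ne_zero
  constructor
  · rw [mem_ball_zero_iff]
    refine lt_of_pow_lt_pow_left₀ 2 hr.le ?_
    nlinarith [sq_nonneg ⟪e, x - p⟫_ℝ]
  · rw [mem_Ioo, ← abs_lt]
    refine lt_of_pow_lt_pow_left₀ 2 hr.le ?_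
    rw [sq_abs]
    nlinarith [sq_nonneg ‖(ℝ ∙ e)ᗮ.orthogonalProjectionOnto (x - p)‖]

/-- Both sides vanish because the support stays away from the boundary. For the volume integral this
is read off the chart formula with the artificial graph `s = R/4`, which lies above the support. -/
theorem local_divergence_interior (hΩ : IsOpen Ω) (hb : Bornology.IsBounded Ω) {ν : Euc N → Euc N}
    {p e : Euc N} (hp : p ∈ Ω) (he : ‖e‖ = 1) :
    ∃ r > 0, ∀ (f : Euc N → ℝ) (f' : Euc N → Euc N →L[ℝ] ℝ), HasC1Closure Ω f f' →
      (∀ x ∈ closure Ω, x ∉ Metric.ball p r → f x = 0) →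
      ∫ x in Ω, f' x e = ∫ x in frontier Ω, f x * ⟪ν x, e⟫_ℝ ∂(μHE[N - 1] : Measure (Euc N)) := by
  obtain ⟨R, hR, hRΩ⟩ := Metric.isOpen_iff.1 hΩ p hp
  refine ⟨R / 8, by positivity, fun f f' hf h0 => ?_⟩
  have hcyl : ∀ h ∈ Metric.ball (0 : (ℝ ∙ e)ᗮ) (R / 4), ∀ s ∈ Icc (-(R / 2)) (R / 2),
      orthoCoord p e (h, s) ∈ Ω := by
    intro h hh s hs
    refine hRΩ ?_
    rw [Metric.mem_ball, dist_eq_norm]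
    refine lt_of_pow_lt_pow_left₀ 2 hR.le ?_
    rw [norm_orthoCoord_sub_sq he]
    rw [mem_ball_zero_iff] at hh
    nlinarith [norm_nonneg h, hs.1, hs.2]
  have h1 := setIntegral_chart hΩ (p := p) he (g := fun _ => R / 4) (ρ := R / 4) (κ := R / 2)
    (r := R / 8) measurable_const (fun h _ => by rw [abs_of_pos (by positivity)]; linarith)
    (fun h hh s hs => ⟨fun _ => hcyl h hh s hs, fun _ => subset_closure (hcyl h hh s hs)⟩)
    (by positivity) (by linarith) ?_ hf hb h0
  · rw [h1, setIntegral_eq_zero_of_forall_eq_zero, setIntegral_eq_zero_of_forall_eq_zero]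
    · intro x hx
      rw [h0 x (frontier_subset_closure hx) fun hxb => ?_, zero_mul]
      rw [hΩ.frontier_eq] at hx
      exact hx.2 (hRΩ (Metric.ball_subset_ball (by linarith) hxb))
    · intro h hh
      refine h0 _ (subset_closure (hcyl h hh _ ⟨by linarith, by linarith⟩)) fun hxb => ?_
      have := (mem_ball_coord he hxb).2.2
      rw [graphMap, inner_orthoCoord_sub he] at this
      linarith
  · rintro x ⟨hx, hxb⟩
    have := mem_ball_coord he hxb
    refine ⟨_, ⟨?_, ?_⟩, eq_orthoCoord he x⟩
    · exact Metric.ball_subset_ball (by linarith) this.1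
    · exact ⟨by linarith [this.2.1], by linarith [this.2.2]⟩

/-- The surface density of the graph times `⟪ν, e⟫` equals one, so the boundary integral turns into
the integral over the base that the fundamental theorem of calculus produces. -/
theorem local_divergence_boundary (hΩ : IsOpen Ω) (hb : Bornology.IsBounded Ω) {ν : Euc N → Euc N}
    (hν : ∀ x ∈ frontier Ω, IsOuterUnitNormal Ω x (ν x)) {p e : Euc N} (hp : p ∈ frontier Ω)
    (he : ‖e‖ = 1) (hpe : 0 < ⟪ν p, e⟫_ℝ) :
    ∃ r > 0, ∀ (f : Euc N → ℝ) (f' : Euc N → Euc N →L[ℝ] ℝ), HasC1Closure Ω f f' →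
      (∀ x ∈ closure Ω, x ∉ Metric.ball p r → f x = 0) →
      ∫ x in Ω, f' x e = ∫ x in frontier Ω, f x * ⟪ν x, e⟫_ℝ ∂(μHE[N - 1] : Measure (Euc N)) := by
  obtain ⟨g, ρ, κ, hρ, hκ, hgm, hgc, hgκ, hgr, hJ⟩ := exists_boundary_chart hΩ hν hp he hpe
  refine ⟨min ρ κ / 2, by positivity, fun f f' hf h0 => ?_⟩
  have hmin : 2 * (min ρ κ / 2) = min ρ κ := by ring
  rw [setIntegral_chart hΩ (p := p) he hgm hgκ
    (fun h hh s hs => ⟨(hgr h hh s hs).1.2, (hgr h hh s hs).2.1.2⟩)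
    (by positivity : 0 < min ρ κ / 2) (by rw [hmin]; exact min_le_right _ _) ?_ hf hb h0]
  · have e1 : ∫ x in frontier Ω, f x * ⟪ν x, e⟫_ℝ ∂(μHE[N - 1] : Measure (Euc N)) =
        ∫ x in graphMap p e g '' Metric.ball 0 ρ, f x * ⟪ν x, e⟫_ℝ
          ∂(μHE[N - 1] : Measure (Euc N)) := by
      refine setIntegral_eq_of_subset_of_forall_sdiff_eq_zero
        (μ := (μHE[N - 1] : Measure (Euc N))) isClosed_frontier.measurableSet ?_ ?_
      · rintro _ ⟨h, hh, rfl⟩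
        exact (hgr h hh _ (abs_le.1 (hgκ h hh).le)).2.2.2 rfl
      · rintro x ⟨hx, hxg⟩
        rw [h0 x (frontier_subset_closure hx) fun hxb => hxg ?_, zero_mul]
        have h1 := mem_ball_coord he (Metric.ball_subset_ball (show min ρ κ / 2 ≤ min ρ κ by
          have : 0 < min ρ κ := by positivity
          linarith) hxb)
        have h2 := Metric.ball_subset_ball (min_le_left ρ κ) h1.1
        refine ⟨_, h2, ?_⟩
        have h3 : ⟪e, x - p⟫_ℝ ∈ Icc (-κ) κ :=
          ⟨by linarith [h1.2.1, min_le_right ρ κ], h1.2.2.le.trans (min_le_right _ _)⟩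
        have h4 := (hgr _ h2 _ h3).2.2
        rw [eq_orthoCoord he] at h4
        rw [graphMap, ← h4.1 hx, eq_orthoCoord he]
    rw [e1, ← finrank_orthogonal_euc he, setIntegral_graph he hgm Metric.isOpen_ball hgc]
    refine setIntegral_congr_fun Metric.isOpen_ball.measurableSet fun h hh => ?_
    have := hJ h hh
    change _ = √(1 + ‖fderiv ℝ g h‖ ^ 2) *
      (f (graphMap p e g h) * ⟪ν (graphMap p e g h), e⟫_ℝ)
    rw [mul_left_comm, this, mul_one]
  · rw [hmin]
    rintro x ⟨hx, hxb⟩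
    have h1 := mem_ball_coord he hxb
    have h2 := Metric.ball_subset_ball (min_le_left ρ κ) h1.1
    have h3 : ⟪e, x - p⟫_ℝ ∈ Ioo (-κ) κ :=
      ⟨by linarith [h1.2.1, min_le_right ρ κ], h1.2.2.trans_le (min_le_right _ _)⟩
    refine ⟨((ℝ ∙ e)ᗮ.orthogonalProjectionOnto (x - p), ⟪e, x - p⟫_ℝ), ⟨h2, h3.1, ?_⟩,
      eq_orthoCoord he x⟩
    have h4 := (hgr _ h2 _ (Ioo_subset_Icc_self h3)).1
    rw [eq_orthoCoord he] at h4
    exact h4.1 hx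

theorem HasC1Closure.mul {f g : Euc N → ℝ} {f' g' : Euc N → Euc N →L[ℝ] ℝ}
    (hf : HasC1Closure Ω f f') (hg : HasC1Closure Ω g g') :
    HasC1Closure Ω (fun x => f x * g x) (fun x => f x • g' x + g x • f' x) where
  cont := hf.cont.mul hg.cont
  cont' := (hf.cont.smul hg.cont').add (hg.cont.smul hf.cont')
  deriv x hx := (hf.deriv x hx).mul (hg.deriv x hx)

theorem ContDiff.hasC1Closure {f : Euc N → ℝ} (hf : ContDiff ℝ 1 f) :
    HasC1Closure Ω f (fderiv ℝ f) where
  cont := hf.continuous.continuousOn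
  cont' := (hf.continuous_fderiv one_ne_zero).continuousOn
  deriv x _ := (hf.differentiable one_ne_zero x).hasFDerivAt

/-- **Divergence theorem** on bounded smooth domains. -/
theorem IsSmoothBoundedDomain.integral_deriv (hΩ : IsSmoothBoundedDomain Ω) {ν : Euc N → Euc N}
    (hν : ∀ x ∈ frontier Ω, IsOuterUnitNormal Ω x (ν x)) {f : Euc N → ℝ}
    {f' : Euc N → Euc N →L[ℝ] ℝ} (hf : HasC1Closure Ω f f') (v : Euc N) :
    ∫ x in Ω, f' x v = ∫ x in frontier Ω, f x * ⟪ν x, v⟫_ℝ ∂(μHE[N - 1] : Measure (Euc N)) := by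
  -- Both sides are linear in the direction. The basis to be tested may therefore depend on the
  -- point near which `f` is supported.
  have hlin : ∀ (f : Euc N → ℝ) (f' : Euc N → Euc N →L[ℝ] ℝ), HasC1Closure Ω f f' →
      ∀ b : Module.Basis (Fin N) ℝ (Euc N), (∀ i, ∫ x in Ω, f' x (b i) =
        ∫ x in frontier Ω, f x * ⟪ν x, b i⟫_ℝ ∂(μHE[N - 1] : Measure (Euc N))) → ∀ v,
      ∫ x in Ω, f' x v =
        ∫ x in frontier Ω, f x * ⟪ν x, v⟫_ℝ ∂(μHE[N - 1] : Measure (Euc N)) := by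
    intro f f' hf b hb v
    rw [← b.sum_repr v]
    simp only [map_sum, map_smul, inner_sum, inner_smul_right, Finset.mul_sum, smul_eq_mul]
    rw [integral_finsetSum, integral_finsetSum]
    · refine Finset.sum_congr rfl fun i _ => ?_
      rw [integral_const_mul, hb i, ← integral_const_mul]
      refine integral_congr_ae (Eventually.of_forall fun x => ?_)
      simp only
      ring
    · intro i _
      refine integrableOn_frontier hΩ ((hf.cont.mono frontier_subset_closure).mul
        (continuousOn_const.mul ?_))
      exact (continuousOn_normal hΩ.isOpen hν).inner continuousOn_const
    · intro i _
      exact (integrableOn_of_continuousOn_closure hΩ.isBounded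
        (hf.cont'.clm_apply continuousOn_const)).const_mul _
  -- functions supported near a point
  have hloc : ∀ p ∈ closure Ω, ∃ r > 0, ∀ (f : Euc N → ℝ) (f' : Euc N → Euc N →L[ℝ] ℝ),
      HasC1Closure Ω f f' → (∀ x ∈ closure Ω, x ∉ Metric.ball p r → f x = 0) → ∀ v,
      ∫ x in Ω, f' x v =
        ∫ x in frontier Ω, f x * ⟪ν x, v⟫_ℝ ∂(μHE[N - 1] : Measure (Euc N)) := by
    intro p hp
    obtain ⟨b, hb⟩ : ∃ b : Module.Basis (Fin N) ℝ (Euc N), ∀ i, ∃ r > 0,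
        ∀ (f : Euc N → ℝ) (f' : Euc N → Euc N →L[ℝ] ℝ), HasC1Closure Ω f f' →
        (∀ x ∈ closure Ω, x ∉ Metric.ball p r → f x = 0) → ∫ x in Ω, f' x (b i) =
        ∫ x in frontier Ω, f x * ⟪ν x, b i⟫_ℝ ∂(μHE[N - 1] : Measure (Euc N)) := by
      by_cases hpΩ : p ∈ Ω
      · refine ⟨(EuclideanSpace.basisFun (Fin N) ℝ).toBasis, fun i => ?_⟩
        exact local_divergence_interior hΩ.isOpen hΩ.isBounded hpΩ (by simp)
      · have hpf : p ∈ frontier Ω := by rw [hΩ.isOpen.frontier_eq]; exact ⟨hp, hpΩ⟩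
        obtain ⟨b, hb⟩ := exists_boundary_direction
          (norm_of_isOuterUnitNormal (hν p hpf))
        exact ⟨b, fun i => local_divergence_boundary hΩ.isOpen hΩ.isBounded hν hpf
          (hb i).1 (hb i).2⟩
    choose r hr hri using hb
    obtain ⟨r₀, hr₀, hr₀i⟩ : ∃ r₀ > 0, ∀ i, r₀ ≤ r i := by
      rcases isEmpty_or_nonempty (Fin N) with h | h
      · exact ⟨1, one_pos, fun i => h.elim i⟩
      · obtain ⟨i, hi⟩ := Finite.exists_min r
        exact ⟨r i, hr i, hi⟩
    refine ⟨r₀, hr₀, fun f f' hf h0 => hlin f f' hf b fun i => hri i f f' hf fun x hx hxb => ?_⟩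
    exact h0 x hx fun h => hxb (Metric.ball_subset_ball (hr₀i i) h)
  choose! r hr hrf using hloc
  obtain ⟨t, ht, htc⟩ := hΩ.isBounded.isCompact_closure.elim_nhds_subcover
    (fun p => Metric.ball p (r p)) fun p hp => Metric.ball_mem_nhds p (hr p hp)
  obtain ⟨ψ, hψ⟩ := SmoothPartitionOfUnity.exists_isSubordinate (modelWithCornersSelf ℝ (Euc N))
    (isClosed_closure (s := Ω)) (fun p : t => Metric.ball (p : Euc N) (r p))
    (fun _ => Metric.isOpen_ball) (fun x hx => by
      obtain ⟨p, hp, hxp⟩ := mem_iUnion₂.1 (htc hx)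
      exact mem_iUnion.2 ⟨⟨p, hp⟩, hxp⟩)
  have hsum : ∀ x ∈ closure Ω, ∑ p, ψ p x = 1 := fun x hx => by
    rw [← finsum_eq_sum_of_fintype]; exact ψ.sum_eq_one hx
  have hψc : ∀ p, HasC1Closure Ω (fun x => ψ p x * f x)
      (fun x => ψ p x • f' x + f x • fderiv ℝ (ψ p) x) := fun p =>
    (ContDiff.hasC1Closure ((ψ p).contMDiff.contDiff.of_le (by simp))).mul hf
  have hpart := fun p : t => hrf p (ht p p.2) _ _ (hψc p) (fun x _ hxb => by
    have : ψ p x = 0 := by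
      by_contra hne
      exact hxb (hψ p (subset_tsupport _ hne))
    rw [this, zero_mul]) v
  -- The identity `∑ ψₚ f = f` holds on the open set `Ω`, so differentiating it there makes the
  -- derivatives of the partition of unity cancel.
  have hd : ∀ x ∈ Ω, f' x v = ∑ p, (ψ p x • f' x + f x • fderiv ℝ (ψ p) x) v := by
    intro x hx
    have h1 : HasFDerivAt (fun y => ∑ p, ψ p y * f y)
        (∑ p, (ψ p x • f' x + f x • fderiv ℝ (ψ p) x)) x :=
      HasFDerivAt.fun_sum fun p _ => (hψc p).deriv x hx
    have h2 : (fun y => ∑ p, ψ p y * f y) =ᶠ[𝓝 x] f := by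
      filter_upwards [hΩ.isOpen.mem_nhds hx] with y hy
      rw [← Finset.sum_mul, hsum y (subset_closure hy), one_mul]
    have h3 := (hf.deriv x hx).unique (h1.congr_of_eventuallyEq h2.symm)
    rw [← sum_apply, ← h3]
  have hbd : ∀ x ∈ frontier Ω, f x * ⟪ν x, v⟫_ℝ = ∑ p, ψ p x * f x * ⟪ν x, v⟫_ℝ := by
    intro x hx
    rw [← Finset.sum_mul, ← Finset.sum_mul, hsum x (frontier_subset_closure hx), one_mul]
  rw [setIntegral_congr_fun hΩ.isOpen.measurableSet hd,
    setIntegral_congr_fun isClosed_frontier.measurableSet hbd, integral_finsetSum,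
    integral_finsetSum]
  · exact Finset.sum_congr rfl fun p _ => hpart p
  · intro p _
    exact integrableOn_frontier hΩ (((hψc p).cont.mono frontier_subset_closure).mul
      ((continuousOn_normal hΩ.isOpen hν).inner continuousOn_const))
  · intro p _
    exact integrableOn_of_continuousOn_closure hΩ.isBounded
      ((hψc p).cont'.clm_apply continuousOn_const)

end Divergence

/-! ### One-sided derivatives up to the boundary and Green's formula. -/

section Regularity

variable {N m : ℕ} {Ω : Set (Euc N)} {T : ℝ}
  {F : Type*} [NormedAddCommGroup F] [NormedSpace ℝ F]

theorem hasFDerivWithinAt_slice {A : Set (Euc N)} {J : Set ℝ} {U : Euc N × ℝ → F}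
    (h : DifferentiableOn ℝ U (A ×ˢ J)) {x : Euc N} {t : ℝ} (hx : x ∈ A) (ht : t ∈ J) :
    HasFDerivWithinAt (fun y => U (y, t))
      ((fderivWithin ℝ U (A ×ˢ J) (x, t)).comp (.inl ℝ (Euc N) ℝ)) A x := by
  have h1 : HasFDerivWithinAt (fun y : Euc N => (y, t)) (.inl ℝ (Euc N) ℝ) A x :=
    (hasFDerivAt_prodMk_left x t).hasFDerivWithinAt
  exact (h (x, t) ⟨hx, ht⟩).hasFDerivWithinAt.comp x h1
    (fun _ hy => mk_mem_prod hy ht : MapsTo (fun y : Euc N => (y, t)) A (A ×ˢ J))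

theorem hasDerivWithinAt_slice {A : Set (Euc N)} {J : Set ℝ} {U : Euc N × ℝ → F}
    (h : DifferentiableOn ℝ U (A ×ˢ J)) {x : Euc N} {t : ℝ} (hx : x ∈ A) (ht : t ∈ J) :
    HasDerivWithinAt (fun τ => U (x, τ)) (fderivWithin ℝ U (A ×ˢ J) (x, t) (0, 1)) J t := by
  have h1 : HasDerivWithinAt (fun τ : ℝ => (x, τ)) ((0 : Euc N), (1 : ℝ)) J t :=
    ((hasDerivAt_const t x).prodMk (hasDerivAt_id t)).hasDerivWithinAt
  exact (h (x, t) ⟨hx, ht⟩).hasFDerivWithinAt.comp_hasDerivWithinAt t h1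
    (fun _ hy => mk_mem_prod hx hy : MapsTo (fun τ : ℝ => (x, τ)) J (A ×ˢ J))

/-- The time derivative, up to the boundary of the space-time cylinder. -/
def timeDeriv (Ω : Set (Euc N)) (T : ℝ) (u : Euc N × ℝ → F) (z : Euc N × ℝ) : F :=
  fderivWithin ℝ u (closure Ω ×ˢ Icc 0 T) z (0, 1)

/-- The Laplacian in space, up to the boundary. -/
def lapl (Ω : Set (Euc N)) (u : Euc N × ℝ → Euc m) (z : Euc N × ℝ) : Euc m :=
  ∑ i, fderivWithin ℝ (fun y => spaceDeriv Ω u (y, z.2)) (closure Ω) z.1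
    (EuclideanSpace.single i 1) (EuclideanSpace.single i 1)

theorem uniqueDiffOn_cylinder (hΩ : IsSmoothBoundedDomain Ω) (hT : 0 < T) :
    UniqueDiffOn ℝ (closure Ω ×ˢ Icc 0 T) :=
  hΩ.uniqueDiffOn_closure.prod (uniqueDiffOn_Icc hT)

variable (hΩ : IsSmoothBoundedDomain Ω) (hT : 0 < T) {u : Euc N × ℝ → Euc m} (hu : IsC2 Ω T u)
include hΩ hT hu

theorem IsC2.differentiableOn : DifferentiableOn ℝ u (closure Ω ×ˢ Icc 0 T) :=
  ContDiffOn.differentiableOn hu two_ne_zero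

theorem IsC2.hasFDerivWithinAt {x : Euc N} {t : ℝ} (hx : x ∈ closure Ω) (ht : t ∈ Icc 0 T) :
    HasFDerivWithinAt (fun y => u (y, t)) (spaceDeriv Ω u (x, t)) (closure Ω) x := by
  have h := hasFDerivWithinAt_slice (IsC2.differentiableOn hΩ hT hu) hx ht
  exact h.differentiableWithinAt.hasFDerivWithinAt

theorem IsC2.spaceDeriv_eq {x : Euc N} {t : ℝ} (hx : x ∈ closure Ω) (ht : t ∈ Icc 0 T) :
    spaceDeriv Ω u (x, t) =
      (fderivWithin ℝ u (closure Ω ×ˢ Icc 0 T) (x, t)).comp (.inl ℝ (Euc N) ℝ) :=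
  (hasFDerivWithinAt_slice (IsC2.differentiableOn hΩ hT hu) hx ht).fderivWithin
    (hΩ.uniqueDiffOn_closure x hx)

theorem IsC2.contDiffOn_fderivWithin :
    ContDiffOn ℝ 1 (fderivWithin ℝ u (closure Ω ×ˢ Icc 0 T)) (closure Ω ×ˢ Icc 0 T) :=
  ContDiffOn.fderivWithin hu (uniqueDiffOn_cylinder hΩ hT) (by norm_num)

theorem IsC2.contDiffOn_spaceDeriv :
    ContDiffOn ℝ 1 (spaceDeriv Ω u) (closure Ω ×ˢ Icc 0 T) := by
  have h1 : ContDiffOn ℝ 1 (fun z => (fderivWithin ℝ u (closure Ω ×ˢ Icc 0 T) z).comp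
      (.inl ℝ (Euc N) ℝ)) (closure Ω ×ˢ Icc 0 T) :=
    (IsC2.contDiffOn_fderivWithin hΩ hT hu).clm_comp contDiffOn_const
  exact h1.congr fun z hz => IsC2.spaceDeriv_eq hΩ hT hu hz.1 hz.2

theorem IsC2.continuousOn_timeDeriv :
    ContinuousOn (timeDeriv Ω T u) (closure Ω ×ˢ Icc 0 T) :=
  (IsC2.contDiffOn_fderivWithin hΩ hT hu).continuousOn.clm_apply continuousOn_const

theorem IsC2.hasDerivWithinAt {x : Euc N} {t : ℝ} (hx : x ∈ closure Ω) (ht : t ∈ Icc 0 T) :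
    HasDerivWithinAt (fun τ => u (x, τ)) (timeDeriv Ω T u (x, t)) (Icc 0 T) t :=
  hasDerivWithinAt_slice (IsC2.differentiableOn hΩ hT hu) hx ht

/-- Joint continuity in space and time is not visible from the slicewise second derivatives. They
are recognized as components of the derivative of `spaceDeriv Ω u` on the whole cylinder. -/
theorem IsC2.continuousOn_lapl : ContinuousOn (lapl Ω u) (closure Ω ×ˢ Icc 0 T) := by
  have h1 := IsC2.contDiffOn_spaceDeriv hΩ hT hu
  refine continuousOn_finsetSum _ fun i _ => ?_
  have h2 : ContinuousOn (fun z => ((fderivWithin ℝ (spaceDeriv Ω u) (closure Ω ×ˢ Icc 0 T) z)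
      (EuclideanSpace.single i 1, 0)) (EuclideanSpace.single i 1)) (closure Ω ×ˢ Icc 0 T) :=
    ((h1.continuousOn_fderivWithin (uniqueDiffOn_cylinder hΩ hT) le_rfl).clm_apply
      continuousOn_const).clm_apply continuousOn_const
  refine h2.congr fun z hz => ?_
  have h3 := (hasFDerivWithinAt_slice (h1.differentiableOn one_ne_zero) hz.1 hz.2).fderivWithin
    (hΩ.uniqueDiffOn_closure z.1 hz.1)
  rw [h3]
  rfl

theorem IsC2.hasFDerivWithinAt_spaceDeriv {x : Euc N} {t : ℝ} (hx : x ∈ closure Ω)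
    (ht : t ∈ Icc 0 T) :
    HasFDerivWithinAt (fun y => spaceDeriv Ω u (y, t))
      (fderivWithin ℝ (fun y => spaceDeriv Ω u (y, t)) (closure Ω) x) (closure Ω) x :=
  (hasFDerivWithinAt_slice ((IsC2.contDiffOn_spaceDeriv hΩ hT hu).differentiableOn one_ne_zero)
    hx ht).differentiableWithinAt.hasFDerivWithinAt

theorem IsC2.continuousOn_second {t : ℝ} (ht : t ∈ Icc 0 T) :
    ContinuousOn (fderivWithin ℝ (fun y => spaceDeriv Ω u (y, t)) (closure Ω)) (closure Ω) := by
  have h1 : ContDiffOn ℝ 1 (fun y => spaceDeriv Ω u (y, t)) (closure Ω) :=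
    (IsC2.contDiffOn_spaceDeriv hΩ hT hu).comp (contDiffOn_id.prodMk contDiffOn_const)
      fun _ hy => ⟨hy, ht⟩
  exact h1.continuousOn_fderivWithin hΩ.uniqueDiffOn_closure le_rfl

theorem IsC2.laplacian_eq {x : Euc N} {t : ℝ} (hx : x ∈ Ω) (ht : t ∈ Icc 0 T) :
    Laplacian.laplacian (fun y => u (y, t)) x = lapl Ω u (x, t) := by
  have hnh : ∀ y ∈ Ω, closure Ω ∈ 𝓝 y := fun y hy =>
    mem_of_superset (hΩ.isOpen.mem_nhds hy) subset_closure
  rw [InnerProductSpace.laplacian_eq_iteratedFDeriv_orthonormalBasis _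
    (EuclideanSpace.basisFun (Fin N) ℝ)]
  refine Finset.sum_congr rfl fun i _ => ?_
  rw [iteratedFDeriv_two_apply]
  have h1 : fderiv ℝ (fun y => u (y, t)) =ᶠ[𝓝 x] fun y => spaceDeriv Ω u (y, t) := by
    filter_upwards [hΩ.isOpen.mem_nhds hx] with y hy
    exact ((IsC2.hasFDerivWithinAt hΩ hT hu (subset_closure hy) ht).hasFDerivAt
      (hnh y hy)).fderiv
  rw [h1.fderiv_eq, ((IsC2.hasFDerivWithinAt_spaceDeriv hΩ hT hu (subset_closure hx)
    ht).hasFDerivAt (hnh x hx)).fderiv]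
  simp

theorem IsC2.residual_eq {W : Euc m → ℝ} {ε : ℝ} {x : Euc N} {t : ℝ} (hx : x ∈ Ω)
    (ht : t ∈ Icc 0 T) : residual T W ε u x t =
      timeDeriv Ω T u (x, t) - lapl Ω u (x, t) + (ε ^ 2)⁻¹ • gradient W (u (x, t)) := by
  rw [residual, IsC2.laplacian_eq hΩ hT hu hx ht,
    (IsC2.hasDerivWithinAt hΩ hT hu (subset_closure hx) ht).derivWithin
      (uniqueDiffOn_Icc hT t ht)]

theorem IsC2.hasC1Closure {t : ℝ} (ht : t ∈ Icc 0 T) :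
    HasC1Closure Ω (fun x => u (x, t)) (fun x => spaceDeriv Ω u (x, t)) where
  cont := (ContDiffOn.continuousOn hu).comp (continuousOn_id.prodMk continuousOn_const)
      fun _ hy => ⟨hy, ht⟩
  cont' := (IsC2.contDiffOn_spaceDeriv hΩ hT hu).continuousOn.comp
      (continuousOn_id.prodMk continuousOn_const) fun _ hy => ⟨hy, ht⟩
  deriv _ hx := (IsC2.hasFDerivWithinAt hΩ hT hu (subset_closure hx) ht).hasFDerivAt
    (mem_of_superset (hΩ.isOpen.mem_nhds hx) subset_closure)

/-- **Green's formula**. -/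
theorem IsC2.green {ν : Euc N → Euc N} (hν : ∀ x ∈ frontier Ω, IsOuterUnitNormal Ω x (ν x))
    {t : ℝ} (ht : t ∈ Icc 0 T) {w : Euc N → Euc m} {w' : Euc N → Euc N →L[ℝ] Euc m}
    (hw : HasC1Closure Ω w w') :
    ∫ x in Ω, ⟪lapl Ω u (x, t), w x⟫_ℝ =
      -(∫ x in Ω, ∑ i, ⟪spaceDeriv Ω u (x, t) (EuclideanSpace.single i 1),
          w' x (EuclideanSpace.single i 1)⟫_ℝ)
        + ∫ x in frontier Ω, ⟪spaceDeriv Ω u (x, t) (ν x), w x⟫_ℝ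
          ∂(μHE[N - 1] : Measure (Euc N)) := by
  set e : Fin N → Euc N := fun i => EuclideanSpace.single i 1 with he
  set D2 := fderivWithin ℝ (fun y => spaceDeriv Ω u (y, t)) (closure Ω) with hD2
  have hu1 := IsC2.hasC1Closure hΩ hT hu ht
  have hD2c := IsC2.continuousOn_second hΩ hT hu ht
  -- The product rule for the scalar `⟪∂ᵢu, w⟫`. The divergence theorem is applied to it in
  -- direction `eᵢ` and summed over `i`.
  set f' : Fin N → Euc N → Euc N →L[ℝ] ℝ := fun i x =>
    (innerSL ℝ (spaceDeriv Ω u (x, t) (e i))).comp (w' x) +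
      (innerSL ℝ (w x)).comp ((ContinuousLinearMap.apply ℝ (Euc m) (e i)).comp (D2 x)) with hf'
  have hf : ∀ i, HasC1Closure Ω (fun x => ⟪spaceDeriv Ω u (x, t) (e i), w x⟫_ℝ) (f' i) := by
    intro i
    refine ⟨(hu1.cont'.clm_apply continuousOn_const).inner hw.cont, ?_, fun x hx => ?_⟩
    · refine ContinuousOn.add ?_ ?_
      · exact ((innerSL ℝ).continuous.comp_continuousOn
          (hu1.cont'.clm_apply continuousOn_const)).clm_comp hw.cont'
      · exact ((innerSL ℝ).continuous.comp_continuousOn hw.cont).clm_comp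
          (continuousOn_const.clm_comp hD2c)
    · have h1 : HasFDerivAt (fun y => spaceDeriv Ω u (y, t)) (D2 x) x :=
        (IsC2.hasFDerivWithinAt_spaceDeriv hΩ hT hu (subset_closure hx) ht).hasFDerivAt
          (mem_of_superset (hΩ.isOpen.mem_nhds hx) subset_closure)
      have h2 : HasFDerivAt (fun y => spaceDeriv Ω u (y, t) (e i))
          ((ContinuousLinearMap.apply ℝ (Euc m) (e i)).comp (D2 x)) x :=
        (ContinuousLinearMap.apply ℝ (Euc m) (e i)).hasFDerivAt.comp x h1
      have h3 := h2.inner ℝ (hw.deriv x hx)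
      have h4 : f' i x = (fderivInnerCLM ℝ (spaceDeriv Ω u (x, t) (e i), w x)).comp
          (((ContinuousLinearMap.apply ℝ (Euc m) (e i)).comp (D2 x)).prod (w' x)) := by
        refine ContinuousLinearMap.ext fun v => ?_
        simp [hf', real_inner_comm]
      rw [h4]
      exact h3
  have hdiv := fun i => hΩ.integral_deriv hν (hf i) (e i)
  have hint1 : IntegrableOn (fun x => ⟪lapl Ω u (x, t), w x⟫_ℝ) Ω := by
    refine integrableOn_of_continuousOn_closure hΩ.isBounded (ContinuousOn.inner ?_ hw.cont)
    exact (IsC2.continuousOn_lapl hΩ hT hu).comp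
      (continuousOn_id.prodMk continuousOn_const) fun _ hy => ⟨hy, ht⟩
  have hint2 : IntegrableOn (fun x => ∑ i, ⟪spaceDeriv Ω u (x, t) (e i), w' x (e i)⟫_ℝ) Ω := by
    refine integrableOn_of_continuousOn_closure hΩ.isBounded ?_
    exact continuousOn_finsetSum _ fun i _ => (hu1.cont'.clm_apply continuousOn_const).inner
      (hw.cont'.clm_apply continuousOn_const)
  have hsum : ∑ i, ∫ x in Ω, f' i x (e i) =
      (∫ x in Ω, ∑ i, ⟪spaceDeriv Ω u (x, t) (e i), w' x (e i)⟫_ℝ) +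
        ∫ x in Ω, ⟪lapl Ω u (x, t), w x⟫_ℝ := by
    rw [← integral_finsetSum, ← integral_add hint2 hint1]
    · refine integral_congr_ae (Eventually.of_forall fun x => ?_)
      simp only [hf', lapl, sum_inner, ← Finset.sum_add_distrib]
      refine Finset.sum_congr rfl fun i _ => ?_
      simp [real_inner_comm, hD2, he]
    · exact fun i _ => integrableOn_of_continuousOn_closure hΩ.isBounded
        ((hf i).cont'.clm_apply continuousOn_const)
  have hbd : ∑ i, ∫ x in frontier Ω, ⟪spaceDeriv Ω u (x, t) (e i), w x⟫_ℝ * ⟪ν x, e i⟫_ℝ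
      ∂(μHE[N - 1] : Measure (Euc N)) =
      ∫ x in frontier Ω, ⟪spaceDeriv Ω u (x, t) (ν x), w x⟫_ℝ
          ∂(μHE[N - 1] : Measure (Euc N)) := by
    rw [← integral_finsetSum]
    · refine integral_congr_ae (Eventually.of_forall fun x => ?_)
      have h1 : ν x = ∑ i, ⟪ν x, e i⟫_ℝ • e i := by
        have := (EuclideanSpace.basisFun (Fin N) ℝ).sum_repr' (ν x)
        simpa [he, real_inner_comm] using this.symm
      have h2 : spaceDeriv Ω u (x, t) (ν x) =
          ∑ i, ⟪ν x, e i⟫_ℝ • spaceDeriv Ω u (x, t) (e i) := by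
        conv_lhs => rw [h1]
        simp only [map_sum, map_smul]
      simp only [h2, sum_inner, inner_smul_left]
      refine Finset.sum_congr rfl fun i _ => ?_
      simp [mul_comm]
    · exact fun i _ => integrableOn_frontier hΩ (((hf i).cont.mono frontier_subset_closure).mul
        ((continuousOn_normal hΩ.isOpen hν).inner continuousOn_const))
  rw [← hbd, ← Finset.sum_congr rfl fun i _ => hdiv i, hsum]
  ring

end Regularity

/-! ### Differentiation under the integral and the maximum principle. -/

section MaximumPrinciple

variable {N m : ℕ} {Ω : Set (Euc N)} {T : ℝ}

theorem isCompact_cylinder (hΩ : Bornology.IsBounded Ω) (T : ℝ) :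
    IsCompact (closure Ω ×ˢ Icc 0 T) :=
  hΩ.isCompact_closure.prod isCompact_Icc

theorem exists_bound_cylinder {F : Type*} [NormedAddCommGroup F] (hΩ : Bornology.IsBounded Ω)
    {f : Euc N × ℝ → F} (hf : ContinuousOn f (closure Ω ×ˢ Icc 0 T)) :
    ∃ C, ∀ x ∈ closure Ω, ∀ t ∈ Icc 0 T, ‖f (x, t)‖ ≤ C := by
  obtain ⟨C, hC⟩ := (isCompact_cylinder hΩ T).exists_bound_of_continuousOn hf
  exact ⟨C, fun x hx t ht => hC (x, t) ⟨hx, ht⟩⟩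

theorem continuousOn_slice {F : Type*} [TopologicalSpace F] {f : Euc N × ℝ → F}
    (hf : ContinuousOn f (closure Ω ×ˢ Icc 0 T)) {t : ℝ} (ht : t ∈ Icc 0 T) :
    ContinuousOn (fun x => f (x, t)) (closure Ω) :=
  hf.comp (continuousOn_id.prodMk continuousOn_const) fun _ hy => ⟨hy, ht⟩

theorem continuousOn_integral_slice (hΩo : MeasurableSet Ω) (hΩ : Bornology.IsBounded Ω)
    {f : Euc N × ℝ → ℝ} (hf : ContinuousOn f (closure Ω ×ˢ Icc 0 T)) :
    ContinuousOn (fun t => ∫ x in Ω, f (x, t)) (Icc 0 T) := by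
  obtain ⟨C, hC⟩ := exists_bound_cylinder hΩ hf
  refine continuousOn_of_dominated (bound := fun _ => C) (fun t ht => ?_) (fun t ht => ?_) ?_ ?_
  · exact (integrableOn_of_continuousOn_closure hΩ (continuousOn_slice hf ht)).1
  · exact (ae_restrict_mem hΩo).mono fun x hx => hC x (subset_closure hx) t ht
  · exact integrableOn_of_continuousOn_closure hΩ continuousOn_const
  · refine (ae_restrict_mem hΩo).mono fun x hx => ?_
    exact hf.comp (continuousOn_const.prodMk continuousOn_id)
      fun _ hy => ⟨subset_closure hx, hy⟩

theorem hasDerivAt_integral_slice (hΩo : MeasurableSet Ω) (hΩ : Bornology.IsBounded Ω)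
    {f g : Euc N × ℝ → ℝ} (hf : ContinuousOn f (closure Ω ×ˢ Icc 0 T))
    (hg : ContinuousOn g (closure Ω ×ˢ Icc 0 T))
    (hfg : ∀ x ∈ Ω, ∀ t ∈ Ioo 0 T, HasDerivAt (fun τ => f (x, τ)) (g (x, t)) t) {t : ℝ}
    (ht : t ∈ Ioo 0 T) :
    HasDerivAt (fun t => ∫ x in Ω, f (x, t)) (∫ x in Ω, g (x, t)) t := by
  obtain ⟨C, hC⟩ := exists_bound_cylinder hΩ hg
  have hsub : Ioo 0 T ⊆ Icc 0 T := Ioo_subset_Icc_self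
  refine (hasDerivAt_integral_of_dominated_loc_of_deriv_le (F := fun t x => f (x, t))
    (F' := fun t x => g (x, t)) (bound := fun _ => C) (Ioo_mem_nhds ht.1 ht.2) ?_ ?_ ?_ ?_ ?_ ?_).2
  · filter_upwards [Ioo_mem_nhds ht.1 ht.2] with τ hτ
    exact (integrableOn_of_continuousOn_closure hΩ (continuousOn_slice hf (hsub hτ))).1
  · exact integrableOn_of_continuousOn_closure hΩ (continuousOn_slice hf (hsub ht))
  · exact (integrableOn_of_continuousOn_closure hΩ (continuousOn_slice hg (hsub ht))).1
  · exact (ae_restrict_mem hΩo).mono fun x hx τ hτ => hC x (subset_closure hx) τ (hsub hτ)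
  · exact integrableOn_of_continuousOn_closure hΩ continuousOn_const
  · exact (ae_restrict_mem hΩo).mono fun x hx τ hτ => hfg x hx τ hτ

/-- At `s = 0` the two one-sided derivatives both vanish because the power is at least two. -/
theorem hasDerivAt_max_pow (n : ℕ) (hn : n ≠ 0) (s : ℝ) :
    HasDerivAt (fun s : ℝ => max s 0 ^ (n + 1)) ((n + 1) * max s 0 ^ n) s := by
  rcases lt_trichotomy s 0 with h | rfl | h
  · have h1 : (fun s : ℝ => max s 0 ^ (n + 1)) =ᶠ[𝓝 s] fun _ => (0 : ℝ) := by
      filter_upwards [Iio_mem_nhds h] with x hx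
      simp [max_eq_right (mem_Iio.1 hx).le]
    refine HasDerivAt.congr_of_eventuallyEq ?_ h1
    simpa [max_eq_right h.le, hn] using hasDerivAt_const s (0 : ℝ)
  · have h1 : HasDerivWithinAt (fun s : ℝ => max s 0 ^ (n + 1)) 0 (Ici 0) 0 := by
      have := (hasDerivAt_pow (n + 1) (0 : ℝ)).hasDerivWithinAt (s := Ici 0)
      simp only [Nat.add_sub_cancel, zero_pow hn, mul_zero] at this
      exact this.congr (fun x hx => by simp [max_eq_left (mem_Ici.1 hx)]) (by simp)
    have h2 : HasDerivWithinAt (fun s : ℝ => max s 0 ^ (n + 1)) 0 (Iic 0) 0 :=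
      (hasDerivWithinAt_const 0 (Iic 0) (0 : ℝ)).congr
        (fun x hx => by simp [max_eq_right (mem_Iic.1 hx)]) (by simp)
    simpa [hn] using (h1.union h2).hasDerivAt (by simp [Ici_union_Iic])
  · have h1 : (fun s : ℝ => max s 0 ^ (n + 1)) =ᶠ[𝓝 s] fun s => s ^ (n + 1) := by
      filter_upwards [Ioi_mem_nhds h] with x hx
      simp only [max_eq_left (mem_Ioi.1 hx).le]
    refine HasDerivAt.congr_of_eventuallyEq ?_ h1
    simpa [max_eq_left h.le] using hasDerivAt_pow (n + 1) s

theorem closure_cylinder (hT : 0 < T) : closure (Ω ×ˢ Ioo 0 T) = closure Ω ×ˢ Icc 0 T := by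
  rw [closure_prod_eq, closure_Ioo hT.ne]

theorem norm_le_on_closure {F : Type*} [NormedAddCommGroup F] (hT : 0 < T)
    {f : Euc N × ℝ → F} (hf : ContinuousOn f (closure Ω ×ˢ Icc 0 T)) {A : ℝ}
    (hA : ∀ x ∈ Ω, ∀ t ∈ Ioo 0 T, ‖f (x, t)‖ ≤ A) {x : Euc N} (hx : x ∈ closure Ω) {t : ℝ}
    (ht : t ∈ Icc 0 T) : ‖f (x, t)‖ ≤ A := by
  have h1 : MapsTo (fun z => ‖f z‖) (Ω ×ˢ Ioo 0 T) (Iic A) := fun z hz => hA z.1 hz.1 z.2 hz.2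
  have h2 := h1.closure_of_continuousOn (by rw [closure_cylinder hT]; exact hf.norm)
  rw [closure_cylinder hT, isClosed_Iic.closure_eq] at h2
  exact h2 (mk_mem_prod hx ht)

theorem continuousOn_smulRight {X : Type*} [TopologicalSpace X] {s : Set X}
    {c : X → Euc N →L[ℝ] ℝ} {w : X → Euc m} (hc : ContinuousOn c s) (hw : ContinuousOn w s) :
    ContinuousOn (fun x => (c x).smulRight (w x)) s :=
  (isBoundedBilinearMap_smulRight (𝕜 := ℝ) (E := Euc N) (F := Euc m)).continuous.comp_continuousOn
    (hc.prodMk hw)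

/-- This provides the test function of the maximum principle. Squaring the positive part makes it
continuously differentiable across the level `‖v‖² = k`. -/
theorem HasC1Closure.max_sq_smul {v : Euc N → Euc m} {v' : Euc N → Euc N →L[ℝ] Euc m}
    (hv : HasC1Closure Ω v v') (k : ℝ) :
    HasC1Closure Ω (fun x => (max (‖v x‖ ^ 2 - k) 0 ^ 2) • v x)
      (fun x => (max (‖v x‖ ^ 2 - k) 0 ^ 2) • v' x +
        ((2 * max (‖v x‖ ^ 2 - k) 0) • (2 • (innerSL ℝ (v x)).comp (v' x))).smulRight (v x)) := by
  have hq : ContinuousOn (fun x => max (‖v x‖ ^ 2 - k) 0) (closure Ω) :=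
    ((hv.cont.norm.pow 2).sub continuousOn_const).sup continuousOn_const
  refine ⟨(hq.pow 2).smul hv.cont, ?_, fun x hx => ?_⟩
  · refine ((hq.pow 2).smul hv.cont').add (continuousOn_smulRight ?_ hv.cont)
    refine (continuousOn_const.mul hq).smul ?_
    exact (((innerSL ℝ).continuous.comp_continuousOn hv.cont).clm_comp hv.cont').const_smul 2
  · have h1 := hv.deriv x hx
    have h2 : HasFDerivAt (fun x => ‖v x‖ ^ 2 - k) (2 • (innerSL ℝ (v x)).comp (v' x)) x :=
      h1.norm_sq.sub_const k
    have h3 := (hasDerivAt_max_pow 1 one_ne_zero (‖v x‖ ^ 2 - k)).comp_hasFDerivAt x h2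
    have h4 := h3.smul h1
    norm_num at h4
    exact h4

/-- Testing the equation with `q² u`, `q = (|u|² - k²)₊`, shows that `∫ q³` does not increase: the
boundary term vanishes by the Neumann condition, the gradient term has a sign, and so has the
reaction term wherever `q ≠ 0`. The integral starts at zero and hence stays zero. -/
theorem IsSolution.norm_le (hΩ : IsSmoothBoundedDomain Ω) (hT : 0 < T) {ν : Euc N → Euc N}
    (hν : ∀ x ∈ frontier Ω, IsOuterUnitNormal Ω x (ν x)) {W : Euc m → ℝ}
    {ε : ℝ} {u₀ : Euc N → Euc m} {u : Euc N × ℝ → Euc m} (hu : IsSolution Ω ν T W ε u₀ u)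
    {k : ℝ} (hk : 0 ≤ k) (hout : ∀ p, k ≤ ‖p‖ → 0 ≤ ⟪p, gradient W p⟫_ℝ)
    (h0 : ∀ x ∈ Ω, ‖u₀ x‖ ≤ k) {x : Euc N} (hx : x ∈ closure Ω) {t : ℝ} (ht : t ∈ Icc 0 T) :
    ‖u (x, t)‖ ≤ k := by
  have hC := hu.isC2
  have hc : ContinuousOn u (closure Ω ×ˢ Icc 0 T) := ContDiffOn.continuousOn hC
  have hct := IsC2.continuousOn_timeDeriv hΩ hT hC
  have hΩm := hΩ.isOpen.measurableSet
  have hsub : Ioo 0 T ⊆ Icc 0 T := Ioo_subset_Icc_self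
  set q : Euc N × ℝ → ℝ := fun z => max (‖u z‖ ^ 2 - k ^ 2) 0 with hq
  have hqc : ContinuousOn q (closure Ω ×ˢ Icc 0 T) :=
    ((hc.norm.pow 2).sub continuousOn_const).sup continuousOn_const
  have hq0 : ∀ z, 0 ≤ q z := fun z => le_max_right _ _
  -- The factor six is three from the cube and two from differentiating `|u|²`.
  set g : Euc N × ℝ → ℝ := fun z => 6 * ⟪timeDeriv Ω T u z, q z ^ 2 • u z⟫_ℝ with hg
  have hgc : ContinuousOn g (closure Ω ×ˢ Icc 0 T) :=
    continuousOn_const.mul (hct.inner ((hqc.pow 2).smul hc))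
  have hderiv : ∀ t ∈ Ioo 0 T,
      HasDerivAt (fun t => ∫ x in Ω, q (x, t) ^ 3) (∫ x in Ω, g (x, t)) t := by
    intro t ht
    refine hasDerivAt_integral_slice (f := fun z => q z ^ 3) hΩm hΩ.isBounded (hqc.pow 3) hgc
      (fun x hx t ht => ?_) ht
    have h1 := (IsC2.hasDerivWithinAt hΩ hT hC (subset_closure hx) (hsub ht)).hasDerivAt
      (Icc_mem_nhds ht.1 ht.2)
    have h2 := (hasDerivAt_max_pow 2 two_ne_zero (‖u (x, t)‖ ^ 2 - k ^ 2)).comp t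
      (h1.norm_sq.sub_const (k ^ 2))
    refine h2.congr_deriv ?_
    simp only [hg, hq, inner_smul_right, real_inner_comm (u (x, t))]
    push_cast
    ring
  have hneg : ∀ t ∈ Ioo 0 T, ∫ x in Ω, g (x, t) ≤ 0 := by
    intro t ht
    have hw := (IsC2.hasC1Closure hΩ hT hC (hsub ht)).max_sq_smul (k ^ 2)
    have hgreen := IsC2.green hΩ hT hC hν (hsub ht) hw
    have hbd : ∫ x in frontier Ω, ⟪spaceDeriv Ω u (x, t) (ν x),
        (max (‖u (x, t)‖ ^ 2 - k ^ 2) 0 ^ 2) • u (x, t)⟫_ℝ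
          ∂(μHE[N - 1] : Measure (Euc N)) = 0 := by
      refine setIntegral_eq_zero_of_forall_eq_zero fun x hx => ?_
      rw [hu.neumann x hx t ht, inner_zero_left]
    rw [hbd, add_zero] at hgreen
    -- Each summand equals `q² |∂ᵢu|² + 4 q ⟪u, ∂ᵢu⟫²`.
    have hsum : 0 ≤ ∫ x in Ω, ∑ i, ⟪spaceDeriv Ω u (x, t) (EuclideanSpace.single i 1),
        ((max (‖u (x, t)‖ ^ 2 - k ^ 2) 0 ^ 2) • spaceDeriv Ω u (x, t) +
        ((2 * max (‖u (x, t)‖ ^ 2 - k ^ 2) 0) • (2 • (innerSL ℝ (u (x, t))).comp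
          (spaceDeriv Ω u (x, t)))).smulRight (u (x, t)))
          (EuclideanSpace.single i 1)⟫_ℝ := by
      refine integral_nonneg fun x => Finset.sum_nonneg fun i _ => ?_
      set d := spaceDeriv Ω u (x, t) (EuclideanSpace.single i 1) with hd
      have h1 : 0 ≤ max (‖u (x, t)‖ ^ 2 - k ^ 2) 0 := le_max_right _ _
      simp only [add_apply, smul_apply,
        ContinuousLinearMap.smulRight_apply, ContinuousLinearMap.comp_apply, innerSL_apply_apply,
        ← hd, inner_add_right, inner_smul_right, smul_eq_mul, real_inner_self_eq_norm_sq,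
        nsmul_eq_mul, real_inner_comm d]
      have h2 := mul_nonneg h1 (mul_self_nonneg ⟪d, u (x, t)⟫_ℝ)
      have h3 := mul_nonneg (sq_nonneg (max (‖u (x, t)‖ ^ 2 - k ^ 2) 0)) (sq_nonneg ‖d‖)
      push_cast
      nlinarith
    have hlap : IntegrableOn (fun x => ⟪lapl Ω u (x, t), q (x, t) ^ 2 • u (x, t)⟫_ℝ) Ω :=
      integrableOn_of_continuousOn_closure hΩ.isBounded <| continuousOn_slice
        (f := fun z => ⟪lapl Ω u z, q z ^ 2 • u z⟫_ℝ)
        ((IsC2.continuousOn_lapl hΩ hT hC).inner ((hqc.pow 2).smul hc)) (hsub ht)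
    have hle : ∫ x in Ω, g (x, t) ≤ ∫ x in Ω, 6 * ⟪lapl Ω u (x, t), q (x, t) ^ 2 • u (x, t)⟫_ℝ := by
      refine setIntegral_mono_on (integrableOn_of_continuousOn_closure hΩ.isBounded
        (continuousOn_slice hgc (hsub ht))) (hlap.const_mul 6) hΩm fun x hx => ?_
      have h1 := hu.pde x hx t ht
      rw [IsC2.residual_eq hΩ hT hC hx (hsub ht)] at h1
      have h2 : timeDeriv Ω T u (x, t) =
          lapl Ω u (x, t) - (ε ^ 2)⁻¹ • gradient W (u (x, t)) := by
        rw [← sub_eq_zero, ← h1]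
        abel
      simp only [hg, h2, inner_sub_left, inner_smul_left, inner_smul_right]
      -- The outward condition on `∇W` is available for `|u| ≥ k` only, and below that level the
      -- test function is zero.
      have h3 : 0 ≤ q (x, t) ^ 2 * ⟪gradient W (u (x, t)), u (x, t)⟫_ℝ := by
        rcases le_or_gt k ‖u (x, t)‖ with h | h
        · rw [real_inner_comm]
          exact mul_nonneg (sq_nonneg _) (hout _ h)
        · have : q (x, t) = 0 := by
            simp only [hq]
            exact max_eq_right (by nlinarith [norm_nonneg (u (x, t))])
          simp [this]
      have h4 : 0 ≤ (ε ^ 2)⁻¹ := by positivity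
      have h5 := mul_nonneg h4 h3
      simp only [conj_trivial]
      nlinarith
    rw [integral_const_mul (6 : ℝ) fun x => ⟪lapl Ω u (x, t), q (x, t) ^ 2 • u (x, t)⟫_ℝ] at hle
    have h6 : ∫ x in Ω, ⟪lapl Ω u (x, t), q (x, t) ^ 2 • u (x, t)⟫_ℝ ≤ 0 := by
      refine hgreen.trans_le ?_
      linarith
    linarith
  have hanti : AntitoneOn (fun t => ∫ x in Ω, q (x, t) ^ 3) (Icc 0 T) := by
    refine antitoneOn_of_deriv_nonpos (convex_Icc 0 T)
      (continuousOn_integral_slice (f := fun z => q z ^ 3) hΩm hΩ.isBounded (hqc.pow 3)) ?_ ?_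
    · rw [interior_Icc]
      exact fun t ht => (hderiv t ht).differentiableAt.differentiableWithinAt
    · rw [interior_Icc]
      intro t ht
      rw [(hderiv t ht).deriv]
      exact hneg t ht
  have hzero : ∀ t ∈ Icc 0 T, ∫ x in Ω, q (x, t) ^ 3 = 0 := by
    intro t ht
    refine le_antisymm ?_ (integral_nonneg fun x => pow_nonneg (hq0 _) 3)
    refine (hanti (left_mem_Icc.2 hT.le) ht ht.1).trans (le_of_eq ?_)
    refine setIntegral_eq_zero_of_forall_eq_zero fun x hx => ?_
    have h1 := h0 x hx
    have : q (x, 0) = 0 := by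
      simp only [hq, hu.initial x hx]
      exact max_eq_right (by nlinarith [norm_nonneg (u₀ x)])
    simp [this]
  refine norm_le_on_closure hT hc (fun x hx t ht => ?_) hx ht
  have ht' := hsub ht
  have hqt := (continuousOn_slice (f := fun z => q z ^ 3) (hqc.pow 3) ht')
  have h1 := (setIntegral_eq_zero_iff_of_nonneg_ae
    (Eventually.of_forall fun x => pow_nonneg (hq0 (x, t)) 3)
    (integrableOn_of_continuousOn_closure hΩ.isBounded hqt)).1 (hzero t ht')
  have h2 := Measure.eqOn_open_of_ae_eq h1 hΩ.isOpen (hqt.mono subset_closure)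
    continuousOn_const hx
  have h3 : q (x, t) = 0 := by simpa using h2
  have h4 : ‖u (x, t)‖ ^ 2 - k ^ 2 ≤ 0 := h3 ▸ le_max_left _ _
  nlinarith [norm_nonneg (u (x, t))]

end MaximumPrinciple

/-! ### A Gagliardo-Nirenberg type inequality in one Lipschitz chart. -/

section ChartInequality

/-- A bound for the measure of images of all subsets says that the image measure is dominated by a
multiple of the pushforward. This replaces a change of variables formula and needs no Jacobian. -/
theorem lintegral_image_le {X Y : Type*} [MeasurableSpace X] [MeasurableSpace Y] {μ : Measure X}
    {ν : Measure Y} {f : X → Y} {B : Set X} (hB : MeasurableSet B)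
    (hf : AEMeasurable f (μ.restrict B)) {C : ENNReal}
    (h : ∀ E ⊆ B, ν (f '' E) ≤ C * μ E) (g : Y → ENNReal) :
    ∫⁻ y in f '' B, g y ∂ν ≤ C * ∫⁻ x in B, g (f x) ∂μ := by
  have hle : ν.restrict (f '' B) ≤ C • Measure.map f (μ.restrict B) := by
    refine Measure.le_iff.2 fun E hE => ?_
    rw [Measure.restrict_apply hE, Measure.smul_apply, Measure.map_apply_of_aemeasurable hf hE,
      Measure.restrict_apply' hB, inter_comm, ← image_inter_preimage, inter_comm, smul_eq_mul]
    exact h _ inter_subset_right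
  calc ∫⁻ y in f '' B, g y ∂ν ≤ ∫⁻ y, g y ∂(C • Measure.map f (μ.restrict B)) :=
        lintegral_mono' hle le_rfl
    _ = C * ∫⁻ y, g y ∂(Measure.map f (μ.restrict B)) := by
        rw [lintegral_smul_measure, smul_eq_mul]
    _ ≤ _ := by gcongr; exact lintegral_map_le _ _

/-- With the supremum metric the `N`-dimensional Hausdorff measure is exactly Lebesgue measure, and
passing from the Euclidean to the supremum norm does not increase distances. The Lipschitz bound for
Hausdorff measures therefore applies without a normalizing constant. -/
theorem volume_image_le_of_lipschitz_pi {ι : Type*} [Fintype ι] {N : ℕ}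
    (hN : Fintype.card ι = N) {f : (ι → ℝ) → Euc N} {B : Set (ι → ℝ)} {L : NNReal}
    (hf : LipschitzOnWith L f B) : volume (f '' B) ≤ (L : ENNReal) ^ (N : ℝ) * volume B := by
  have h1 : volume (f '' B) ≤ volume ((fun x : Euc N => WithLp.ofLp x) '' (f '' B)) := by
    have h := (PiLp.volume_preserving_ofLp (Fin N)).measure_preimage_equiv
      (f := (MeasurableEquiv.toLp 2 (Fin N → ℝ)).symm)
    rw [← h]
    exact measure_mono (subset_preimage_image _ _)
  have h2 : LipschitzOnWith L ((fun x : Euc N => WithLp.ofLp x) ∘ f) B := by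
    simpa using (PiLp.lipschitzWith_ofLp 2 (fun _ : Fin N => ℝ)).comp_lipschitzOnWith hf
  have h3 := h2.hausdorffMeasure_image_le (d := N) (Nat.cast_nonneg N)
  rw [image_comp] at h3
  have h4 : (μH[(N : ℝ)] : Measure (Fin N → ℝ)) = volume := by
    simpa using hausdorffMeasure_pi_real (ι := Fin N)
  have h5 : (μH[(N : ℝ)] : Measure (ι → ℝ)) = volume := by
    simpa [hN] using hausdorffMeasure_pi_real (ι := ι)
  rw [h4, h5] at h3
  exact h1.trans h3

/-- In this direction the comparison of the two norms costs a factor `√N` in the Lipschitz constant.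
-/
theorem volume_image_le_of_lipschitz_euc {ι : Type*} [Fintype ι] {N : ℕ}
    (hN : Fintype.card ι = N) {f : Euc N → (ι → ℝ)} {B : Set (Euc N)} {L : NNReal}
    (hf : LipschitzOnWith L f B) :
    volume (f '' B) ≤ ((L * NNReal.sqrt N : NNReal) : ENNReal) ^ (N : ℝ) * volume B := by
  set A : Set (Fin N → ℝ) := WithLp.ofLp '' B with hA
  have hBA : WithLp.toLp 2 '' A = B := by
    rw [hA, ← image_comp]
    simp
  have h1 : volume A = volume B := by
    have h := (PiLp.volume_preserving_ofLp (Fin N)).measure_preimage_equiv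
      (f := (MeasurableEquiv.toLp 2 (Fin N → ℝ)).symm) A
    rw [← h]
    congr 1
    exact preimage_image_eq _ (WithLp.ofLp_injective 2)
  have h2 : LipschitzOnWith (L * NNReal.sqrt N) (f ∘ WithLp.toLp 2) A := by
    have h := (PiLp.lipschitzWith_toLp 2 (fun _ : Fin N => ℝ)).lipschitzOnWith (s := A)
    have h' := (LipschitzOnWith.comp (t := B) hf h fun z hz => hBA ▸ mem_image_of_mem _ hz)
    simpa [NNReal.sqrt_eq_rpow] using h'
  have h3 := h2.hausdorffMeasure_image_le (d := N) (Nat.cast_nonneg N)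
  rw [image_comp, hBA] at h3
  have h4 : (μH[(N : ℝ)] : Measure (Fin N → ℝ)) = volume := by
    simpa using hausdorffMeasure_pi_real (ι := Fin N)
  have h5 : (μH[(N : ℝ)] : Measure (ι → ℝ)) = volume := by
    simpa [hN] using hausdorffMeasure_pi_real (ι := ι)
  rwa [h4, h5, h1] at h3

/-- Integrate the derivative of `(1 - τ/ℓ)‖V‖^γ` over the segment. The linear cutoff removes the far
end, so no boundary condition on `V` is needed, and its derivative produces `‖V‖^γ/ℓ`, which `‖V‖ ≤
H` absorbs. The condition `γ > 1` makes `‖·‖^γ` differentiable at zero. -/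
theorem norm_rpow_le_integral {E : Type*} [NormedAddCommGroup E] [InnerProductSpace ℝ E]
    {γ ℓ a : ℝ} (hγ : 1 < γ) (hℓ : 0 < ℓ) (ha : 1 ≤ a) {V : ℝ → E} {H : ℝ → ℝ}
    (hV : ContinuousOn V (Icc 0 ℓ)) (hH : ContinuousOn H (Icc 0 ℓ))
    (hVH : ∀ τ ∈ Icc 0 ℓ, ‖V τ‖ ≤ H τ)
    (hd : ∀ τ ∈ Ioo 0 ℓ, ∃ d, HasDerivAt V d τ ∧ ‖d‖ ≤ a * H τ) :
    ‖V 0‖ ^ γ ≤ (1 / ℓ + γ) * a * ∫ τ in (0 : ℝ)..ℓ, ‖V τ‖ ^ (γ - 1) * H τ := by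
  choose! d hd1 hd2 using hd
  have hcpow : ∀ s : ℝ, 0 ≤ s → ContinuousOn (fun τ => ‖V τ‖ ^ s) (Icc 0 ℓ) := fun s hs =>
    hV.norm.rpow_const fun _ _ => Or.inr hs
  have hint : ContinuousOn (fun τ => (1 / ℓ + γ) * a * (‖V τ‖ ^ (γ - 1) * H τ)) (Icc 0 ℓ) :=
    continuousOn_const.mul ((hcpow _ (by linarith)).mul hH)
  have hmain := intervalIntegral.sub_le_integral_of_hasDeriv_right_of_le (a := 0) (b := ℓ)
    (g := fun τ => -((1 - τ / ℓ) * ‖V τ‖ ^ γ))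
    (g' := fun τ => -((-(1 / ℓ)) * ‖V τ‖ ^ γ +
      (1 - τ / ℓ) * ((γ * ‖V τ‖ ^ (γ - 2)) * ⟪V τ, d τ⟫_ℝ)))
    (φ := fun τ => (1 / ℓ + γ) * a * (‖V τ‖ ^ (γ - 1) * H τ)) hℓ.le ?_ ?_ ?_ ?_
  · rw [intervalIntegral.integral_const_mul] at hmain
    simpa [hℓ.ne'] using hmain
  · exact ((continuousOn_const.sub (continuousOn_id.div_const ℓ)).mul
      (hcpow γ (by linarith))).neg
  · intro τ hτ
    have h1 : HasDerivAt (fun τ => ‖V τ‖ ^ γ) ((γ * ‖V τ‖ ^ (γ - 2)) * ⟪V τ, d τ⟫_ℝ) τ := by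
      have h := (hasFDerivAt_norm_rpow (V τ) hγ).comp_hasDerivAt τ (hd1 τ hτ)
      simp only [smul_apply, innerSL_apply_apply, smul_eq_mul] at h
      exact h
    have h2 : HasDerivAt (fun τ : ℝ => 1 - τ / ℓ) (-(1 / ℓ)) τ :=
      ((hasDerivAt_id τ).div_const ℓ).const_sub 1
    exact (h2.mul h1).neg.hasDerivWithinAt
  · exact hint.integrableOn_Icc
  · intro τ hτ
    have hτ' := Ioo_subset_Icc_self hτ
    have hv := norm_nonneg (V τ)
    have hVH' := hVH τ hτ'
    have hH0 : 0 ≤ H τ := hv.trans hVH'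
    have h1 : ‖V τ‖ ^ γ ≤ ‖V τ‖ ^ (γ - 1) * H τ := by
      have : ‖V τ‖ ^ γ = ‖V τ‖ ^ (γ - 1) * ‖V τ‖ := by
        rw [← Real.rpow_add_one' hv (by linarith)]
        congr 1
        ring
      rw [this]
      gcongr
    have h2 : -(‖V τ‖ ^ (γ - 2) * ⟪V τ, d τ⟫_ℝ) ≤ ‖V τ‖ ^ (γ - 1) * (a * H τ) := by
      rcases eq_or_ne (V τ) 0 with h0 | h0
      · have : 0 ≤ ‖V τ‖ ^ (γ - 1) * (a * H τ) := by positivity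
        simpa [h0] using this
      · have h3 : ‖V τ‖ ^ (γ - 1) = ‖V τ‖ ^ (γ - 2) * ‖V τ‖ := by
          rw [← Real.rpow_add_one (norm_ne_zero_iff.2 h0)]
          congr 1
          ring
        rw [h3, ← mul_neg, mul_assoc]
        gcongr
        calc -⟪V τ, d τ⟫_ℝ ≤ |⟪V τ, d τ⟫_ℝ| := neg_le_abs _
          _ ≤ ‖V τ‖ * ‖d τ‖ := abs_real_inner_le_norm _ _
          _ ≤ ‖V τ‖ * (a * H τ) := by gcongr; exact hd2 τ hτ
    have h4 : 0 ≤ 1 - τ / ℓ := by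
      rw [sub_nonneg, div_le_one hℓ]; exact hτ.2.le
    have h5 : 1 - τ / ℓ ≤ 1 := by
      have := div_nonneg hτ.1.le hℓ.le
      linarith
    have h6 : 0 ≤ ‖V τ‖ ^ (γ - 1) * H τ := by positivity
    have h7 : (1 - τ / ℓ) * (γ * -(‖V τ‖ ^ (γ - 2) * ⟪V τ, d τ⟫_ℝ)) ≤
        γ * (‖V τ‖ ^ (γ - 1) * (a * H τ)) := by
      have h8 : 0 ≤ γ * (‖V τ‖ ^ (γ - 1) * (a * H τ)) := by positivity
      calc _ ≤ (1 - τ / ℓ) * (γ * (‖V τ‖ ^ (γ - 1) * (a * H τ))) := by gcongr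
        _ ≤ _ := mul_le_of_le_one_left h8 h5
    have h9 : 1 / ℓ * ‖V τ‖ ^ γ ≤ 1 / ℓ * (a * (‖V τ‖ ^ (γ - 1) * H τ)) := by
      gcongr
      exact h1.trans (le_mul_of_one_le_left h6 ha)
    show -((-(1 / ℓ)) * ‖V τ‖ ^ γ + (1 - τ / ℓ) * ((γ * ‖V τ‖ ^ (γ - 2)) * ⟪V τ, d τ⟫_ℝ)) ≤
      (1 / ℓ + γ) * a * (‖V τ‖ ^ (γ - 1) * H τ)
    nlinarith [h7, h9]

/-- The value of `‖V‖^γ` at `z` is bounded by a line integral in each of the `n` coordinate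
directions. The product of these bounds, to the power `1/(n-1)`, is integrated with the grid-lines
inequality. The constants `a i` enter only through their product, which later confines the loss to a
single `ε⁻¹`. -/
theorem lintegral_rpow_pi_le {ι : Type*} [Fintype ι] [DecidableEq ι] (hι : 2 ≤ Fintype.card ι)
    {E : Type*} [NormedAddCommGroup E] [InnerProductSpace ℝ E]
    {γ ℓ : ℝ} (hγ : 1 < γ) (hℓ : 0 < ℓ) {a : ι → ℝ} (ha : ∀ i, 1 ≤ a i) {B₀ B : Set (ι → ℝ)}
    (hB₀ : MeasurableSet B₀) (hB : MeasurableSet B) {V : (ι → ℝ) → E} {H : (ι → ℝ) → ℝ}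
    (hV : ContinuousOn V B) (hH : ContinuousOn H B) (hVH : ∀ z ∈ B, ‖V z‖ ≤ H z)
    (hseg : ∀ z ∈ B₀, ∀ i, ∀ τ ∈ Icc 0 ℓ, z + τ • Pi.single i 1 ∈ B)
    (hd : ∀ z ∈ B₀, ∀ i, ∀ τ ∈ Ioo 0 ℓ, ∃ d,
      HasDerivAt (fun τ : ℝ => V (z + τ • Pi.single i 1)) d τ ∧
        ‖d‖ ≤ a i * H (z + τ • Pi.single i 1)) :
    ∫⁻ z in B₀, ENNReal.ofReal (‖V z‖ ^ (γ * (Fintype.card ι / (Fintype.card ι - 1)))) ≤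
      ENNReal.ofReal (∏ i, (1 / ℓ + γ) * a i) ^ (1 / (Fintype.card ι - 1 : ℝ)) *
      (∫⁻ z in B, ENNReal.ofReal (‖V z‖ ^ (γ - 1) * H z)) ^
        ((Fintype.card ι : ℝ) / (Fintype.card ι - 1)) := by
  set n : ℝ := ((Fintype.card ι : ℕ) : ℝ) with hn
  have hn2 : 2 ≤ n := by rw [hn]; exact_mod_cast hι
  set r : ℝ := 1 / (n - 1) with hr
  have hr0 : 0 ≤ r := by rw [hr]; apply div_nonneg zero_le_one; linarith
  have hp : n / (n - 1) = n * r := by rw [hr]; ring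
  set f : (ι → ℝ) → ℝ := fun z => ‖V z‖ ^ (γ - 1) * H z with hf
  have hfc : ContinuousOn f B :=
    (hV.norm.rpow_const fun _ _ => Or.inr (by linarith)).mul hH
  -- The extension by zero allows whole coordinate lines in the grid-lines inequality, although only
  -- segments of length `ℓ` inside `B` are used.
  set F : (ι → ℝ) → ENNReal := B.indicator fun z => ENNReal.ofReal (f z) with hF
  have hFm : Measurable F := by
    classical
    rw [hF, ← piecewise_eq_indicator]
    exact (ENNReal.continuous_ofReal.comp_continuousOn hfc).measurable_piecewise
      continuousOn_const hB
  have hgrid := lintegral_prod_lintegral_pow_le (fun _ : ι => (volume : Measure ℝ))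
    (p := n / (n - 1)) (by
      have := Real.HolderConjugate.conjExponent (p := n) (by linarith)
      simpa [Real.conjExponent] using this) hFm
  have hFint : ∫⁻ z, F z ∂(Measure.pi fun _ : ι => (volume : Measure ℝ)) =
      ∫⁻ z in B, ENNReal.ofReal (f z) := by
    rw [← volume_pi, hF, lintegral_indicator hB]
  rw [hFint] at hgrid
  have hpt : ∀ z ∈ B₀, ∀ i, ENNReal.ofReal (‖V z‖ ^ γ) ≤
      ENNReal.ofReal ((1 / ℓ + γ) * a i) * ∫⁻ τ, F (Function.update z i τ) := by
    intro z hz i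
    have hup : ∀ τ : ℝ, Function.update z i (z i + τ) = z + τ • Pi.single i (1 : ℝ) := by
      intro τ
      ext j
      rcases eq_or_ne j i with rfl | hj
      · simp
      · simp [hj]
    have hpath : ContinuousOn (fun τ : ℝ => z + τ • Pi.single i (1 : ℝ)) (Icc 0 ℓ) := by fun_prop
    have h1 := norm_rpow_le_integral (V := fun τ : ℝ => V (z + τ • Pi.single i (1 : ℝ)))
      (H := fun τ : ℝ => H (z + τ • Pi.single i (1 : ℝ))) hγ hℓ (ha i)
      (hV.comp hpath fun τ hτ => hseg z hz i τ hτ) (hH.comp hpath fun τ hτ => hseg z hz i τ hτ)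
      (fun τ hτ => hVH _ (hseg z hz i τ hτ)) (hd z hz i)
    have hca : 0 ≤ (1 / ℓ + γ) * a i := by
      have := ha i
      positivity
    simp only [zero_smul, add_zero] at h1
    refine (ENNReal.ofReal_le_ofReal h1).trans ?_
    rw [ENNReal.ofReal_mul hca]
    gcongr
    rw [intervalIntegral.integral_of_le hℓ.le, ofReal_integral_eq_lintegral_ofReal]
    · rw [← lintegral_add_left_eq_self (fun τ => F (Function.update z i τ)) (z i)]
      refine (setLIntegral_mono' measurableSet_Ioc fun τ hτ => ?_).trans (setLIntegral_le_lintegral _ _)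
      rw [hup, hF, indicator_of_mem (hseg z hz i τ ⟨hτ.1.le, hτ.2⟩)]
    · exact ((hfc.comp hpath fun τ hτ => hseg z hz i τ hτ).integrableOn_Icc).mono_set
        Ioc_subset_Icc_self
    · refine (ae_restrict_mem measurableSet_Ioc).mono fun τ hτ => ?_
      have := hVH _ (hseg z hz i τ ⟨hτ.1.le, hτ.2⟩)
      have h0 := (norm_nonneg _).trans this
      simp only [Pi.zero_apply]
      positivity
  have hpow : ∀ z ∈ B₀, ENNReal.ofReal (‖V z‖ ^ (γ * (n / (n - 1)))) ≤
      ENNReal.ofReal (∏ i, (1 / ℓ + γ) * a i) ^ r *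
        ∏ i, (∫⁻ τ, F (Function.update z i τ)) ^ r := by
    intro z hz
    have h1 : ENNReal.ofReal (‖V z‖ ^ (γ * (n / (n - 1)))) =
        ∏ _i : ι, ENNReal.ofReal (‖V z‖ ^ γ) ^ r := by
      rw [Finset.prod_const, Finset.card_univ, ← ENNReal.rpow_natCast, ← ENNReal.rpow_mul,
        Real.rpow_mul (norm_nonneg _), ENNReal.ofReal_rpow_of_nonneg (by positivity) (by positivity),
        hp, mul_comm n r]
    rw [h1, ENNReal.ofReal_prod_of_nonneg fun i _ => by
      have := ha i
      positivity, ← ENNReal.prod_rpow_of_nonneg hr0, ← Finset.prod_mul_distrib]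
    refine Finset.prod_le_prod' fun i _ => ?_
    rw [← ENNReal.mul_rpow_of_nonneg _ _ hr0]
    exact ENNReal.rpow_le_rpow (hpt z hz i) hr0
  calc _ ≤ ∫⁻ z in B₀, ENNReal.ofReal (∏ i, (1 / ℓ + γ) * a i) ^ r *
        ∏ i, (∫⁻ τ, F (Function.update z i τ)) ^ r := setLIntegral_mono' hB₀ hpow
    _ ≤ ∫⁻ z, ENNReal.ofReal (∏ i, (1 / ℓ + γ) * a i) ^ r *
        ∏ i, (∫⁻ τ, F (Function.update z i τ)) ^ r := setLIntegral_le_lintegral _ _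
    _ = ENNReal.ofReal (∏ i, (1 / ℓ + γ) * a i) ^ r *
        ∫⁻ z, ∏ i, (∫⁻ τ, F (Function.update z i τ)) ^ r := by
      rw [lintegral_const_mul' _ _ (ENNReal.rpow_ne_top_of_nonneg hr0 ENNReal.ofReal_ne_top)]
    _ ≤ _ := by
      gcongr
      exact hgrid

/-- Interpolation inequality in a Lipschitz chart `Z` with Lipschitz inverse `Y`. -/
theorem lintegral_rpow_chart_le {ι : Type*} [Fintype ι] [DecidableEq ι] {N m : ℕ}
    (hι : Fintype.card ι = N) (hN : 2 ≤ N) {γ ℓ : ℝ} (hγ : 1 < γ) (hℓ : 0 < ℓ) {a : ι → ℝ}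
    (ha : ∀ i, 1 ≤ a i) {B₀ B : Set (ι → ℝ)} (hB₀ : MeasurableSet B₀) (hB : MeasurableSet B)
    (hBB : B₀ ⊆ B) {Z : (ι → ℝ) → Euc N} {Y : Euc N → (ι → ℝ)} {L : NNReal}
    (hZ : LipschitzOnWith L Z B) (hY : LipschitzOnWith L Y (Z '' B)) (hYZ : LeftInvOn Y Z B)
    {v : Euc N → Euc m} {H : Euc N → ℝ}
    (hv : ContinuousOn v (Z '' B)) (hH : ContinuousOn H (Z '' B)) (hvH : ∀ x ∈ Z '' B, ‖v x‖ ≤ H x)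
    (hseg : ∀ z ∈ B₀, ∀ i, ∀ τ ∈ Icc 0 ℓ, z + τ • Pi.single i 1 ∈ B)
    (hd : ∀ z ∈ B₀, ∀ i, ∀ τ ∈ Ioo 0 ℓ, ∃ d,
      HasDerivAt (fun τ : ℝ => v (Z (z + τ • Pi.single i 1))) d τ ∧
        ‖d‖ ≤ a i * H (Z (z + τ • Pi.single i 1))) :
    ∫⁻ x in Z '' B₀, ENNReal.ofReal (‖v x‖ ^ (γ * (N / (N - 1)))) ≤
      (L : ENNReal) ^ (N : ℝ) *
      (ENNReal.ofReal (∏ i, (1 / ℓ + γ) * a i) ^ (1 / (N - 1 : ℝ)) *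
      (((L * NNReal.sqrt N : NNReal) : ENNReal) ^ (N : ℝ) *
        ∫⁻ x in Z '' B, ENNReal.ofReal (‖v x‖ ^ (γ - 1) * H x)) ^ ((N : ℝ) / (N - 1))) := by
  have hZB : MeasurableSet (Z '' B) :=
    hB.image_of_continuousOn_injOn hZ.continuousOn hYZ.injOn
  have h1 := lintegral_image_le hB₀ ((hZ.mono hBB).continuousOn.aemeasurable hB₀)
    (μ := volume) (ν := volume)
    (fun E hE => volume_image_le_of_lipschitz_pi hι (hZ.mono (hE.trans hBB)))
    (fun x => ENNReal.ofReal (‖v x‖ ^ (γ * (N / (N - 1)))))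
  have hYB : Y '' (Z '' B) = B := hYZ.image_image
  have h2 := lintegral_image_le hZB (hY.continuousOn.aemeasurable hZB)
    (μ := volume) (ν := volume)
    (fun E hE => volume_image_le_of_lipschitz_euc hι (hY.mono hE))
    (fun z => ENNReal.ofReal (‖v (Z z)‖ ^ (γ - 1) * H (Z z)))
  rw [hYB] at h2
  have h3 : ∫⁻ x in Z '' B, ENNReal.ofReal (‖v (Z (Y x))‖ ^ (γ - 1) * H (Z (Y x))) =
      ∫⁻ x in Z '' B, ENNReal.ofReal (‖v x‖ ^ (γ - 1) * H x) := by
    refine setLIntegral_congr_fun hZB ?_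
    rintro x ⟨z, hz, rfl⟩
    simp only [hYZ hz]
  rw [h3] at h2
  have h4 := lintegral_rpow_pi_le (by omega) hγ hℓ ha hB₀ hB (V := fun z => v (Z z))
    (H := fun z => H (Z z)) (hv.comp hZ.continuousOn (mapsTo_image Z B))
    (hH.comp hZ.continuousOn (mapsTo_image Z B)) (fun z hz => hvH _ (mem_image_of_mem Z hz)) hseg hd
  rw [hι] at h4
  refine h1.trans ?_
  gcongr
  refine h4.trans ?_
  gcongr
  apply div_nonneg (Nat.cast_nonneg N)
  have : (2 : ℝ) ≤ N := by exact_mod_cast hN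
  linarith

end ChartInequality

/-! ### Anisotropic energy density and charts for the domain and the hypersurface. -/

section Charts

variable {N m : ℕ} {Ω : Set (Euc N)} {T : ℝ} {Γ : EvolvingHypersurface Ω T} {a : ℝ}

theorem frobSq_nonneg (L : Euc N →L[ℝ] Euc m) : 0 ≤ frobSq L :=
  Finset.sum_nonneg fun _ _ => sq_nonneg _

theorem norm_apply_le_frobSq (L : Euc N →L[ℝ] Euc m) (w : Euc N) :
    ‖L w‖ ≤ √(frobSq L) * ‖w‖ := by
  have h1 : w = ∑ i, w i • (EuclideanSpace.single i (1 : ℝ) : Euc N) := by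
    have := (EuclideanSpace.basisFun (Fin N) ℝ).sum_repr w
    simpa using this.symm
  have h2 : ‖L w‖ ≤ ∑ i, ‖w i‖ * ‖L (EuclideanSpace.single i 1)‖ := by
    conv_lhs => rw [h1, map_sum]
    refine (norm_sum_le _ _).trans (Finset.sum_le_sum fun i _ => ?_)
    rw [map_smul, norm_smul]
  refine h2.trans ?_
  rw [EuclideanSpace.norm_eq, frobSq, mul_comm]
  exact Real.sum_mul_le_sqrt_mul_sqrt _ _ _

theorem continuous_frobSq : Continuous (frobSq : (Euc N →L[ℝ] Euc m) → ℝ) := by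
  unfold frobSq
  fun_prop

theorem frobSq_comp_le (L : Euc N →L[ℝ] Euc m) (P : Euc N →L[ℝ] Euc N) :
    frobSq (L.comp P) ≤ N * ‖P‖ ^ 2 * frobSq L := by
  unfold frobSq
  calc _ ≤ ∑ _i : Fin N, ‖P‖ ^ 2 * frobSq L := by
        refine Finset.sum_le_sum fun i _ => ?_
        have h1 := norm_apply_le_frobSq L (P (EuclideanSpace.single i 1))
        have h2 : ‖P (EuclideanSpace.single i 1)‖ ≤ ‖P‖ := by
          simpa using P.le_opNorm (EuclideanSpace.single i 1)
        have h3 : ‖L (P (EuclideanSpace.single i 1))‖ ≤ √(frobSq L) * ‖P‖ :=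
          h1.trans (by gcongr)
        calc _ ≤ (√(frobSq L) * ‖P‖) ^ 2 := by
              simp only [ContinuousLinearMap.comp_apply]; gcongr
          _ = _ := by rw [mul_pow, Real.sq_sqrt (frobSq_nonneg L), mul_comm]
    _ = _ := by simp [frobSq, mul_assoc]

/-- The size of a function and its derivatives, anisotropic near the interface. -/
def energyDensity (K : CurvilinearCoordinates Γ a) (δ ε t : ℝ) (v : Euc N → Euc m)
    (v' : Euc N → Euc N →L[ℝ] Euc m) (x : Euc N) : ℝ :=
  open Classical in
  ‖v x‖ + if x ∈ K.slice δ t then √(frobSq (K.tangentialDeriv (x, t) (v' x)))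
    + ε * ‖K.normalDeriv (x, t) (v' x)‖ else √(frobSq (v' x))

/-- `v` is continuously differentiable on `closure Ω` with one-sided derivative `v'`. -/
structure IsC1Closure {F : Type*} [NormedAddCommGroup F] [NormedSpace ℝ F]
    (Ω : Set (Euc N)) (v : Euc N → F) (v' : Euc N → Euc N →L[ℝ] F) : Prop where
  cont' : ContinuousOn v' (closure Ω)
  deriv : ∀ x ∈ closure Ω, HasFDerivWithinAt v (v' x) (closure Ω) x

theorem IsC1Closure.cont {F : Type*} [NormedAddCommGroup F] [NormedSpace ℝ F]
    {v : Euc N → F} {v' : Euc N → Euc N →L[ℝ] F} (h : IsC1Closure Ω v v') :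
    ContinuousOn v (closure Ω) := fun x hx => (h.deriv x hx).continuousWithinAt

/-- The interpolation inequality on a part of `Ω` covered by one chart. -/
theorem local_estimate_of_chart (hΩ : IsSmoothBoundedDomain Ω) (hN : 2 ≤ N)
    {ι : Type*} [Fintype ι] [DecidableEq ι] (hι : Fintype.card ι = N) {γ ℓ : ℝ} (hγ : 1 < γ)
    (hℓ : 0 < ℓ) {α : ι → ℝ} (hα : ∀ i, 1 ≤ α i) {P ε : ℝ} (hε : 0 < ε)
    (hP : ∏ i, α i ≤ P * ε⁻¹)
    {B₀ B : Set (ι → ℝ)} (hB₀ : MeasurableSet B₀) (hB : MeasurableSet B) (hBB : B₀ ⊆ B)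
    {Z : (ι → ℝ) → Euc N} {Y : Euc N → (ι → ℝ)} {L : NNReal} (hZ : LipschitzOnWith L Z B)
    (hY : LipschitzOnWith L Y (Z '' B)) (hYZ : LeftInvOn Y Z B) (hZΩ : MapsTo Z B (closure Ω))
    {v : Euc N → Euc m} {v' : Euc N → Euc N →L[ℝ] Euc m} (hv : IsC1Closure Ω v v')
    {H H' : Euc N → ℝ} (hH : ContinuousOn H (Z '' B)) (hvH : ∀ x ∈ Z '' B, ‖v x‖ ≤ H x)
    {c : ℝ} (hc : 0 ≤ c) (hHH' : ∀ x ∈ Z '' B, H x ≤ c * H' x)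
    (hseg : ∀ z ∈ B₀, ∀ i, ∀ τ ∈ Icc 0 ℓ, z + τ • Pi.single i 1 ∈ B)
    (hpath : ∀ z ∈ B₀, ∀ i, ∀ τ ∈ Ioo 0 ℓ, ∃ w,
      HasDerivAt (fun τ : ℝ => Z (z + τ • Pi.single i 1)) w τ ∧
        ‖v' (Z (z + τ • Pi.single i 1)) w‖ ≤ α i * H (Z (z + τ • Pi.single i 1))) :
    ∫⁻ x in Z '' B₀, ENNReal.ofReal (‖v x‖ ^ (γ * (N / (N - 1)))) ≤
      ((L : ENNReal) ^ (N : ℝ) * (ENNReal.ofReal ((1 / ℓ + γ) ^ N * P) ^ (1 / (N - 1 : ℝ)) *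
        (((L * NNReal.sqrt N : NNReal) : ENNReal) ^ (N : ℝ) * ENNReal.ofReal c)
          ^ ((N : ℝ) / (N - 1)))) * ENNReal.ofReal ε⁻¹ ^ (1 / (N - 1 : ℝ)) *
      (∫⁻ x in Ω, ENNReal.ofReal (‖v x‖ ^ (γ - 1) * H' x)) ^ ((N : ℝ) / (N - 1)) := by
  have hN1 : (0 : ℝ) < N - 1 := by
    have : (2 : ℝ) ≤ N := by exact_mod_cast hN
    linarith
  have hsub : Z '' B ⊆ closure Ω := image_subset_iff.2 hZΩ
  have h1 := lintegral_rpow_chart_le hι hN hγ hℓ hα hB₀ hB hBB hZ hY hYZ (hv.cont.mono hsub) hH hvH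
    hseg (fun z hz i τ hτ => by
      obtain ⟨w, hw, hle⟩ := hpath z hz i τ hτ
      refine ⟨_, ?_, hle⟩
      have hmaps : MapsTo (fun τ : ℝ => Z (z + τ • Pi.single i (1 : ℝ))) (Icc 0 ℓ) (closure Ω) :=
        fun τ hτ => hZΩ (hseg z hz i τ hτ)
      exact ((hv.deriv _ (hmaps (Ioo_subset_Icc_self hτ))).comp_hasDerivWithinAt τ
        hw.hasDerivWithinAt hmaps).hasDerivAt (Icc_mem_nhds hτ.1 hτ.2))
  have h2 : ∫⁻ x in Z '' B, ENNReal.ofReal (‖v x‖ ^ (γ - 1) * H x) ≤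
      ENNReal.ofReal c * ∫⁻ x in Ω, ENNReal.ofReal (‖v x‖ ^ (γ - 1) * H' x) := by
    have hZB : MeasurableSet (Z '' B) :=
      hB.image_of_continuousOn_injOn hZ.continuousOn hYZ.injOn
    -- Charts cover parts of the closure while the energy is integrated over `Ω`. The boundary is a
    -- null set since its surface measure is finite.
    have hae : (Ω : Set (Euc N)) =ᵐ[volume] closure Ω := by
      refine (LE.le.eventuallyLE (subset_closure : Ω ⊆ closure Ω)).antisymm ?_
      rw [ae_le_set, ← hΩ.isOpen.frontier_eq]
      exact hΩ.volume_frontier (by omega)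
    rw [setLIntegral_congr hae, ← lintegral_const_mul' _ _ ENNReal.ofReal_ne_top]
    refine le_trans ?_ (lintegral_mono_set hsub)
    refine setLIntegral_mono' hZB fun x hx => ?_
    rw [← ENNReal.ofReal_mul hc]
    refine ENNReal.ofReal_le_ofReal ?_
    have := hHH' x hx
    calc ‖v x‖ ^ (γ - 1) * H x ≤ ‖v x‖ ^ (γ - 1) * (c * H' x) := by gcongr
      _ = _ := by ring
  refine h1.trans ?_
  have h3 : ENNReal.ofReal (∏ i, (1 / ℓ + γ) * α i) ≤
      ENNReal.ofReal ((1 / ℓ + γ) ^ N * P) * ENNReal.ofReal ε⁻¹ := by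
    rw [← ENNReal.ofReal_mul' (by positivity)]
    refine ENNReal.ofReal_le_ofReal ?_
    rw [Finset.prod_mul_distrib, Finset.prod_const, Finset.card_univ, hι, mul_assoc]
    gcongr
  have hr : 0 ≤ 1 / (N - 1 : ℝ) := by positivity
  have hp : 0 ≤ (N : ℝ) / (N - 1) := by positivity
  calc _ ≤ (L : ENNReal) ^ (N : ℝ) *
      ((ENNReal.ofReal ((1 / ℓ + γ) ^ N * P) * ENNReal.ofReal ε⁻¹) ^ (1 / (N - 1 : ℝ)) *
      (((L * NNReal.sqrt N : NNReal) : ENNReal) ^ (N : ℝ) *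
        (ENNReal.ofReal c * ∫⁻ x in Ω, ENNReal.ofReal (‖v x‖ ^ (γ - 1) * H' x)))
          ^ ((N : ℝ) / (N - 1))) := by gcongr
    _ = _ := by
      rw [ENNReal.mul_rpow_of_nonneg _ _ hr, ← mul_assoc (_ ^ (N : ℝ)) (ENNReal.ofReal c),
        ENNReal.mul_rpow_of_nonneg _ _ hp]
      ring

/-- The local interpolation inequality near the point `(x₀, t₀)`. -/
def LocalEstimate (K : CurvilinearCoordinates Γ a) (δ γ : ℝ) (m : ℕ) (z₀ : Euc N × ℝ) : Prop :=
  ∃ O ∈ 𝓝 z₀, ∃ C : ENNReal, C ≠ ⊤ ∧ ∀ t ∈ Icc 0 T, ∀ ε ∈ Ioc (0 : ℝ) 1, ∀ (v : Euc N → Euc m)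
    (v' : Euc N → Euc N →L[ℝ] Euc m), IsC1Closure Ω v v' →
    ∫⁻ x in {x | x ∈ closure Ω ∧ (x, t) ∈ O}, ENNReal.ofReal (‖v x‖ ^ (γ * (N / (N - 1)))) ≤
      C * ENNReal.ofReal ε⁻¹ ^ (1 / (N - 1 : ℝ)) *
      (∫⁻ x in Ω, ENNReal.ofReal (‖v x‖ ^ (γ - 1) * energyDensity K δ ε t v v' x))
        ^ ((N : ℝ) / (N - 1))

theorem const_ne_top (hN : 2 ≤ N) (L : NNReal) (s c : ℝ) :
    (L : ENNReal) ^ (N : ℝ) * (ENNReal.ofReal s ^ (1 / (N - 1 : ℝ)) *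
        (((L * NNReal.sqrt N : NNReal) : ENNReal) ^ (N : ℝ) * ENNReal.ofReal c)
          ^ ((N : ℝ) / (N - 1))) ≠ ⊤ := by
  have hN1 : (0 : ℝ) < N - 1 := by
    have : (2 : ℝ) ≤ N := by exact_mod_cast hN
    linarith
  have hN0 : (0 : ℝ) ≤ N := Nat.cast_nonneg N
  have hr : 0 ≤ 1 / (N - 1 : ℝ) := by positivity
  have hp : 0 ≤ (N : ℝ) / (N - 1) := by positivity
  refine ENNReal.mul_ne_top (ENNReal.rpow_ne_top_of_nonneg hN0 ENNReal.coe_ne_top)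
    (ENNReal.mul_ne_top (ENNReal.rpow_ne_top_of_nonneg hr ENNReal.ofReal_ne_top)
    (ENNReal.rpow_ne_top_of_nonneg hp (ENNReal.mul_ne_top
      (ENNReal.rpow_ne_top_of_nonneg hN0 ENNReal.coe_ne_top) ENNReal.ofReal_ne_top)))

/-- Away from the tube the energy density contains the full gradient. An affine chart along the cone
directions then gives the estimate with no loss in `ε`; the factor `ε⁻¹ ≥ 1` is inserted only to
match the common form. -/
theorem localEstimate_of_notMem (hΩ : IsSmoothBoundedDomain Ω) (hN : 2 ≤ N)
    (K : CurvilinearCoordinates Γ a) {δ γ : ℝ} (hγ : 1 < γ) {x₀ : Euc N} {t₀ : ℝ}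
    (hx₀ : x₀ ∈ closure Ω) (hO : ∀ᶠ z in 𝓝 (x₀, t₀), z ∉ K.tube δ) :
    LocalEstimate K δ γ m (x₀, t₀) := by
  obtain ⟨b, ρ, ℓ₀, hρ, hℓ₀, hcone⟩ := hΩ.exists_cone hx₀
  obtain ⟨ρ', hρ', hball⟩ := Metric.eventually_nhds_iff_ball.1 hO
  set M : ℝ := 1 + ∑ i, ‖b i‖ with hM
  have hM1 : 1 ≤ M := by
    have : 0 ≤ ∑ i, ‖b i‖ := Finset.sum_nonneg fun i _ => norm_nonneg _
    linarith
  have hbM : ∀ i, ‖b i‖ ≤ M := fun i => by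
    have := Finset.single_le_sum (fun i _ => norm_nonneg (b i)) (Finset.mem_univ i)
    linarith
  set ρ₀ : ℝ := min ρ ρ' / 2 with hρ₀
  have hρ₀0 : 0 < ρ₀ := by positivity
  have hρ₀1 : 2 * ρ₀ ≤ ρ := by rw [hρ₀]; linarith [min_le_left ρ ρ']
  have hρ₀2 : 2 * ρ₀ ≤ ρ' := by rw [hρ₀]; linarith [min_le_right ρ ρ']
  -- The first bound keeps the segments in `Ω` by the cone condition, the second in the ball of
  -- radius `2ρ₀`, which does not meet the tube.
  set ℓ : ℝ := min ℓ₀ (ρ₀ / M) with hℓd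
  have hℓ : 0 < ℓ := by positivity
  have hℓ1 : ℓ ≤ ℓ₀ := min_le_left _ _
  have hℓ2 : ℓ * M ≤ ρ₀ := by
    rw [← le_div_iff₀ (by positivity)]; exact min_le_right _ _
  set e : (Fin N → ℝ) ≃L[ℝ] Euc N := b.equivFunL.symm with he
  have heb : ∀ i, e (Pi.single i 1) = b i := fun i => by
    show b.equivFun.symm _ = _
    simp [Module.Basis.equivFun_symm_apply, Pi.single_apply, ite_smul]
  set L : NNReal := max ‖(e : (Fin N → ℝ) →L[ℝ] Euc N)‖₊
    ‖(e.symm : Euc N →L[ℝ] (Fin N → ℝ))‖₊ with hL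
  refine ⟨Metric.ball x₀ ρ₀ ×ˢ Metric.ball t₀ ρ₀,
    prod_mem_nhds (Metric.ball_mem_nhds _ hρ₀0) (Metric.ball_mem_nhds _ hρ₀0), _,
    const_ne_top hN L ((1 / ℓ + γ) ^ N * M ^ N) 1, fun t ht ε hε v v' hv => ?_⟩
  set Z : (Fin N → ℝ) → Euc N := fun z => x₀ + e z with hZd
  set Y : Euc N → (Fin N → ℝ) := fun x => e.symm (x - x₀) with hYd
  have hZL : LipschitzWith L Z := by
    have h1 := ((e : (Fin N → ℝ) →L[ℝ] Euc N).lipschitz).weaken (le_max_left _ _ : _ ≤ L)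
    refine LipschitzWith.of_dist_le_mul fun z w => ?_
    have := h1.dist_le_mul z w
    show dist (x₀ + e z) (x₀ + e w) ≤ _
    rw [dist_add_left]
    exact this
  have hYL : LipschitzWith L Y := by
    have h1 := ((e.symm : Euc N →L[ℝ] (Fin N → ℝ)).lipschitz).weaken (le_max_right _ _ : _ ≤ L)
    refine LipschitzWith.of_dist_le_mul fun z w => ?_
    have := h1.dist_le_mul (z - x₀) (w - x₀)
    rw [dist_sub_right] at this
    exact this
  have hYZ : ∀ z, Y (Z z) = z := fun z => by simp [hYd, hZd]
  have hZY : ∀ x, Z (Y x) = x := fun x => by simp [hYd, hZd]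
  by_cases htt : t ∈ Metric.ball t₀ ρ₀
  swap
  · have hempty : {x | x ∈ closure Ω ∧ (x, t) ∈ Metric.ball x₀ ρ₀ ×ˢ Metric.ball t₀ ρ₀} = ∅ := by
      ext x
      simp only [mem_ofPred_eq, mem_prod, mem_empty_iff_false, iff_false]
      exact fun h => htt h.2.2
    rw [hempty, setLIntegral_empty]
    exact zero_le
  have hB : MeasurableSet (Z ⁻¹' (Metric.ball x₀ (2 * ρ₀) ∩ closure Ω)) :=
    hZL.continuous.measurable (Metric.isOpen_ball.measurableSet.inter isClosed_closure.measurableSet)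
  have hB₀ : MeasurableSet (Z ⁻¹' (Metric.ball x₀ ρ₀ ∩ closure Ω)) :=
    hZL.continuous.measurable (Metric.isOpen_ball.measurableSet.inter isClosed_closure.measurableSet)
  have hstep : ∀ (z : Fin N → ℝ) (i) (τ : ℝ), Z (z + τ • Pi.single i 1) = Z z + τ • b i := by
    intro z i τ
    simp only [hZd, map_add, map_smul, heb, add_assoc]
  set H : Euc N → ℝ := fun x => ‖v x‖ + √(frobSq (v' x)) with hH
  have key := local_estimate_of_chart hΩ hN (Fintype.card_fin N) hγ hℓ (α := fun _ => M)
    (fun _ => hM1) (P := M ^ N) hε.1 (by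
      rw [Finset.prod_const, Finset.card_univ, Fintype.card_fin]
      exact le_mul_of_one_le_right (by positivity) ((one_le_inv₀ hε.1).2 hε.2)) hB₀ hB
    (preimage_mono (inter_subset_inter_left _ (Metric.ball_subset_ball (by linarith))))
    hZL.lipschitzOnWith hYL.lipschitzOnWith (fun z _ => hYZ z) (fun z hz => hz.2) hv
    (H := H) (H' := energyDensity K δ ε t v v') ?_ ?_ zero_le_one ?_ ?_ ?_
  · have himg : {x | x ∈ closure Ω ∧ (x, t) ∈ Metric.ball x₀ ρ₀ ×ˢ Metric.ball t₀ ρ₀} ⊆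
        Z '' (Z ⁻¹' (Metric.ball x₀ ρ₀ ∩ closure Ω)) := fun x hx => by
      refine ⟨Y x, ?_, hZY x⟩
      rw [mem_preimage, hZY]
      exact ⟨hx.2.1, hx.1⟩
    exact (lintegral_mono_set himg).trans key
  · have : Z '' (Z ⁻¹' (Metric.ball x₀ (2 * ρ₀) ∩ closure Ω)) ⊆ closure Ω :=
      (image_preimage_subset _ _).trans inter_subset_right
    refine ContinuousOn.mono (hv.cont.norm.add ?_) this
    exact Real.continuous_sqrt.comp_continuousOn (continuous_frobSq.comp_continuousOn hv.cont')
  · exact fun x _ => le_add_of_nonneg_right (Real.sqrt_nonneg _)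
  · rintro x ⟨z, hz, rfl⟩
    have hnot : Z z ∉ K.slice δ t := by
      refine hball (Z z, t) ?_
      rw [← ball_prod_same]
      exact ⟨Metric.ball_subset_ball hρ₀2 hz.1, Metric.ball_subset_ball (by linarith) htt⟩
    simp only [energyDensity, hnot, if_false, one_mul, hH, le_refl]
  · intro z hz i τ hτ
    rw [mem_preimage, hstep]
    have h1 : ‖τ • b i‖ ≤ ρ₀ := by
      rw [norm_smul, Real.norm_of_nonneg hτ.1]
      exact (mul_le_mul hτ.2 (hbM i) (norm_nonneg _) hℓ.le).trans hℓ2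
    refine ⟨?_, ?_⟩
    · have h2 := hz.1
      rw [Metric.mem_ball, dist_eq_norm] at h2 ⊢
      calc ‖Z z + τ • b i - x₀‖ = ‖(Z z - x₀) + τ • b i‖ := by congr 1; abel
        _ ≤ ‖Z z - x₀‖ + ‖τ • b i‖ := norm_add_le _ _
        _ < 2 * ρ₀ := by linarith
    · rcases hτ.1.eq_or_lt with h0 | h0
      · rw [← h0, zero_smul, add_zero]
        exact hz.2
      · exact subset_closure (hcone _ (Metric.ball_subset_ball (by linarith) hz.1) hz.2 i τ
          ⟨h0, hτ.2.trans hℓ1⟩)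
  · intro z hz i τ hτ
    refine ⟨b i, ?_, ?_⟩
    · simp only [hstep]
      simpa using ((hasDerivAt_id τ).smul_const (b i)).const_add (Z z)
    · refine (norm_apply_le_frobSq _ _).trans ?_
      rw [mul_comm]
      refine mul_le_mul (hbM i) ?_ (Real.sqrt_nonneg _) (by linarith)
      exact le_add_of_nonneg_left (norm_nonneg _)

/-- Local parametrization of a hypersurface with boundary, over a set satisfying a cone condition
in the coordinate directions. -/
theorem exists_surface_chart {S : Set (Euc N)} {p₀ : Euc N}
    (hS : IsInteriorHypersurfacePoint S p₀ ∨ IsBoundaryHypersurfacePoint S p₀) (hp₀ : p₀ ∈ S) :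
    ∃ (G : (Fin (N - 1) → ℝ) → Euc N) (P : Euc N → (Fin (N - 1) → ℝ))
      (χ : (Fin (N - 1) → ℝ) → ℝ) (κ ℓ : ℝ) (L : NNReal), 0 < κ ∧ 0 < ℓ ∧ G 0 = p₀ ∧ P p₀ = 0 ∧
      ContDiffOn ℝ 1 G (Metric.ball 0 κ) ∧ LipschitzWith L P ∧
      ContinuousOn χ (Metric.ball 0 κ) ∧ (∀ σ ∈ Metric.ball 0 κ, χ σ ≤ 0 → G σ ∈ S) ∧
      (∀ σ ∈ Metric.ball 0 κ, P (G σ) = σ) ∧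
      (∀ σ ∈ Metric.ball 0 κ, χ σ ≤ 0 → ∀ i, ∀ τ ∈ Ioc 0 ℓ, χ (σ + τ • Pi.single i 1) < 0) ∧
      ∀ᶠ p in 𝓝 p₀, p ∈ S → G (P p) = p ∧ χ (P p) ≤ 0 := by
  -- An interior point is treated like a boundary point with the inactive constraint `χ₀ = -1`.
  obtain ⟨U, φ, χ₀, hU, hpU, hφ, hχ, hg, hχp, hSU⟩ : ∃ (U : Set (Euc N)) (φ χ₀ : Euc N → ℝ),
      IsOpen U ∧ p₀ ∈ U ∧ ContDiffOn ℝ ∞ φ U ∧ ContDiffOn ℝ ∞ χ₀ U ∧ gradient φ p₀ ≠ 0 ∧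
      (χ₀ p₀ < 0 ∨ LinearIndependent ℝ ![gradient φ p₀, gradient χ₀ p₀]) ∧
      S ∩ U = {x ∈ U | φ x = 0 ∧ χ₀ x ≤ 0} := by
    rcases hS with ⟨U, φ, hU, hpU, hφ, hg, hSU⟩ | ⟨U, φ, χ₀, hU, hpU, hφ, hχ, _, hli, hSU⟩
    · exact ⟨U, φ, fun _ => -1, hU, hpU, hφ, contDiffOn_const, hg, Or.inl (by norm_num),
        by simpa using hSU⟩
    · exact ⟨U, φ, χ₀, hU, hpU, hφ, hχ, hli.ne_zero 0, Or.inr hli, hSU⟩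
  have hmem : ∀ x ∈ U, (x ∈ S ↔ φ x = 0 ∧ χ₀ x ≤ 0) := fun x hx => by
    have := Set.ext_iff.1 hSU x
    simpa [hx] using this
  have hφ1 : ContDiffAt ℝ 1 φ p₀ := ((hφ.contDiffAt (hU.mem_nhds hpU))).of_le (by norm_num)
  have hχ1 : ContDiffAt ℝ 1 χ₀ p₀ := ((hχ.contDiffAt (hU.mem_nhds hpU))).of_le (by norm_num)
  set e : Euc N := ‖gradient φ p₀‖⁻¹ • gradient φ p₀ with he
  have hgn : 0 < ‖gradient φ p₀‖ := norm_pos_iff.2 hg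
  have he1 : ‖e‖ = 1 := by rw [he, norm_smul, norm_inv, norm_norm, inv_mul_cancel₀ hgn.ne']
  have hfe : 0 < fderiv ℝ φ p₀ e := by
    rw [he, map_smul, ← inner_gradient, real_inner_self_eq_norm_sq, smul_eq_mul]
    positivity
  obtain ⟨g, ρ, κ, hρ, hκ, hg0, hgC, hgκ, hgr⟩ :=
    exists_graph hφ1 ((hmem p₀ hpU).1 hp₀).1 hfe (hU.mem_nhds hpU)
  set G₁ : (ℝ ∙ e)ᗮ → Euc N := fun h => orthoCoord p₀ e (h, g h) with hG₁
  have hG₁0 : G₁ 0 = p₀ := by simp [hG₁, orthoCoord, hg0]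
  have hG₁C : ContDiffOn ℝ 1 G₁ (Metric.ball 0 ρ) :=
    ((contDiff_orthoCoord p₀ e).of_le (by norm_num)).comp_contDiffOn (contDiffOn_id.prodMk hgC)
  have hin : ∀ h ∈ Metric.ball (0 : (ℝ ∙ e)ᗮ) ρ, g h ∈ Icc (-κ) κ := fun h hh =>
    abs_le.1 (hgκ h hh).le
  have hG₁U : ∀ h ∈ Metric.ball (0 : (ℝ ∙ e)ᗮ) ρ, G₁ h ∈ U ∧ φ (G₁ h) = 0 := fun h hh =>
    ⟨(hgr h hh _ (hin h hh)).1, (hgr h hh _ (hin h hh)).2.2.2.2.2 rfl⟩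
  have hG₁C0 : ContDiffAt ℝ 1 G₁ 0 := hG₁C.contDiffAt (Metric.ball_mem_nhds _ hρ)
  have hψ0 : ContDiffAt ℝ 1 (χ₀ ∘ G₁) 0 := by
    refine ContDiffAt.comp 0 ?_ hG₁C0
    rw [hG₁0]; exact hχ1
  -- If the constraint had zero derivative along the surface, then `Dχ₀` and `Dφ` would both vanish
  -- on the tangent space. `Dχ₀` would then be a multiple of `Dφ`, against the linear independence
  -- of the gradients.
  have hψ : (χ₀ ∘ G₁) 0 < 0 ∨ fderiv ℝ (χ₀ ∘ G₁) 0 ≠ 0 := by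
    refine hχp.imp (fun h => by simpa [hG₁0] using h) fun hli h0 => ?_
    set L := fderiv ℝ g 0 with hL
    have hgd : HasFDerivAt g L 0 :=
      ((hgC.contDiffAt (Metric.ball_mem_nhds _ hρ)).differentiableAt one_ne_zero).hasFDerivAt
    have hGd : HasFDerivAt G₁ ((orthoCoordL e).comp ((ContinuousLinearMap.id ℝ _).prod L)) 0 :=
      HasFDerivAt.comp (g := orthoCoord p₀ e) (f := fun h => (h, g h)) 0
        (hasFDerivAt_orthoCoord p₀ e (0, g 0)) ((hasFDerivAt_id 0).prodMk hgd)
    have hχd : HasFDerivAt χ₀ (fderiv ℝ χ₀ p₀) (G₁ 0) := by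
      rw [hG₁0]; exact (hχ1.differentiableAt one_ne_zero).hasFDerivAt
    have hφd : HasFDerivAt φ (fderiv ℝ φ p₀) (G₁ 0) := by
      rw [hG₁0]; exact (hφ1.differentiableAt one_ne_zero).hasFDerivAt
    have h1 : ∀ h : (ℝ ∙ e)ᗮ, fderiv ℝ χ₀ p₀ ((h : Euc N) + L h • e) = 0 := fun h => by
      have h2 := (hχd.comp 0 hGd).fderiv
      rw [h0] at h2
      exact (DFunLike.congr_fun h2 h).symm
    have h2 : ∀ h : (ℝ ∙ e)ᗮ, fderiv ℝ φ p₀ ((h : Euc N) + L h • e) = 0 := fun h => by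
      have h3 := hφd.comp 0 hGd
      have h4 : HasFDerivAt (φ ∘ G₁) (0 : (ℝ ∙ e)ᗮ →L[ℝ] ℝ) 0 := by
        refine (hasFDerivAt_const (0 : ℝ) (0 : (ℝ ∙ e)ᗮ)).congr_of_eventuallyEq ?_
        filter_upwards [Metric.ball_mem_nhds (0 : (ℝ ∙ e)ᗮ) hρ] with h hh
        exact (hG₁U h hh).2
      exact DFunLike.congr_fun (h3.unique h4) h
    set c : ℝ := fderiv ℝ χ₀ p₀ e / fderiv ℝ φ p₀ e with hc
    have hce : fderiv ℝ χ₀ p₀ e = c * fderiv ℝ φ p₀ e := by rw [hc, div_mul_cancel₀ _ hfe.ne']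
    have h3 : ∀ x, fderiv ℝ χ₀ p₀ x = c * fderiv ℝ φ p₀ x := fun x => by
      have hx := eq_orthoCoord (p := (0 : Euc N)) he1 x
      simp only [orthoCoord, zero_add, sub_zero] at hx
      set h := (ℝ ∙ e)ᗮ.orthogonalProjectionOnto x
      have h4 := h1 h
      have h5 := h2 h
      simp only [map_add, map_smul, smul_eq_mul] at h4 h5
      rw [← hx]
      simp only [map_add, map_smul, smul_eq_mul]
      linear_combination h4 - c * h5 + (⟪e, x⟫_ℝ - L h) * hce
    have h4 : (-c) • gradient φ p₀ + (1 : ℝ) • gradient χ₀ p₀ = 0 := by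
      refine ext_inner_right ℝ fun x => ?_
      rw [inner_add_left, inner_smul_left, inner_smul_left, inner_gradient, inner_gradient, h3 x]
      simp
    exact one_ne_zero (LinearIndependent.pair_iff.1 hli _ _ h4).2
  -- Coordinates on the hyperplane are taken with respect to this basis, so that short steps along
  -- the coordinate axes remain on the hypersurface.
  obtain ⟨b, ρ', ℓ, hρ', hℓ, hcone⟩ := exists_cone hψ0 hψ (finrank_orthogonal_euc he1)
  set E : (ℝ ∙ e)ᗮ ≃L[ℝ] (Fin (N - 1) → ℝ) := b.equivFunL with hE
  have hEb : ∀ i, E.symm (Pi.single i 1) = b i := fun i => by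
    show b.equivFun.symm _ = _
    simp [Module.Basis.equivFun_symm_apply, Pi.single_apply, ite_smul]
  obtain ⟨κ', hκ', hball⟩ : ∃ κ' > 0, ∀ σ ∈ Metric.ball (0 : Fin (N - 1) → ℝ) κ',
      E.symm σ ∈ Metric.ball (0 : (ℝ ∙ e)ᗮ) (min ρ ρ') := by
    have h1 : Tendsto E.symm (𝓝 0) (𝓝 0) := by
      simpa using E.symm.continuous.tendsto 0
    exact Metric.eventually_nhds_iff_ball.1 (h1 (Metric.ball_mem_nhds _ (lt_min hρ hρ')))
  have hb1 : ∀ σ ∈ Metric.ball (0 : Fin (N - 1) → ℝ) κ',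
      E.symm σ ∈ Metric.ball (0 : (ℝ ∙ e)ᗮ) ρ := fun σ hσ =>
    Metric.ball_subset_ball (min_le_left _ _) (hball σ hσ)
  have hproj : ∀ h : (ℝ ∙ e)ᗮ, (ℝ ∙ e)ᗮ.orthogonalProjectionOnto (G₁ h - p₀) = h := fun h => by
    have h1 := eq_orthoCoord (p := p₀) he1 (G₁ h)
    have h2 := injective_orthoCoord he1 (h1.trans (rfl : G₁ h = orthoCoord p₀ e (h, g h)))
    exact congrArg Prod.fst h2
  have hGC : ContDiffOn ℝ 1 (fun σ => G₁ (E.symm σ)) (Metric.ball 0 κ') :=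
    hG₁C.comp E.symm.contDiff.contDiffOn hb1
  set Pl : Euc N →L[ℝ] (Fin (N - 1) → ℝ) :=
    (E : (ℝ ∙ e)ᗮ →L[ℝ] (Fin (N - 1) → ℝ)).comp (ℝ ∙ e)ᗮ.orthogonalProjectionOnto with hPl
  refine ⟨fun σ => G₁ (E.symm σ), fun p => Pl (p - p₀), fun σ => χ₀ (G₁ (E.symm σ)), κ', ℓ, ‖Pl‖₊,
    hκ', hℓ, by simp [hG₁0], by simp, hGC, ?_, ?_, ?_, ?_, ?_, ?_⟩
  · refine LipschitzWith.of_dist_le_mul fun x y => ?_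
    have := Pl.lipschitz.dist_le_mul (x - p₀) (y - p₀)
    simpa [dist_eq_norm] using this
  · exact hχ.continuousOn.comp hGC.continuousOn fun σ hσ => (hG₁U _ (hb1 σ hσ)).1
  · intro σ hσ hχσ
    have h1 := hG₁U _ (hb1 σ hσ)
    exact (hmem _ h1.1).2 ⟨h1.2, hχσ⟩
  · intro σ hσ
    simp [hPl, hproj]
  · intro σ hσ hχσ i τ hτ
    have h1 := hcone (E.symm σ) (Metric.ball_subset_ball (min_le_right _ _) (hball σ hσ)) hχσ i τ hτ
    simpa only [map_add, map_smul, hEb, Function.comp_apply] using h1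
  · have hκρ : 0 < min κ ρ := lt_min hκ hρ
    filter_upwards [Metric.ball_mem_nhds p₀ hκρ, hU.mem_nhds hpU] with p hp hpU hpS
    have h1 := mem_ball_coord he1 hp
    have h2 := eq_orthoCoord (p := p₀) he1 p
    set h := (ℝ ∙ e)ᗮ.orthogonalProjectionOnto (p - p₀) with hh
    have h3 : h ∈ Metric.ball (0 : (ℝ ∙ e)ᗮ) ρ :=
      Metric.ball_subset_ball (min_le_right _ _) h1.1
    have h4 : ⟪e, p - p₀⟫_ℝ ∈ Icc (-κ) κ :=
      ⟨by linarith [h1.2.1, min_le_left κ ρ], by linarith [h1.2.2, min_le_left κ ρ]⟩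
    have h5 := (hgr h h3 _ h4).2.2.2.2
    rw [h2] at h5
    have h6 := (hmem p hpU).1 hpS
    have h7 : G₁ h = p := by
      simp only [hG₁]
      rw [← h5.1 h6.1, h2]
    have h8 : E.symm (Pl (p - p₀)) = h := by simp [hPl, hh]
    simp only [h8, h7]
    exact ⟨trivial, h6.2⟩

end Charts

/-! ### Continuity and bounds for the derivatives in curvilinear coordinates. -/

namespace CurvilinearCoordinates

variable {N m : ℕ} {Ω : Set (Euc N)} {T : ℝ} {Γ : EvolvingHypersurface Ω T} {a : ℝ}
  (K : CurvilinearCoordinates Γ a)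

/-- The derivative of `X` along `Σ₀`, in the coordinates of the point `z`. -/
def derivSurface (z : Euc N × ℝ) : Euc N →L[ℝ] Euc N :=
  fderiv ℝ (fun p => K.X (K.r z, p, z.2)) (K.s z)

/-- The spatial derivative of the coordinate `s`. -/
def derivProj (z : Euc N × ℝ) : Euc N →L[ℝ] Euc N := fderiv ℝ (fun y => K.s (y, z.2)) z.1

/-- The derivative of `X` in direction of `r`, in the coordinates of the point `z`. -/
def derivRadial (z : Euc N × ℝ) : Euc N := deriv (fun ρ => K.X (ρ, K.s z, z.2)) (K.r z)

theorem tangentialDeriv_def (z : Euc N × ℝ) (D : Euc N →L[ℝ] Euc m) :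
    K.tangentialDeriv z D = D.comp ((K.derivSurface z).comp (K.derivProj z)) := rfl

theorem normalDeriv_def (z : Euc N × ℝ) (D : Euc N →L[ℝ] Euc m) :
    K.normalDeriv z D = D (K.derivRadial z) := rfl

theorem continuousOn_coord :
    ContinuousOn (fun z : Euc N × ℝ => (K.r z, K.s z, z.2)) K.cod :=
  K.smooth_r.continuousOn.prodMk (K.smooth_s.continuousOn.prodMk continuousOn_snd)

theorem coord_mem {z : Euc N × ℝ} (hz : z ∈ K.cod) : (K.r z, K.s z, z.2) ∈ K.dom :=
  (K.right_inv z.1 z.2 hz).2.1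

theorem hasFDerivAt_X {q : ℝ × Euc N × ℝ} (hq : q ∈ K.dom) :
    HasFDerivAt K.X (fderiv ℝ K.X q) q :=
  ((K.smooth_X.contDiffAt (K.isOpen_dom.mem_nhds hq)).differentiableAt (by simp)).hasFDerivAt

theorem hasFDerivAt_X_surface {ρ t : ℝ} {p : Euc N} (hq : (ρ, p, t) ∈ K.dom) :
    HasFDerivAt (fun p => K.X (ρ, p, t))
      ((fderiv ℝ K.X (ρ, p, t)).comp
        ((ContinuousLinearMap.inr ℝ ℝ (Euc N × ℝ)).comp (.inl ℝ (Euc N) ℝ))) p := by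
  have h1 : HasFDerivAt (fun p : Euc N => ((ρ, p, t) : ℝ × Euc N × ℝ))
      ((ContinuousLinearMap.inr ℝ ℝ (Euc N × ℝ)).comp (.inl ℝ (Euc N) ℝ)) p :=
    HasFDerivAt.comp (g := fun q : Euc N × ℝ => (ρ, q)) (f := fun p : Euc N => (p, t)) p
      (hasFDerivAt_prodMk_right ρ (p, t)) (hasFDerivAt_prodMk_left p t)
  exact HasFDerivAt.comp (g := K.X) (f := fun p : Euc N => ((ρ, p, t) : ℝ × Euc N × ℝ)) p
    (K.hasFDerivAt_X hq) h1

theorem hasDerivAt_X_radial {ρ t : ℝ} {p : Euc N} (hq : (ρ, p, t) ∈ K.dom) :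
    HasDerivAt (fun ρ => K.X (ρ, p, t)) (fderiv ℝ K.X (ρ, p, t) (1, 0)) ρ := by
  have h1 : HasDerivAt (fun ρ : ℝ => ((ρ, p, t) : ℝ × Euc N × ℝ)) (1, 0) ρ :=
    (hasDerivAt_id ρ).prodMk (hasDerivAt_const ρ (p, t))
  exact HasFDerivAt.comp_hasDerivAt (l := K.X) ρ (K.hasFDerivAt_X hq) h1

theorem continuousOn_fderiv_X : ContinuousOn (fderiv ℝ K.X) K.dom :=
  K.smooth_X.continuousOn_fderiv_of_isOpen K.isOpen_dom (by simp)

theorem continuousOn_derivSurface : ContinuousOn K.derivSurface K.cod := by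
  have h1 := K.continuousOn_fderiv_X.comp K.continuousOn_coord fun z hz => K.coord_mem hz
  have h2 : ContinuousOn (fun z : Euc N × ℝ => (fderiv ℝ K.X (K.r z, K.s z, z.2)).comp
      ((ContinuousLinearMap.inr ℝ ℝ (Euc N × ℝ)).comp (.inl ℝ (Euc N) ℝ))) K.cod :=
    ContinuousOn.clm_comp h1 continuousOn_const
  exact h2.congr fun z hz => (K.hasFDerivAt_X_surface (K.coord_mem hz)).fderiv

theorem continuousOn_derivRadial : ContinuousOn K.derivRadial K.cod := by
  have h1 := K.continuousOn_fderiv_X.comp K.continuousOn_coord fun z hz => K.coord_mem hz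
  have h2 : ContinuousOn (fun z : Euc N × ℝ => (fderiv ℝ K.X (K.r z, K.s z, z.2)) (1, 0)) K.cod :=
    ContinuousOn.clm_apply h1 continuousOn_const
  exact h2.congr fun z hz => (K.hasDerivAt_X_radial (K.coord_mem hz)).deriv

theorem hasFDerivAt_s {x : Euc N} {t : ℝ} (hz : (x, t) ∈ K.cod) :
    HasFDerivAt (fun y => K.s (y, t)) ((fderiv ℝ K.s (x, t)).comp (.inl ℝ (Euc N) ℝ)) x :=
  HasFDerivAt.comp (g := K.s) (f := fun y : Euc N => (y, t)) x
    ((K.smooth_s.contDiffAt (K.isOpen_cod.mem_nhds hz)).differentiableAt (by simp)).hasFDerivAt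
    (hasFDerivAt_prodMk_left x t)

theorem continuousOn_derivProj : ContinuousOn K.derivProj K.cod := by
  have h1 := K.smooth_s.continuousOn_fderiv_of_isOpen K.isOpen_cod (by simp)
  have h2 : ContinuousOn (fun z : Euc N × ℝ => (fderiv ℝ K.s z).comp
      (.inl ℝ (Euc N) ℝ)) K.cod := ContinuousOn.clm_comp h1 continuousOn_const
  exact h2.congr fun z hz => (K.hasFDerivAt_s hz).fderiv

theorem continuousOn_tangentialDeriv {X : Type*} [TopologicalSpace X] {A : Set X}
    {f : X → Euc N × ℝ} {D : X → Euc N →L[ℝ] Euc m} (hf : ContinuousOn f A)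
    (hD : ContinuousOn D A) (hA : MapsTo f A K.cod) :
    ContinuousOn (fun x => K.tangentialDeriv (f x) (D x)) A :=
  hD.clm_comp ((K.continuousOn_derivSurface.comp hf hA).clm_comp
    (K.continuousOn_derivProj.comp hf hA))

theorem continuousOn_normalDeriv {X : Type*} [TopologicalSpace X] {A : Set X}
    {f : X → Euc N × ℝ} {D : X → Euc N →L[ℝ] Euc m} (hf : ContinuousOn f A)
    (hD : ContinuousOn D A) (hA : MapsTo f A K.cod) :
    ContinuousOn (fun x => K.normalDeriv (f x) (D x)) A :=
  hD.clm_apply (K.continuousOn_derivRadial.comp hf hA)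

/-- Only the geometric factors `∂ᵣX`, `d_ΣX` and `Dₓs` need to be bounded, which compactness
provides. The constant is therefore independent of `D` and of the dimension `m` of the target. -/
theorem exists_bound_derivs {A : Set (Euc N × ℝ)} (hA : IsCompact A) (hAc : A ⊆ K.cod) :
    ∃ C : ℝ, 0 ≤ C ∧ ∀ z ∈ A, ∀ (m : ℕ) (D : Euc N →L[ℝ] Euc m),
      frobSq (K.tangentialDeriv z D) ≤ C * frobSq D ∧
        ‖K.normalDeriv z D‖ ^ 2 ≤ C * frobSq D := by
  obtain ⟨C₁, hC₁⟩ := hA.exists_bound_of_continuousOn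
    ((K.continuousOn_derivSurface.clm_comp K.continuousOn_derivProj).mono hAc)
  obtain ⟨C₂, hC₂⟩ := hA.exists_bound_of_continuousOn (K.continuousOn_derivRadial.mono hAc)
  refine ⟨N * C₁ ^ 2 + C₂ ^ 2, by positivity, fun z hz m D => ⟨?_, ?_⟩⟩
  · rw [tangentialDeriv_def]
    refine (frobSq_comp_le _ _).trans (mul_le_mul_of_nonneg_right ?_ (frobSq_nonneg D))
    have h1 : ‖(K.derivSurface z).comp (K.derivProj z)‖ ^ 2 ≤ C₁ ^ 2 :=
      pow_le_pow_left₀ (norm_nonneg _) (hC₁ z hz) 2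
    have h2 : (N : ℝ) * ‖(K.derivSurface z).comp (K.derivProj z)‖ ^ 2 ≤ N * C₁ ^ 2 := by gcongr
    linarith [sq_nonneg C₂]
  · rw [normalDeriv_def]
    have h1 := norm_apply_le_frobSq D (K.derivRadial z)
    have h2 : ‖K.derivRadial z‖ ^ 2 ≤ C₂ ^ 2 := pow_le_pow_left₀ (norm_nonneg _) (hC₂ z hz) 2
    calc ‖D (K.derivRadial z)‖ ^ 2 ≤ (√(frobSq D) * ‖K.derivRadial z‖) ^ 2 := by gcongr
      _ = ‖K.derivRadial z‖ ^ 2 * frobSq D := by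
        rw [mul_pow, Real.sq_sqrt (frobSq_nonneg D), mul_comm]
      _ ≤ _ := mul_le_mul_of_nonneg_right (by nlinarith [sq_nonneg C₁]) (frobSq_nonneg D)

/-- The closed tubular neighbourhood. -/
def closedTube (δ : ℝ) : Set (Euc N × ℝ) :=
  (fun q : ℝ × Euc N × ℝ => (K.X q, q.2.2)) '' (Icc (-δ) δ ×ˢ Γ.S ×ˢ Icc 0 T)

theorem tube_subset_closedTube (δ : ℝ) : K.tube δ ⊆ K.closedTube δ :=
  image_mono (prod_mono Ioo_subset_Icc_self Subset.rfl)

theorem mem_dom {δ : ℝ} (hδ : δ ≤ a) {q : ℝ × Euc N × ℝ}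
    (hq : q ∈ Icc (-δ) δ ×ˢ Γ.S ×ˢ Icc 0 T) : q ∈ K.dom :=
  K.subset_dom ⟨⟨by linarith [hq.1.1], by linarith [hq.1.2]⟩, hq.2⟩

theorem isCompact_closedTube {δ : ℝ} (hδ : δ ≤ a) : IsCompact (K.closedTube δ) := by
  refine (isCompact_Icc.prod (Γ.isCompact_S.prod isCompact_Icc)).image_of_continuousOn ?_
  refine (K.smooth_X.continuousOn.mono fun q hq => K.mem_dom hδ hq).prodMk ?_
  exact (continuous_snd.comp continuous_snd).continuousOn

theorem closedTube_subset_cod {δ : ℝ} (hδ : δ ≤ a) : K.closedTube δ ⊆ K.cod := by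
  rintro _ ⟨⟨ρ, p, t⟩, hq, rfl⟩
  exact (K.left_inv ρ p t (K.mem_dom hδ hq) (Γ.S_ssubset.subset hq.2.1)).1

theorem closedTube_subset_cylinder {δ : ℝ} (hδ : δ ≤ a) :
    K.closedTube δ ⊆ closure Ω ×ˢ Icc 0 T := by
  rintro _ ⟨⟨ρ, p, t⟩, hq, rfl⟩
  exact ⟨K.X_mem ρ ⟨by linarith [hq.1.1], by linarith [hq.1.2]⟩ p hq.2.1 t hq.2.2, hq.2.2⟩

theorem tube_eq {δ : ℝ} (hδ : δ ∈ Ioc 0 a) : ∃ O : Set (Euc N × ℝ), IsOpen O ∧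
    K.tube δ = O ∩ closure Ω ×ˢ Icc 0 T := K.tube_open δ hδ

theorem measurableSet_tube {δ : ℝ} (hδ : δ ∈ Ioc 0 a) : MeasurableSet (K.tube δ) := by
  obtain ⟨O, hO, h⟩ := K.tube_eq hδ
  rw [h]
  exact hO.measurableSet.inter (isClosed_closure.measurableSet.prod measurableSet_Icc)

theorem measurableSet_slice {δ : ℝ} (hδ : δ ∈ Ioc 0 a) (t : ℝ) :
    MeasurableSet (K.slice δ t) :=
  measurable_prodMk_right (y := t) (K.measurableSet_tube hδ)

end CurvilinearCoordinates

/-! ### The local inequality near the interface, with anisotropic charts. -/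

section TubeChart

variable {N m : ℕ} {Ω : Set (Euc N)} {T : ℝ} {Γ : EvolvingHypersurface Ω T} {a : ℝ}

/-- The chart is `(r, σ) ↦ X(r, G σ, t)`. Moving in `r` differentiates `v` in normal direction, of
which the energy contains only `ε|∂ₙv|`, so this direction costs `ε⁻¹`. Moving in `σ` has a velocity
on which the tangential derivative acts like the full one, at a cost independent of `ε`. The product
of all costs is of order `ε⁻¹`. The point may lie anywhere in the tube of width `a`, in particular
on the lateral boundary of the tube of width `δ`. -/
theorem localEstimate_of_mem (hΩ : IsSmoothBoundedDomain Ω) (hN : 2 ≤ N)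
    (K : CurvilinearCoordinates Γ a) {δ γ : ℝ} (hγ : 1 < γ) {r₀ t₀ : ℝ} {p₀ : Euc N}
    (hr₀ : r₀ ∈ Ioo (-a) a) (hp₀ : p₀ ∈ Γ.S) (ht₀ : t₀ ∈ Icc 0 T) :
    LocalEstimate K δ γ m (K.X (r₀, p₀, t₀), t₀) := by
  have ha : 0 < a := by linarith [hr₀.1, hr₀.2]
  have hS : IsInteriorHypersurfacePoint Γ.S p₀ ∨ IsBoundaryHypersurfacePoint Γ.S p₀ := by
    by_cases h : p₀ ∈ Γ.bd
    · exact Or.inr (Γ.boundary_point p₀ h)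
    · exact Or.inl (Γ.interior_point p₀ ⟨hp₀, h⟩)
  obtain ⟨G, P, χ, κ, ℓ₀, LP, hκ, hℓ₀, hG0, hP0, hGC, hPL, hχ, hGS, hPG, hcone, hev⟩ :=
    exists_surface_chart hS hp₀
  set x₀ := K.X (r₀, p₀, t₀) with hx₀
  have hq₀ : (r₀, p₀, t₀) ∈ K.dom := K.subset_dom ⟨Ioo_subset_Icc_self hr₀, hp₀, ht₀⟩
  obtain ⟨hz₀, hr, hs⟩ := K.left_inv r₀ p₀ t₀ hq₀ (Γ.S_ssubset.subset hp₀)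
  rw [← hx₀] at hz₀ hr hs
  -- The index `none` stands for the normal coordinate `r`, and `some j` for the coordinates on the
  -- hypersurface.
  set ι := Option (Fin (N - 1)) with hι
  have hcard : Fintype.card ι = N := by simp [hι]; omega
  set σ : (ι → ℝ) → (Fin (N - 1) → ℝ) := fun z j => z (some j) with hσ
  have hσC : ContDiff ℝ ∞ σ := contDiff_pi.2 fun j => contDiff_apply ℝ ℝ (some j)
  set z₀ : ι → ℝ := fun o => o.elim r₀ fun _ => 0 with hz₀d
  have hσz₀ : σ z₀ = 0 := rfl
  have hσball : ∀ {η : ℝ} {z : ι → ℝ}, z ∈ Metric.ball z₀ η → σ z ∈ Metric.ball 0 η := by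
    intro η z hz
    have hη := Metric.pos_of_mem_ball hz
    rw [Metric.mem_ball, dist_pi_lt_iff hη] at hz ⊢
    exact fun j => hz (some j)
  set q : (ι → ℝ) × ℝ → ℝ × Euc N × ℝ := fun w => (w.1 none, G (σ w.1), w.2) with hq
  have hqz₀ : q (z₀, t₀) = (r₀, p₀, t₀) := by
    show (r₀, G (σ z₀), t₀) = _
    rw [hσz₀, hG0]
  have hqC : ContDiffAt ℝ 1 q (z₀, t₀) := by
    have h1 : ContDiffAt ℝ 1 G (σ z₀) := by
      rw [hσz₀]; exact hGC.contDiffAt (Metric.ball_mem_nhds _ hκ)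
    have h2 : ContDiffAt ℝ 1 (fun w : (ι → ℝ) × ℝ => σ w.1) (z₀, t₀) :=
      ((hσC.of_le (by norm_num)).comp contDiff_fst).contDiffAt
    have h3 : ContDiffAt ℝ 1 (fun w : (ι → ℝ) × ℝ => G (σ w.1)) (z₀, t₀) :=
      ContDiffAt.comp (g := G) (f := fun w : (ι → ℝ) × ℝ => σ w.1) (z₀, t₀) h1 h2
    exact (((contDiff_apply ℝ ℝ none).comp contDiff_fst).contDiffAt).prodMk
      (h3.prodMk contDiffAt_snd)
  have hXC : ContDiffAt ℝ 1 K.X (q (z₀, t₀)) := by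
    rw [hqz₀]
    exact (K.smooth_X.contDiffAt (K.isOpen_dom.mem_nhds hq₀)).of_le (by norm_num)
  obtain ⟨L₁, W₁, hW₁, hL₁⟩ := (hXC.comp _ hqC).exists_lipschitzOnWith
  have hsC : ContDiffAt ℝ 1 K.s (x₀, t₀) :=
    (K.smooth_s.contDiffAt (K.isOpen_cod.mem_nhds hz₀)).of_le (by norm_num)
  have hrC : ContDiffAt ℝ 1 K.r (x₀, t₀) :=
    (K.smooth_r.contDiffAt (K.isOpen_cod.mem_nhds hz₀)).of_le (by norm_num)
  obtain ⟨Ls, Ws, hWs, hLs⟩ := hsC.exists_lipschitzOnWith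
  obtain ⟨Lr, Wr, hWr, hLr⟩ := hrC.exists_lipschitzOnWith
  obtain ⟨A, hAc, hA₀, hA⟩ := exists_compact_subset K.isOpen_cod hz₀
  obtain ⟨C, hC, hCb⟩ := K.exists_bound_derivs hAc hA
  have hΦc : ContinuousAt (fun w : (ι → ℝ) × ℝ => (K.X (q w), w.2)) (z₀, t₀) :=
    ((hXC.comp _ hqC).continuousAt).prodMk continuousAt_snd
  have hO₂ : A ∩ Ws ∩ Wr ∈ 𝓝 (x₀, t₀) :=
    inter_mem (inter_mem (mem_interior_iff_mem_nhds.1 hA₀) hWs) hWr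
  have hbox : ∀ᶠ w in 𝓝 (z₀, t₀), w ∈ W₁ ∧ q w ∈ K.dom ∧ (K.X (q w), w.2) ∈ A ∩ Ws ∩ Wr ∧
      w.1 none ∈ Ioo (-a) a := by
    have h1 : ∀ᶠ w in 𝓝 (z₀, t₀), q w ∈ K.dom :=
      hqC.continuousAt.eventually (by rw [hqz₀]; exact K.isOpen_dom.mem_nhds hq₀)
    have h2 : ∀ᶠ w in 𝓝 (z₀, t₀), (K.X (q w), w.2) ∈ A ∩ Ws ∩ Wr :=
      hΦc.eventually (by simp only [hqz₀]; exact hO₂)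
    have h3 : ∀ᶠ w : (ι → ℝ) × ℝ in 𝓝 (z₀, t₀), w.1 none ∈ Ioo (-a) a := by
      have : ContinuousAt (fun w : (ι → ℝ) × ℝ => w.1 none) (z₀, t₀) := by fun_prop
      exact this.eventually (isOpen_Ioo.mem_nhds hr₀)
    filter_upwards [hW₁, h1, h2, h3] with w a b c d using ⟨a, b, c, d⟩
  obtain ⟨κ₀, hκ₀, hκb⟩ := Metric.eventually_nhds_iff_ball.1 hbox
  set κ₁ := min κ₀ κ with hκ₁
  have hκ₁0 : 0 < κ₁ := lt_min hκ₀ hκ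
  have hgood : ∀ z ∈ Metric.ball z₀ κ₁, ∀ t ∈ Metric.ball t₀ κ₁, (z, t) ∈ W₁ ∧
      (z none, G (σ z), t) ∈ K.dom ∧ (K.X (z none, G (σ z), t), t) ∈ A ∩ Ws ∩ Wr ∧
      z none ∈ Ioo (-a) a := fun z hz t ht => hκb (z, t) (by
    rw [← ball_prod_same]
    exact ⟨Metric.ball_subset_ball (min_le_left _ _) hz,
      Metric.ball_subset_ball (min_le_left _ _) ht⟩)
  have hσκ : ∀ z ∈ Metric.ball z₀ κ₁, σ z ∈ Metric.ball 0 κ := fun z hz =>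
    Metric.ball_subset_ball (min_le_right _ _) (hσball hz)
  set ℓ := min ℓ₀ (κ₁ / 4) with hℓd
  have hℓ : 0 < ℓ := by positivity
  have hℓ1 : ℓ ≤ ℓ₀ := min_le_left _ _
  have hℓ2 : ℓ ≤ κ₁ / 4 := min_le_right _ _
  set B : ℝ → Set (ι → ℝ) := fun η => Metric.ball z₀ η ∩ {z | χ (σ z) ≤ 0} with hB
  have hBm : ∀ η ≤ κ₁, MeasurableSet (B η) := by
    intro η hη
    have h1 : ContinuousOn (fun z => χ (σ z)) (Metric.ball z₀ η) :=
      hχ.comp hσC.continuous.continuousOn fun z hz => hσκ z (Metric.ball_subset_ball hη hz)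
    have h2 := h1.isOpen_inter_preimage Metric.isOpen_ball (isOpen_Ioi (a := (0 : ℝ)))
    have h3 : B η = Metric.ball z₀ η \
        (Metric.ball z₀ η ∩ (fun z => χ (σ z)) ⁻¹' Ioi 0) := by
      ext z
      simp only [hB, mem_inter_iff, mem_ofPred_eq, Set.mem_sdiff, mem_preimage, mem_Ioi]
      constructor
      · exact fun h => ⟨h.1, fun h' => absurd h.2 (not_le.2 h'.2)⟩
      · exact fun h => ⟨h.1, not_lt.1 fun h' => h.2 ⟨h.1, h'⟩⟩
    rw [h3]
    exact Metric.isOpen_ball.measurableSet.diff h2.measurableSet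
  set Lmax : NNReal := max L₁ (max Lr (LP * Ls)) with hLmax
  -- By relative openness of the tube, points of `closure Ω` near `x₀` have coordinates over `Σ`.
  -- Continuity of `r` and `s` places these coordinates in the parameter box.
  have hcover : ∀ᶠ z in 𝓝 (x₀, t₀), z.1 ∈ closure Ω → z.2 ∈ Icc 0 T →
      z.1 ∈ (fun w : ι → ℝ => K.X (w none, G (σ w), z.2)) '' B (κ₁ / 2) := by
    obtain ⟨O, hO, hOeq⟩ := K.tube_open a ⟨ha, le_rfl⟩
    have hmem : (x₀, t₀) ∈ O := by
      have : (x₀, t₀) ∈ O ∩ closure Ω ×ˢ Icc 0 T := by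
        rw [← hOeq]
        exact ⟨(r₀, p₀, t₀), ⟨hr₀, hp₀, ht₀⟩, rfl⟩
      exact this.1
    have hs' : ContinuousAt K.s (x₀, t₀) := hsC.continuousAt
    have hr' : ContinuousAt K.r (x₀, t₀) := hrC.continuousAt
    have e1 : ∀ᶠ z in 𝓝 (x₀, t₀), K.s z ∈ Γ.S → G (P (K.s z)) = K.s z ∧ χ (P (K.s z)) ≤ 0 :=
      hs'.eventually (by rw [hs]; exact hev)
    have e2 : ∀ᶠ z in 𝓝 (x₀, t₀), P (K.s z) ∈ Metric.ball 0 (κ₁ / 2) := by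
      refine (hPL.continuous.continuousAt.comp hs').eventually ?_
      simp only [Function.comp_apply, hs, hP0]
      exact Metric.ball_mem_nhds _ (by positivity)
    have e3 : ∀ᶠ z in 𝓝 (x₀, t₀), K.r z ∈ Metric.ball r₀ (κ₁ / 2) :=
      hr'.eventually (by rw [hr]; exact Metric.ball_mem_nhds _ (by positivity))
    filter_upwards [hO.mem_nhds hmem, e1, e2, e3] with ⟨x, t⟩ h0 h1 h2 h3 hx ht
    have h4 : (x, t) ∈ O ∩ closure Ω ×ˢ Icc 0 T := ⟨h0, hx, ht⟩
    rw [← hOeq] at h4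
    obtain ⟨⟨ρ, p, t'⟩, ⟨hρ, hp, ht'⟩, heq⟩ := h4
    simp only [Prod.mk.injEq] at heq
    obtain ⟨hxe, rfl⟩ := heq
    have h5 := K.left_inv ρ p t' (K.subset_dom ⟨Ioo_subset_Icc_self hρ, hp, ht'⟩)
      (Γ.S_ssubset.subset hp)
    rw [hxe] at h5
    obtain ⟨_, h6, h7⟩ := h5
    rw [h7] at h1 h2
    rw [h6] at h3
    obtain ⟨h8, h9⟩ := h1 hp
    refine ⟨fun o => o.elim ρ (P p), ⟨?_, ?_⟩, ?_⟩
    · rw [Metric.mem_ball, dist_pi_lt_iff (by positivity)] at h2 ⊢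
      rintro (_ | j)
      · exact h3
      · exact h2 j
    · exact h9
    · show K.X (ρ, G (P p), t') = x
      rw [h8, hxe]
  refine ⟨{z | z.1 ∈ closure Ω → z.2 ∈ Icc 0 T →
      z.1 ∈ (fun w : ι → ℝ => K.X (w none, G (σ w), z.2)) '' B (κ₁ / 2)} ∩
      {z | z.2 ∈ Metric.ball t₀ κ₁}, inter_mem hcover ?_, _,
    const_ne_top hN Lmax ((1 / ℓ + γ) ^ N * (1 + L₁) ^ (N - 1)) (1 + 2 * √C),
    fun t ht ε hε v v' hv => ?_⟩
  · exact continuousAt_snd.eventually (Metric.ball_mem_nhds t₀ hκ₁0)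
  by_cases htt : t ∈ Metric.ball t₀ κ₁
  swap
  · have hempty : {x | x ∈ closure Ω ∧ (x, t) ∈ {z : Euc N × ℝ | z.1 ∈ closure Ω → z.2 ∈ Icc 0 T →
      z.1 ∈ (fun w : ι → ℝ => K.X (w none, G (σ w), z.2)) '' B (κ₁ / 2)} ∩
      {z | z.2 ∈ Metric.ball t₀ κ₁}} = ∅ := by
      ext x
      simp only [mem_ofPred_eq, mem_inter_iff, mem_empty_iff_false, iff_false]
      exact fun h => htt h.2.2
    rw [hempty, setLIntegral_empty]
    exact zero_le
  set Z : (ι → ℝ) → Euc N := fun w => K.X (w none, G (σ w), t) with hZ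
  set Y : Euc N → (ι → ℝ) := fun x o => o.elim (K.r (x, t)) (P (K.s (x, t))) with hY
  have hB1 : ∀ z ∈ B κ₁, G (σ z) ∈ Γ.S := fun z hz => hGS _ (hσκ z hz.1) hz.2
  have hinv : ∀ z ∈ B κ₁, (Z z, t) ∈ K.cod ∧ K.r (Z z, t) = z none ∧
      K.s (Z z, t) = G (σ z) := fun z hz =>
    K.left_inv _ _ t (hgood z hz.1 t htt).2.1 (Γ.S_ssubset.subset (hB1 z hz))
  have hZL : LipschitzOnWith L₁ Z (Metric.ball z₀ κ₁) := by
    refine LipschitzOnWith.of_dist_le_mul fun z hz w hw => ?_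
    have h1 := hL₁.dist_le_mul (z, t) (hgood z hz t htt).1 (w, t) (hgood w hw t htt).1
    simpa [Prod.dist_eq] using h1
  have hYL : LipschitzOnWith Lmax Y (Z '' B κ₁) := by
    refine LipschitzOnWith.of_dist_le_mul ?_
    rintro _ ⟨z, hz, rfl⟩ _ ⟨w, hw, rfl⟩
    have hz' := (hgood z hz.1 t htt).2.2.1
    have hw' := (hgood w hw.1 t htt).2.2.1
    have h1 := hLr.dist_le_mul (Z z, t) hz'.2 (Z w, t) hw'.2
    have h2 := hLs.dist_le_mul (Z z, t) hz'.1.2 (Z w, t) hw'.1.2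
    have h3 := hPL.dist_le_mul (K.s (Z z, t)) (K.s (Z w, t))
    have hd : dist ((Z z, t) : Euc N × ℝ) (Z w, t) = dist (Z z) (Z w) := by simp [Prod.dist_eq]
    rw [hd] at h1 h2
    rw [dist_pi_le_iff (by positivity)]
    rintro (_ | j)
    · refine h1.trans (mul_le_mul_of_nonneg_right ?_ dist_nonneg)
      exact_mod_cast (le_max_left Lr (LP * Ls)).trans (le_max_right _ _)
    · refine (dist_le_pi_dist (P (K.s (Z z, t))) (P (K.s (Z w, t))) j).trans (h3.trans ?_)
      calc (LP : ℝ) * dist (K.s (Z z, t)) (K.s (Z w, t)) ≤ LP * (Ls * dist (Z z) (Z w)) := by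
            gcongr
        _ = ((LP * Ls : NNReal) : ℝ) * dist (Z z) (Z w) := by push_cast; ring
        _ ≤ Lmax * dist (Z z) (Z w) := by
            refine mul_le_mul_of_nonneg_right ?_ dist_nonneg
            exact_mod_cast (le_max_right Lr (LP * Ls)).trans (le_max_right _ _)
  have hYZ : LeftInvOn Y Z (B κ₁) := by
    intro z hz
    obtain ⟨_, h1, h2⟩ := hinv z hz
    ext (_ | j)
    · exact h1
    · show P (K.s (Z z, t)) j = z (some j)
      rw [h2, hPG _ (hσκ z hz.1)]
  have hZΩ : MapsTo Z (B κ₁) (closure Ω) := fun z hz =>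
    K.X_mem _ (Ioo_subset_Icc_self (hgood z hz.1 t htt).2.2.2) _ (hB1 z hz) t ht
  have hBsub : B (κ₁ / 2) ⊆ B κ₁ :=
    inter_subset_inter_left _ (Metric.ball_subset_ball (by linarith))
  have hballseg : ∀ z ∈ Metric.ball z₀ (κ₁ / 2), ∀ i, ∀ τ ∈ Icc 0 ℓ,
      z + τ • Pi.single i 1 ∈ Metric.ball z₀ κ₁ := by
    intro z hz i τ hτ
    have h1 : ‖τ • (Pi.single i 1 : ι → ℝ)‖ ≤ κ₁ / 4 := by
      rw [norm_smul, Real.norm_of_nonneg hτ.1, Pi.norm_single, norm_one, mul_one]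
      exact hτ.2.trans hℓ2
    rw [Metric.mem_ball, dist_eq_norm] at hz ⊢
    calc ‖z + τ • Pi.single i 1 - z₀‖ = ‖(z - z₀) + τ • Pi.single i 1‖ := by congr 1; abel
      _ ≤ ‖z - z₀‖ + ‖τ • (Pi.single i 1 : ι → ℝ)‖ := norm_add_le _ _
      _ < κ₁ := by linarith
  have hσnone : ∀ (z : ι → ℝ) (τ : ℝ), σ (z + τ • Pi.single none 1) = σ z := by
    intro z τ; ext j; simp [hσ]
  have hσsome : ∀ (z : ι → ℝ) (τ : ℝ) (j), σ (z + τ • Pi.single (some j) 1) =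
      σ z + τ • Pi.single j 1 := by
    intro z τ j; ext k
    rcases eq_or_ne k j with rfl | hk
    · simp [hσ]
    · simp [hσ, hk]
  have hχseg : ∀ z ∈ B (κ₁ / 2), ∀ j, ∀ τ ∈ Ioc 0 ℓ,
      χ (σ (z + τ • Pi.single (some j) 1)) < 0 := by
    intro z hz j τ hτ
    rw [hσsome]
    exact hcone _ (hσκ z (hBsub hz).1) hz.2 j τ ⟨hτ.1, hτ.2.trans hℓ1⟩
  have hseg : ∀ z ∈ B (κ₁ / 2), ∀ i, ∀ τ ∈ Icc 0 ℓ, z + τ • Pi.single i 1 ∈ B κ₁ := by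
    intro z hz i τ hτ
    refine ⟨hballseg z hz.1 i τ hτ, ?_⟩
    rcases i with _ | j
    · show χ _ ≤ 0
      rw [hσnone]; exact hz.2
    · rcases hτ.1.eq_or_lt with h0 | h0
      · rw [← h0, zero_smul, add_zero]; exact hz.2
      · exact (hχseg z hz j τ ⟨h0, hτ.2⟩).le
  set H : Euc N → ℝ := fun x => ‖v x‖ + (√(frobSq (K.tangentialDeriv (x, t) (v' x)))
    + ε * ‖K.normalDeriv (x, t) (v' x)‖) with hH
  have hε0 := hε.1
  -- The normal direction costs `ε⁻¹`; in the others the speed of the coordinate curves is at most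
  -- the Lipschitz constant `L₁` of the chart. The summand one ensures `α ≥ 1`.
  set α : ι → ℝ := fun o => o.elim ε⁻¹ fun _ => 1 + L₁ with hα
  have hL₁0 : (0 : ℝ) ≤ L₁ := L₁.2
  have key := local_estimate_of_chart hΩ hN hcard hγ hℓ (α := α)
    (by
      rintro (_ | j)
      · exact (one_le_inv₀ hε.1).2 hε.2
      · exact le_add_of_nonneg_right hL₁0) (P := (1 + L₁) ^ (N - 1)) hε.1 (by
      rw [Fintype.prod_option]
      simp only [hα, Option.elim, Finset.prod_const, Finset.card_univ, Fintype.card_fin]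
      rw [mul_comm]) (hBm _ (by linarith)) (hBm κ₁ le_rfl) hBsub
    ((hZL.mono inter_subset_left).weaken (le_max_left _ _)) hYL hYZ hZΩ hv
    (H := H) (H' := energyDensity K δ ε t v v') ?_ ?_ (c := 1 + 2 * √C) (by positivity) ?_ hseg ?_
  · have himg : {x | x ∈ closure Ω ∧ (x, t) ∈ {z : Euc N × ℝ | z.1 ∈ closure Ω → z.2 ∈ Icc 0 T →
      z.1 ∈ (fun w : ι → ℝ => K.X (w none, G (σ w), z.2)) '' B (κ₁ / 2)} ∩
      {z | z.2 ∈ Metric.ball t₀ κ₁}} ⊆ Z '' B (κ₁ / 2) := fun x hx => hx.2.1 hx.1 ht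
    exact (lintegral_mono_set himg).trans key
  · have hsub : Z '' B κ₁ ⊆ closure Ω := image_subset_iff.2 hZΩ
    have hcod : MapsTo (fun x => (x, t)) (Z '' B κ₁) K.cod := by
      rintro _ ⟨z, hz, rfl⟩
      exact (hinv z hz).1
    have hpc : ContinuousOn (fun x : Euc N => (x, t)) (Z '' B κ₁) := by fun_prop
    have hv'c := hv.cont'.mono hsub
    refine ((hv.cont.mono hsub).norm).add (ContinuousOn.add ?_ (continuousOn_const.mul ?_))
    · exact Real.continuous_sqrt.comp_continuousOn (continuous_frobSq.comp_continuousOn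
        (K.continuousOn_tangentialDeriv hpc hv'c hcod))
    · exact (K.continuousOn_normalDeriv hpc hv'c hcod).norm
  · exact fun x _ => le_add_of_nonneg_right (by positivity)
  · rintro _ ⟨z, hz, rfl⟩
    -- The chart may leave the tube of width `δ`, where the energy density contains the full
    -- gradient. This dominates the tangential and the normal derivative, each up to `√C`.
    have hzA := (hgood z hz.1 t htt).2.2.1.1.1
    obtain ⟨h1, h2⟩ := hCb _ hzA m (v' (Z z))
    have h0 := frobSq_nonneg (v' (Z z))
    have h3 : √(frobSq (K.tangentialDeriv (Z z, t) (v' (Z z)))) ≤ √C * √(frobSq (v' (Z z))) := by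
      rw [← Real.sqrt_mul hC]; exact Real.sqrt_le_sqrt h1
    have h4 : ‖K.normalDeriv (Z z, t) (v' (Z z))‖ ≤ √C * √(frobSq (v' (Z z))) := by
      rw [← Real.sqrt_mul hC]; exact Real.le_sqrt_of_sq_le h2
    have h5 : ε * ‖K.normalDeriv (Z z, t) (v' (Z z))‖ ≤ √C * √(frobSq (v' (Z z))) := by
      refine le_trans ?_ h4
      exact mul_le_of_le_one_left (norm_nonneg _) hε.2
    have hsC := Real.sqrt_nonneg C
    have hsf := Real.sqrt_nonneg (frobSq (v' (Z z)))
    have hvn := norm_nonneg (v (Z z))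
    simp only [hH, energyDensity]
    split_ifs with hsl
    · refine le_mul_of_one_le_left ?_ (by linarith)
      positivity
    · nlinarith [mul_nonneg hsC hvn, mul_nonneg hsC hsf]
  · intro z hz i τ hτ
    have hτ' := Ioo_subset_Icc_self hτ
    have hzB := hseg z hz i τ hτ'
    have hdom := (hgood _ hzB.1 t htt).2.1
    obtain ⟨hcod, hri, hsi⟩ := hinv _ hzB
    rcases i with _ | j
    · have hnone : ∀ τ : ℝ, (z + τ • (Pi.single none 1 : ι → ℝ)) none = z none + τ := by
        intro τ; simp
      rw [hnone, hσnone] at hdom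
      have h1 := (K.hasDerivAt_X_radial hdom).comp_const_add (z none) τ
      refine ⟨fderiv ℝ K.X (z none + τ, G (σ z), t) (1, 0), ?_, ?_⟩
      · refine h1.congr_of_eventuallyEq (Eventually.of_forall fun τ => ?_)
        simp only [hZ, hnone, hσnone]
      · have h2 : K.derivRadial (Z (z + τ • Pi.single none 1), t) =
            fderiv ℝ K.X (z none + τ, G (σ z), t) (1, 0) := by
          rw [CurvilinearCoordinates.derivRadial, hri, hsi, hnone, hσnone]
          exact (K.hasDerivAt_X_radial hdom).deriv
        rw [← h2, ← K.normalDeriv_def]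
        show _ ≤ ε⁻¹ * _
        rw [← div_eq_inv_mul, le_div_iff₀ hε.1, mul_comm]
        have := norm_nonneg (v (Z (z + τ • Pi.single none 1)))
        have := Real.sqrt_nonneg (frobSq (K.tangentialDeriv (Z (z + τ • Pi.single none 1), t)
          (v' (Z (z + τ • Pi.single none 1)))))
        simp only [hH]
        linarith
    · have hsome : ∀ τ : ℝ, (z + τ • (Pi.single (some j) 1 : ι → ℝ)) none = z none := by
        intro τ; simp
      rw [hsome, hσsome] at hdom
      rw [hsome] at hri
      rw [hσsome] at hsi
      have hσz := hσκ _ hzB.1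
      rw [hσsome] at hσz
      have hGd : DifferentiableAt ℝ G (σ z + τ • Pi.single j 1) :=
        (hGC.contDiffAt (Metric.isOpen_ball.mem_nhds hσz)).differentiableAt one_ne_zero
      have hline : HasDerivAt (fun τ : ℝ => σ z + τ • (Pi.single j 1 : Fin (N - 1) → ℝ))
          (Pi.single j 1) τ := by
        simpa using ((hasDerivAt_id τ).smul_const (Pi.single j (1 : ℝ))).const_add (σ z)
      have hg := hGd.hasFDerivAt.comp_hasDerivAt τ hline
      set g := fderiv ℝ G (σ z + τ • Pi.single j 1) (Pi.single j 1) with hgdef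
      have hXs := K.hasFDerivAt_X_surface hdom
      have hDS : K.derivSurface (Z (z + τ • Pi.single (some j) 1), t) =
          fderiv ℝ (fun p => K.X (z none, p, t)) (G (σ z + τ • Pi.single j 1)) := by
        rw [CurvilinearCoordinates.derivSurface, hri, hsi]
      rw [hXs.fderiv] at hDS
      have hcurve : HasDerivAt (fun τ : ℝ => Z (z + τ • Pi.single (some j) 1))
          (K.derivSurface (Z (z + τ • Pi.single (some j) 1), t) g) τ := by
        rw [hDS]
        have h1 := HasFDerivAt.comp_hasDerivAt
          (l := fun p => K.X (z none, p, t)) τ hXs hg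
        refine h1.congr_of_eventuallyEq (Eventually.of_forall fun τ => ?_)
        simp only [hZ, hsome, hσsome, Function.comp_apply]
      set w := K.derivSurface (Z (z + τ • Pi.single (some j) 1), t) g with hw
      -- Along the curve the coordinate `s` equals `G(σ)`, so `Dₓs` maps the velocity `w` back to
      -- the velocity `g` on the hypersurface. As `d_ΣX` maps `g` to `w`, the composition in
      -- `tangentialDeriv` fixes `w`.
      have hDP : K.derivProj (Z (z + τ • Pi.single (some j) 1), t) w = g := by
        have h1 : HasDerivAt (fun τ : ℝ => K.s (Z (z + τ • Pi.single (some j) 1), t))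
            (K.derivProj (Z (z + τ • Pi.single (some j) 1), t) w) τ := by
          have h2 := K.hasFDerivAt_s hcod
          have h3 : K.derivProj (Z (z + τ • Pi.single (some j) 1), t) = _ := h2.fderiv
          rw [h3]
          exact HasFDerivAt.comp_hasDerivAt (l := fun y => K.s (y, t)) τ h2 hcurve
        refine h1.unique (hg.congr_of_eventuallyEq ?_)
        filter_upwards [Ioo_mem_nhds hτ.1 hτ.2] with τ' hτ''
        have h4 := (hinv _ (hseg z hz (some j) τ' (Ioo_subset_Icc_self hτ''))).2.2
        rw [hσsome] at h4
        exact h4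
      have hwn : ‖w‖ ≤ L₁ := by
        have hnhds : Ioo 0 ℓ ∈ 𝓝 τ := Ioo_mem_nhds hτ.1 hτ.2
        refine hcurve.le_of_lipschitzOn hnhds (LipschitzOnWith.of_dist_le_mul ?_)
        intro τ₁ h₁ τ₂ h₂
        have h3 := hZL.dist_le_mul _ (hseg z hz (some j) τ₁ (Ioo_subset_Icc_self h₁)).1 _
          (hseg z hz (some j) τ₂ (Ioo_subset_Icc_self h₂)).1
        refine h3.trans (mul_le_mul_of_nonneg_left (le_of_eq ?_) hL₁0)
        rw [dist_add_left, dist_eq_norm, ← sub_smul, norm_smul, Pi.norm_single, norm_one, mul_one,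
          dist_eq_norm]
      refine ⟨w, hcurve, ?_⟩
      have h5 : v' (Z (z + τ • Pi.single (some j) 1)) w =
          K.tangentialDeriv (Z (z + τ • Pi.single (some j) 1), t)
            (v' (Z (z + τ • Pi.single (some j) 1))) w := by
        rw [K.tangentialDeriv_def]
        simp only [ContinuousLinearMap.comp_apply, hDP, ← hw]
      rw [h5]
      refine (norm_apply_le_frobSq _ _).trans ?_
      rw [mul_comm]
      have hHge : √(frobSq (K.tangentialDeriv (Z (z + τ • Pi.single (some j) 1), t)
          (v' (Z (z + τ • Pi.single (some j) 1))))) ≤ H (Z (z + τ • Pi.single (some j) 1)) := by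
        have := norm_nonneg (v (Z (z + τ • Pi.single (some j) 1)))
        have : 0 ≤ ε * ‖K.normalDeriv (Z (z + τ • Pi.single (some j) 1), t)
          (v' (Z (z + τ • Pi.single (some j) 1)))‖ := by positivity
        simp only [hH]
        linarith
      exact mul_le_mul (by show ‖w‖ ≤ 1 + L₁; linarith) hHge (Real.sqrt_nonneg _)
        (by show (0 : ℝ) ≤ 1 + L₁; linarith)

end TubeChart

/-! ### Globalization of the chart inequality and the anisotropic energy. -/

section Interpolation

variable {N m : ℕ} {Ω : Set (Euc N)} {T : ℝ} {Γ : EvolvingHypersurface Ω T} {a : ℝ}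

/-- Compactness of the space-time cylinder reduces the claim to the two local estimates: the tube
chart on the closed tube, where `δ < a` leaves room, and an affine chart on its complement. Covering
space-time instead of `Ω` at fixed time makes the constant uniform in `t`. -/
theorem global_estimate (hΩ : IsSmoothBoundedDomain Ω) (hN : 2 ≤ N)
    (K : CurvilinearCoordinates Γ a) {δ γ : ℝ} (hδ : δ ∈ Ioo 0 a) (hγ : 1 < γ) (m : ℕ) :
    ∃ C : ENNReal, C ≠ ⊤ ∧ ∀ t ∈ Icc 0 T, ∀ ε ∈ Ioc (0 : ℝ) 1, ∀ (v : Euc N → Euc m)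
    (v' : Euc N → Euc N →L[ℝ] Euc m), IsC1Closure Ω v v' →
    ∫⁻ x in Ω, ENNReal.ofReal (‖v x‖ ^ (γ * (N / (N - 1)))) ≤
      C * ENNReal.ofReal ε⁻¹ ^ (1 / (N - 1 : ℝ)) *
      (∫⁻ x in Ω, ENNReal.ofReal (‖v x‖ ^ (γ - 1) * energyDensity K δ ε t v v' x))
        ^ ((N : ℝ) / (N - 1)) := by
  have hcpt : IsCompact (closure Ω ×ˢ Icc 0 T) := isCompact_cylinder hΩ.isBounded T
  suffices h : ∃ C : ENNReal, C ≠ ⊤ ∧ ∀ t ∈ Icc 0 T, ∀ ε ∈ Ioc (0 : ℝ) 1, ∀ (v : Euc N → Euc m)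
      (v' : Euc N → Euc N →L[ℝ] Euc m), IsC1Closure Ω v v' →
      ∫⁻ x in {x | x ∈ closure Ω ∧ (x, t) ∈ closure Ω ×ˢ Icc 0 T},
        ENNReal.ofReal (‖v x‖ ^ (γ * (N / (N - 1)))) ≤
      C * ENNReal.ofReal ε⁻¹ ^ (1 / (N - 1 : ℝ)) *
      (∫⁻ x in Ω, ENNReal.ofReal (‖v x‖ ^ (γ - 1) * energyDensity K δ ε t v v' x))
        ^ ((N : ℝ) / (N - 1)) by
    obtain ⟨C, hC, h⟩ := h
    refine ⟨C, hC, fun t ht ε hε v v' hv => le_trans (lintegral_mono_set ?_) (h t ht ε hε v v' hv)⟩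
    exact fun x hx => ⟨subset_closure hx, subset_closure hx, ht⟩
  refine hcpt.induction_on (p := fun s => ∃ C : ENNReal, C ≠ ⊤ ∧ ∀ t ∈ Icc 0 T,
      ∀ ε ∈ Ioc (0 : ℝ) 1, ∀ (v : Euc N → Euc m)
      (v' : Euc N → Euc N →L[ℝ] Euc m), IsC1Closure Ω v v' →
      ∫⁻ x in {x | x ∈ closure Ω ∧ (x, t) ∈ s},
        ENNReal.ofReal (‖v x‖ ^ (γ * (N / (N - 1)))) ≤
      C * ENNReal.ofReal ε⁻¹ ^ (1 / (N - 1 : ℝ)) *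
      (∫⁻ x in Ω, ENNReal.ofReal (‖v x‖ ^ (γ - 1) * energyDensity K δ ε t v v' x))
        ^ ((N : ℝ) / (N - 1))) ?_ ?_ ?_ ?_
  · refine ⟨0, ENNReal.zero_ne_top, fun t ht ε hε v v' hv => ?_⟩
    simp
  · rintro s s' hss ⟨C, hC, h⟩
    refine ⟨C, hC, fun t ht ε hε v v' hv => le_trans (lintegral_mono_set ?_) (h t ht ε hε v v' hv)⟩
    exact fun x hx => ⟨hx.1, hss hx.2⟩
  · rintro s s' ⟨C, hC, h⟩ ⟨C', hC', h'⟩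
    refine ⟨C + C', ENNReal.add_ne_top.2 ⟨hC, hC'⟩, fun t ht ε hε v v' hv => ?_⟩
    have hu : {x | x ∈ closure Ω ∧ (x, t) ∈ s ∪ s'} =
        {x | x ∈ closure Ω ∧ (x, t) ∈ s} ∪ {x | x ∈ closure Ω ∧ (x, t) ∈ s'} := by
      ext x
      simp only [mem_ofPred_eq, mem_union]
      tauto
    rw [hu, add_mul, add_mul]
    exact (lintegral_union_le _ _ _).trans
      (add_le_add (h t ht ε hε v v' hv) (h' t ht ε hε v v' hv))
  · rintro ⟨x₀, t₀⟩ ⟨hx₀, ht₀⟩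
    have hloc : LocalEstimate K δ γ m (x₀, t₀) := by
      by_cases h : (x₀, t₀) ∈ K.closedTube δ
      · obtain ⟨⟨r, p, t⟩, ⟨hr, hp, ht⟩, heq⟩ := h
        rw [← heq]
        exact localEstimate_of_mem hΩ hN K hγ ⟨by linarith [hr.1, hδ.2], by linarith [hr.2, hδ.2]⟩
          hp ht
      · refine localEstimate_of_notMem hΩ hN K hγ hx₀ ?_
        filter_upwards [(K.isCompact_closedTube hδ.2.le).isClosed.isOpen_compl.mem_nhds h] with z hz
        exact fun h' => hz (K.tube_subset_closedTube δ h')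
    obtain ⟨O, hO, hC⟩ := hloc
    exact ⟨O, mem_nhdsWithin_of_mem_nhds hO, hC⟩

/-- Integrability on the open tube is inherited from the closed one, which is compact and still
contained in the domain of the coordinates. -/
theorem integrableOn_slice (hΩ : IsSmoothBoundedDomain Ω) (K : CurvilinearCoordinates Γ a) {δ : ℝ}
    (hδ : δ ∈ Ioc 0 a) (t : ℝ) {F : Type*} [NormedAddCommGroup F] {f : Euc N → F}
    (hf : ContinuousOn f {x | (x, t) ∈ K.closedTube δ}) : IntegrableOn f (Ω ∩ K.slice δ t) := by
  have hsub : {x | (x, t) ∈ K.closedTube δ} ⊆ closure Ω := fun x hx =>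
    (K.closedTube_subset_cylinder hδ.2 hx).1
  have hcl : IsClosed {x | (x, t) ∈ K.closedTube δ} :=
    (K.isCompact_closedTube hδ.2).isClosed.preimage (by fun_prop)
  have hcpt := hΩ.isBounded.isCompact_closure.of_isClosed_subset hcl hsub
  exact (hf.integrableOn_compact hcpt).mono_set fun x hx => K.tube_subset_closedTube δ hx.2

theorem continuousOn_slice_tangentialDeriv (K : CurvilinearCoordinates Γ a) {δ : ℝ}
    (hδ : δ ≤ a) (t : ℝ) {v' : Euc N → Euc N →L[ℝ] Euc m}
    (hv : ContinuousOn v' (closure Ω)) :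
    ContinuousOn (fun x => K.tangentialDeriv (x, t) (v' x)) {x | (x, t) ∈ K.closedTube δ} :=
  K.continuousOn_tangentialDeriv (by fun_prop)
    (hv.mono fun _ hx => (K.closedTube_subset_cylinder hδ hx).1)
    fun _ hx => K.closedTube_subset_cod hδ hx

theorem continuousOn_slice_normalDeriv (K : CurvilinearCoordinates Γ a) {δ : ℝ}
    (hδ : δ ≤ a) (t : ℝ) {v' : Euc N → Euc N →L[ℝ] Euc m}
    (hv : ContinuousOn v' (closure Ω)) :
    ContinuousOn (fun x => K.normalDeriv (x, t) (v' x)) {x | (x, t) ∈ K.closedTube δ} :=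
  K.continuousOn_normalDeriv (by fun_prop)
    (hv.mono fun _ hx => (K.closedTube_subset_cylinder hδ hx).1)
    fun _ hx => K.closedTube_subset_cod hδ hx

/-- The anisotropic `H¹` energy. -/
def anisotropicEnergy (K : CurvilinearCoordinates Γ a) (δ ε t : ℝ) (v : Euc N → Euc m)
    (v' : Euc N → Euc N →L[ℝ] Euc m) : ℝ :=
  (∫ x in Ω, ‖v x‖ ^ 2) + (∫ x in Ω \ K.slice δ t, frobSq (v' x)) +
    (∫ x in Ω ∩ K.slice δ t, frobSq (K.tangentialDeriv (x, t) (v' x))) +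
    ε ^ 2 * ∫ x in Ω ∩ K.slice δ t, ‖K.normalDeriv (x, t) (v' x)‖ ^ 2

variable (K : CurvilinearCoordinates Γ a) {δ : ℝ} (hδ : δ ∈ Ioc 0 a)
  (hΩ : IsSmoothBoundedDomain Ω)
include hδ hΩ

theorem integrableOn_frobSq_tangential (t : ℝ) {v' : Euc N → Euc N →L[ℝ] Euc m}
    (hv : ContinuousOn v' (closure Ω)) :
    IntegrableOn (fun x => frobSq (K.tangentialDeriv (x, t) (v' x))) (Ω ∩ K.slice δ t) :=
  integrableOn_slice hΩ K hδ t (continuous_frobSq.comp_continuousOn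
    (continuousOn_slice_tangentialDeriv K hδ.2 t hv))

theorem integrableOn_norm_normal (t : ℝ) {v' : Euc N → Euc N →L[ℝ] Euc m}
    (hv : ContinuousOn v' (closure Ω)) :
    IntegrableOn (fun x => ‖K.normalDeriv (x, t) (v' x)‖ ^ 2) (Ω ∩ K.slice δ t) :=
  integrableOn_slice hΩ K hδ t ((continuousOn_slice_normalDeriv K hδ.2 t hv).norm.pow 2)

theorem lintegral_energyDensity_sq_le (t : ℝ) {ε : ℝ} {v : Euc N → Euc m}
    {v' : Euc N → Euc N →L[ℝ] Euc m} (hv : IsC1Closure Ω v v') :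
    ∫⁻ x in Ω, ENNReal.ofReal (energyDensity K δ ε t v v' x ^ 2) ≤
      ENNReal.ofReal (3 * anisotropicEnergy K δ ε t v v') := by
  have hsm := K.measurableSet_slice hδ t
  have hΩm := hΩ.isOpen.measurableSet
  have i1 : IntegrableOn (fun x => ‖v x‖ ^ 2) Ω :=
    integrableOn_of_continuousOn_closure hΩ.isBounded (hv.cont.norm.pow 2)
  have i2 : IntegrableOn (fun x => frobSq (v' x)) Ω :=
    integrableOn_of_continuousOn_closure hΩ.isBounded
      (continuous_frobSq.comp_continuousOn hv.cont')
  have i3 := integrableOn_frobSq_tangential K hδ hΩ t hv.cont'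
  have i4 := integrableOn_norm_normal K hδ hΩ t hv.cont'
  set f1 : Euc N → ℝ := (K.slice δ t)ᶜ.indicator fun x => frobSq (v' x)
  set f2 : Euc N → ℝ := (K.slice δ t).indicator fun x => frobSq (K.tangentialDeriv (x, t) (v' x))
  set f3 : Euc N → ℝ := (K.slice δ t).indicator fun x => ‖K.normalDeriv (x, t) (v' x)‖ ^ 2
  have j1 : IntegrableOn f1 Ω := i2.indicator hsm.compl
  have j2 : IntegrableOn f2 Ω := by
    rw [IntegrableOn, integrable_indicator_iff hsm, IntegrableOn,
      Measure.restrict_restrict hsm, inter_comm]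
    exact i3
  have j3 : IntegrableOn f3 Ω := by
    rw [IntegrableOn, integrable_indicator_iff hsm, IntegrableOn,
      Measure.restrict_restrict hsm, inter_comm]
    exact i4
  have hsum : anisotropicEnergy K δ ε t v v' =
      ∫ x in Ω, (‖v x‖ ^ 2 + f1 x + f2 x + ε ^ 2 * f3 x) := by
    have k1 : IntegrableOn (fun x => ‖v x‖ ^ 2 + f1 x) Ω := i1.add j1
    have k2 : IntegrableOn (fun x => ‖v x‖ ^ 2 + f1 x + f2 x) Ω := k1.add j2
    rw [integral_add k2 (j3.const_mul _), integral_add k1 j2,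
      integral_add i1 j1, integral_const_mul, setIntegral_indicator hsm.compl,
      setIntegral_indicator hsm, setIntegral_indicator hsm, ← sdiff_eq]
    rfl
  have hint : IntegrableOn (fun x => 3 * (‖v x‖ ^ 2 + f1 x + f2 x + ε ^ 2 * f3 x)) Ω :=
    (((i1.add j1).add j2).add (j3.const_mul _)).const_mul 3
  have hnn : ∀ x, 0 ≤ ‖v x‖ ^ 2 + f1 x + f2 x + ε ^ 2 * f3 x := fun x => by
    have h1 : 0 ≤ f1 x := indicator_nonneg (fun x _ => frobSq_nonneg _) x
    have h2 : 0 ≤ f2 x := indicator_nonneg (fun x _ => frobSq_nonneg _) x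
    have h3 : 0 ≤ f3 x := indicator_nonneg (fun x _ => sq_nonneg _) x
    positivity
  rw [hsum, ← integral_const_mul, ofReal_integral_eq_lintegral_ofReal hint
    (Eventually.of_forall fun x => by have := hnn x; simp only [Pi.zero_apply]; positivity)]
  refine lintegral_mono fun x => ENNReal.ofReal_le_ofReal ?_
  simp only [energyDensity]
  split_ifs with h
  · have e1 : f1 x = 0 := indicator_of_notMem (notMem_compl_iff.2 h) _
    have e2 : f2 x = frobSq (K.tangentialDeriv (x, t) (v' x)) := indicator_of_mem h _
    have e3 : f3 x = ‖K.normalDeriv (x, t) (v' x)‖ ^ 2 := indicator_of_mem h _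
    rw [e1, e2, e3]
    have h4 := Real.sq_sqrt (frobSq_nonneg (K.tangentialDeriv (x, t) (v' x)))
    set A := √(frobSq (K.tangentialDeriv (x, t) (v' x)))
    rw [← h4]
    nlinarith [sq_nonneg (‖v x‖ - A), sq_nonneg (‖v x‖ - ε * ‖K.normalDeriv (x, t) (v' x)‖),
      sq_nonneg (A - ε * ‖K.normalDeriv (x, t) (v' x)‖)]
  · have e1 : f1 x = frobSq (v' x) := indicator_of_mem h _
    have e2 : f2 x = 0 := indicator_of_notMem h _
    have e3 : f3 x = 0 := indicator_of_notMem h _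
    rw [e1, e2, e3]
    have h4 := Real.sq_sqrt (frobSq_nonneg (v' x))
    set A := √(frobSq (v' x))
    rw [← h4]
    nlinarith [sq_nonneg (‖v x‖ - A), sq_nonneg ‖v x‖, sq_nonneg A]

theorem aemeasurable_energyDensity (t ε : ℝ) {v : Euc N → Euc m}
    {v' : Euc N → Euc N →L[ℝ] Euc m} (hv : IsC1Closure Ω v v') :
    AEMeasurable (energyDensity K δ ε t v v') (volume.restrict Ω) := by
  have hsm := K.measurableSet_slice hδ t
  have i1 : AEMeasurable (fun x => ‖v x‖) (volume.restrict Ω) :=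
    (integrableOn_of_continuousOn_closure hΩ.isBounded hv.cont.norm).aemeasurable
  have i2 : AEMeasurable (fun x => √(frobSq (v' x))) (volume.restrict Ω) :=
    (integrableOn_of_continuousOn_closure hΩ.isBounded (Real.continuous_sqrt.comp_continuousOn
      (continuous_frobSq.comp_continuousOn hv.cont'))).aemeasurable
  have i3 : AEMeasurable (fun x => √(frobSq (K.tangentialDeriv (x, t) (v' x)))
      + ε * ‖K.normalDeriv (x, t) (v' x)‖) (volume.restrict (Ω ∩ K.slice δ t)) := by
    refine (integrableOn_slice hΩ K hδ t ?_).aemeasurable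
    exact (Real.continuous_sqrt.comp_continuousOn (continuous_frobSq.comp_continuousOn
      (continuousOn_slice_tangentialDeriv K hδ.2 t hv.cont'))).add
      (continuousOn_const.mul (continuousOn_slice_normalDeriv K hδ.2 t hv.cont').norm)
  have j2 : AEMeasurable ((K.slice δ t)ᶜ.indicator fun x => √(frobSq (v' x)))
      (volume.restrict Ω) := i2.indicator hsm.compl
  have j3 : AEMeasurable ((K.slice δ t).indicator
      fun x => √(frobSq (K.tangentialDeriv (x, t) (v' x)))
      + ε * ‖K.normalDeriv (x, t) (v' x)‖) (volume.restrict Ω) := by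
    rw [aemeasurable_indicator_iff hsm, Measure.restrict_restrict hsm, inter_comm]
    exact i3
  refine ((i1.add j2).add j3).congr (Eventually.of_forall fun x => ?_)
  by_cases h : x ∈ K.slice δ t
  · simp [energyDensity, h]
  · simp [energyDensity, h]

end Interpolation

/-! ### The interpolation inequality with exponent `2 + 4/N`. -/

section Absorption

/-- The finiteness of `Q` permits the cancellation. It will hold since the function is continuous up
to the boundary. -/
theorem le_of_le_mul_rpow {Q R : ENNReal} {s : ℝ} (hQ : Q ≠ ⊤) (hs : 0 ≤ s)
    (h : Q ^ (1 + s) ≤ R * Q ^ s) : Q ≤ R := by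
  rcases eq_or_ne Q 0 with h0 | h0
  · rw [h0]; exact zero_le
  · rw [ENNReal.rpow_add _ _ h0 hQ, ENNReal.rpow_one] at h
    exact (ENNReal.mul_le_mul_iff_left (ENNReal.rpow_pos (pos_iff_ne_zero.2 h0) hQ).ne'
      (ENNReal.rpow_ne_top_of_nonneg hs hQ)).1 h

variable {N m : ℕ} {Ω : Set (Euc N)} {T : ℝ} {Γ : EvolvingHypersurface Ω T} {a : ℝ}

/-- **Interpolation inequality** of Gagliardo-Nirenberg type with an anisotropic energy. -/
theorem exists_interpolation (hΩ : IsSmoothBoundedDomain Ω) (hN : 2 ≤ N)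
    (K : CurvilinearCoordinates Γ a) {δ : ℝ} (hδ : δ ∈ Ioo 0 a) (m : ℕ) :
    ∃ C : ℝ, 0 < C ∧ ∀ t ∈ Icc 0 T, ∀ ε ∈ Ioc (0 : ℝ) 1, ∀ (v : Euc N → Euc m)
    (v' : Euc N → Euc N →L[ℝ] Euc m), IsC1Closure Ω v v' →
    ∫ x in Ω, ‖v x‖ ^ (2 + 4 / N : ℝ) ≤
      C * ε⁻¹ ^ (2 / N : ℝ) * (∫ x in Ω, ‖v x‖ ^ 2) ^ (2 / N : ℝ) *
        anisotropicEnergy K δ ε t v v' := by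
  have hδ' : δ ∈ Ioc 0 a := ⟨hδ.1, hδ.2.le⟩
  have hN2 : (2 : ℝ) ≤ N := by exact_mod_cast hN
  have hN0 : (0 : ℝ) < N := by linarith
  have hN1 : (0 : ℝ) < N - 1 := by linarith
  -- The exponent is determined by `γ N/(N-1) = 2 + 4/N`; it exceeds one for `N ≥ 2`.
  set γ : ℝ := 2 * (N + 2) * (N - 1) / N ^ 2 with hγd
  have hγ : 1 < γ := by
    rw [hγd, lt_div_iff₀ (by positivity)]
    nlinarith
  have hq : γ * (N / (N - 1)) = 2 + 4 / N := by
    rw [hγd]; field_simp; ring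
  obtain ⟨C, hC, h⟩ := global_estimate hΩ hN K hδ hγ m
  -- Raising the chart inequality to the power `s` makes the energy appear linearly, since
  -- `(1/2)·(N/(N-1))·s = 1`, and turns `ε^(-1/(N-1))` into `ε^(-2/N)`.
  set s : ℝ := 2 * (N - 1) / N with hs
  have hs0 : 0 ≤ s := by positivity
  have hNs : (N - 2 : ℝ) / N = s - 1 := by rw [hs]; field_simp; ring
  have hNs0 : 0 ≤ (N - 2 : ℝ) / N := div_nonneg (by linarith) hN0.le
  have hC's : C ^ s ≠ ⊤ := ENNReal.rpow_ne_top_of_nonneg hs0 hC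
  -- The factor three comes from squaring the three terms of the energy density; the summand one
  -- makes the constant positive.
  refine ⟨(C ^ s).toReal * 3 + 1, by positivity, fun t ht ε hε v v' hv => ?_⟩
  have hmain := h t ht ε hε v v' hv
  rw [hq] at hmain
  set f : Euc N → ENNReal := fun x => ENNReal.ofReal (‖v x‖ ^ 2) with hf
  set g : Euc N → ENNReal := fun x => ENNReal.ofReal (‖v x‖ ^ (2 + 4 / N : ℝ)) with hg
  set E : Euc N → ENNReal := fun x => ENNReal.ofReal (energyDensity K δ ε t v v' x ^ 2) with hE
  have iy : IntegrableOn (fun x => ‖v x‖ ^ 2) Ω :=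
    integrableOn_of_continuousOn_closure hΩ.isBounded (hv.cont.norm.pow 2)
  have iQ : IntegrableOn (fun x => ‖v x‖ ^ (2 + 4 / N : ℝ)) Ω :=
    integrableOn_of_continuousOn_closure hΩ.isBounded
      (hv.cont.norm.rpow_const fun _ _ => Or.inr (by positivity))
  have hfm : AEMeasurable f (volume.restrict Ω) := iy.aemeasurable.ennreal_ofReal
  have hgm : AEMeasurable g (volume.restrict Ω) := iQ.aemeasurable.ennreal_ofReal
  have hEm : AEMeasurable E (volume.restrict Ω) :=
    ((aemeasurable_energyDensity K hδ' hΩ t ε hv).pow_const 2).ennreal_ofReal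
  have hE0 : ∀ x, 0 ≤ energyDensity K δ ε t v v' x := fun x => by
    have := hε.1
    unfold energyDensity
    split_ifs <;> positivity
  -- Preparation for Cauchy-Schwarz against the energy density, followed by Hölder with weights
  -- `2/N` and `(N-2)/N`: the power `2(γ-1)` of `|v|` is written as an interpolation between the
  -- powers `2` and `2 + 4/N`.
  have hp1 : ∀ x, ENNReal.ofReal (‖v x‖ ^ (γ - 1) * energyDensity K δ ε t v v' x) =
      (f x ^ (2 / N : ℝ) * g x ^ ((N - 2) / N : ℝ)) ^ (1 / 2 : ℝ) * E x ^ (1 / 2 : ℝ) := fun x => by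
    have hv0 := norm_nonneg (v x)
    have e1 : f x ^ (2 / N : ℝ) = ENNReal.ofReal (‖v x‖ ^ (2 * (2 / N) : ℝ)) := by
      simp only [hf]
      rw [ENNReal.ofReal_rpow_of_nonneg (by positivity) (by positivity), ← Real.rpow_natCast,
        ← Real.rpow_mul hv0]
      norm_num
    have e2 : g x ^ ((N - 2) / N : ℝ) =
        ENNReal.ofReal (‖v x‖ ^ ((2 + 4 / N) * ((N - 2) / N) : ℝ)) := by
      simp only [hg]
      rw [ENNReal.ofReal_rpow_of_nonneg (by positivity) hNs0, ← Real.rpow_mul hv0]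
    have e3 : E x ^ (1 / 2 : ℝ) = ENNReal.ofReal (energyDensity K δ ε t v v' x) := by
      simp only [hE]
      rw [ENNReal.ofReal_rpow_of_nonneg (by positivity) (by norm_num), ← Real.sqrt_eq_rpow,
        Real.sqrt_sq (hE0 x)]
    rw [e1, e2, e3, ← ENNReal.ofReal_mul (by positivity),
      ENNReal.ofReal_rpow_of_nonneg (by positivity) (by norm_num),
      ← ENNReal.ofReal_mul (by positivity),
      ← Real.rpow_add_of_nonneg hv0 (by positivity) (by positivity), ← Real.rpow_mul hv0]
    congr 3
    rw [hγd]
    field_simp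
    ring
  have hCS : ∫⁻ x in Ω, ENNReal.ofReal (‖v x‖ ^ (γ - 1) * energyDensity K δ ε t v v' x) ≤
      ((∫⁻ x in Ω, f x) ^ (2 / N : ℝ) * (∫⁻ x in Ω, g x) ^ ((N - 2) / N : ℝ)) ^ (1 / 2 : ℝ) *
        (∫⁻ x in Ω, E x) ^ (1 / 2 : ℝ) := by
    simp only [hp1]
    refine (ENNReal.lintegral_mul_norm_pow_le ((hfm.pow_const _).mul (hgm.pow_const _)) hEm
      (by norm_num) (by norm_num) (by norm_num)).trans ?_
    gcongr
    exact ENNReal.lintegral_mul_norm_pow_le hfm hgm (by positivity) hNs0 (by field_simp; ring)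
  set Q := ∫⁻ x in Ω, g x with hQ
  set y := ∫⁻ x in Ω, f x with hy
  set D := ∫⁻ x in Ω, E x with hD
  set e := ENNReal.ofReal ε⁻¹ with he
  have hQeq : Q = ENNReal.ofReal (∫ x in Ω, ‖v x‖ ^ (2 + 4 / N : ℝ)) :=
    (ofReal_integral_eq_lintegral_ofReal iQ (Eventually.of_forall fun x => by
      simp only [Pi.zero_apply]; positivity)).symm
  have hyeq : y = ENNReal.ofReal (∫ x in Ω, ‖v x‖ ^ 2) :=
    (ofReal_integral_eq_lintegral_ofReal iy (Eventually.of_forall fun x => by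
      simp only [Pi.zero_apply]; positivity)).symm
  have hp : 0 ≤ (N : ℝ) / (N - 1) := by positivity
  have h2 : Q ≤ C * e ^ (1 / (N - 1 : ℝ)) *
      ((y ^ (2 / N : ℝ) * Q ^ ((N - 2) / N : ℝ)) ^ (1 / 2 : ℝ) * D ^ (1 / 2 : ℝ))
        ^ ((N : ℝ) / (N - 1)) := by
    refine hmain.trans ?_
    gcongr
  -- After raising to the power `s = 1 + (N-2)/N`, the integral `Q` appears on the right with a
  -- power smaller by exactly one and can be cancelled.
  have h3 : Q ^ (1 + (N - 2) / N : ℝ) ≤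
      (C ^ s * e ^ (2 / N : ℝ) * y ^ (2 / N : ℝ) * D) * Q ^ ((N - 2) / N : ℝ) := by
    have h4 := ENNReal.rpow_le_rpow h2 hs0
    have hexp : (1 + (N - 2) / N : ℝ) = s := by rw [hNs]; ring
    rw [hexp]
    refine h4.trans (le_of_eq ?_)
    rw [ENNReal.mul_rpow_of_nonneg _ _ hs0, ENNReal.mul_rpow_of_nonneg _ _ hs0, ← ENNReal.rpow_mul,
      ← ENNReal.rpow_mul, ← ENNReal.mul_rpow_of_nonneg _ _ (by norm_num : (0 : ℝ) ≤ 1 / 2),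
      ← ENNReal.rpow_mul]
    have e1 : 1 / (N - 1 : ℝ) * s = 2 / N := by rw [hs]; field_simp
    have e2 : 1 / 2 * ((N : ℝ) / (N - 1) * s) = 1 := by rw [hs]; field_simp
    rw [e1, e2, ENNReal.rpow_one]
    ring
  have hQtop : Q ≠ ⊤ := by rw [hQeq]; exact ENNReal.ofReal_ne_top
  have h5 := le_of_le_mul_rpow hQtop hNs0 h3
  have hDle := lintegral_energyDensity_sq_le (ε := ε) K hδ' hΩ t hv
  have hε0 := hε.1
  have hy0 : 0 ≤ ∫ x in Ω, ‖v x‖ ^ 2 := integral_nonneg fun x => sq_nonneg _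
  have hA0 : 0 ≤ anisotropicEnergy K δ ε t v v' := by
    unfold anisotropicEnergy
    have h1 : 0 ≤ ∫ x in Ω \ K.slice δ t, frobSq (v' x) := integral_nonneg fun x => frobSq_nonneg _
    have h2 : 0 ≤ ∫ x in Ω ∩ K.slice δ t, frobSq (K.tangentialDeriv (x, t) (v' x)) :=
      integral_nonneg fun x => frobSq_nonneg _
    have h3 : 0 ≤ ∫ x in Ω ∩ K.slice δ t, ‖K.normalDeriv (x, t) (v' x)‖ ^ 2 :=
      integral_nonneg fun x => sq_nonneg _
    positivity
  have h6 : Q ≤ ENNReal.ofReal ((C ^ s).toReal * ε⁻¹ ^ (2 / N : ℝ) *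
      (∫ x in Ω, ‖v x‖ ^ 2) ^ (2 / N : ℝ) * (3 * anisotropicEnergy K δ ε t v v')) := by
    refine h5.trans ?_
    rw [ENNReal.ofReal_mul (by positivity), ENNReal.ofReal_mul (by positivity),
      ENNReal.ofReal_mul (by positivity), ENNReal.ofReal_toReal hC's, he, hyeq,
      ENNReal.ofReal_rpow_of_nonneg (by positivity) (by positivity),
      ENNReal.ofReal_rpow_of_nonneg hy0 (by positivity)]
    gcongr
  rw [hQeq, ENNReal.ofReal_le_ofReal_iff (by positivity)] at h6
  refine h6.trans ?_
  have h7 : 0 ≤ ε⁻¹ ^ (2 / N : ℝ) * (∫ x in Ω, ‖v x‖ ^ 2) ^ (2 / N : ℝ) *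
      anisotropicEnergy K δ ε t v v' := by positivity
  nlinarith [h7]

end Absorption

/-! ### Taylor expansion of the potential term and the energy identity. -/

section Energy

variable {N m : ℕ} {Ω : Set (Euc N)} {T : ℝ}

theorem contDiff_gradient {W : Euc m → ℝ} (hW : ContDiff ℝ ∞ W) : ContDiff ℝ ∞ (gradient W) := by
  have h1 : ContDiff ℝ ∞ (fderiv ℝ W) := hW.fderiv_right (by norm_num)
  exact (InnerProductSpace.toDual ℝ (Euc m)).symm.toContinuousLinearEquiv.contDiff.comp h1

/-- Taylor's formula for the gradient, uniformly on balls. -/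
theorem exists_taylor_gradient {W : Euc m → ℝ} (hW : ContDiff ℝ ∞ W) (k : ℝ) :
    ∃ C : ℝ, 0 ≤ C ∧ ∀ a b : Euc m, ‖a‖ ≤ k → ‖b‖ ≤ k →
      ‖gradient W b - gradient W a - hess W a (b - a)‖ ≤ C * ‖b - a‖ ^ 2 ∧
      ∀ w, ‖hess W a w‖ ≤ C * ‖w‖ := by
  have hg := contDiff_gradient hW
  have hg0 : ContDiff ℝ ∞ (fderiv ℝ (gradient W)) := hg.fderiv_right (by norm_num)
  have hg1 : ContDiff ℝ 1 (fderiv ℝ (gradient W)) := hg0.of_le (by norm_num)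
  have hcpt : IsCompact (Metric.closedBall (0 : Euc m) k) := isCompact_closedBall 0 k
  obtain ⟨C₁, hC₁⟩ := hcpt.exists_bound_of_continuousOn hg1.continuous.continuousOn
  obtain ⟨C₂, hC₂⟩ := hcpt.exists_bound_of_continuousOn
    (hg1.continuous_fderiv one_ne_zero).continuousOn
  refine ⟨max 0 (max C₁ C₂), le_max_left _ _, fun a b ha hb => ⟨?_, fun w => ?_⟩⟩
  · have ha' : a ∈ Metric.closedBall (0 : Euc m) k := by simpa using ha
    have hb' : b ∈ Metric.closedBall (0 : Euc m) k := by simpa using hb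
    have hseg : segment ℝ a b ⊆ Metric.closedBall (0 : Euc m) k :=
      (convex_closedBall 0 k).segment_subset ha' hb'
    have h1 : ∀ z ∈ segment ℝ a b, ‖fderiv ℝ (gradient W) z - fderiv ℝ (gradient W) a‖ ≤
        max 0 (max C₁ C₂) * ‖b - a‖ := by
      intro z hz
      have h2 := (convex_closedBall (0 : Euc m) k).norm_image_sub_le_of_norm_fderiv_le
        (f := fderiv ℝ (gradient W)) (fun x _ => hg1.differentiable one_ne_zero x) hC₂ ha' (hseg hz)
      have h3 : ‖z - a‖ ≤ ‖b - a‖ := by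
        obtain ⟨θ, hθ, rfl⟩ := (segment_eq_image' ℝ a b) ▸ hz
        rw [add_sub_cancel_left, norm_smul, Real.norm_of_nonneg hθ.1]
        exact mul_le_of_le_one_left (norm_nonneg _) hθ.2
      refine h2.trans (mul_le_mul ?_ h3 (norm_nonneg _) (le_max_left _ _))
      exact (le_max_right C₁ C₂).trans (le_max_right _ _)
    have h4 := (convex_segment a b).norm_image_sub_le_of_norm_fderiv_le' (f := gradient W)
      (fun x _ => (hg.differentiable (by norm_num)) x) h1 (left_mem_segment ℝ a b)
      (right_mem_segment ℝ a b)
    rw [sq, ← mul_assoc]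
    exact h4
  · refine ((fderiv ℝ (gradient W) a).le_opNorm w).trans ?_
    refine mul_le_mul_of_nonneg_right ?_ (norm_nonneg w)
    exact (hC₁ a (by simpa using ha)).trans ((le_max_left C₁ C₂).trans (le_max_right _ _))

theorem IsC2.sub {u w : Euc N × ℝ → Euc m} (hu : IsC2 Ω T u) (hw : IsC2 Ω T w) :
    IsC2 Ω T (u - w) := ContDiffOn.sub hu hw

theorem IsC2.isC1Closure (hΩ : IsSmoothBoundedDomain Ω) (hT : 0 < T) {u : Euc N × ℝ → Euc m}
    (hu : IsC2 Ω T u) {t : ℝ} (ht : t ∈ Icc 0 T) :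
    IsC1Closure Ω (fun x => u (x, t)) (fun x => spaceDeriv Ω u (x, t)) where
  cont' := continuousOn_slice (IsC2.contDiffOn_spaceDeriv hΩ hT hu).continuousOn ht
  deriv _ hx := IsC2.hasFDerivWithinAt hΩ hT hu hx ht

theorem IsC2.spaceDeriv_sub (hΩ : IsSmoothBoundedDomain Ω) (hT : 0 < T)
    {u w : Euc N × ℝ → Euc m} (hu : IsC2 Ω T u) (hw : IsC2 Ω T w) {x : Euc N}
    (hx : x ∈ closure Ω) {t : ℝ} (ht : t ∈ Icc 0 T) :
    spaceDeriv Ω (u - w) (x, t) = spaceDeriv Ω u (x, t) - spaceDeriv Ω w (x, t) :=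
  ((IsC2.hasFDerivWithinAt hΩ hT hu hx ht).sub
    (IsC2.hasFDerivWithinAt hΩ hT hw hx ht)).fderivWithin (hΩ.uniqueDiffOn_closure x hx)

theorem IsC2.timeDeriv_sub (hΩ : IsSmoothBoundedDomain Ω) (hT : 0 < T)
    {u w : Euc N × ℝ → Euc m} (hu : IsC2 Ω T u) (hw : IsC2 Ω T w) {x : Euc N}
    (hx : x ∈ closure Ω) {t : ℝ} (ht : t ∈ Icc 0 T) :
    timeDeriv Ω T (u - w) (x, t) = timeDeriv Ω T u (x, t) - timeDeriv Ω T w (x, t) := by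
  have h := ((IsC2.differentiableOn hΩ hT hu (x, t) ⟨hx, ht⟩).hasFDerivWithinAt.sub
    (IsC2.differentiableOn hΩ hT hw (x, t) ⟨hx, ht⟩).hasFDerivWithinAt).fderivWithin
    (uniqueDiffOn_cylinder hΩ hT (x, t) ⟨hx, ht⟩)
  unfold timeDeriv
  rw [h]
  rfl

theorem IsC1Closure.hasC1Closure (hΩ : IsOpen Ω) {F : Type*} [NormedAddCommGroup F]
    [NormedSpace ℝ F] {v : Euc N → F} {v' : Euc N → Euc N →L[ℝ] F} (hv : IsC1Closure Ω v v') :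
    HasC1Closure Ω v v' where
  cont := hv.cont
  cont' := hv.cont'
  deriv x hx := (hv.deriv x (subset_closure hx)).hasFDerivAt
    (mem_of_superset (hΩ.mem_nhds hx) subset_closure)

theorem HasC1Closure.const_inner {v : Euc N → Euc m} {v' : Euc N → Euc N →L[ℝ] Euc m}
    (hv : HasC1Closure Ω v v') (c : Euc m) :
    HasC1Closure Ω (fun x => ⟪c, v x⟫_ℝ) (fun x => (innerSL ℝ c).comp (v' x)) where
  cont := continuousOn_const.inner hv.cont
  cont' := continuousOn_const.clm_comp hv.cont'
  deriv x hx := (innerSL ℝ c).hasFDerivAt.comp x (hv.deriv x hx)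

/-- This admits classical functions in the spectral estimate. Pairing with a constant vector reduces
integration by parts to the scalar divergence theorem, whose boundary term vanishes because the
support of the test function lies in `Ω`. -/
theorem IsC1Closure.isH1 (hΩ : IsSmoothBoundedDomain Ω) {ν : Euc N → Euc N}
    (hν : ∀ x ∈ frontier Ω, IsOuterUnitNormal Ω x (ν x)) {v : Euc N → Euc m}
    {v' : Euc N → Euc N →L[ℝ] Euc m} (hv : IsC1Closure Ω v v') : IsH1 Ω v v' where
  memLp := (memLp_two_iff_integrable_sq_norm (integrableOn_of_continuousOn_closure hΩ.isBounded
      hv.cont).1).2 (integrableOn_of_continuousOn_closure hΩ.isBounded (hv.cont.norm.pow 2))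
  memLp_deriv := (memLp_two_iff_integrable_sq_norm (integrableOn_of_continuousOn_closure
      hΩ.isBounded hv.cont').1).2
      (integrableOn_of_continuousOn_closure hΩ.isBounded (hv.cont'.norm.pow 2))
  weak_deriv φ hφ _ hsupp e := by
    have hφ1 : ContDiff ℝ 1 φ := hφ.of_le (by norm_num)
    have i1 : IntegrableOn (fun x => fderiv ℝ φ x e • v x) Ω :=
      integrableOn_of_continuousOn_closure hΩ.isBounded
        (((hφ1.continuous_fderiv one_ne_zero).clm_apply continuous_const).continuousOn.smul hv.cont)
    have i2 : IntegrableOn (fun x => φ x • v' x e) Ω :=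
      integrableOn_of_continuousOn_closure hΩ.isBounded
        (hφ1.continuous.continuousOn.smul (hv.cont'.clm_apply continuousOn_const))
    rw [← add_eq_zero_iff_eq_neg, ← integral_add i1 i2]
    refine ext_inner_left ℝ fun c => ?_
    have h1 := (ContDiff.hasC1Closure (Ω := Ω) hφ1).mul
      ((hv.hasC1Closure hΩ.isOpen).const_inner c)
    have h2 := hΩ.integral_deriv hν h1 e
    rw [setIntegral_eq_zero_of_forall_eq_zero (t := frontier Ω)] at h2
    · have h3 := integral_inner (𝕜 := ℝ) (i1.add i2) c
      simp only [Pi.add_apply] at h3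
      rw [← h3, inner_zero_right, ← h2]
      refine integral_congr_ae (Eventually.of_forall fun x => ?_)
      simp only [inner_add_right, inner_smul_right, add_apply, smul_apply,
        ContinuousLinearMap.comp_apply, innerSL_apply_apply, smul_eq_mul]
      ring
    · intro x hx
      have : φ x = 0 := image_eq_zero_of_notMem_tsupport fun h => by
        have := hsupp h
        rw [hΩ.isOpen.frontier_eq] at hx
        exact hx.2 this
      simp [this]

/-- The remainder term of the approximate solution `w`, tested with `v`. -/
def remainder (Ω : Set (Euc N)) (ν : Euc N → Euc N) (T : ℝ) (W : Euc m → ℝ) (ε : ℝ)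
    (u w : Euc N × ℝ → Euc m) (t : ℝ) : ℝ :=
  (∫ x in frontier Ω, ⟪spaceDeriv Ω w (x, t) (ν x), u (x, t) - w (x, t)⟫_ℝ
    ∂(Measure.euclideanHausdorffMeasure (N - 1))) +
    ∫ x in Ω, ⟪residual T W ε w x t, u (x, t) - w (x, t)⟫_ℝ

theorem hasDerivAt_integral_norm_sq (hΩ : IsSmoothBoundedDomain Ω) (hT : 0 < T)
    {v : Euc N × ℝ → Euc m} (hv : IsC2 Ω T v) {t : ℝ} (ht : t ∈ Ioo 0 T) :
    HasDerivAt (fun t => ∫ x in Ω, ‖v (x, t)‖ ^ 2)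
      (∫ x in Ω, 2 * ⟪v (x, t), timeDeriv Ω T v (x, t)⟫_ℝ) t := by
  have hc : ContinuousOn v (closure Ω ×ˢ Icc 0 T) := ContDiffOn.continuousOn hv
  refine hasDerivAt_integral_slice (f := fun z => ‖v z‖ ^ 2)
    (g := fun z => 2 * ⟪v z, timeDeriv Ω T v z⟫_ℝ) hΩ.isOpen.measurableSet hΩ.isBounded
    (hc.norm.pow 2) (continuousOn_const.mul (hc.inner (IsC2.continuousOn_timeDeriv hΩ hT hv)))
    (fun x hx t ht => ?_) ht
  exact ((IsC2.hasDerivWithinAt hΩ hT hv (subset_closure hx)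
    (Ioo_subset_Icc_self ht)).hasDerivAt (Icc_mem_nhds ht.1 ht.2)).norm_sq

/-- Green's formula is used for `u` and for `w` separately. The boundary term of `u` vanishes by the
Neumann condition; that of `w`, together with its residual, forms the remainder. -/
theorem energy_identity (hΩ : IsSmoothBoundedDomain Ω) (hT : 0 < T) {ν : Euc N → Euc N}
    (hν : ∀ x ∈ frontier Ω, IsOuterUnitNormal Ω x (ν x)) {W : Euc m → ℝ} (hW : ContDiff ℝ ∞ W)
    {ε : ℝ} {u₀ : Euc N → Euc m} {u w : Euc N × ℝ → Euc m} (hu : IsSolution Ω ν T W ε u₀ u)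
    (hw : IsC2 Ω T w) {t : ℝ} (ht : t ∈ Ioo 0 T) :
    ∫ x in Ω, 2 * ⟪(u - w) (x, t), timeDeriv Ω T (u - w) (x, t)⟫_ℝ =
      -2 * (∫ x in Ω, frobSq (spaceDeriv Ω (u - w) (x, t))) -
      2 * ((ε ^ 2)⁻¹ * ∫ x in Ω, ⟪(u - w) (x, t),
        gradient W (u (x, t)) - gradient W (w (x, t))⟫_ℝ) -
      2 * remainder Ω ν T W ε u w t := by
  have ht' := Ioo_subset_Icc_self ht
  have hu2 := hu.isC2
  have hΩm := hΩ.isOpen.measurableSet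
  set v : Euc N → Euc m := fun x => (u - w) (x, t) with hv
  have hvC := (IsC2.isC1Closure hΩ hT (hu2.sub hw) ht')
  have hvC1 := hvC.hasC1Closure hΩ.isOpen
  have hvc : ContinuousOn v (closure Ω) := hvC.cont
  have huc := (IsC2.isC1Closure hΩ hT hu2 ht')
  have hwc := (IsC2.isC1Closure hΩ hT hw ht')
  have gu := IsC2.green hΩ hT hu2 hν ht' hvC1
  have gw := IsC2.green hΩ hT hw hν ht' hvC1
  rw [setIntegral_eq_zero_of_forall_eq_zero (t := frontier Ω) (fun x hx => by
    rw [hu.neumann x hx t ht, inner_zero_left]), add_zero] at gu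
  have hgW := (contDiff_gradient hW).continuous
  have cont_sum : ∀ {z : Euc N → Euc m} {z' : Euc N → Euc N →L[ℝ] Euc m}, IsC1Closure Ω z z' →
      IntegrableOn (fun x => ∑ i, ⟪z' x (EuclideanSpace.single i 1),
        spaceDeriv Ω (u - w) (x, t) (EuclideanSpace.single i 1)⟫_ℝ) Ω := fun hz =>
    integrableOn_of_continuousOn_closure hΩ.isBounded (continuousOn_finsetSum _ fun i _ =>
      (hz.cont'.clm_apply continuousOn_const).inner (hvC.cont'.clm_apply continuousOn_const))
  have hF : ∫ x in Ω, frobSq (spaceDeriv Ω (u - w) (x, t)) =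
      (∫ x in Ω, ∑ i, ⟪spaceDeriv Ω u (x, t) (EuclideanSpace.single i 1),
        spaceDeriv Ω (u - w) (x, t) (EuclideanSpace.single i 1)⟫_ℝ) -
      ∫ x in Ω, ∑ i, ⟪spaceDeriv Ω w (x, t) (EuclideanSpace.single i 1),
        spaceDeriv Ω (u - w) (x, t) (EuclideanSpace.single i 1)⟫_ℝ := by
    rw [← integral_sub (cont_sum huc) (cont_sum hwc)]
    refine setIntegral_congr_fun hΩm fun x hx => ?_
    simp only [frobSq, ← Finset.sum_sub_distrib, ← inner_sub_left]
    refine Finset.sum_congr rfl fun i _ => ?_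
    rw [← real_inner_self_eq_norm_sq]
    congr 1
    rw [IsC2.spaceDeriv_sub hΩ hT hu2 hw (subset_closure hx) ht']
    rfl
  have ilap : ∀ {z : Euc N × ℝ → Euc m}, IsC2 Ω T z →
      IntegrableOn (fun x => ⟪lapl Ω z (x, t), v x⟫_ℝ) Ω := fun hz =>
    integrableOn_of_continuousOn_closure hΩ.isBounded
      ((continuousOn_slice (IsC2.continuousOn_lapl hΩ hT hz) ht').inner hvc)
  have igW : IntegrableOn (fun x => ⟪v x, gradient W (u (x, t)) - gradient W (w (x, t))⟫_ℝ) Ω :=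
    integrableOn_of_continuousOn_closure hΩ.isBounded (hvc.inner
      ((hgW.comp_continuousOn huc.cont).sub (hgW.comp_continuousOn hwc.cont)))
  have ires : IntegrableOn (fun x => ⟪residual T W ε w x t, v x⟫_ℝ) Ω := by
    have c1 : ContinuousOn (fun x => timeDeriv Ω T w (x, t)) (closure Ω) :=
      continuousOn_slice (IsC2.continuousOn_timeDeriv hΩ hT hw) ht'
    have c2 : ContinuousOn (fun x => lapl Ω w (x, t)) (closure Ω) :=
      continuousOn_slice (IsC2.continuousOn_lapl hΩ hT hw) ht'
    have c3 : ContinuousOn (fun x => (ε ^ 2)⁻¹ • gradient W (w (x, t))) (closure Ω) :=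
      ((hgW.comp_continuousOn hwc.cont).const_smul (ε ^ 2)⁻¹).congr fun x _ => rfl
    have h1 := integrableOn_of_continuousOn_closure hΩ.isBounded
      (((c1.sub c2).add c3).inner (𝕜 := ℝ) hvc)
    refine (integrableOn_congr_fun (fun x hx => ?_) hΩm).2 h1
    simp only [IsC2.residual_eq hΩ hT hw hx ht', Pi.add_apply, Pi.sub_apply]
  have hpt : ∀ x ∈ Ω, 2 * ⟪v x, timeDeriv Ω T (u - w) (x, t)⟫_ℝ =
      2 * (⟪lapl Ω u (x, t), v x⟫_ℝ - ⟪lapl Ω w (x, t), v x⟫_ℝ -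
        (ε ^ 2)⁻¹ * ⟪v x, gradient W (u (x, t)) - gradient W (w (x, t))⟫_ℝ -
        ⟪residual T W ε w x t, v x⟫_ℝ) := by
    intro x hx
    have h1 := hu.pde x hx t ht
    rw [IsC2.residual_eq hΩ hT hu2 hx ht'] at h1
    have h2 : timeDeriv Ω T u (x, t) = lapl Ω u (x, t) - (ε ^ 2)⁻¹ • gradient W (u (x, t)) := by
      rw [← sub_eq_zero, ← h1]; abel
    rw [IsC2.timeDeriv_sub hΩ hT hu2 hw (subset_closure hx) ht', h2,
      IsC2.residual_eq hΩ hT hw hx ht']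
    simp only [real_inner_comm (v x), inner_sub_right, inner_add_right, inner_smul_right]
    ring
  have k1 : IntegrableOn (fun x => ⟪lapl Ω u (x, t), v x⟫_ℝ - ⟪lapl Ω w (x, t), v x⟫_ℝ) Ω :=
    (ilap hu2).sub (ilap hw)
  have k2 : IntegrableOn (fun x => ⟪lapl Ω u (x, t), v x⟫_ℝ - ⟪lapl Ω w (x, t), v x⟫_ℝ -
        (ε ^ 2)⁻¹ * ⟪v x, gradient W (u (x, t)) - gradient W (w (x, t))⟫_ℝ) Ω :=
    k1.sub (igW.const_mul _)
  rw [setIntegral_congr_fun hΩm hpt, integral_const_mul, integral_sub k2 ires,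
    integral_sub k1 (igW.const_mul _), integral_sub (ilap hu2) (ilap hw), integral_const_mul, hF,
    remainder]
  simp only [Pi.sub_apply] at gu gw ⊢
  simp only [hv, Pi.sub_apply, gu, gw]
  ring

end Energy

/-! ### Absorption of the error terms. -/

section DifferentialInequality

theorem mul_sqrt_le_add_sq {q s α : ℝ} (hs : 0 ≤ s) (hα : 0 < α) :
    q * √s ≤ α * s + q ^ 2 / (4 * α) := by
  have h1 : 0 ≤ (2 * α * √s - q) ^ 2 := sq_nonneg _
  have h2 := Real.sq_sqrt hs
  have h3 : α * s + q ^ 2 / (4 * α) - q * √s = (2 * α * √s - q) ^ 2 / (4 * α) := by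
    field_simp
    linear_combination (4 * α ^ 2) * (-h2)
  have h4 : 0 ≤ (2 * α * √s - q) ^ 2 / (4 * α) := by positivity
  linarith

/-- The spectral estimate does not see the normal derivative, so it is applied only to the fraction
`1 - C₃ε²` of `F + H`. In the remaining fraction, `C₃ε²F ≥ ε²n`, while `ε²H` is bounded below by a
multiple of `y`. The lower bound `9/10` of the dissipation, less `1/10` each for the nonlinear term
and the remainder, leaves `2·7/10 = 7/5`. -/
theorem energy_rate_le {y P S F n H NL ρ c₀ C₀ B C₃ ε k q : ℝ} (hy : 0 ≤ y) (hP : 0 ≤ P)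
    (hS : 0 ≤ S) (hn₀ : 0 ≤ n) (hc₀ : 0 < c₀) (hC₀ : 0 ≤ C₀) (hC₃ : 0 ≤ C₃)
    (hε : C₃ * ε ^ 2 ≤ 1 / 10) (hspec : -C₀ * y + P + c₀ * S ≤ F + H)
    (hH : -(B * y) ≤ ε ^ 2 * H) (hn : n ≤ C₃ * F)
    (hNL : |NL| ≤ k * y + (1 / 10) * (P + c₀ * S + ε ^ 2 * n))
    (hρ : |ρ| ≤ q * (√y + √S + √P)) :
    -2 * F - 2 * (H + NL) - 2 * ρ ≤ -(7 / 5) * (P + c₀ * S + ε ^ 2 * n) +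
      2 * (C₀ + C₃ * B + k + 1) * y + 2 * (3 + 3 / c₀) * q ^ 2 := by
  have hcS : 0 ≤ c₀ * S := by positivity
  have h1 := mul_le_mul_of_nonneg_left hspec (show 0 ≤ 1 - C₃ * ε ^ 2 by linarith)
  have h2 := mul_le_mul_of_nonneg_left hH hC₃
  have h3 := mul_le_mul_of_nonneg_left hn (sq_nonneg ε)
  have h4 : C₃ * ε ^ 2 * (P + c₀ * S) ≤ 1 / 10 * (P + c₀ * S) :=
    mul_le_mul_of_nonneg_right hε (by linarith)
  have h5 : 0 ≤ C₃ * ε ^ 2 * (C₀ * y) := by positivity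
  have h6 : F + H ≥ 9 / 10 * (P + c₀ * S) + ε ^ 2 * n - (C₀ + C₃ * B) * y := by nlinarith
  have k1 := mul_sqrt_le_add_sq (q := q) hy one_pos
  have k2 := mul_sqrt_le_add_sq (q := q) hP (show (0 : ℝ) < 1 / 10 by norm_num)
  have k3 := mul_sqrt_le_add_sq (q := q) hS (show (0 : ℝ) < c₀ / 10 by positivity)
  have k4 : q ^ 2 / (4 * (c₀ / 10)) = 5 / 2 * (1 / c₀ * q ^ 2) := by field_simp; ring
  have k5 : 0 ≤ 1 / c₀ * q ^ 2 := by positivity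
  have k6 : 2 * (3 + 3 / c₀) * q ^ 2 = 6 * q ^ 2 + 6 * (1 / c₀ * q ^ 2) := by ring
  have k7 := neg_le_of_abs_le hρ
  have k8 := neg_le_of_abs_le hNL
  have k9 := sq_nonneg q
  have k10 : 0 ≤ ε ^ 2 * n := by positivity
  rw [k4, show c₀ / 10 * S = 1 / 10 * (c₀ * S) by ring] at k3
  rw [show q ^ 2 / (4 * 1) = 1 / 4 * q ^ 2 by ring] at k1
  rw [show q ^ 2 / (4 * (1 / 10)) = 5 / 2 * q ^ 2 by ring] at k2
  rw [k6]
  linarith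

end DifferentialInequality

/-! ### The differential inequality for the `L²` norm. -/

section Dissipation

variable {N m : ℕ} {Ω : Set (Euc N)} {T : ℝ} {Γ : EvolvingHypersurface Ω T} {a : ℝ}

/-- The part of the energy controlled by the spectral estimate. -/
def dissipation (K : CurvilinearCoordinates Γ a) (δ c₀ ε t : ℝ)
    (v' : Euc N → Euc N →L[ℝ] Euc m) : ℝ :=
  (∫ x in Ω \ K.slice δ t, frobSq (v' x)) +
    c₀ * (∫ x in Ω ∩ K.slice δ t, frobSq (K.tangentialDeriv (x, t) (v' x))) +
    ε ^ 2 * ∫ x in Ω ∩ K.slice δ t, ‖K.normalDeriv (x, t) (v' x)‖ ^ 2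

theorem anisotropicEnergy_le (K : CurvilinearCoordinates Γ a) (δ ε t : ℝ) {c₀ : ℝ} (hc₀ : 0 < c₀)
    (v : Euc N → Euc m) (v' : Euc N → Euc N →L[ℝ] Euc m) :
    anisotropicEnergy K δ ε t v v' ≤
      (∫ x in Ω, ‖v x‖ ^ 2) + (1 + 1 / c₀) * dissipation K δ c₀ ε t v' := by
  have h1 : 0 ≤ ∫ x in Ω \ K.slice δ t, frobSq (v' x) :=
    integral_nonneg fun x => frobSq_nonneg _
  have h2 : 0 ≤ ∫ x in Ω ∩ K.slice δ t, frobSq (K.tangentialDeriv (x, t) (v' x)) :=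
    integral_nonneg fun x => frobSq_nonneg _
  have h3 : 0 ≤ ε ^ 2 * ∫ x in Ω ∩ K.slice δ t, ‖K.normalDeriv (x, t) (v' x)‖ ^ 2 :=
    mul_nonneg (sq_nonneg ε) (integral_nonneg fun x => sq_nonneg _)
  unfold anisotropicEnergy dissipation
  set P := ∫ x in Ω \ K.slice δ t, frobSq (v' x)
  set S := ∫ x in Ω ∩ K.slice δ t, frobSq (K.tangentialDeriv (x, t) (v' x))
  set n := ε ^ 2 * ∫ x in Ω ∩ K.slice δ t, ‖K.normalDeriv (x, t) (v' x)‖ ^ 2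
  have h4 : (1 + 1 / c₀) * (P + c₀ * S + n) = P + c₀ * S + n + (P / c₀ + S + n / c₀) := by
    field_simp
  have h5 : 0 ≤ P / c₀ := by positivity
  have h6 : 0 ≤ n / c₀ := by positivity
  have h7 : 0 ≤ c₀ * S := by positivity
  linarith

theorem dissipation_nonneg (K : CurvilinearCoordinates Γ a) (δ ε t : ℝ) {c₀ : ℝ} (hc₀ : 0 < c₀)
    (v' : Euc N → Euc N →L[ℝ] Euc m) : 0 ≤ dissipation K δ c₀ ε t v' :=
  add_nonneg (add_nonneg (integral_nonneg fun _ => frobSq_nonneg _)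
    (mul_nonneg hc₀.le (integral_nonneg fun _ => frobSq_nonneg _)))
    (mul_nonneg (sq_nonneg ε) (integral_nonneg fun _ => sq_nonneg _))

/-- The `L²` norm of the difference to the approximate solution obeys a differential inequality
as long as the coefficient of the superquadratic term is small. -/
theorem exists_differential_inequality (hΩ : IsSmoothBoundedDomain Ω) (hN : 2 ≤ N) (hT : 0 < T)
    {ν : Euc N → Euc N} (hν : ∀ x ∈ frontier Ω, IsOuterUnitNormal Ω x (ν x))
    (K : CurvilinearCoordinates Γ a) {δ : ℝ} (hδ : δ ∈ Ioo 0 a) {W : Euc m → ℝ}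
    (hW : ContDiff ℝ ∞ W) (κ : ℝ) {c₀ C₀ C : ℝ} (hc₀ : 0 < c₀) (hC₀ : 0 < C₀) (hC : 0 < C) :
    ∃ L > 0, ∃ K₂ > 0, ∃ ε₂ ∈ Ioc (0 : ℝ) 1, ∀ k₁ η p : ℝ, 0 ≤ k₁ → 0 ≤ η → ∃ K₁ > 0,
      ∀ ε ∈ Ioc 0 ε₂,
        (∀ b ∈ Icc 0 (2 * κ),
          (ε ^ 2)⁻¹ * b ^ 3 ≤ k₁ * b ^ 2 + η * ε⁻¹ ^ p * b ^ (2 + 4 / N : ℝ)) →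
        ∀ (M : ℝ) (u₀ : Euc N → Euc m) (u w : Euc N × ℝ → Euc m),
          IsSolution Ω ν T W ε u₀ u → IsC2 Ω T w →
          (∀ x ∈ closure Ω, ∀ t ∈ Icc 0 T, ‖u (x, t)‖ ≤ κ) →
          (∀ x ∈ closure Ω, ∀ t ∈ Icc 0 T, ‖w (x, t)‖ ≤ κ) →
          SpectralEstimate K δ W c₀ C₀ ε w → RemainderEstimate K δ ν W C M ε w u →
          ∀ t ∈ Ioo 0 T,
            L * η * ε⁻¹ ^ p * ε⁻¹ ^ (2 / N : ℝ) *
              (∫ x in Ω, ‖(u - w) (x, t)‖ ^ 2) ^ (2 / N : ℝ) ≤ 1 →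
            ∫ x in Ω, 2 * ⟪(u - w) (x, t), timeDeriv Ω T (u - w) (x, t)⟫_ℝ ≤
              -(7 / 5) * dissipation K δ c₀ ε t (fun x => spaceDeriv Ω (u - w) (x, t)) +
                K₁ * (∫ x in Ω, ‖(u - w) (x, t)‖ ^ 2) + K₂ * (ε ^ (M + 1 / 2)) ^ 2 := by
  have hδ' : δ ∈ Ioc 0 a := ⟨hδ.1, hδ.2.le⟩
  have hΩm := hΩ.isOpen.measurableSet
  obtain ⟨CW, hCW, hTay⟩ := exists_taylor_gradient hW κ
  obtain ⟨CI, hCI, hint⟩ := exists_interpolation hΩ hN K hδ m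
  obtain ⟨C₃, hC₃, hder⟩ := K.exists_bound_derivs (K.isCompact_closedTube hδ'.2)
    (K.closedTube_subset_cod hδ'.2)
  -- The choice of `L` turns the smallness condition into `10 (1 + 1/c₀) θ ≤ 1` for the coefficient
  -- `θ` below, and `ε₂` ensures `C₃ε² ≤ 1/10`. Only `K₁` depends on `k₁`, and no constant depends
  -- on `η` or `p`; hence `η` may be fixed after `L`.
  refine ⟨10 * (1 + 1 / c₀) * (CW + 1) * CI, by positivity, 2 * (3 + 3 / c₀) * C ^ 2, by positivity,
    min 1 (√(1 / (10 * (C₃ + 1)))), ⟨lt_min one_pos (Real.sqrt_pos.2 (by positivity)),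
      min_le_left _ _⟩, fun k₁ η p hk₁ hη => ⟨2 * (C₀ + C₃ * CW + (CW * k₁ + 1) + 1),
      by positivity, ?_⟩⟩
  intro ε hε hcub M u₀ u w hu hw huκ hwκ hspec hrem t ht hsmall
  have ht' := Ioo_subset_Icc_self ht
  have hε1 : ε ∈ Ioc (0 : ℝ) 1 := ⟨hε.1, hε.2.trans (min_le_left _ _)⟩
  have hε2 : C₃ * ε ^ 2 ≤ 1 / 10 := by
    have h1 : ε ^ 2 ≤ 1 / (10 * (C₃ + 1)) :=
      Real.le_sqrt' hε.1 |>.1 (hε.2.trans (min_le_right _ _))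
    rw [le_div_iff₀ (by positivity)] at h1
    nlinarith [sq_nonneg ε]
  have hvC2 := hu.isC2.sub hw
  set v : Euc N → Euc m := fun x => (u - w) (x, t) with hv
  set v' : Euc N → Euc N →L[ℝ] Euc m := fun x => spaceDeriv Ω (u - w) (x, t) with hv'
  have hvC : IsC1Closure Ω v v' := IsC2.isC1Closure hΩ hT hvC2 ht'
  have huc := (IsC2.isC1Closure hΩ hT hu.isC2 ht').cont
  have hwc := (IsC2.isC1Closure hΩ hT hw ht').cont
  have hgW := (contDiff_gradient hW).continuous
  have hhess : ContinuousOn (fun x => hess W (w (x, t)) (v x)) (closure Ω) :=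
    (((contDiff_gradient hW).continuous_fderiv (by norm_num)).comp_continuousOn hwc).clm_apply
      hvC.cont
  have iy : IntegrableOn (fun x => ‖v x‖ ^ 2) Ω :=
    integrableOn_of_continuousOn_closure hΩ.isBounded (hvC.cont.norm.pow 2)
  have iF : IntegrableOn (fun x => frobSq (v' x)) Ω :=
    integrableOn_of_continuousOn_closure hΩ.isBounded
      (continuous_frobSq.comp_continuousOn hvC.cont')
  have iH : IntegrableOn (fun x => ⟪v x, hess W (w (x, t)) (v x)⟫_ℝ) Ω :=
    integrableOn_of_continuousOn_closure hΩ.isBounded (hvC.cont.inner hhess)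
  have iNL : IntegrableOn (fun x => ⟪v x, gradient W (u (x, t)) - gradient W (w (x, t)) -
      hess W (w (x, t)) (v x)⟫_ℝ) Ω :=
    integrableOn_of_continuousOn_closure hΩ.isBounded (hvC.cont.inner
      (((hgW.comp_continuousOn huc).sub (hgW.comp_continuousOn hwc)).sub hhess))
  have iq : IntegrableOn (fun x => ‖v x‖ ^ (2 + 4 / N : ℝ)) Ω :=
    integrableOn_of_continuousOn_closure hΩ.isBounded
      (hvC.cont.norm.rpow_const fun x _ => Or.inr (by positivity))
  have hv2κ : ∀ x ∈ Ω, ‖v x‖ ≤ 2 * κ := fun x hx => by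
    have h1 := huκ x (subset_closure hx) t ht'
    have h2 := hwκ x (subset_closure hx) t ht'
    have h3 : ‖v x‖ ≤ ‖u (x, t)‖ + ‖w (x, t)‖ := norm_sub_le _ _
    linarith
  have hT1 := fun x (hx : x ∈ Ω) => hTay (w (x, t)) (u (x, t)) (hwκ x (subset_closure hx) t ht')
    (huκ x (subset_closure hx) t ht')
  set y := ∫ x in Ω, ‖v x‖ ^ 2 with hy
  have hy0 : 0 ≤ y := integral_nonneg fun x => sq_nonneg _
  set D := dissipation K δ c₀ ε t v' with hD
  have hD0 : 0 ≤ D := dissipation_nonneg K δ ε t hc₀ v'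
  have hsplit : ∫ x in Ω, ⟪v x, gradient W (u (x, t)) - gradient W (w (x, t))⟫_ℝ =
      (∫ x in Ω, ⟪v x, hess W (w (x, t)) (v x)⟫_ℝ) +
      ∫ x in Ω, ⟪v x, gradient W (u (x, t)) - gradient W (w (x, t)) -
        hess W (w (x, t)) (v x)⟫_ℝ := by
    rw [← integral_add iH iNL]
    refine integral_congr_ae (Eventually.of_forall fun x => ?_)
    simp only [← inner_add_right, add_sub_cancel]
  have hid := energy_identity hΩ hT hν hW hu hw ht
  rw [hsplit, mul_add] at hid
  rw [hid]
  have hspec' := hspec t ht' v v' (hvC.isH1 hΩ hν)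
  rw [integral_add iF (iH.const_mul _), integral_const_mul] at hspec'
  have hH : -(CW * y) ≤ ε ^ 2 * ((ε ^ 2)⁻¹ * ∫ x in Ω, ⟪v x, hess W (w (x, t)) (v x)⟫_ℝ) := by
    rw [mul_inv_cancel_left₀ (pow_pos hε.1 2).ne', hy, ← integral_const_mul, ← integral_neg]
    refine setIntegral_mono_on (iy.const_mul _).neg iH hΩm fun x hx => ?_
    have h1 := (hT1 x hx).2 (v x)
    have h2 := neg_le_of_abs_le ((abs_real_inner_le_norm (v x) (hess W (w (x, t)) (v x))).trans
      (mul_le_mul_of_nonneg_left h1 (norm_nonneg _)))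
    refine le_trans (le_of_eq ?_) h2
    ring
  -- The full gradient dominates the normal derivative, with a constant from the compact closed
  -- tube.
  have hn : ∫ x in Ω ∩ K.slice δ t, ‖K.normalDeriv (x, t) (v' x)‖ ^ 2 ≤
      C₃ * ∫ x in Ω, frobSq (v' x) := by
    rw [← integral_const_mul]
    refine (setIntegral_mono_on (integrableOn_norm_normal K hδ' hΩ t hvC.cont')
      (IntegrableOn.mono_set (iF.const_mul C₃) inter_subset_left)
      (hΩm.inter (K.measurableSet_slice hδ' t))
      fun x hx => (hder (x, t) (K.tube_subset_closedTube δ hx.2) m (v' x)).2).trans ?_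
    exact setIntegral_mono_set (iF.const_mul C₃)
      (Eventually.of_forall fun x => mul_nonneg hC₃ (frobSq_nonneg _))
      inter_subset_left.eventuallyLE
  have hNL : |(ε ^ 2)⁻¹ * ∫ x in Ω, ⟪v x, gradient W (u (x, t)) - gradient W (w (x, t)) -
        hess W (w (x, t)) (v x)⟫_ℝ| ≤ (CW * k₁ + 1) * y + 1 / 10 * D := by
    have h1 : |(ε ^ 2)⁻¹ * ∫ x in Ω, ⟪v x, gradient W (u (x, t)) - gradient W (w (x, t)) -
        hess W (w (x, t)) (v x)⟫_ℝ| ≤ ∫ x in Ω, (CW * k₁ * ‖v x‖ ^ 2 +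
          CW * η * ε⁻¹ ^ p * ‖v x‖ ^ (2 + 4 / N : ℝ)) := by
      rw [← integral_const_mul, ← Real.norm_eq_abs]
      refine norm_integral_le_of_norm_le (Integrable.add (f := fun x => CW * k₁ * ‖v x‖ ^ 2)
        (g := fun x => CW * η * ε⁻¹ ^ p * ‖v x‖ ^ (2 + 4 / N : ℝ)) (iy.const_mul _)
        (iq.const_mul _)) ((ae_restrict_mem hΩm).mono fun x hx => ?_)
      have h2 := (hT1 x hx).1
      have h3 := hcub ‖v x‖ ⟨norm_nonneg _, hv2κ x hx⟩
      have h4 := (abs_real_inner_le_norm (v x) _).trans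
        (mul_le_mul_of_nonneg_left h2 (norm_nonneg (v x)))
      rw [Real.norm_eq_abs, abs_mul, abs_of_nonneg (inv_nonneg.2 (sq_nonneg ε))]
      calc _ ≤ (ε ^ 2)⁻¹ * (‖v x‖ * (CW * ‖v x‖ ^ 2)) := mul_le_mul_of_nonneg_left h4
            (inv_nonneg.2 (sq_nonneg ε))
        _ = CW * ((ε ^ 2)⁻¹ * ‖v x‖ ^ 3) := by ring
        _ ≤ CW * (k₁ * ‖v x‖ ^ 2 + η * ε⁻¹ ^ p * ‖v x‖ ^ (2 + 4 / N : ℝ)) :=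
          mul_le_mul_of_nonneg_left h3 hCW
        _ = _ := by ring
    rw [integral_add (iy.const_mul _) (iq.const_mul _), integral_const_mul,
      integral_const_mul] at h1
    have hep : 0 ≤ ε⁻¹ ^ p := Real.rpow_nonneg (inv_nonneg.2 hε.1.le) _
    have heN : 0 ≤ ε⁻¹ ^ (2 / N : ℝ) := Real.rpow_nonneg (inv_nonneg.2 hε.1.le) _
    have hyN : 0 ≤ y ^ (2 / N : ℝ) := Real.rpow_nonneg hy0 _
    -- This is the coefficient with which the interpolation inequality bounds the superquadratic
    -- term by the energy. By the smallness assumption at most a tenth of the dissipation is used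
    -- up.
    set θ : ℝ := CW * η * ε⁻¹ ^ p * (CI * ε⁻¹ ^ (2 / N : ℝ) * y ^ (2 / N : ℝ)) with hθ
    have hθ0 : 0 ≤ θ := by positivity
    have h5 := hint t ht' ε hε1 v v' hvC
    have h6 := anisotropicEnergy_le K δ ε t hc₀ v v'
    have h7 : CW * η * ε⁻¹ ^ p * ∫ x in Ω, ‖v x‖ ^ (2 + 4 / N : ℝ) ≤
        θ * (y + (1 + 1 / c₀) * D) :=
      (mul_le_mul_of_nonneg_left (h5.trans (mul_le_mul_of_nonneg_left h6 (by positivity)))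
        (by positivity)).trans (le_of_eq (by rw [hθ]; ring))
    have h8 : 10 * ((1 + 1 / c₀) * θ) ≤ 1 := by
      refine le_trans ?_ hsmall
      rw [hθ]
      have h9 : 0 ≤ 10 * (1 + 1 / c₀) * CI * η * ε⁻¹ ^ p * ε⁻¹ ^ (2 / N : ℝ) *
        y ^ (2 / N : ℝ) := by positivity
      linarith
    have h10 : 0 ≤ 1 / c₀ * θ := by positivity
    have h11 : (1 + 1 / c₀) * θ * D ≤ 1 / 10 * D :=
      mul_le_mul_of_nonneg_right (by linarith) hD0
    have h12 : θ * y ≤ 1 * y := mul_le_mul_of_nonneg_right (by linarith) hy0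
    linarith
  have hρ : |remainder Ω ν T W ε u w t| ≤ C * ε ^ (M + 1 / 2) * (√y +
      √(∫ x in Ω ∩ K.slice δ t, frobSq (K.tangentialDeriv (x, t) (v' x))) +
      √(∫ x in Ω \ K.slice δ t, frobSq (v' x))) := hrem t ⟨ht.1, ht.2.le⟩
  have := energy_rate_le (F := ∫ x in Ω, frobSq (v' x)) (B := CW) hy0
    (integral_nonneg fun x => frobSq_nonneg _) (integral_nonneg fun x => frobSq_nonneg _)
    (integral_nonneg fun x => sq_nonneg _) hc₀
    hC₀.le hC₃ hε2 hspec' hH hn hNL hρ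
  refine this.trans (le_of_eq ?_)
  rw [mul_pow, ← mul_assoc, mul_assoc (2 * (3 + 3 / c₀))]
  rfl

end Dissipation

/-! ### The continuation argument. -/

section Bootstrap

/-- A continuation argument: an estimate that holds as long as `z ≤ 2E` and that yields `z < 2E`
persists. -/
theorem add_integral_le_of_bootstrap {T E : ℝ} {z z' D Φ φ : ℝ → ℝ} (hE : 0 < E)
    (hz : ContinuousOn z (Icc 0 T)) (hz' : ∀ t ∈ Ioo 0 T, HasDerivAt z (z' t) t)
    (hD : IntegrableOn D (Ioo 0 T)) (hD0 : ∀ t ∈ Ioo 0 T, 0 ≤ D t)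
    (hΦ : ∀ t, HasDerivAt Φ (φ t) t) (hΦ0 : Φ 0 = 0) (hΦE : ∀ t ∈ Icc 0 T, Φ t ≤ E / 10)
    (h0 : z 0 ≤ E) (hle : ∀ t ∈ Ioo 0 T, z t ≤ 2 * E → z' t ≤ -D t + φ t) {t : ℝ}
    (ht : t ∈ Icc 0 T) : z t + ∫ s in Ioo 0 t, D s ≤ 11 / 10 * E := by
  have hΦc : Continuous Φ := continuous_iff_continuousAt.2 fun t => (hΦ t).continuousAt
  have hw : ContinuousOn (fun t => z t - Φ t) (Icc 0 T) := hz.sub hΦc.continuousOn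
  have hlt : ∀ s ∈ Icc 0 T, z s < 2 * E := by
    by_contra! hcon
    obtain ⟨s₀, hs₀, hs₀E⟩ := hcon
    set S : Set ℝ := Icc 0 T ∩ z ⁻¹' Ici (2 * E) with hS
    have hScl : IsCompact S :=
      isCompact_Icc.of_isClosed_subset (hz.preimage_isClosed_of_isClosed isClosed_Icc isClosed_Ici)
        inter_subset_left
    have h1 := hScl.sInf_mem ⟨s₀, hs₀, hs₀E⟩
    -- The first time at which `z` reaches `2E`. Up to then `z - Φ` does not increase, so `z(t₁) ≤ E
    -- + E/10`, a contradiction.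
    set t₁ := sInf S with ht₁
    have hsub : Icc 0 t₁ ⊆ Icc 0 T := Icc_subset_Icc_right h1.1.2
    have hanti : AntitoneOn (fun t => z t - Φ t) (Icc 0 t₁) := by
      refine antitoneOn_of_deriv_nonpos (convex_Icc 0 t₁) (hw.mono hsub) ?_ ?_ <;>
        rw [interior_Icc] <;> intro s hs <;>
        have hs' : s ∈ Ioo 0 T := ⟨hs.1, hs.2.trans_le h1.1.2⟩
      · exact ((hz' s hs').sub (hΦ s)).differentiableAt.differentiableWithinAt
      · have hd : HasDerivAt (fun t => z t - Φ t) (z' s - φ s) s := (hz' s hs').sub (hΦ s)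
        rw [hd.deriv]
        have h2 : z s ≤ 2 * E := by
          by_contra! h3
          exact absurd (csInf_le hScl.bddBelow ⟨Ioo_subset_Icc_self hs', h3.le⟩) (not_le.2 hs.2)
        linarith [hle s hs' h2, hD0 s hs']
    have h2 := hanti (left_mem_Icc.2 h1.1.1) (right_mem_Icc.2 h1.1.1) h1.1.1
    have h3 := hΦE t₁ h1.1
    have h4 : 2 * E ≤ z t₁ := h1.2
    simp only [hΦ0] at h2
    linarith
  have hsub : Ioo 0 t ⊆ Ioo 0 T := Ioo_subset_Ioo_right ht.2
  have h1 := intervalIntegral.sub_le_integral_of_hasDeriv_right_of_le ht.1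
    (hw.mono (Icc_subset_Icc_right ht.2))
    (fun s hs => ((hz' s (hsub hs)).sub (hΦ s)).hasDerivWithinAt) (φ := fun s => -D s)
    ((integrableOn_Icc_iff_integrableOn_Ioo (by simp) (by simp)).2 (hD.mono_set hsub)).neg
    (fun s hs => by
      linarith [hle s (hsub hs) (hlt s (Ioo_subset_Icc_self (hsub hs))).le])
  rw [intervalIntegral.integral_of_le ht.1, integral_Ioc_eq_integral_Ioo, integral_neg] at h1
  have h2 := hΦE t ht
  simp only [hΦ0] at h1
  linarith

end Bootstrap

/-! ### Pointwise control of the cubic term. -/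

section Superquadratic

theorem rpow_two_add {b e : ℝ} (hb : 0 < b) : b ^ (2 + e) = b ^ 2 * b ^ e := by
  rw [Real.rpow_add hb, Real.rpow_two]

/-- A cubic term is controlled by a quadratic and a small supercubic one. -/
theorem cubic_le_of_one_lt {e η : ℝ} (he : 1 < e) (hη : 0 < η) :
    ∃ k₁ : ℝ, 0 ≤ k₁ ∧ ∀ ε > 0, ∀ b ≥ 0,
      (ε ^ 2)⁻¹ * b ^ 3 ≤ k₁ * b ^ 2 + η * ε⁻¹ ^ (2 * e) * b ^ (2 + e) := by
  -- With `c = ε⁻²b`, the claim is `c ≤ k₁ + η c^e`. The threshold `k₁` is the value at which `η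
  -- c^(e-1) = 1`; above it the power dominates.
  refine ⟨(1 / η) ^ (1 / (e - 1)), by positivity, fun ε hε b hb => ?_⟩
  rcases hb.eq_or_lt with rfl | hb
  · have : 0 ≤ η * ε⁻¹ ^ (2 * e) * (0 : ℝ) ^ (2 + e) := by positivity
    simpa using this
  set k₁ := (1 / η) ^ (1 / (e - 1)) with hk₁
  have hc : 0 < (ε ^ 2)⁻¹ * b := by positivity
  have h1 : ε⁻¹ ^ (2 * e) * b ^ e = ((ε ^ 2)⁻¹ * b) ^ e := by
    rw [Real.mul_rpow (by positivity) hb.le, Real.rpow_mul (by positivity), Real.rpow_two, inv_pow]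
  have h2 : (ε ^ 2)⁻¹ * b ≤ k₁ + η * ((ε ^ 2)⁻¹ * b) ^ e := by
    set c := (ε ^ 2)⁻¹ * b
    rcases le_total c k₁ with h | h
    · have : 0 ≤ η * c ^ e := by positivity
      linarith
    · have h3 : 1 / η ≤ c ^ (e - 1) := by
        have h4 := Real.rpow_le_rpow (by positivity) h (show 0 ≤ e - 1 by linarith)
        rwa [hk₁, ← Real.rpow_mul (by positivity), one_div_mul_cancel (by linarith),
          Real.rpow_one] at h4
      have h5 : c ^ e = c ^ (e - 1) * c := by
        rw [← Real.rpow_add_one hc.ne', sub_add_cancel]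
      have h6 : 1 ≤ η * c ^ (e - 1) := by
        rwa [div_le_iff₀' hη] at h3
      have h7 : 1 * c ≤ η * c ^ (e - 1) * c := mul_le_mul_of_nonneg_right h6 hc.le
      have h8 : 0 ≤ k₁ := by positivity
      rw [h5]
      linarith
  have h9 := mul_le_mul_of_nonneg_right h2 (sq_nonneg b)
  rw [rpow_two_add hb]
  calc (ε ^ 2)⁻¹ * b ^ 3 = (ε ^ 2)⁻¹ * b * b ^ 2 := by ring
    _ ≤ _ := h9
    _ = k₁ * b ^ 2 + η * (ε⁻¹ ^ (2 * e) * b ^ e) * b ^ 2 := by rw [h1]; ring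
    _ = _ := by ring

/-- For `e ≤ 1` the missing power of `b` is supplied by the bound `b ≤ κ`. In contrast to the case
`e > 1`, the coefficient cannot be made small. -/
theorem cubic_le_of_le_one {e κ : ℝ} (he0 : 0 ≤ e) (he : e ≤ 1) (ε : ℝ) {b : ℝ}
    (hb : b ∈ Icc 0 κ) :
    (ε ^ 2)⁻¹ * b ^ 3 ≤ κ ^ (1 - e) * ε⁻¹ ^ (2 : ℝ) * b ^ (2 + e) := by
  rcases hb.1.eq_or_lt with rfl | hb0
  · simp [Real.zero_rpow (show 2 + e ≠ 0 by linarith)]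
  have h1 : b ≤ κ ^ (1 - e) * b ^ e := by
    have h2 := Real.rpow_le_rpow hb.1 hb.2 (show 0 ≤ 1 - e by linarith)
    calc b = b ^ (1 - e) * b ^ e := by
          rw [← Real.rpow_add hb0, sub_add_cancel, Real.rpow_one]
      _ ≤ _ := mul_le_mul_of_nonneg_right h2 (by positivity)
  have h3 := mul_le_mul_of_nonneg_left h1 (show 0 ≤ (ε ^ 2)⁻¹ * b ^ 2 by positivity)
  rw [rpow_two_add hb0, Real.rpow_two, inv_pow]
  linarith

/-- With `e = 4/N`, the power of `ε⁻¹` is `2e = 8/N` when `N < 4` and `2` otherwise. In both cases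
this is `4k/N` for the critical order `k`. -/
theorem exists_cubic_le {N : ℕ} (hN : 2 ≤ N) {κ : ℝ} (hκ : 0 < κ) :
    ∃ k₁ η : ℝ, 0 ≤ k₁ ∧ 0 < η ∧ ∀ ε > 0, ∀ b ∈ Icc 0 κ,
      (ε ^ 2)⁻¹ * b ^ 3 ≤
        k₁ * b ^ 2 + η * ε⁻¹ ^ (4 * critOrder N / N) * b ^ (2 + 4 / N : ℝ) := by
  have hN2 : (2 : ℝ) ≤ N := by exact_mod_cast hN
  rcases lt_or_ge N 4 with h | h
  · have h4 : (N : ℝ) < 4 := by exact_mod_cast h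
    have hc : critOrder N = 2 := max_eq_left (by linarith)
    obtain ⟨k₁, hk₁, h1⟩ := cubic_le_of_one_lt (e := 4 / N) (η := 1)
      (by rw [lt_div_iff₀ (by linarith)]; linarith) one_pos
    refine ⟨k₁, 1, hk₁, one_pos, fun ε hε b hb => ?_⟩
    rw [hc, show (4 * 2 / N : ℝ) = 2 * (4 / N) by ring]
    exact h1 ε hε b hb.1
  · have h4 : (4 : ℝ) ≤ N := by exact_mod_cast h
    have hc : critOrder N = N / 2 := max_eq_right (by linarith)
    refine ⟨0, κ ^ (1 - 4 / N : ℝ), le_rfl, by positivity, fun ε hε b hb => ?_⟩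
    rw [hc, show (4 * (N / 2) / N : ℝ) = 2 by field_simp; norm_num, zero_mul, zero_add]
    exact cubic_le_of_le_one (by positivity) (by rw [div_le_one (by linarith)]; exact h4) ε hb

end Superquadratic

/-! ### Space-time integrals and the passage to energy bounds. -/

section Fubini

variable {N m : ℕ} {Ω : Set (Euc N)} {T : ℝ} {Γ : EvolvingHypersurface Ω T} {a : ℝ}

theorem integral_cylinder_inter {Ω : Set (Euc N)} {I : Set ℝ}
    {A : Set (Euc N × ℝ)} (hA : MeasurableSet A) {F : Euc N × ℝ → ℝ}
    (hF : IntegrableOn F ((Ω ×ˢ I) ∩ A)) :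
    IntegrableOn (fun s => ∫ x in Ω ∩ {x | (x, s) ∈ A}, F (x, s)) I ∧
      ∫ z in (Ω ×ˢ I) ∩ A, F z = ∫ s in I, ∫ x in Ω ∩ {x | (x, s) ∈ A}, F (x, s) := by
  have hAs : ∀ s, MeasurableSet {x : Euc N | (x, s) ∈ A} := fun s =>
    measurable_prodMk_right (y := s) hA
  have h1 : ∀ s, ∫ x in Ω ∩ {x | (x, s) ∈ A}, F (x, s) =
      ∫ x in Ω, A.indicator F (x, s) := fun s => by
    rw [← setIntegral_indicator (hAs s)]
    rfl
  have h2 : (volume : Measure (Euc N × ℝ)).restrict (Ω ×ˢ I) =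
      (volume.restrict Ω).prod (volume.restrict I) := by
    rw [Measure.volume_eq_prod, Measure.prod_restrict]
  have h3 : Integrable (A.indicator F) ((volume.restrict Ω).prod (volume.restrict I)) := by
    rw [← h2, integrable_indicator_iff hA, IntegrableOn, Measure.restrict_restrict hA, inter_comm]
    exact hF
  simp only [h1]
  refine ⟨h3.integral_prod_right, ?_⟩
  rw [← setIntegral_indicator hA, h2, integral_prod_symm _ h3]

theorem frobSq_smul (c : ℝ) (L : Euc N →L[ℝ] Euc m) : frobSq (c • L) = c ^ 2 * frobSq L := by
  simp only [frobSq, smul_apply, norm_smul, mul_pow, Real.norm_eq_abs, sq_abs, Finset.mul_sum]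

/-- The weighted energy bounds follow from a differential inequality. -/
theorem energyBounds_of_deriv_le (hΩ : IsSmoothBoundedDomain Ω) (hT : 0 < T)
    (K : CurvilinearCoordinates Γ a) {δ : ℝ} (hδ : δ ∈ Ioc 0 a) {v : Euc N × ℝ → Euc m}
    (hv : IsC2 Ω T v) {c₀ ε β E τ₀ : ℝ} (hc₀ : 0 < c₀) (hE : 0 < E) (hτ₀ : τ₀ ∈ Ioc 0 T)
    {Φ φ : ℝ → ℝ} (hΦ : ∀ t, HasDerivAt Φ (φ t) t) (hΦ0 : Φ 0 = 0)
    (hΦE : ∀ t ∈ Icc 0 τ₀, Φ t ≤ E / 10) (h0 : ∫ x in Ω, ‖v (x, 0)‖ ^ 2 ≤ E)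
    (hle : ∀ t ∈ Ioo 0 τ₀, Real.exp (-β * t) ^ 2 * (∫ x in Ω, ‖v (x, t)‖ ^ 2) ≤ 2 * E →
      Real.exp (-β * t) ^ 2 * ((∫ x in Ω, 2 * ⟪v (x, t), timeDeriv Ω T v (x, t)⟫_ℝ) -
        2 * β * ∫ x in Ω, ‖v (x, t)‖ ^ 2) ≤
      -(7 / 5 * (Real.exp (-β * t) ^ 2 *
        dissipation K δ c₀ ε t (fun x => spaceDeriv Ω v (x, t)))) + φ t)
    {τ : ℝ} (hτ : τ ∈ Ioc 0 τ₀) : EnergyBounds K δ c₀ ε β (2 * E) τ v := by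
  have hΩm := hΩ.isOpen.measurableSet
  have hτT : τ₀ ≤ T := hτ₀.2
  have hvc : ContinuousOn v (closure Ω ×ˢ Icc 0 T) := ContDiffOn.continuousOn hv
  have hv'c : ContinuousOn (spaceDeriv Ω v) (closure Ω ×ˢ Icc 0 T) :=
    (IsC2.contDiffOn_spaceDeriv hΩ hT hv).continuousOn
  have hexp : Continuous fun z : Euc N × ℝ => Real.exp (-β * z.2) := by fun_prop
  have hcpt := K.isCompact_closedTube hδ.2
  have hcyl := K.closedTube_subset_cylinder hδ.2
  have hcod : MapsTo id (K.closedTube δ) K.cod := K.closedTube_subset_cod hδ.2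
  have iP : ∀ {τ}, τ ≤ T → IntegrableOn (fun z => frobSq (Real.exp (-β * z.2) • spaceDeriv Ω v z))
      ((Ω ×ˢ Ioo 0 τ) ∩ (K.tube δ)ᶜ) := fun hτ =>
    ((continuous_frobSq.comp_continuousOn (hexp.continuousOn.smul hv'c)).integrableOn_compact
      (isCompact_cylinder hΩ.isBounded T)).mono_set
      fun z hz => ⟨subset_closure hz.1.1, hz.1.2.1.le, hz.1.2.2.le.trans hτ⟩
  have iS : ∀ τ, IntegrableOn (fun z => frobSq (Real.exp (-β * z.2) •
      K.tangentialDeriv z (spaceDeriv Ω v z))) ((Ω ×ˢ Ioo 0 τ) ∩ K.tube δ) := fun τ =>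
    ((continuous_frobSq.comp_continuousOn (hexp.continuousOn.smul (K.continuousOn_tangentialDeriv
      continuousOn_id (hv'c.mono hcyl) hcod))).integrableOn_compact hcpt).mono_set
      fun z hz => K.tube_subset_closedTube δ hz.2
  have iN : ∀ τ, IntegrableOn (fun z => ‖Real.exp (-β * z.2) •
      K.normalDeriv z (spaceDeriv Ω v z)‖ ^ 2) ((Ω ×ˢ Ioo 0 τ) ∩ K.tube δ) := fun τ =>
    (((hexp.continuousOn.smul (K.continuousOn_normalDeriv continuousOn_id
      (hv'c.mono hcyl) hcod)).norm.pow 2).integrableOn_compact hcpt).mono_set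
      fun z hz => K.tube_subset_closedTube δ hz.2
  have htm := K.measurableSet_tube hδ
  have fP := fun {τ} (hτ : τ ≤ T) => integral_cylinder_inter htm.compl (iP hτ)
  have fS := fun τ => integral_cylinder_inter htm (iS τ)
  have fN := fun τ => integral_cylinder_inter htm (iN τ)
  set P : ℝ → ℝ := fun s => ∫ x in Ω ∩ {x | (x, s) ∈ (K.tube δ)ᶜ},
    frobSq (Real.exp (-β * s) • spaceDeriv Ω v (x, s)) with hP
  set S : ℝ → ℝ := fun s => ∫ x in Ω ∩ {x | (x, s) ∈ K.tube δ},
    frobSq (Real.exp (-β * s) • K.tangentialDeriv (x, s) (spaceDeriv Ω v (x, s))) with hS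
  set n : ℝ → ℝ := fun s => ∫ x in Ω ∩ {x | (x, s) ∈ K.tube δ},
    ‖Real.exp (-β * s) • K.normalDeriv (x, s) (spaceDeriv Ω v (x, s))‖ ^ 2 with hn
  have hP0 : ∀ s, 0 ≤ P s := fun s => integral_nonneg fun x => frobSq_nonneg _
  have hS0 : ∀ s, 0 ≤ S s := fun s => integral_nonneg fun x => frobSq_nonneg _
  have hn0 : ∀ s, 0 ≤ n s := fun s => integral_nonneg fun x => sq_nonneg _
  have hdiss : ∀ s, Real.exp (-β * s) ^ 2 *
      dissipation K δ c₀ ε s (fun x => spaceDeriv Ω v (x, s)) = P s + c₀ * S s + ε ^ 2 * n s := by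
    intro s
    simp only [hP, hS, hn, frobSq_smul, norm_smul, mul_pow, integral_const_mul, Real.norm_eq_abs,
      sq_abs, dissipation]
    rw [show Ω \ K.slice δ s = Ω ∩ {x | (x, s) ∈ (K.tube δ)ᶜ} from rfl,
      show Ω ∩ K.slice δ s = Ω ∩ {x | (x, s) ∈ K.tube δ} from rfl]
    ring
  have hD0 : ∀ s, 0 ≤ P s + c₀ * S s + ε ^ 2 * n s := fun s =>
    add_nonneg (add_nonneg (hP0 s) (mul_nonneg hc₀.le (hS0 s))) (mul_nonneg (sq_nonneg ε) (hn0 s))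
  have iD : ∀ {τ}, τ ≤ T → IntegrableOn (fun s => P s + c₀ * S s + ε ^ 2 * n s) (Ioo 0 τ) :=
    fun {τ} hτ => ((fP hτ).1.add ((fS τ).1.const_mul _)).add ((fN τ).1.const_mul _)
  set z : ℝ → ℝ := fun t => Real.exp (-β * t) ^ 2 * ∫ x in Ω, ‖v (x, t)‖ ^ 2 with hz
  have hzc : ContinuousOn z (Icc 0 τ₀) := ((by fun_prop : Continuous fun t : ℝ =>
    Real.exp (-β * t) ^ 2).continuousOn.mul (continuousOn_integral_slice (f := fun z => ‖v z‖ ^ 2)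
      hΩm hΩ.isBounded (hvc.norm.pow 2))).mono (Icc_subset_Icc_right hτT)
  have hz' : ∀ t ∈ Ioo 0 τ₀, HasDerivAt z (Real.exp (-β * t) ^ 2 *
      ((∫ x in Ω, 2 * ⟪v (x, t), timeDeriv Ω T v (x, t)⟫_ℝ) -
        2 * β * ∫ x in Ω, ‖v (x, t)‖ ^ 2)) t := by
    intro t ht
    have h1 := hasDerivAt_integral_norm_sq hΩ hT hv (t := t) ⟨ht.1, ht.2.trans_le hτT⟩
    have h2 : HasDerivAt (fun t => Real.exp (-β * t) ^ 2)
        (2 * Real.exp (-β * t) * (Real.exp (-β * t) * -β)) t := by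
      have := ((hasDerivAt_id t).const_mul (-β)).exp.fun_pow 2
      simpa using this
    refine (h2.mul h1).congr_deriv ?_
    ring
  have key : ∀ t ∈ Icc 0 τ₀, z t + ∫ s in Ioo 0 t, 7 / 5 * (P s + c₀ * S s + ε ^ 2 * n s) ≤
      11 / 10 * E := fun t ht =>
    add_integral_le_of_bootstrap hE hzc hz' ((iD hτT).const_mul _)
      (fun s _ => mul_nonneg (by norm_num) (hD0 s)) hΦ hΦ0 hΦE (by simpa [hz] using h0)
      (fun t ht h => by rw [← hdiss]; exact hle t ht h) ht
  have hz0 : ∀ t, 0 ≤ z t := fun t =>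
    mul_nonneg (sq_nonneg _) (integral_nonneg fun x => sq_nonneg _)
  have hτ' : τ ≤ T := hτ.2.trans hτT
  -- The supremum and the space-time integral are bounded separately, since `t` and `τ` differ. The
  -- factor `7/5` in front of the dissipation turns `11/10` into `11/14`, and `11/10 + 11/14 < 2`.
  have hI : ∫ s in Ioo 0 τ, (P s + c₀ * S s + ε ^ 2 * n s) ≤ 11 / 14 * E := by
    have h1 := key τ ⟨hτ.1.le, hτ.2⟩
    rw [integral_const_mul] at h1
    linarith [hz0 τ]
  have e1 : ∫ z in (Ω ×ˢ Ioo 0 τ) \ K.tube δ, frobSq (Real.exp (-β * z.2) • spaceDeriv Ω v z) =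
      ∫ s in Ioo 0 τ, P s := (fP hτ').2
  have hsum : ∫ s in Ioo 0 τ, (P s + c₀ * S s + ε ^ 2 * n s) =
      (∫ s in Ioo 0 τ, P s) + c₀ * (∫ s in Ioo 0 τ, S s) + ε ^ 2 * ∫ s in Ioo 0 τ, n s := by
    have i1 : IntegrableOn (fun s => P s + c₀ * S s) (Ioo 0 τ) :=
      (fP hτ').1.add ((fS τ).1.const_mul _)
    rw [integral_add i1 ((fN τ).1.const_mul _),
      integral_add (fP hτ').1 ((fS τ).1.const_mul _), integral_const_mul, integral_const_mul]
  have j1 : 0 ≤ ∫ s in Ioo 0 τ, P s := integral_nonneg fun s => hP0 s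
  have j2 : 0 ≤ c₀ * ∫ s in Ioo 0 τ, S s := mul_nonneg hc₀.le (integral_nonneg fun s => hS0 s)
  have j3 : 0 ≤ ε ^ 2 * ∫ s in Ioo 0 τ, n s :=
    mul_nonneg (sq_nonneg ε) (integral_nonneg fun s => hn0 s)
  rw [hsum] at hI
  refine ⟨fun t ht => ?_, ?_⟩
  · have h1 := key t ⟨ht.1, ht.2.trans hτ.2⟩
    have h2 : 0 ≤ ∫ s in Ioo 0 t, 7 / 5 * (P s + c₀ * S s + ε ^ 2 * n s) :=
      integral_nonneg fun s => mul_nonneg (by norm_num) (hD0 s)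
    have h3 : ∫ x in Ω, ‖Real.exp (-β * t) • v (x, t)‖ ^ 2 = z t := by
      simp only [hz, norm_smul, mul_pow, integral_const_mul, Real.norm_eq_abs, sq_abs]
    rw [e1, h3]
    linarith
  · rw [(fS τ).2, (fN τ).2]
    linarith

end Fubini

/-! ### Choice of weights and scaling in `ε`. -/

section Conclusion

variable {N m : ℕ} {Ω : Set (Euc N)} {T : ℝ} {Γ : EvolvingHypersurface Ω T} {a : ℝ}

theorem hasDerivAt_exp_sq (β t : ℝ) :
    HasDerivAt (fun t => Real.exp (-β * t) ^ 2) (-(2 * β) * Real.exp (-β * t) ^ 2) t := by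
  have h := ((hasDerivAt_id t).const_mul (-β)).exp.fun_pow 2
  refine h.congr_deriv ?_
  simp only [id, mul_one, Nat.cast_ofNat]
  ring

/-- Weighted energy bounds for a given exact and approximate solution, provided that the
superquadratic term and the remainder are small compared to the bound `E`, and that either the
weight decays fast enough or the time interval is short enough. -/
theorem exists_energyBounds (hΩ : IsSmoothBoundedDomain Ω) (hN : 2 ≤ N) (hT : 0 < T)
    {ν : Euc N → Euc N} (hν : ∀ x ∈ frontier Ω, IsOuterUnitNormal Ω x (ν x))
    (K : CurvilinearCoordinates Γ a) {δ : ℝ} (hδ : δ ∈ Ioo 0 a) {W : Euc m → ℝ}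
    (hW : IsPotential W) (A A' : ℝ) {c₀ C₀ C : ℝ} (hc₀ : 0 < c₀) (hC₀ : 0 < C₀) (hC : 0 < C) :
    ∃ κ > 0, ∃ L > 0, ∃ K₂ > 0, ∃ ε₂ > 0, ∀ k₁ η p : ℝ, 0 ≤ k₁ → 0 ≤ η → ∃ K₁ > 0,
      ∀ ε ∈ Ioc 0 ε₂,
        (∀ b ∈ Icc 0 κ,
          (ε ^ 2)⁻¹ * b ^ 3 ≤ k₁ * b ^ 2 + η * ε⁻¹ ^ p * b ^ (2 + 4 / N : ℝ)) →
        ∀ (M M' R : ℝ) (u₀ : Euc N → Euc m) (u w : Euc N × ℝ → Euc m), 0 < R →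
          IsSolution Ω ν T W ε u₀ u → IsC2 Ω T w → (∀ x ∈ Ω, ‖u₀ x‖ ≤ A') →
          (∀ x ∈ Ω, ∀ t ∈ Ioo 0 T, ‖w (x, t)‖ ≤ A) → SpectralEstimate K δ W c₀ C₀ ε w →
          RemainderEstimate K δ ν W C M' ε w u → WellPrepared Ω R M ε w u₀ →
          ∀ β b τ₀ : ℝ, 0 ≤ β → τ₀ ∈ Ioc 0 T →
            L * η * (ε⁻¹ ^ p * ε⁻¹ ^ (2 / N : ℝ) *
              (2 * (R * ε ^ (M + 1 / 2)) ^ 2 * Real.exp (β * T) ^ 2) ^ (2 / N : ℝ)) ≤ 1 →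
            K₂ * (ε ^ (M' + 1 / 2)) ^ 2 ≤ b * (R * ε ^ (M + 1 / 2)) ^ 2 →
            (K₁ ≤ 2 * β ∧ b ≤ β / 5) ∨ (β = 0 ∧ (2 * K₁ + b) * τ₀ ≤ 1 / 10) →
            ∀ τ ∈ Ioc 0 τ₀,
              EnergyBounds K δ c₀ ε β (2 * (R * ε ^ (M + 1 / 2)) ^ 2) τ (u - w) := by
  obtain ⟨R₀, hR₀, hout⟩ := hW.outward
  have hk : 0 < max A' R₀ := lt_max_of_lt_right hR₀
  -- A common bound for both functions: `A` for the approximate solution, and `max A' R₀` for the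
  -- exact one by the maximum principle. The difference is then bounded by twice this number.
  obtain ⟨L, hL, K₂, hK₂, ε₂, hε₂, h⟩ := exists_differential_inequality hΩ hN hT hν K hδ hW.smooth
    (max A (max A' R₀)) hc₀ hC₀ hC
  refine ⟨2 * max A (max A' R₀), mul_pos two_pos (lt_max_of_lt_right hk), L, hL, K₂, hK₂, ε₂,
    hε₂.1, fun k₁ η p hk₁ hη => ?_⟩
  obtain ⟨K₁, hK₁, h⟩ := h k₁ η p hk₁ hη
  refine ⟨K₁, hK₁, ?_⟩
  intro ε hε hcub M M' R u₀ u w hR hu hw hA' hA hspec hrem hprep β b τ₀ hβ hτ₀ hsmall hb hcase τ hτ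
  have huκ : ∀ x ∈ closure Ω, ∀ t ∈ Icc 0 T, ‖u (x, t)‖ ≤ max A (max A' R₀) := fun x hx t ht =>
    (hu.norm_le hΩ hT hν hk.le (fun p hp => hout p ((le_max_right _ _).trans hp))
      (fun x hx => (hA' x hx).trans (le_max_left _ _)) hx ht).trans (le_max_right _ _)
  have hwκ : ∀ x ∈ closure Ω, ∀ t ∈ Icc 0 T, ‖w (x, t)‖ ≤ max A (max A' R₀) := fun x hx t ht =>
    (norm_le_on_closure hT (ContDiffOn.continuousOn hw) hA hx ht).trans (le_max_left _ _)
  have h := h ε hε hcub M' u₀ u w hu hw huκ hwκ hspec hrem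
  have hεM : 0 < ε ^ (M + 1 / 2) := Real.rpow_pos_of_pos hε.1 _
  set E : ℝ := (R * ε ^ (M + 1 / 2)) ^ 2 with hEd
  have hE : 0 < E := by positivity
  have hbE : 0 < b * E := lt_of_lt_of_le (mul_pos hK₂ (pow_pos (Real.rpow_pos_of_pos hε.1 _) 2)) hb
  have hb0 : 0 < b := pos_of_mul_pos_left hbE hE.le
  have h0 : ∫ x in Ω, ‖(u - w) (x, 0)‖ ^ 2 ≤ E := by
    have h1 : ∫ x in Ω, ‖(u - w) (x, 0)‖ ^ 2 = ∫ x in Ω, ‖u₀ x - w (x, 0)‖ ^ 2 :=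
      setIntegral_congr_fun hΩ.isOpen.measurableSet fun x hx => by
        simp only [Pi.sub_apply, hu.initial x hx]
    rw [h1]
    exact (Real.sqrt_le_left (by positivity)).1 hprep
  have hrate : ∀ t ∈ Ioo 0 τ₀,
      Real.exp (-β * t) ^ 2 * (∫ x in Ω, ‖(u - w) (x, t)‖ ^ 2) ≤ 2 * E →
      ∫ x in Ω, 2 * ⟪(u - w) (x, t), timeDeriv Ω T (u - w) (x, t)⟫_ℝ ≤
        -(7 / 5) * dissipation K δ c₀ ε t (fun x => spaceDeriv Ω (u - w) (x, t)) +
          K₁ * (∫ x in Ω, ‖(u - w) (x, t)‖ ^ 2) + b * E := by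
    intro t ht hy
    have htT : t ∈ Ioo 0 T := ⟨ht.1, ht.2.trans_le hτ₀.2⟩
    refine (h t htT (le_trans ?_ hsmall)).trans (by linarith)
    -- Removing the weight from the bootstrap assumption costs the factor `e^(2βT)`, which therefore
    -- appears in the smallness condition.
    have hyX : ∫ x in Ω, ‖(u - w) (x, t)‖ ^ 2 ≤ 2 * E * Real.exp (β * T) ^ 2 := by
      have h1 : Real.exp (β * t) ^ 2 * Real.exp (-β * t) ^ 2 = 1 := by
        rw [← mul_pow, ← Real.exp_add]; simp
      have h2 : Real.exp (β * t) ≤ Real.exp (β * T) :=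
        Real.exp_le_exp.2 (mul_le_mul_of_nonneg_left htT.2.le hβ)
      calc ∫ x in Ω, ‖(u - w) (x, t)‖ ^ 2 = Real.exp (β * t) ^ 2 *
            (Real.exp (-β * t) ^ 2 * ∫ x in Ω, ‖(u - w) (x, t)‖ ^ 2) := by
            rw [← mul_assoc, h1, one_mul]
        _ ≤ Real.exp (β * T) ^ 2 * (2 * E) := by gcongr
        _ = _ := mul_comm _ _
    have h3 : (∫ x in Ω, ‖(u - w) (x, t)‖ ^ 2) ^ (2 / N : ℝ) ≤
        (2 * E * Real.exp (β * T) ^ 2) ^ (2 / N : ℝ) :=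
      Real.rpow_le_rpow (integral_nonneg fun x => sq_nonneg _) hyX (by positivity)
    have h4 : 0 ≤ L * η * (ε⁻¹ ^ p * ε⁻¹ ^ (2 / N : ℝ)) :=
      mul_nonneg (mul_nonneg hL.le hη) (mul_nonneg (Real.rpow_nonneg (inv_nonneg.2 hε.1.le) _)
        (Real.rpow_nonneg (inv_nonneg.2 hε.1.le) _))
    have h5 := mul_le_mul_of_nonneg_left h3 h4
    simpa only [mul_assoc] using h5
  have hδ' : δ ∈ Ioc 0 a := ⟨hδ.1, hδ.2.le⟩
  -- In the first case the weight absorbs `K₁ y` because `K₁ ≤ 2β`, and the source has integral at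
  -- most `bE/(2β) ≤ E/10`. In the second, `y ≤ 2E` makes `(2K₁ + b)E` a bound for all growth terms,
  -- whose integral is kept below `E/10` by the short time.
  rcases hcase with ⟨h1, h2⟩ | ⟨rfl, h2⟩
  · have hβ0 : 0 < β := by linarith
    refine energyBounds_of_deriv_le hΩ hT K hδ' (hu.isC2.sub hw) hc₀ hE hτ₀
      (Φ := fun t => b * E / (2 * β) * (1 - Real.exp (-β * t) ^ 2))
      (φ := fun t => b * E * Real.exp (-β * t) ^ 2) (fun t => ?_) (by simp) (fun t _ => ?_) h0
      (fun t ht hy => ?_) hτ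
    · refine (((hasDerivAt_exp_sq β t).const_sub 1).const_mul (b * E / (2 * β))).congr_deriv ?_
      field_simp
    · have h3 : b * E / (2 * β) ≤ E / 10 := by
        rw [div_le_div_iff₀ (by positivity) (by norm_num)]
        nlinarith
      have h4 : 0 ≤ b * E / (2 * β) := by positivity
      have h5 : 1 - Real.exp (-β * t) ^ 2 ≤ 1 := by linarith [sq_nonneg (Real.exp (-β * t))]
      exact (mul_le_of_le_one_right h4 h5).trans h3
    · have h3 := mul_le_mul_of_nonneg_left (hrate t ht hy) (sq_nonneg (Real.exp (-β * t)))
      have h4 : 0 ≤ Real.exp (-β * t) ^ 2 * ((2 * β - K₁) *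
          ∫ x in Ω, ‖(u - w) (x, t)‖ ^ 2) :=
        mul_nonneg (sq_nonneg _) (mul_nonneg (by linarith) (integral_nonneg fun x => sq_nonneg _))
      linarith
  · refine energyBounds_of_deriv_le hΩ hT K hδ' (hu.isC2.sub hw) hc₀ hE hτ₀
      (Φ := fun t => (2 * K₁ + b) * E * t) (φ := fun _ => (2 * K₁ + b) * E)
      (fun t => by simpa using (hasDerivAt_id t).const_mul ((2 * K₁ + b) * E)) (by simp)
      (fun t ht => ?_) h0 (fun t ht hy => ?_) hτ
    · have h3 : (2 * K₁ + b) * t ≤ (2 * K₁ + b) * τ₀ :=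
        mul_le_mul_of_nonneg_left ht.2 (by positivity)
      have h4 := mul_le_mul_of_nonneg_right (h3.trans h2) hE.le
      linarith
    · have h3 := hrate t ht hy
      simp only [neg_zero, zero_mul, Real.exp_zero, one_pow, one_mul, mul_zero, sub_zero] at hy ⊢
      have h4 := mul_le_mul_of_nonneg_left hy hK₁.le
      linarith

theorem exists_mul_rpow_le_one {c s : ℝ} (hc : 0 ≤ c) (hs : 0 < s) :
    ∃ ε₁ > 0, ∀ ε ∈ Ioc 0 ε₁, c * ε ^ s ≤ 1 := by
  refine ⟨(1 / (c + 1)) ^ (1 / s), by positivity, fun ε hε => ?_⟩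
  have h1 := Real.rpow_le_rpow hε.1.le hε.2 hs.le
  rw [← Real.rpow_mul (by positivity), one_div_mul_cancel hs.ne', Real.rpow_one,
    le_div_iff₀ (by positivity)] at h1
  linarith [Real.rpow_nonneg hε.1.le s]

/-- The power of `ε` in the coefficient of the superquadratic term. -/
theorem rpow_scaling {N : ℕ} (hN : 0 < N) {ε R G k M : ℝ} (hε : 0 < ε) (hG : 0 ≤ G) :
    ε⁻¹ ^ (4 * k / N) * ε⁻¹ ^ (2 / N : ℝ) *
      (2 * (R * ε ^ (M + 1 / 2)) ^ 2 * G) ^ (2 / N : ℝ) =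
    (2 * R ^ 2 * G) ^ (2 / N : ℝ) * ε ^ (4 * (M - k) / N) := by
  have hN' : (0 : ℝ) < N := by exact_mod_cast hN
  have h1 : 2 * (R * ε ^ (M + 1 / 2)) ^ 2 * G = 2 * R ^ 2 * G * (ε ^ (M + 1 / 2)) ^ (2 : ℝ) := by
    rw [Real.rpow_two]; ring
  rw [h1, Real.mul_rpow (by positivity) (by positivity), ← Real.rpow_mul hε.le,
    ← Real.rpow_mul hε.le, Real.inv_rpow hε.le, Real.inv_rpow hε.le, ← Real.rpow_neg hε.le,
    ← Real.rpow_neg hε.le, mul_left_comm, ← Real.rpow_add hε, ← Real.rpow_add hε]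
  congr 2
  field_simp
  ring

theorem sq_rpow_add_half {ε : ℝ} (hε : 0 < ε) (M : ℕ) (R : ℝ) :
    2 * (R * ε ^ ((M : ℝ) + 1 / 2)) ^ 2 = 2 * R ^ 2 * ε ^ (2 * M + 1) := by
  have h : (ε ^ ((M : ℝ) + 1 / 2)) ^ 2 = ε ^ (2 * M + 1) := by
    rw [← Real.rpow_mul_natCast hε.le, ← Real.rpow_natCast]
    congr 1
    push_cast
    ring
  rw [mul_pow, h]
  ring

end Conclusion
end AllenCahn

end

/-! ### The three regimes: supercritical order, critical order, short times. -/

theorem theorem6p7 {N m : ℕ} (hN : 2 ≤ N) {Ω : Set (Euc N)} (hΩ : IsSmoothBoundedDomain Ω)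
    {ν : Euc N → Euc N} (hν : ∀ x ∈ frontier Ω, IsOuterUnitNormal Ω x (ν x))
    {T₀ : ℝ} (hT₀ : 0 < T₀) (Γ : EvolvingHypersurface Ω T₀)
    {δ : ℝ} (hδ : 0 < δ) (K : CurvilinearCoordinates Γ (2 * δ))
    {W : Euc m → ℝ} (hW : IsPotential W)
    {ε₀ : ℝ} (hε₀ : 0 < ε₀) {M : ℕ} (hM : critOrder N ≤ M)
    {uA : ℝ → Euc N × ℝ → Euc m} (huA : ∀ ε ∈ Set.Ioc 0 ε₀, IsC2 Ω T₀ (uA ε))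
    {A : ℝ} (hA : ∀ ε ∈ Set.Ioc 0 ε₀, ∀ x ∈ Ω, ∀ t ∈ Set.Ioo 0 T₀, ‖uA ε (x, t)‖ ≤ A)
    {c₀ C₀ : ℝ} (hc₀ : 0 < c₀) (hC₀ : 0 < C₀)
    (hspec : ∀ ε ∈ Set.Ioc 0 ε₀, SpectralEstimate K δ W c₀ C₀ ε (uA ε)) :
    (critOrder N < M →
      ∀ R > 0, ∀ A' > 0, ∀ C > 0, ∀ (u₀ : ℝ → Euc N → Euc m) (u : ℝ → Euc N × ℝ → Euc m),
        (∀ ε ∈ Set.Ioc 0 ε₀, IsInitialValue Ω ν (u₀ ε) ∧ IsSolution Ω ν T₀ W ε (u₀ ε) (u ε) ∧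
          (∀ x ∈ Ω, ‖u₀ ε x‖ ≤ A') ∧ RemainderEstimate K δ ν W C M ε (uA ε) (u ε) ∧
          WellPrepared Ω R M ε (uA ε) (u₀ ε)) →
        ∃ β > 0, ∃ ε₁ ∈ Set.Ioc 0 ε₀, ∀ ε ∈ Set.Ioc 0 ε₁, ∀ T ∈ Set.Ioc 0 T₀,
          EnergyBounds K δ c₀ ε β (2 * R ^ 2 * ε ^ (2 * M + 1)) T (u ε - uA ε)) ∧
    ((M : ℝ) = critOrder N →
      ∀ M' > (M : ℝ), ∀ A' > 0, ∀ C > 0, ∃ β > 0, ∃ R > 0, ∃ ε₁ ∈ Set.Ioc 0 ε₀,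
        ∀ (u₀ : ℝ → Euc N → Euc m) (u : ℝ → Euc N × ℝ → Euc m),
        (∀ ε ∈ Set.Ioc 0 ε₀, IsInitialValue Ω ν (u₀ ε) ∧ IsSolution Ω ν T₀ W ε (u₀ ε) (u ε) ∧
          (∀ x ∈ Ω, ‖u₀ ε x‖ ≤ A') ∧ RemainderEstimate K δ ν W C M' ε (uA ε) (u ε) ∧
          WellPrepared Ω R M ε (uA ε) (u₀ ε)) →
        ∀ ε ∈ Set.Ioc 0 ε₁, ∀ T ∈ Set.Ioc 0 T₀,
          EnergyBounds K δ c₀ ε β (2 * R ^ 2 * ε ^ (2 * M + 1)) T (u ε - uA ε)) ∧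
    ((N = 2 ∨ N = 3) → M = 2 →
      ∀ R > 0, ∀ A' > 0, ∀ C > 0, ∀ (u₀ : ℝ → Euc N → Euc m) (u : ℝ → Euc N × ℝ → Euc m),
        (∀ ε ∈ Set.Ioc 0 ε₀, IsInitialValue Ω ν (u₀ ε) ∧ IsSolution Ω ν T₀ W ε (u₀ ε) (u ε) ∧
          (∀ x ∈ Ω, ‖u₀ ε x‖ ≤ A') ∧ RemainderEstimate K δ ν W C M ε (uA ε) (u ε) ∧
          WellPrepared Ω R M ε (uA ε) (u₀ ε)) →
        ∃ ε₁ ∈ Set.Ioc 0 ε₀, ∃ T₁ ∈ Set.Ioc 0 T₀, ∀ ε ∈ Set.Ioc 0 ε₁, ∀ T ∈ Set.Ioc 0 T₁,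
          EnergyBounds K δ c₀ ε 0 (2 * R ^ 2 * ε ^ (2 * M + 1)) T (u ε - uA ε)) := by
  have hδ2 : δ ∈ Set.Ioo 0 (2 * δ) := ⟨hδ, by linarith⟩
  have hN0 : 0 < N := by omega
  have hN' : (0 : ℝ) < N := by exact_mod_cast hN0
  refine ⟨fun hMk R hR A' _ C hC u₀ u hu => ?_, fun hMk M' hM' A' _ C hC => ?_,
    fun hN23 hM2 R hR A' _ C hC u₀ u hu => ?_⟩
  · obtain ⟨κ, hκ, L, hL, K₂, hK₂, ε₂, hε₂, h⟩ :=
      exists_energyBounds hΩ hN hT₀ hν K hδ2 hW A A' hc₀ hC₀ hC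
    obtain ⟨k₁, η, hk₁, hη, hcub⟩ := exists_cubic_le hN hκ
    obtain ⟨K₁, hK₁, h⟩ := h k₁ η (4 * critOrder N / N) hk₁ hη.le
    -- The remainder has the same order as `E`, so `b = K₂/R²`, and `β` must dominate both `K₁` and
    -- `5b`.
    set β : ℝ := max K₁ (5 * (K₂ / R ^ 2)) with hβ
    have hβK : K₁ ≤ β := le_max_left _ _
    have hβ0 : 0 < β := hK₁.trans_le hβK
    -- For `M > k` a positive power of `ε` is left in the smallness condition and compensates for
    -- the given `R` and `β`.
    obtain ⟨ε₃, hε₃, hsmall⟩ := exists_mul_rpow_le_one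
      (c := L * η * (2 * R ^ 2 * Real.exp (β * T₀) ^ 2) ^ (2 / N : ℝ))
      (s := 4 * (M - critOrder N) / N) (by positivity)
      (div_pos (mul_pos four_pos (sub_pos.2 hMk)) hN')
    refine ⟨β, hβ0, min ε₀ (min ε₂ ε₃), ⟨lt_min hε₀ (lt_min hε₂ hε₃), min_le_left _ _⟩,
      fun ε hε T hT => ?_⟩
    have hε₀' : ε ∈ Set.Ioc 0 ε₀ := ⟨hε.1, hε.2.trans (min_le_left _ _)⟩
    have hε₂' : ε ∈ Set.Ioc 0 ε₂ :=
      ⟨hε.1, hε.2.trans ((min_le_right _ _).trans (min_le_left _ _))⟩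
    have hε₃' : ε ∈ Set.Ioc 0 ε₃ :=
      ⟨hε.1, hε.2.trans ((min_le_right _ _).trans (min_le_right _ _))⟩
    obtain ⟨-, hsol, hu₀, hrem, hprep⟩ := hu ε hε₀'
    rw [← sq_rpow_add_half hε.1]
    refine h ε hε₂' (hcub ε hε.1) M M R (u₀ ε) (u ε) (uA ε) hR hsol (huA ε hε₀') hu₀ (hA ε hε₀')
      (hspec ε hε₀') hrem hprep β (K₂ / R ^ 2) T₀ hβ0.le ⟨hT₀, le_rfl⟩ ?_ (le_of_eq ?_)
      (Or.inl ⟨by linarith, ?_⟩) T hT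
    · rw [rpow_scaling hN0 hε.1 (sq_nonneg _), ← mul_assoc]
      exact hsmall ε hε₃'
    · field_simp
    · have := le_max_right K₁ (5 * (K₂ / R ^ 2))
      linarith
  · obtain ⟨κ, hκ, L, hL, K₂, hK₂, ε₂, hε₂, h⟩ :=
      exists_energyBounds hΩ hN hT₀ hν K hδ2 hW A A' hc₀ hC₀ hC
    obtain ⟨k₁, η, hk₁, hη, hcub⟩ := exists_cubic_le hN hκ
    obtain ⟨K₁, hK₁, h⟩ := h k₁ η (4 * critOrder N / N) hk₁ hη.le
    -- At the critical order no power of `ε` remains, so `R` is chosen to give equality in the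
    -- smallness condition. This is not circular: `β = K₁` does not depend on `R`.
    set R : ℝ := √((1 / (L * η)) ^ ((N : ℝ) / 2) / (2 * Real.exp (K₁ * T₀) ^ 2)) with hRd
    have hR : 0 < R := Real.sqrt_pos.2 (by positivity)
    have hR2 : 2 * R ^ 2 * Real.exp (K₁ * T₀) ^ 2 = (1 / (L * η)) ^ ((N : ℝ) / 2) := by
      rw [hRd, Real.sq_sqrt (by positivity)]
      field_simp
    -- The choice `b = K₁/5` is dictated by `β`, and the small `R` works against the bound on the
    -- source. The gain `ε^(2(M'-M))` makes up for it.
    obtain ⟨ε₃, hε₃, hsmall⟩ := exists_mul_rpow_le_one (c := K₂ / (K₁ / 5 * R ^ 2))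
      (s := (M' - M) * (2 : ℕ)) (by positivity)
      (mul_pos (sub_pos.2 hM') (by norm_num))
    refine ⟨K₁, hK₁, R, hR, min ε₀ (min ε₂ ε₃), ⟨lt_min hε₀ (lt_min hε₂ hε₃), min_le_left _ _⟩,
      fun u₀ u hu ε hε T hT => ?_⟩
    have hε₀' : ε ∈ Set.Ioc 0 ε₀ := ⟨hε.1, hε.2.trans (min_le_left _ _)⟩
    have hε₂' : ε ∈ Set.Ioc 0 ε₂ :=
      ⟨hε.1, hε.2.trans ((min_le_right _ _).trans (min_le_left _ _))⟩
    have hε₃' : ε ∈ Set.Ioc 0 ε₃ :=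
      ⟨hε.1, hε.2.trans ((min_le_right _ _).trans (min_le_right _ _))⟩
    obtain ⟨-, hsol, hu₀, hrem, hprep⟩ := hu ε hε₀'
    rw [← sq_rpow_add_half hε.1]
    refine h ε hε₂' (hcub ε hε.1) M M' R (u₀ ε) (u ε) (uA ε) hR hsol (huA ε hε₀') hu₀ (hA ε hε₀')
      (hspec ε hε₀') hrem hprep K₁ (K₁ / 5) T₀ hK₁.le ⟨hT₀, le_rfl⟩ (le_of_eq ?_) ?_
      (Or.inl ⟨by linarith, le_rfl⟩) T hT
    · rw [rpow_scaling hN0 hε.1 (sq_nonneg _), hMk, sub_self, mul_zero, zero_div, Real.rpow_zero,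
        mul_one, hR2, ← Real.rpow_mul (by positivity), div_mul_div_cancel₀ two_ne_zero,
        div_self hN'.ne', Real.rpow_one, mul_one_div_cancel (by positivity)]
    · have h1 : ε ^ (M' + 1 / 2) = ε ^ (M' - M) * ε ^ ((M : ℝ) + 1 / 2) := by
        rw [← Real.rpow_add hε.1]
        congr 1
        ring
      have h2 := hsmall ε hε₃'
      rw [Real.rpow_mul_natCast hε.1.le, div_mul_eq_mul_div, div_le_one (by positivity)] at h2
      have h3 := mul_le_mul_of_nonneg_right h2 (sq_nonneg (ε ^ ((M : ℝ) + 1 / 2)))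
      rw [h1]
      linarith
  · obtain ⟨κ, hκ, L, hL, K₂, hK₂, ε₂, hε₂, h⟩ :=
      exists_energyBounds hΩ hN hT₀ hν K hδ2 hW A A' hc₀ hC₀ hC
    have hN3 : (N : ℝ) ≤ 3 := by
      rcases hN23 with rfl | rfl <;> norm_num
    have hk : critOrder N = M := by
      rw [hM2]
      exact max_eq_left (by linarith)
    have hM2' : (M : ℝ) = 2 := by rw [hM2]; norm_num
    have hS : 0 < (2 * R ^ 2 * Real.exp (0 * T₀) ^ 2) ^ (2 / N : ℝ) := by positivity
    set S := (2 * R ^ 2 * Real.exp (0 * T₀) ^ 2) ^ (2 / N : ℝ) with hSd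
    -- Here `4/N > 1`, so the coefficient `η` can be tuned to the given `R`. The resulting large
    -- `k₁`, and with it `K₁`, only shortens the time interval.
    obtain ⟨k₁, hk₁, hcub⟩ := cubic_le_of_one_lt (e := 4 / N) (η := 1 / (L * S))
      (by rw [lt_div_iff₀ hN']; linarith) (by positivity)
    obtain ⟨K₁, hK₁, h⟩ := h k₁ (1 / (L * S)) (4 * M / N) hk₁ (by positivity)
    refine ⟨min ε₀ ε₂, ⟨lt_min hε₀ hε₂, min_le_left _ _⟩,
      min T₀ (1 / (10 * (2 * K₁ + K₂ / R ^ 2))), ⟨lt_min hT₀ (by positivity), min_le_left _ _⟩,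
      fun ε hε T hT => ?_⟩
    have hε₀' : ε ∈ Set.Ioc 0 ε₀ := ⟨hε.1, hε.2.trans (min_le_left _ _)⟩
    have hε₂' : ε ∈ Set.Ioc 0 ε₂ := ⟨hε.1, hε.2.trans (min_le_right _ _)⟩
    obtain ⟨-, hsol, hu₀, hrem, hprep⟩ := hu ε hε₀'
    rw [← sq_rpow_add_half hε.1]
    refine h ε hε₂' (fun b hb => ?_) M M R (u₀ ε) (u ε) (uA ε) hR hsol (huA ε hε₀') hu₀
      (hA ε hε₀') (hspec ε hε₀') hrem hprep 0 (K₂ / R ^ 2) _ le_rfl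
      ⟨lt_min hT₀ (by positivity), min_le_left _ _⟩ (le_of_eq ?_) (le_of_eq ?_)
      (Or.inr ⟨rfl, ?_⟩) T hT
    · have h1 := hcub ε hε.1 b hb.1
      rwa [show 2 * (4 / N : ℝ) = 4 * M / N by rw [hM2']; ring] at h1
    · rw [rpow_scaling hN0 hε.1 (sq_nonneg _), sub_self, mul_zero, zero_div, Real.rpow_zero,
        mul_one, ← hSd]
      field_simp
    · field_simp
    · have h1 : 0 < 2 * K₁ + K₂ / R ^ 2 := by positivity
      refine (mul_le_mul_of_nonneg_left (min_le_right _ _) h1.le).trans (le_of_eq ?_)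
      field_simp
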